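/- Let $\Omega\subset\mathbb R^3$ be a bounded domain with $C^2$ boundary, let $R,c_v,\kappa,\mu>0$ and $\lambda\in\mathbb R$ with $2\mu+3\lambda\ge 0$, let $q\in(3,6)$ and $T_0>0$. Write $L^p=L^p(\Omega)$, $W^{m,p}=W^{m,p}(\Omega)$, $H^m=W^{m,2}$, $H^1_0=H^1_0(\Omega)$. Let the initial data satisfy $0\le\rho_0\in W^{1,q}$, $u_0\in H^1_0$, $\theta_0\ge 0$ measurable and finite a.e., and $\sqrt{\rho_0}\,\theta_0\in L^2$ (vacuum is allowed, and no compatibility condition is imposed). Let $(\rho,u,\theta)$, with $\rho\ge0$ and $\theta\ge0$, be a solution on $\Omega\times(0,T_0)$ of \begin{align*} &\rho_t+\operatorname{div}(\rho u)=0,\\ &\rho(u_t+u\cdot\nabla u)-\mu\Delta u-(\mu+\lambda)\nabla\operatorname{div}u+\nabla P=0,\qquad P=R\rho\theta,\\ &c_v\rho(\theta_t+u\cdot\nabla\theta)-\kappa\Delta\theta+P\operatorname{div}u=\tfrac{\mu}{2}\,|\nabla u+(\nabla u)^T|^2+\lambda(\operatorname{div}u)^2 \end{align*} (satisfied a.e.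 in $\Omega\times(0,T_0)$, derivatives being weak ones) with the boundary conditions $u|_{\partial\Omega}=0$, $\theta|_{\partial\Omega}=0$, the initial condition $(\rho,\rho u,\rho\theta)|_{t=0}=(\rho_0,\rho_0u_0,\rho_0\theta_0)$, and the regularity \begin{align*} &\rho\in C([0,T_0];L^2)\cap L^\infty(0,T_0;W^{1,q}),\quad \rho_t\in L^\infty(0,T_0;L^2),\\ &\rho u\in C([0,T_0];L^2),\quad u\in L^\infty(0,T_0;H^1_0)\cap L^2(0,T_0;H^2)\cap L^1(0,T_0;W^{2,q}),\\ &\sqrt\rho\,u_t\in L^2(0,T_0;L^2),\quad \sqrt t\,u\in L^\infty(0,T_0;H^2)\cap L^2(0,T_0;W^{2,q}),\quad \sqrt t\,u_t\in L^2(0,T_0;H^1_0),\\ &\rho\theta\in C_w([0,T_0];L^2),\quad \theta\in L^2(0,T_0;H^1_0),\quad \sqrt t\,\theta\in L^\infty(0,T_0;H^1_0)\cap L^2(0,T_0;H^2),\\ &\sqrt t\sqrt\rho\,\theta_t\in L^2(0,T_0;L^2),\quad t\theta\in L^2(0,T_0;W^{2,6}),\quad t\theta_t\in L^2(0,T_0;H^1_0),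 \end{align*} where $C_w$ denotes weak continuity in time. Let $\varphi(\cdot,t):\Omega\to\Omega$, $t\in[0,T_0]$, be the flow of $u$, that is, $\partial_t\varphi(y,t)=u(\varphi(y,t),t)$ and $\varphi(y,0)=y$ for $y\in\Omega$ (in integrated form, $u(\cdot,t)$ being evaluated through its continuous representative for a.e. $t$), and set $$v(y,t)=u(\varphi(y,t),t),\qquad \vartheta(y,t)=\theta(\varphi(y,t),t).$$ Then $\sqrt{\rho_0}\,v$ and $\sqrt{\rho_0}\,\vartheta$ belong to $C([0,T_0];L^2)$ (after redefinition on a null set of times), and $$\sqrt{\rho_0}\,v\to\sqrt{\rho_0}\,u_0,\qquad \sqrt{\rho_0}\,\vartheta\to\sqrt{\rho_0}\,\theta_0\qquad\text{strongly in }L^2\text{ as }t\to0^+ .$$ -/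

import Mathlib

open MeasureTheory Set Filter Topology
open scoped ENNReal ContDiff

noncomputable section

namespace CNS

/-- Euclidean three-space. -/
abbrev E3 : Type := EuclideanSpace ℝ (Fin 3)

/-- The `i`-th standard basis vector. -/
abbrev e (i : Fin 3) : E3 := EuclideanSpace.single i (1 : ℝ)

/-- Lebesgue measure on `Ω`. -/
abbrev spaceM (Ω : Set E3) : Measure E3 := volume.restrict Ω

/-- Lebesgue measure on the time interval `(0, T)`. -/
abbrev timeM (T : ℝ) : Measure ℝ := volume.restrict (Ioo 0 T)

/-! ### Domains -/

/-- `Ω` has a `C²` boundary: near each boundary point it is the sublevel set `{g < 0}` of a `C²`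
function whose differential does not vanish at that point. -/
def HasC2Boundary (Ω : Set E3) : Prop :=
  ∀ x ∈ frontier Ω, ∃ (U : Set E3) (g : E3 → ℝ), IsOpen U ∧ x ∈ U ∧ ContDiffOn ℝ 2 g U ∧
    fderiv ℝ g x ≠ 0 ∧ ∀ z ∈ U, (z ∈ Ω ↔ g z < 0)

/-- Bounded domain (nonempty, connected, open set) with `C²` boundary. -/
structure IsSmoothBoundedDomain (Ω : Set E3) : Prop where
  isOpen : IsOpen Ω
  isConnected : IsConnected Ω
  isBounded : Bornology.IsBounded Ω
  boundary : HasC2Boundary Ω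

section Spaces

variable {F : Type*} [NormedAddCommGroup F] [NormedSpace ℝ F]

/-! ### Sobolev spaces on `Ω` -/

/-- `G` is the weak (distributional) derivative of `f` on `Ω`; `G x v` is the derivative of `f` at
`x` in the direction `v`. -/
def HasWeakDeriv (Ω : Set E3) (f : E3 → F) (G : E3 → E3 →L[ℝ] F) : Prop :=
  LocallyIntegrableOn f Ω ∧ LocallyIntegrableOn G Ω ∧
    ∀ η : E3 → ℝ, ContDiff ℝ ∞ η → HasCompactSupport η → tsupport η ⊆ Ω →
      ∀ v : E3, ∫ x in Ω, (fderiv ℝ η x v) • f x = - ∫ x in Ω, η x • G x v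

/-- `f ∈ W^{1,p}(Ω)` with weak derivative `G`. -/
def MemW1 (Ω : Set E3) (p : ℝ≥0∞) (f : E3 → F) (G : E3 → E3 →L[ℝ] F) : Prop :=
  HasWeakDeriv Ω f G ∧ MemLp f p (spaceM Ω) ∧ MemLp G p (spaceM Ω)

/-- `f ∈ H₀¹(Ω)` with weak derivative `G`: the pair `(f, G)` is the `L²` limit of pairs
`(η, ∇η)` with `η ∈ C_c^∞(Ω)`. -/
def MemH10 (Ω : Set E3) (f : E3 → F) (G : E3 → E3 →L[ℝ] F) : Prop :=
  MemLp f 2 (spaceM Ω) ∧ MemLp G 2 (spaceM Ω) ∧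
    ∀ ε : ℝ≥0∞, 0 < ε → ∃ η : E3 → F, ContDiff ℝ ∞ η ∧ HasCompactSupport η ∧ tsupport η ⊆ Ω ∧
      eLpNorm (fun x => f x - η x) 2 (spaceM Ω) < ε ∧
      eLpNorm (fun x => G x - fderiv ℝ η x) 2 (spaceM Ω) < ε

/-! ### Functions of time with values in function spaces; `f t x` is the value at time `t` -/

/-- `f ∈ L^r(0,T; L^p(Ω))`. -/
def InLL (Ω : Set E3) (T : ℝ) (r p : ℝ≥0∞) (f : ℝ → E3 → F) : Prop :=
  AEStronglyMeasurable (Function.uncurry f) ((timeM T).prod (spaceM Ω)) ∧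
    eLpNorm (fun t => eLpNorm (f t) p (spaceM Ω)) r (timeM T) < ⊤

/-- `f ∈ L^r(0,T; W^{1,p}(Ω))`, with spatial weak derivative `Df`. -/
def InLW1 (Ω : Set E3) (T : ℝ) (r p : ℝ≥0∞) (f : ℝ → E3 → F) (Df : ℝ → E3 → E3 →L[ℝ] F) : Prop :=
  (∀ᵐ t ∂timeM T, HasWeakDeriv Ω (f t) (Df t)) ∧ InLL Ω T r p f ∧ InLL Ω T r p Df

/-- `f ∈ L^r(0,T; W^{2,p}(Ω))`, with spatial weak derivatives `Df` and `D2f`. -/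
def InLW2 (Ω : Set E3) (T : ℝ) (r p : ℝ≥0∞) (f : ℝ → E3 → F) (Df : ℝ → E3 → E3 →L[ℝ] F)
    (D2f : ℝ → E3 → E3 →L[ℝ] E3 →L[ℝ] F) : Prop :=
  InLW1 Ω T r p f Df ∧ InLW1 Ω T r p Df D2f

/-- `f ∈ L^r(0,T; H₀¹(Ω))`, with spatial weak derivative `Df`. -/
def InLH10 (Ω : Set E3) (T : ℝ) (r : ℝ≥0∞) (f : ℝ → E3 → F) (Df : ℝ → E3 → E3 →L[ℝ] F) : Prop :=
  (∀ᵐ t ∂timeM T, MemH10 Ω (f t) (Df t)) ∧ InLL Ω T r 2 f ∧ InLL Ω T r 2 Df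

/-- Multiplication of a time-dependent field by a function of time. -/
def wt (w : ℝ → ℝ) (f : ℝ → E3 → F) : ℝ → E3 → F := fun t x => w t • f t x

/-- `g` is the weak derivative of `f` with respect to time on `(0,T) × Ω`. -/
def HasWeakTimeDeriv (Ω : Set E3) (T : ℝ) (f g : ℝ → E3 → F) : Prop :=
  LocallyIntegrableOn (Function.uncurry f) (Ioo 0 T ×ˢ Ω) ∧
  LocallyIntegrableOn (Function.uncurry g) (Ioo 0 T ×ˢ Ω) ∧
    ∀ η : ℝ × E3 → ℝ, ContDiff ℝ ∞ η → HasCompactSupport η → tsupport η ⊆ Ioo 0 T ×ˢ Ω →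
      ∫ z in Ioo 0 T ×ˢ Ω, (fderiv ℝ η z ((1 : ℝ), (0 : E3))) • f z.1 z.2
        = - ∫ z in Ioo 0 T ×ˢ Ω, η z • g z.1 z.2

/-- `V : [0,T] → L²(Ω)` is a version of `f`: the two agree at almost every time. -/
def IsVersion (Ω : Set E3) (T : ℝ) (f : ℝ → E3 → F) (V : ℝ → Lp F 2 (spaceM Ω)) : Prop :=
  ∀ᵐ t ∂timeM T, V t =ᵐ[spaceM Ω] f t

/-- `f ∈ C([0,T]; L²(Ω))` and `f|_{t=0} = f₀`. -/
def InCL2 (Ω : Set E3) (T : ℝ) (f : ℝ → E3 → F) (f₀ : E3 → F) : Prop :=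
  ∃ V : ℝ → Lp F 2 (spaceM Ω), IsVersion Ω T f V ∧ ContinuousOn V (Icc 0 T) ∧
    V 0 =ᵐ[spaceM Ω] f₀

/-- `f ∈ C_w([0,T]; L²(Ω))` (continuity for the weak topology of `L²`) and `f|_{t=0} = f₀`. -/
def InCwL2 (Ω : Set E3) (T : ℝ) (f : ℝ → E3 → F) (f₀ : E3 → F) : Prop :=
  ∃ V : ℝ → Lp F 2 (spaceM Ω), IsVersion Ω T f V ∧
    (∀ l : Lp F 2 (spaceM Ω) →L[ℝ] ℝ, ContinuousOn (fun t => l (V t)) (Icc 0 T)) ∧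
    V 0 =ᵐ[spaceM Ω] f₀

end Spaces

/-! ### The equations -/

/-- `div u`, from the derivative `L = Du(x)`. -/
def divOf (L : E3 →L[ℝ] E3) : ℝ := ∑ i, (L (e i)) i

/-- `Δf = ∑ᵢ ∂ᵢ∂ᵢ f`, from the second derivative `H = D²f(x)`. -/
def lapOf {F : Type*} [NormedAddCommGroup F] [NormedSpace ℝ F] (H : E3 →L[ℝ] E3 →L[ℝ] F) : F :=
  ∑ i, H (e i) (e i)

/-- `∂ⱼ (div u)`, from the second derivative `H = D²u(x)`. -/
def gradDivOf (H : E3 →L[ℝ] E3 →L[ℝ] E3) (j : Fin 3) : ℝ := ∑ i, (H (e j) (e i)) i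

/-- `𝒬(∇u) = (μ/2) |∇u + (∇u)ᵀ|² + lam (div u)²`, from the derivative `L = Du(x)`. -/
def dissip (μ lam : ℝ) (L : E3 →L[ℝ] E3) : ℝ :=
  μ / 2 * ∑ i, ∑ j, ((L (e i)) j + (L (e j)) i) ^ 2 + lam * divOf L ^ 2

/-- The physical constants: `R`, `cv`, `κ` positive, `μ > 0` and `2μ + 3lam ≥ 0`. -/
structure PhysicalConstants (R μ lam κ cv : ℝ) : Prop where
  R_pos : 0 < R
  μ_pos : 0 < μ
  lam_bd : 0 ≤ 2 * μ + 3 * lam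
  κ_pos : 0 < κ
  cv_pos : 0 < cv

/-- The initial data: `0 ≤ ρ₀ ∈ W^{1,q}`, `u₀ ∈ H₀¹`, `θ₀ ≥ 0` measurable, `√ρ₀ θ₀ ∈ L²`. -/
structure InitialData (Ω : Set E3) (q : ℝ) (ρ₀ : E3 → ℝ) (u₀ : E3 → E3) (θ₀ : E3 → ℝ) : Prop where
  ρ_nonneg : ∀ᵐ x ∂spaceM Ω, 0 ≤ ρ₀ x
  ρ_mem : ∃ Dρ₀, MemW1 Ω (ENNReal.ofReal q) ρ₀ Dρ₀
  u_mem : ∃ Du₀, MemH10 Ω u₀ Du₀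
  θ_nonneg : ∀ᵐ x ∂spaceM Ω, 0 ≤ θ₀ x
  θ_meas : AEStronglyMeasurable θ₀ (spaceM Ω)
  θ_mem : MemLp (fun x => √(ρ₀ x) * θ₀ x) 2 (spaceM Ω)

/-- `(ρ, u, θ)` is a solution on `Ω × (0,T)` of the heat conductive compressible Navier-Stokes
equations with homogeneous Dirichlet conditions for `u` and `θ`, where the remaining arguments are
its weak derivatives: `ρt, ut, θt` in time; `Dρ, Du, D2u, Dut, Dθ, D2θ, Dθt` in space; `DM` and
`DP` are the spatial derivatives of the momentum `ρ u` and of the pressure `P = R ρ θ`. -/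
structure IsSolutionWith (Ω : Set E3) (T R μ lam κ cv q : ℝ)
    (ρ₀ : E3 → ℝ) (u₀ : E3 → E3) (θ₀ : E3 → ℝ)
    (ρ : ℝ → E3 → ℝ) (u : ℝ → E3 → E3) (θ : ℝ → E3 → ℝ)
    (ρt : ℝ → E3 → ℝ) (Dρ : ℝ → E3 → E3 →L[ℝ] ℝ)
    (ut : ℝ → E3 → E3) (Du : ℝ → E3 → E3 →L[ℝ] E3) (D2u : ℝ → E3 → E3 →L[ℝ] E3 →L[ℝ] E3)
    (Dut : ℝ → E3 → E3 →L[ℝ] E3)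
    (θt : ℝ → E3 → ℝ) (Dθ : ℝ → E3 → E3 →L[ℝ] ℝ) (D2θ : ℝ → E3 → E3 →L[ℝ] E3 →L[ℝ] ℝ)
    (Dθt : ℝ → E3 → E3 →L[ℝ] ℝ)
    (DM : ℝ → E3 → E3 →L[ℝ] E3) (DP : ℝ → E3 → E3 →L[ℝ] ℝ) : Prop where
  -- time derivatives
  ρ_time : HasWeakTimeDeriv Ω T ρ ρt
  u_time : HasWeakTimeDeriv Ω T u ut
  θ_time : HasWeakTimeDeriv Ω T θ θt
  -- density
  ρ_nonneg : ∀ᵐ t ∂timeM T, ∀ᵐ x ∂spaceM Ω, 0 ≤ ρ t x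
  ρ_cont : InCL2 Ω T ρ ρ₀
  ρ_W1q : InLW1 Ω T ⊤ (ENNReal.ofReal q) ρ Dρ
  ρt_mem : InLL Ω T ⊤ 2 ρt
  -- velocity
  ρu_cont : InCL2 Ω T (fun t x => ρ t x • u t x) (fun x => ρ₀ x • u₀ x)
  u_H10 : InLH10 Ω T ⊤ u Du
  u_H2 : InLW2 Ω T 2 2 u Du D2u
  u_W2q : InLW2 Ω T 1 (ENNReal.ofReal q) u Du D2u
  sqrtρ_ut : InLL Ω T 2 2 (fun t x => √(ρ t x) • ut t x)
  sqrt_u_H2 : InLW2 Ω T ⊤ 2 (wt Real.sqrt u) (wt Real.sqrt Du) (wt Real.sqrt D2u)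
  sqrt_u_W2q : InLW2 Ω T 2 (ENNReal.ofReal q)
    (wt Real.sqrt u) (wt Real.sqrt Du) (wt Real.sqrt D2u)
  sqrt_ut : InLH10 Ω T 2 (wt Real.sqrt ut) (wt Real.sqrt Dut)
  -- temperature
  ρθ_cont : InCwL2 Ω T (fun t x => ρ t x * θ t x) (fun x => ρ₀ x * θ₀ x)
  θ_nonneg : ∀ᵐ t ∂timeM T, ∀ᵐ x ∂spaceM Ω, 0 ≤ θ t x
  θ_H10 : InLH10 Ω T 2 θ Dθ
  sqrt_θ_H10 : InLH10 Ω T ⊤ (wt Real.sqrt θ) (wt Real.sqrt Dθ)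
  sqrt_θ_H2 : InLW2 Ω T 2 2 (wt Real.sqrt θ) (wt Real.sqrt Dθ) (wt Real.sqrt D2θ)
  sqrt_sqrtρ_θt : InLL Ω T 2 2 (wt Real.sqrt fun t x => √(ρ t x) * θt t x)
  id_θ_W26 : InLW2 Ω T 2 6 (wt id θ) (wt id Dθ) (wt id D2θ)
  id_θt : InLH10 Ω T 2 (wt id θt) (wt id Dθt)
  -- fluxes
  M_deriv : ∀ᵐ t ∂timeM T, HasWeakDeriv Ω (fun x => ρ t x • u t x) (DM t)
  P_deriv : ∀ᵐ t ∂timeM T, HasWeakDeriv Ω (fun x => R * ρ t x * θ t x) (DP t)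
  -- conservation of mass, momentum and energy
  mass : ∀ᵐ t ∂timeM T, ∀ᵐ x ∂spaceM Ω, ρt t x + divOf (DM t x) = 0
  momentum : ∀ᵐ t ∂timeM T, ∀ᵐ x ∂spaceM Ω, ∀ j : Fin 3,
    ρ t x * (ut t x + Du t x (u t x)) j - μ * (lapOf (D2u t x)) j
      - (μ + lam) * gradDivOf (D2u t x) j + DP t x (e j) = 0
  energy : ∀ᵐ t ∂timeM T, ∀ᵐ x ∂spaceM Ω,
    cv * ρ t x * (θt t x + Dθ t x (u t x)) - κ * lapOf (D2θ t x)
      + R * ρ t x * θ t x * divOf (Du t x) = dissip μ lam (Du t x)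

/-- `(ρ, u, θ)` is a solution on `Ω × (0,T)` in the regularity class in which the continuity of
`√ρ u` and `√ρ θ` in `L²` is replaced by `ρ u ∈ C([0,T]; L²)` and `ρ θ ∈ C_w([0,T]; L²)`. -/
def IsSolution (Ω : Set E3) (T R μ lam κ cv q : ℝ)
    (ρ₀ : E3 → ℝ) (u₀ : E3 → E3) (θ₀ : E3 → ℝ)
    (ρ : ℝ → E3 → ℝ) (u : ℝ → E3 → E3) (θ : ℝ → E3 → ℝ) : Prop :=
  ∃ ρt Dρ ut Du D2u Dut θt Dθ D2θ Dθt DM DP,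
    IsSolutionWith Ω T R μ lam κ cv q ρ₀ u₀ θ₀ ρ u θ ρt Dρ ut Du D2u Dut θt Dθ D2θ Dθt DM DP

/-- `φ t : Ω → Ω`, `t ∈ [0,T]`, is the flow of the velocity field `u`:
`∂ₜφ(y,t) = u(φ(y,t),t)`, `φ(y,0) = y`, in integrated form. At almost every time the velocity is
evaluated through its continuous representative `U t`. -/
def IsFlow (Ω : Set E3) (T : ℝ) (u : ℝ → E3 → E3) (φ : ℝ → E3 → E3) : Prop :=
  ∃ U : ℝ → E3 → E3,
    (∀ᵐ t ∂timeM T, ContinuousOn (U t) Ω ∧ U t =ᵐ[spaceM Ω] u t) ∧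
    ∀ y ∈ Ω, ∀ t ∈ Icc 0 T, φ t y ∈ Ω ∧
      IntervalIntegrable (fun s => U s (φ s y)) volume 0 t ∧
      φ t y = y + ∫ s in (0 : ℝ)..t, U s (φ s y)

end CNS

end

/-! The flow transports mass. Composition with `φ t` is therefore an isometry from `L²(ρ(t) dx)` to
`L²(ρ₀ dx)`, and multiplication by `√ρ₀` is an isometry from `L²(ρ₀ dx)` to `L²(dx)`. Convergence of
`√ρ₀ v` and `√ρ₀ ϑ` thus becomes convergence of `u ∘ φ` and `θ ∘ φ` in the fixed space `L²(ρ₀ dx)`,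
which does not see the initial vacuum.

Transport of mass. Since `q > 3`, Morrey's bound (`IsSmoothBoundedDomain.ae_norm_le`) makes `ρ`
bounded and puts `u` in `L¹(0,T; W^{1,∞})`. As `u(t) ∈ H₀¹`, its extension by zero is Lipschitz on
the whole space (`MemH10.exists_lipschitzWith`), with a constant `a(t)` that is integrable in time.
For the same reason the continuity equation may be tested with functions that do not vanish on the
boundary. Density and flow are compared over a fine partition of `[0,t]`, each step being measured
against a smooth displacement by the mollified velocity. In the limit `∫ ψ ρ(t) = ∫ ψ(φ t) ρ₀`
(`IsDensityVersion.integral_eq_comp_flow`), and cosines as test functions give the identity of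
measures (`IsDensityVersion.map_flow`).

Positive times. Away from `t = 0` the time derivatives of `u` and `θ` are square integrable, so both
fields are continuous in `L²`. Composition with the flow is bounded from `L²(Ω)` to `L²(ρ₀ dx)`
uniformly in time, and `ψ ∘ φ t` depends continuously on `t` for `ψ` continuous with compact
support; approximation by such `ψ` gives continuity (`IsDensityVersion.exists_continuous_version`).

Initial time (`IsDensityVersion.tendsto_initial`). Let `h` be `u` or `θ`, with datum `h₀`. By
transport, `∫ ρ₀ |h(t) ∘ φ t - ψ ∘ φ t|² = ∫ ρ(t) |h(t) - ψ|²`. On expanding the square, the cross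
term converges because `ρh` is weakly continuous, and everything rests on `∫ ρ|h|² → ∫ ρ₀|h₀|²`.
This follows from two facts. Weakly in `L²(ρ₀ dx)`, `h(t) → h₀`, because `‖ρ(t) - ρ₀‖₂ = O(t)` while
`‖h(t)‖₄² = O(1/t)`. And the pairing of `ρh(t) - ρ₀h₀` with `h(t)` itself tends to zero. For the
velocity this is immediate: `ρu` is strongly continuous and `u` is bounded in `L²`. For the
temperature, `ρθ` is only weakly continuous and no bound of `θ(t)` in `L²` up to `t = 0` is
available. Here the energy equation bounds `(ρθ)_t` in the dual of `H₀¹` by a multiple of `‖∇θ‖₂ +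
√a` (`IsSolutionWith.exists_energy_bound`). Since `b = ‖∇θ‖₂² + a` is integrable in time, the
pairing is at most a constant times `√t ‖∇θ(t)‖₂ (∫₀ᵗ b)^{1/2}`, which tends to zero because `√t ∇θ`
is bounded in `L²`. -/

noncomputable section

namespace CNS

/-! ### A sup bound for functions in `W^{1,q}`, `q > 3`, on domains with the cone property -/

section Morrey

variable {F : Type*} [NormedAddCommGroup F] [NormedSpace ℝ F]

/-- The rescaled kernel `r⁻³ K ((z - x) / r)`. -/
def scaledKernel (K : E3 → ℝ) (x : E3) (r : ℝ) (z : E3) : ℝ := r⁻¹ ^ 3 * K (r⁻¹ • (z - x))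

lemma sum_coord_smul (y : E3) : ∑ i, y i • e i = y := by
  have := (EuclideanSpace.basisFun (Fin 3) ℝ).sum_repr y
  simpa using this

lemma map_eq_sum_coord (L : E3 →L[ℝ] F) (y : E3) : L y = ∑ i, y i • L (e i) := by
  conv_lhs => rw [← sum_coord_smul y]
  simp only [map_sum, map_smul]

/-- The bracket is the divergence of `y ↦ K y • y` at `y = (z - x) / r`. This turns a derivative in
`r` into a divergence in `z`, to which a weak derivative can respond. -/
lemma hasDerivAt_scaledKernel {K : E3 → ℝ} (hK : ContDiff ℝ ∞ K) (x z : E3) {r : ℝ} (hr : r ≠ 0) :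
    HasDerivAt (fun r => scaledKernel K x r z)
      (-(r⁻¹ ^ 4 * (3 * K (r⁻¹ • (z - x)) + fderiv ℝ K (r⁻¹ • (z - x)) (r⁻¹ • (z - x))))) r := by
  have h1 : HasDerivAt (fun r : ℝ => r⁻¹) (-(r ^ 2)⁻¹) r := hasDerivAt_inv hr
  have h2 : HasDerivAt (fun r : ℝ => r⁻¹ • (z - x)) ((-(r ^ 2)⁻¹) • (z - x)) r :=
    h1.smul_const (z - x)
  have h3 : HasFDerivAt K (fderiv ℝ K (r⁻¹ • (z - x))) (r⁻¹ • (z - x)) :=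
    (hK.differentiable (by simp)).differentiableAt.hasFDerivAt
  have h4 := h3.comp_hasDerivAt r h2
  have h5 := (h1.pow 3).mul h4
  refine h5.congr_deriv ?_
  simp only [map_smul, smul_eq_mul, Function.comp]
  simp
  field_simp
  ring

/-- Summed over `i`, these expressions give exactly minus the `r`-derivative found in
`hasDerivAt_scaledKernel`. -/
lemma hasFDerivAt_scaledKernel_mul {K : E3 → ℝ} (hK : ContDiff ℝ ∞ K) (x z : E3) (r : ℝ)
    (i : Fin 3) :
    fderiv ℝ (fun z => scaledKernel K x r z * (r⁻¹ • (z - x)) i) z (e i) =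
      r⁻¹ ^ 4 * (fderiv ℝ K (r⁻¹ • (z - x)) (e i) * (r⁻¹ • (z - x)) i + K (r⁻¹ • (z - x))) := by
  have h2 : HasFDerivAt (fun z : E3 => r⁻¹ • (z - x)) (r⁻¹ • ContinuousLinearMap.id ℝ E3) z :=
    ((hasFDerivAt_id z).sub_const x).const_smul r⁻¹
  have h3 : HasFDerivAt K (fderiv ℝ K (r⁻¹ • (z - x))) (r⁻¹ • (z - x)) :=
    (hK.differentiable (by simp)).differentiableAt.hasFDerivAt
  have h4 : HasFDerivAt (fun z => scaledKernel K x r z)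
      (r⁻¹ ^ 3 • (fderiv ℝ K (r⁻¹ • (z - x))).comp (r⁻¹ • ContinuousLinearMap.id ℝ E3)) z :=
    (h3.comp z h2).const_mul (r⁻¹ ^ 3)
  have h5 : HasFDerivAt (fun z : E3 => (r⁻¹ • (z - x)) i)
      ((EuclideanSpace.proj i : E3 →L[ℝ] ℝ).comp (r⁻¹ • ContinuousLinearMap.id ℝ E3)) z :=
    (EuclideanSpace.proj i : E3 →L[ℝ] ℝ).hasFDerivAt.comp z h2
  have h6 := (h4.mul h5).fderiv
  simp only [Pi.mul_def] at h6
  rw [h6]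
  simp [scaledKernel]
  ring

lemma contDiff_scaledKernel {K : E3 → ℝ} (hK : ContDiff ℝ ∞ K) (x : E3) (r : ℝ) :
    ContDiff ℝ ∞ (scaledKernel K x r) := by
  unfold scaledKernel
  fun_prop

lemma tsupport_scaledKernel_subset {K : E3 → ℝ} {p : E3} {δ : ℝ}
    (hKs : ∀ h, h ∉ Metric.closedBall p δ → K h = 0) (x : E3) {r : ℝ} (hr : 0 < r) :
    tsupport (scaledKernel K x r) ⊆ Metric.closedBall (x + r • p) (r * δ) := by
  refine closure_minimal ?_ Metric.isClosed_closedBall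
  intro z hz
  by_contra hcon
  apply hz
  have : r⁻¹ • (z - x) ∉ Metric.closedBall p δ := by
    intro h
    apply hcon
    rw [Metric.mem_closedBall, dist_eq_norm] at h ⊢
    have h1 : z - (x + r • p) = r • (r⁻¹ • (z - x) - p) := by
      rw [smul_sub, smul_inv_smul₀ hr.ne']; abel
    rw [h1, norm_smul, Real.norm_of_nonneg hr.le]
    exact mul_le_mul_of_nonneg_left h hr.le
  simp [scaledKernel, hKs _ this]

lemma exists_mem_closedBall_of_mem {x p z : E3} {r δ : ℝ} (hr : 0 < r)
    (hz : z ∈ Metric.closedBall (x + r • p) (r * δ)) :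
    ∃ h ∈ Metric.closedBall p δ, z = x + r • h := by
  refine ⟨r⁻¹ • (z - x), ?_, by rw [smul_inv_smul₀ hr.ne']; abel⟩
  rw [Metric.mem_closedBall, dist_eq_norm] at hz ⊢
  have h1 : z - (x + r • p) = r • (r⁻¹ • (z - x) - p) := by
    rw [smul_sub, smul_inv_smul₀ hr.ne']; abel
  rw [h1, norm_smul, Real.norm_of_nonneg hr.le] at hz
  exact le_of_mul_le_mul_left hz hr

lemma integral_scaledKernel (K : E3 → ℝ) (x : E3) {r : ℝ} (hr : 0 < r) :
    ∫ z, scaledKernel K x r z = ∫ h, K h := by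
  unfold scaledKernel
  rw [integral_const_mul, integral_sub_right_eq_self (fun z => K (r⁻¹ • z)) x,
    Measure.integral_comp_inv_smul]
  simp [abs_of_pos hr]
  field_simp

/-- The derivative in `r` of the averages `∫ r⁻³ K ((z - x) / r) f z dz`. -/
lemma hasDerivAt_integral_scaledKernel [CompleteSpace F] {Ω : Set E3} {f : E3 → F}
    {G : E3 → E3 →L[ℝ] F}
    (hf : HasWeakDeriv Ω f G) (hfi : IntegrableOn f Ω) (hGi : IntegrableOn G Ω)
    {K : E3 → ℝ} (hK : ContDiff ℝ ∞ K) {p : E3} {δ : ℝ}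
    (hKs : ∀ h, h ∉ Metric.closedBall p δ → K h = 0) {x : E3} {r : ℝ} (hr : 0 < r)
    (hΩ : Metric.closedBall (x + r • p) (r * δ) ⊆ Ω) :
    HasDerivAt (fun r => ∫ z in Ω, scaledKernel K x r z • f z)
      (∫ z in Ω, scaledKernel K x r z • G z (r⁻¹ • (z - x))) r := by
  have hKc : HasCompactSupport K :=
    HasCompactSupport.intro (isCompact_closedBall p δ) hKs
  have hDK : Continuous (fderiv ℝ K) := hK.continuous_fderiv (by simp)
  set Q : E3 → ℝ := fun y => 3 * K y + fderiv ℝ K y y with hQ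
  have hQc : Continuous Q := by
    have := hK.continuous
    fun_prop
  have hQs : HasCompactSupport Q := by
    refine HasCompactSupport.intro (isCompact_closedBall p δ) fun h hh => ?_
    have h1 : fderiv ℝ K h = 0 := by
      apply image_eq_zero_of_notMem_tsupport
      intro h2
      have h3 := (tsupport_fderiv_subset ℝ) h2
      have h4 : tsupport K ⊆ Metric.closedBall p δ :=
        closure_minimal (fun z hz => by by_contra hc; exact hz (hKs z hc))
          Metric.isClosed_closedBall
      exact hh (h4 h3)
    simp [hQ, hKs h hh, h1]
  obtain ⟨C, hC⟩ := hQs.exists_bound_of_continuous hQc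
  have hC0 : 0 ≤ C := (norm_nonneg _).trans (hC 0)
  have hkc : ∀ r, Continuous (scaledKernel K x r) := fun r =>
    (contDiff_scaledKernel hK x r).continuous
  have hkb : ∀ r, ∃ B, ∀ z, ‖scaledKernel K x r z‖ ≤ B := by
    intro r
    obtain ⟨B, hB⟩ := hKc.exists_bound_of_continuous hK.continuous
    refine ⟨|r⁻¹ ^ 3| * B, fun z => ?_⟩
    simp only [scaledKernel, norm_mul, Real.norm_eq_abs]
    exact mul_le_mul_of_nonneg_left (hB _) (abs_nonneg _)
  have key := hasDerivAt_integral_of_dominated_loc_of_deriv_le (μ := volume.restrict Ω) (𝕜 := ℝ)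
    (F := fun r z => scaledKernel K x r z • f z) (x₀ := r) (s := Ioi (r / 2))
    (F' := fun r z => (-(r⁻¹ ^ 4 * Q (r⁻¹ • (z - x)))) • f z)
    (bound := fun z => ((r / 2)⁻¹ ^ 4 * C) * ‖f z‖)
    (Ioi_mem_nhds (by linarith))
    (Eventually.of_forall fun s => (hkc s).aestronglyMeasurable.smul hfi.aestronglyMeasurable)
    (by
      obtain ⟨B, hB⟩ := hkb r
      exact hfi.bdd_smul B (hkc r).aestronglyMeasurable (Eventually.of_forall hB))
    (by
      refine AEStronglyMeasurable.smul ?_ hfi.aestronglyMeasurable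
      exact (by fun_prop : Continuous fun z => -(r⁻¹ ^ 4 * Q (r⁻¹ • (z - x)))).aestronglyMeasurable)
    (Eventually.of_forall fun z s hs => by
      rw [norm_smul]
      refine mul_le_mul_of_nonneg_right ?_ (norm_nonneg _)
      have hs0 : 0 < s := lt_trans (by linarith) hs
      rw [norm_neg, norm_mul]
      refine mul_le_mul ?_ (hC _) (norm_nonneg _) (by positivity)
      rw [Real.norm_of_nonneg (by positivity)]
      gcongr
      exact (mem_Ioi.1 hs).le)
    (hfi.norm.const_mul _)
    (Eventually.of_forall fun z s hs => by
      have hs0 : 0 < s := lt_trans (by linarith) hs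
      exact (hasDerivAt_scaledKernel hK x z hs0.ne').smul_const (f z))
  refine key.2.congr_deriv ?_
  have hξ : ∀ i : Fin 3, ContDiff ℝ ∞ (fun z : E3 => scaledKernel K x r z * (r⁻¹ • (z - x)) i) := by
    intro i
    have := contDiff_scaledKernel hK x r
    have h2 : ContDiff ℝ ∞ fun z : E3 => (r⁻¹ • (z - x)) i :=
      (EuclideanSpace.proj i : E3 →L[ℝ] ℝ).contDiff.comp
        ((contDiff_id.sub contDiff_const).const_smul r⁻¹)
    exact this.mul h2
  have hts : ∀ i : Fin 3, tsupport (fun z : E3 => scaledKernel K x r z * (r⁻¹ • (z - x)) i) ⊆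
      Metric.closedBall (x + r • p) (r * δ) := fun i =>
    (tsupport_mul_subset_left).trans (tsupport_scaledKernel_subset hKs x hr)
  have hcs : ∀ i : Fin 3, HasCompactSupport
      (fun z : E3 => scaledKernel K x r z * (r⁻¹ • (z - x)) i) := fun i =>
    HasCompactSupport.of_support_subset_isCompact (isCompact_closedBall (x + r • p) (r * δ))
      ((subset_tsupport _).trans (hts i))
  -- The weak derivative is tested with the components of the field `r⁻³ K((z - x)/r) (z - x)/r`,
  -- whose support lies in `Ω` by the assumption on the off-centre ball.
  have hw := fun i : Fin 3 => hf.2.2 _ (hξ i) (hcs i) ((hts i).trans hΩ) (e i)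
  have hb1 : ∀ i : Fin 3, Integrable (fun z => (fderiv ℝ
      (fun z => scaledKernel K x r z * (r⁻¹ • (z - x)) i) z (e i)) • f z) (volume.restrict Ω) := by
    intro i
    have hc : Continuous fun z => fderiv ℝ
      (fun z => scaledKernel K x r z * (r⁻¹ • (z - x)) i) z (e i) := by
      have := (hξ i).continuous_fderiv (by simp)
      fun_prop
    obtain ⟨B, hB⟩ := ((hcs i).fderiv_apply ℝ (e i)).exists_bound_of_continuous hc
    exact hfi.bdd_smul B hc.aestronglyMeasurable (Eventually.of_forall hB)
  have hb2 : ∀ i : Fin 3, Integrable (fun z =>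
      (scaledKernel K x r z * (r⁻¹ • (z - x)) i) • G z (e i)) (volume.restrict Ω) := by
    intro i
    obtain ⟨B, hB⟩ := (hcs i).exists_bound_of_continuous (hξ i).continuous
    exact (hGi.apply_continuousLinearMap (e i)).bdd_smul B (hξ i).continuous.aestronglyMeasurable
      (Eventually.of_forall hB)
  calc ∫ z in Ω, (-(r⁻¹ ^ 4 * Q (r⁻¹ • (z - x)))) • f z
      = ∫ z in Ω, -∑ i : Fin 3, (fderiv ℝ
          (fun z => scaledKernel K x r z * (r⁻¹ • (z - x)) i) z (e i)) • f z := by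
        refine integral_congr_ae (Eventually.of_forall fun z => ?_)
        simp only []
        rw [← Finset.sum_smul, ← neg_smul]
        congr 2
        simp_rw [hasFDerivAt_scaledKernel_mul hK]
        rw [← Finset.mul_sum, Finset.sum_add_distrib]
        congr 1
        have h1 : fderiv ℝ K (r⁻¹ • (z - x)) (r⁻¹ • (z - x)) =
            ∑ i, fderiv ℝ K (r⁻¹ • (z - x)) (e i) * (r⁻¹ • (z - x)) i := by
          rw [map_eq_sum_coord]
          exact Finset.sum_congr rfl fun i _ => by rw [smul_eq_mul, mul_comm]
        rw [hQ]
        simp only []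
        rw [h1]
        simp only [Finset.sum_const, Finset.card_univ, Fintype.card_fin]
        ring
    _ = -∑ i : Fin 3, ∫ z in Ω, (fderiv ℝ
          (fun z => scaledKernel K x r z * (r⁻¹ • (z - x)) i) z (e i)) • f z := by
        rw [integral_neg, integral_finsetSum _ fun i _ => hb1 i]
    _ = ∑ i : Fin 3, ∫ z in Ω, (scaledKernel K x r z * (r⁻¹ • (z - x)) i) • G z (e i) := by
        simp_rw [hw, Finset.sum_neg_distrib, neg_neg]
    _ = ∫ z in Ω, scaledKernel K x r z • G z (r⁻¹ • (z - x)) := by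
        rw [← integral_finsetSum _ fun i _ => hb2 i]
        refine integral_congr_ae (Eventually.of_forall fun z => ?_)
        simp only []
        rw [map_eq_sum_coord (G z), Finset.smul_sum]
        exact Finset.sum_congr rfl fun i _ => by rw [mul_smul]

/-- Hölder's inequality against the constant `1`; what matters is the power `s^{3 - 3/q}` of the
radius. -/
lemma setIntegral_norm_closedBall_le {N : Type*} [NormedAddCommGroup N] {q : ℝ} (hq : 1 ≤ q)
    {Ω : Set E3} {g : E3 → N}
    (hg : MemLp g (ENNReal.ofReal q) (spaceM Ω)) {c : E3} {s : ℝ} (hs : 0 ≤ s)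
    (hsub : Metric.closedBall c s ⊆ Ω) :
    ∫ z in Metric.closedBall c s, ‖g z‖ ≤
      (eLpNorm g (ENNReal.ofReal q) (spaceM Ω)).toReal *
        (s ^ 3 * (volume (Metric.ball (0 : E3) 1)).toReal) ^ (1 - 1 / q) := by
  have hle : (volume.restrict (Metric.closedBall c s) : Measure E3) ≤ spaceM Ω :=
    Measure.restrict_mono hsub le_rfl
  have hg' : MemLp g (ENNReal.ofReal q) (volume.restrict (Metric.closedBall c s)) :=
    hg.mono_measure hle
  have h1q : (1 : ℝ≥0∞) ≤ ENNReal.ofReal q := by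
    rw [← ENNReal.ofReal_one]; exact ENNReal.ofReal_le_ofReal hq
  have hfin : volume (Metric.closedBall c s) ≠ ⊤ :=
    (isCompact_closedBall c s).measure_lt_top.ne
  have : IsFiniteMeasure (volume.restrict (Metric.closedBall c s) : Measure E3) :=
    ⟨by rw [Measure.restrict_apply_univ]; exact hfin.lt_top⟩
  have h2 := eLpNorm_le_eLpNorm_mul_rpow_measure_univ h1q hg'.1
  have hvol : (volume (Metric.closedBall c s)).toReal =
      s ^ 3 * (volume (Metric.ball (0 : E3) 1)).toReal := by
    rw [Measure.addHaar_closedBall volume c hs, ENNReal.toReal_mul,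
      ENNReal.toReal_ofReal (by positivity)]
    simp
  rw [Measure.restrict_apply_univ, ENNReal.toReal_ofReal (by linarith)] at h2
  have hi := hg'.integrable h1q
  rw [integral_norm_eq_lintegral_enorm hi.1, ← eLpNorm_one_eq_lintegral_enorm, ← hvol,
    ENNReal.toReal_rpow, ← ENNReal.toReal_mul]
  refine ENNReal.toReal_mono ?_ (h2.trans ?_)
  · exact ENNReal.mul_ne_top hg.2.ne (ENNReal.rpow_ne_top_of_nonneg (by
      rw [sub_nonneg, div_le_one (by linarith)]; exact hq) hfin)
  · simp only [ENNReal.toReal_one, div_one]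
    gcongr

/-- The kernel contributes `r⁻³` and Hölder's inequality `r^{3 - 3/q}`, whence `r^{-3/q}`. The
integrand `H` is only dominated by `g`, so that the bound serves both the averages of `f` and those
of `G z ((z - x)/r)`. -/
lemma norm_integral_scaledKernel_smul_le {N F' : Type*} [NormedAddCommGroup N]
    [NormedAddCommGroup F'] [NormedSpace ℝ F']
    {q : ℝ} (hq : 1 ≤ q) {Ω : Set E3} (hΩm : MeasurableSet Ω) {g : E3 → N}
    (hg : MemLp g (ENNReal.ofReal q) (spaceM Ω))
    {K : E3 → ℝ} {p : E3} {δ : ℝ} (hδ : 0 ≤ δ)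
    (hKs : ∀ h, h ∉ Metric.closedBall p δ → K h = 0) {κ : ℝ} (hκ : ∀ h, ‖K h‖ ≤ κ) {x : E3} {r : ℝ}
    (hr : 0 < r) (hΩ : Metric.closedBall (x + r • p) (r * δ) ⊆ Ω) {H : E3 → F'} {B : ℝ}
    (hB : 0 ≤ B)
    (hH : ∀ z ∈ Metric.closedBall (x + r • p) (r * δ), ‖H z‖ ≤ B * ‖g z‖) :
    ‖∫ z in Ω, scaledKernel K x r z • H z‖ ≤
      κ * B * (δ ^ 3 * (volume (Metric.ball (0 : E3) 1)).toReal) ^ (1 - 1 / q) *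
        (eLpNorm g (ENNReal.ofReal q) (spaceM Ω)).toReal * r ^ (-(3 / q)) := by
  have hκ0 : 0 ≤ κ := (norm_nonneg _).trans (hκ 0)
  have h1q : (1 : ℝ≥0∞) ≤ ENNReal.ofReal q := by
    rw [← ENNReal.ofReal_one]; exact ENNReal.ofReal_le_ofReal hq
  have hker0 : ∀ z ∉ Metric.closedBall (x + r • p) (r * δ), scaledKernel K x r z = 0 := fun z hz =>
    image_eq_zero_of_notMem_tsupport fun h => hz (tsupport_scaledKernel_subset hKs x hr h)
  have e1 : ∫ z in Ω, scaledKernel K x r z • H z =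
      ∫ z in Metric.closedBall (x + r • p) (r * δ), scaledKernel K x r z • H z := by
    refine setIntegral_eq_of_subset_of_forall_sdiff_eq_zero hΩm hΩ fun z hz => ?_
    rw [hker0 z hz.2, zero_smul]
  have : IsFiniteMeasure (volume.restrict (Metric.closedBall (x + r • p) (r * δ)) : Measure E3) :=
    ⟨by rw [Measure.restrict_apply_univ]; exact (isCompact_closedBall _ _).measure_lt_top⟩
  have hgi : IntegrableOn g (Metric.closedBall (x + r • p) (r * δ)) :=
    (hg.mono_measure (Measure.restrict_mono hΩ le_rfl)).integrable h1q
  have hrδ : 0 ≤ r * δ := by positivity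
  calc ‖∫ z in Ω, scaledKernel K x r z • H z‖
      ≤ ∫ z in Metric.closedBall (x + r • p) (r * δ), (r⁻¹ ^ 3 * κ * B) * ‖g z‖ := by
        rw [e1]
        refine norm_integral_le_of_norm_le (hgi.norm.const_mul _) ?_
        refine (ae_restrict_iff' Metric.isClosed_closedBall.measurableSet).2
          (Eventually.of_forall fun z hz => ?_)
        rw [norm_smul, scaledKernel, norm_mul, Real.norm_of_nonneg (by positivity : 0 ≤ r⁻¹ ^ 3)]
        have := hH z hz
        calc r⁻¹ ^ 3 * ‖K (r⁻¹ • (z - x))‖ * ‖H z‖ ≤ r⁻¹ ^ 3 * κ * (B * ‖g z‖) := by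
              gcongr
              exact hκ _
          _ = _ := by ring
    _ ≤ (r⁻¹ ^ 3 * κ * B) * ((eLpNorm g (ENNReal.ofReal q) (spaceM Ω)).toReal *
        ((r * δ) ^ 3 * (volume (Metric.ball (0 : E3) 1)).toReal) ^ (1 - 1 / q)) := by
        rw [integral_const_mul]
        gcongr
        exact setIntegral_norm_closedBall_le hq hg hrδ hΩ
    _ = _ := by
        have h3 : ((r * δ) ^ 3 * (volume (Metric.ball (0 : E3) 1)).toReal) ^ (1 - 1 / q) =
            (r ^ 3 * r ^ (-(3 / q))) *
              (δ ^ 3 * (volume (Metric.ball (0 : E3) 1)).toReal) ^ (1 - 1 / q) := by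
          rw [mul_pow, mul_assoc, Real.mul_rpow (by positivity) (by positivity)]
          congr 1
          rw [← Real.rpow_natCast r 3, ← Real.rpow_mul hr.le, ← Real.rpow_add hr]
          congr 1
          push_cast
          ring
        rw [h3]
        field_simp

/-- Morrey's argument, with averages over balls inside a cone with vertex `x` so that it works up to
the boundary. As `r → 0` the averages tend to `f x` at Lebesgue points; at `r = r₀` they are
controlled by the `L^q` norm of `f`; and their `r`-derivative is `O(r^{-3/q})`, which is integrable
at `0` because `q > 3`. The constant is fixed before `Ω`, `f` and `x`, which allows patching over
the domain. -/
theorem ae_norm_le_of_cone [CompleteSpace F] {q : ℝ} (hq : 3 < q) (p : E3) {δ r₀ : ℝ} (hδ : 0 < δ)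
    (hr₀ : 0 < r₀) :
    ∃ C : ℝ, 0 ≤ C ∧ ∀ {Ω : Set E3} {f : E3 → F} {G : E3 → E3 →L[ℝ] F}, MeasurableSet Ω →
      volume Ω ≠ ⊤ → MemW1 Ω (ENNReal.ofReal q) f G →
      ∀ᵐ x, x ∈ Ω → (∀ r ∈ Ioc 0 r₀, Metric.closedBall (x + r • p) (r * δ) ⊆ Ω) →
        ‖f x‖ ≤ C * ((eLpNorm f (ENNReal.ofReal q) (spaceM Ω)).toReal +
          (eLpNorm G (ENNReal.ofReal q) (spaceM Ω)).toReal) := by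
  obtain ⟨K, hK, hKs, hKi⟩ : ∃ K : E3 → ℝ, ContDiff ℝ ∞ K ∧
      (∀ h, h ∉ Metric.closedBall p δ → K h = 0) ∧ ∫ h, K h = 1 := by
    let b : ContDiffBump p := ⟨δ / 2, δ, by positivity, by linarith⟩
    refine ⟨b.normed volume, b.contDiff_normed, fun h hh => ?_, b.integral_normed⟩
    apply image_eq_zero_of_notMem_tsupport
    rwa [b.tsupport_normed_eq]
  have hKc : HasCompactSupport K := HasCompactSupport.intro (isCompact_closedBall p δ) hKs
  obtain ⟨κ, hκ⟩ := hKc.exists_bound_of_continuous hK.continuous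
  have hκ0 : 0 ≤ κ := (norm_nonneg _).trans (hκ 0)
  set D : ℝ := (δ ^ 3 * (volume (Metric.ball (0 : E3) 1)).toReal) ^ (1 - 1 / q) with hD
  have hD0 : 0 ≤ D := by positivity
  set β : ℝ := 1 - 3 / q with hβ
  have hβ0 : 0 < β := by
    rw [hβ, sub_pos, div_lt_one (by linarith)]; exact hq
  have hq0 : 0 < q := by linarith
  set C₁ : ℝ := κ * (‖p‖ + δ) * D with hC₁
  have hC₁0 : 0 ≤ C₁ := by positivity
  set C₂ : ℝ := κ * 1 * D * r₀ ^ (-(3 / q)) with hC₂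
  have hC₂0 : 0 ≤ C₂ := by positivity
  refine ⟨C₂ + C₁ / β * r₀ ^ β, by positivity, ?_⟩
  intro Ω f G hΩm hΩv hfG
  obtain ⟨hw, hf, hG⟩ := hfG
  have : IsFiniteMeasure (spaceM Ω) := ⟨by
    rw [Measure.restrict_apply_univ]; exact hΩv.lt_top⟩
  have h1q : (1 : ℝ≥0∞) ≤ ENNReal.ofReal q := by
    rw [← ENNReal.ofReal_one]; exact ENNReal.ofReal_le_ofReal (by linarith)
  have hfi : IntegrableOn f Ω := hf.integrable h1q
  have hGi : IntegrableOn G Ω := hG.integrable h1q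
  set Nf := (eLpNorm f (ENNReal.ofReal q) (spaceM Ω)).toReal
  set NG := (eLpNorm G (ENNReal.ofReal q) (spaceM Ω)).toReal
  have hNf : 0 ≤ Nf := ENNReal.toReal_nonneg
  have hNG : 0 ≤ NG := ENNReal.toReal_nonneg
  have hfl : LocallyIntegrable (Ω.indicator f) volume :=
    ((integrable_indicator_iff hΩm).2 hfi).locallyIntegrable
  -- Lebesgue differentiation along balls not centred at `x`: the centre `x + r • p` is at distance
  -- `‖p‖ / δ` radii from `x`.
  filter_upwards [IsUnifLocDoublingMeasure.ae_tendsto_average_norm_sub volume hfl (‖p‖ / δ)]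
    with x hx hxΩ hcone
  set Φ : ℝ → F := fun r => ∫ z in Ω, scaledKernel K x r z • f z with hΦ
  have hder : ∀ r ∈ Ioc 0 r₀, HasDerivAt Φ
      (∫ z in Ω, scaledKernel K x r z • G z (r⁻¹ • (z - x))) r := fun r hr =>
    hasDerivAt_integral_scaledKernel hw hfi hGi hK hKs hr.1 (hcone r hr)
  have hderb : ∀ r ∈ Ioc 0 r₀, ‖∫ z in Ω, scaledKernel K x r z • G z (r⁻¹ • (z - x))‖ ≤
      C₁ * NG * r ^ (-(3 / q)) := by
    intro r hr
    refine norm_integral_scaledKernel_smul_le (by linarith) hΩm hG hδ.le hKs hκ hr.1 (hcone r hr)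
      (by positivity) fun z hz => ?_
    obtain ⟨h, hh, rfl⟩ := exists_mem_closedBall_of_mem hr.1 hz
    refine (ContinuousLinearMap.le_opNorm _ _).trans ?_
    rw [mul_comm]
    refine mul_le_mul_of_nonneg_right ?_ (norm_nonneg _)
    rw [add_sub_cancel_left, inv_smul_smul₀ hr.1.ne']
    have h2 := norm_le_norm_add_norm_sub' h p
    rw [Metric.mem_closedBall, dist_eq_norm] at hh
    linarith
  have hΦ₀ : ‖Φ r₀‖ ≤ C₂ * Nf := by
    have := norm_integral_scaledKernel_smul_le (B := 1) (H := f) (q := q) (by linarith) hΩm hf hδ.le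
      hKs hκ hr₀ (hcone r₀ ⟨hr₀, le_rfl⟩) zero_le_one (fun z _ => by simp)
    refine this.trans (le_of_eq ?_)
    rw [hC₂]; ring
  have hbound : ∀ r ∈ Ioc 0 r₀, ‖Φ r‖ ≤ C₂ * Nf + C₁ / β * r₀ ^ β * NG := by
    intro r hr
    have hsub : ∀ s ∈ Icc r r₀, s ∈ Ioc 0 r₀ := fun s hs => ⟨hr.1.trans_le hs.1, hs.2⟩
    -- Comparison with the primitive of `s ↦ C₁ NG s^{-3/q}` that vanishes at `s = r`; the exponents
    -- match because `β - 1 = -3/q`.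
    have := image_norm_le_of_norm_deriv_right_le_deriv_boundary' (a := r) (b := r₀)
      (f := fun s => Φ s - Φ r)
      (f' := fun s => ∫ z in Ω, scaledKernel K x s z • G z (s⁻¹ • (z - x)))
      (B := fun s => C₁ * NG / β * (s ^ β - r ^ β)) (B' := fun s => C₁ * NG * s ^ (-(3 / q)))
      (fun s hs => ((hder s (hsub s hs)).sub_const _).continuousAt.continuousWithinAt)
      (fun s hs => ((hder s (hsub s (Ico_subset_Icc_self hs))).sub_const _).hasDerivWithinAt)
      (by simp)
      (by
        have : ContinuousOn (fun s : ℝ => s ^ β) (Icc r r₀) := fun s hs =>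
          (Real.continuousAt_rpow_const s β (Or.inr hβ0.le)).continuousWithinAt
        fun_prop)
      (fun s hs => by
        have hs0 : 0 < s := (hsub s (Ico_subset_Icc_self hs)).1
        have h1 := ((Real.hasDerivAt_rpow_const (p := β) (Or.inl hs0.ne')).sub_const
          (r ^ β)).const_mul (C₁ * NG / β)
        refine (h1.congr_deriv ?_).hasDerivWithinAt
        have : β - 1 = -(3 / q) := by rw [hβ]; ring
        rw [this]
        field_simp)
      (fun s hs => hderb s (hsub s (Ico_subset_Icc_self hs)))
      (right_mem_Icc.2 hr.2)
    have h2 : ‖Φ r‖ ≤ ‖Φ r₀‖ + ‖Φ r₀ - Φ r‖ := by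
      have := norm_sub_norm_le (Φ r) (Φ r₀)
      rw [norm_sub_rev] at this
      linarith
    have h3 : C₁ * NG / β * (r₀ ^ β - r ^ β) ≤ C₁ / β * r₀ ^ β * NG := by
      have : 0 ≤ C₁ * NG / β * r ^ β := by
        have := Real.rpow_nonneg hr.1.le β
        positivity
      have h4 : C₁ * NG / β * (r₀ ^ β - r ^ β) =
        C₁ / β * r₀ ^ β * NG - C₁ * NG / β * r ^ β := by ring
      linarith
    linarith
  have hlim : Tendsto Φ (𝓝[>] 0) (𝓝 (f x)) := by
    have hr0 : ∀ᶠ r : ℝ in 𝓝[>] 0, r ∈ Ioc 0 r₀ := Ioc_mem_nhdsGT hr₀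
    have hx' := hx (l := 𝓝[>] (0 : ℝ)) (fun r => x + r • p) (fun r => r * δ)
      (by
        rw [tendsto_nhdsWithin_iff]
        refine ⟨?_, ?_⟩
        · have : Tendsto (fun r : ℝ => r * δ) (𝓝 0) (𝓝 (0 * δ)) :=
            (continuous_id.mul continuous_const).tendsto 0
          rw [zero_mul] at this
          exact this.mono_left nhdsWithin_le_nhds
        · filter_upwards [self_mem_nhdsWithin] with r hr
          exact mul_pos hr hδ)
      (by
        filter_upwards [self_mem_nhdsWithin] with r hr
        have hr' : (0 : ℝ) < r := hr
        rw [Metric.mem_closedBall, dist_eq_norm, sub_add_cancel_left, norm_neg, norm_smul,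
          Real.norm_of_nonneg hr'.le]
        field_simp
        exact le_rfl)
    rw [tendsto_iff_norm_sub_tendsto_zero]
    have hc : Tendsto (fun r => (κ * (δ ^ 3 * (volume (Metric.ball (0 : E3) 1)).toReal)) *
        ⨍ y in Metric.closedBall (x + r • p) (r * δ), ‖Ω.indicator f y - Ω.indicator f x‖)
        (𝓝[>] 0) (𝓝 0) := by
      have := hx'.const_mul (κ * (δ ^ 3 * (volume (Metric.ball (0 : E3) 1)).toReal))
      rwa [mul_zero] at this
    refine squeeze_zero' (Eventually.of_forall fun r => norm_nonneg _) ?_ hc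
    filter_upwards [hr0] with r hr
    have hker0 : ∀ z ∉ Metric.closedBall (x + r • p) (r * δ), scaledKernel K x r z = 0 :=
      fun z hz => image_eq_zero_of_notMem_tsupport fun h =>
        hz (tsupport_scaledKernel_subset hKs x hr.1 h)
    have hBm : MeasurableSet (Metric.closedBall (x + r • p) (r * δ)) :=
      Metric.isClosed_closedBall.measurableSet
    have hkc : Continuous (scaledKernel K x r) := (contDiff_scaledKernel hK x r).continuous
    have hkb : ∀ z, ‖scaledKernel K x r z‖ ≤ r⁻¹ ^ 3 * κ := fun z => by
      rw [scaledKernel, norm_mul, Real.norm_of_nonneg (by have := hr.1; positivity)]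
      exact mul_le_mul_of_nonneg_left (hκ _) (by have := hr.1; positivity)
    have hone : ∫ z in Metric.closedBall (x + r • p) (r * δ), scaledKernel K x r z = 1 := by
      rw [setIntegral_eq_integral_of_forall_compl_eq_zero hker0,
        integral_scaledKernel K x hr.1, hKi]
    have hBfin : volume (Metric.closedBall (x + r • p) (r * δ)) ≠ ⊤ :=
      (isCompact_closedBall _ _).measure_lt_top.ne
    have hBf : IsFiniteMeasure (volume.restrict (Metric.closedBall (x + r • p) (r * δ)) :
      Measure E3) := ⟨by rw [Measure.restrict_apply_univ]; exact hBfin.lt_top⟩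
    have hfB : IntegrableOn f (Metric.closedBall (x + r • p) (r * δ)) :=
      hfi.mono_set (hcone r hr)
    have e1 : Φ r - f x = ∫ z in Metric.closedBall (x + r • p) (r * δ),
        scaledKernel K x r z • (f z - f x) := by
      have e2 : Φ r = ∫ z in Metric.closedBall (x + r • p) (r * δ), scaledKernel K x r z • f z := by
        refine setIntegral_eq_of_subset_of_forall_sdiff_eq_zero hΩm (hcone r hr) fun z hz => ?_
        rw [hker0 z hz.2, zero_smul]
      have i1 : IntegrableOn (fun z => scaledKernel K x r z • f z)
          (Metric.closedBall (x + r • p) (r * δ)) :=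
        hfB.bdd_smul (r⁻¹ ^ 3 * κ) hkc.aestronglyMeasurable (Eventually.of_forall hkb)
      have i2 : IntegrableOn (fun z => scaledKernel K x r z • f x)
          (Metric.closedBall (x + r • p) (r * δ)) :=
        (integrable_const (f x)).bdd_smul (r⁻¹ ^ 3 * κ) hkc.aestronglyMeasurable
          (Eventually.of_forall hkb)
      simp_rw [smul_sub]
      rw [integral_sub i1 i2, integral_smul_const, hone, one_smul, e2]
    rw [e1]
    have hvol : (volume (Metric.closedBall (x + r • p) (r * δ))).toReal =
        (r * δ) ^ 3 * (volume (Metric.ball (0 : E3) 1)).toReal := by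
      rw [Measure.addHaar_closedBall volume _ (by have := hr.1; positivity), ENNReal.toReal_mul,
        ENNReal.toReal_ofReal (by have := hr.1; positivity)]
      simp
    have hvpos : 0 < (volume (Metric.ball (0 : E3) 1)).toReal :=
      ENNReal.toReal_pos (Metric.measure_ball_pos volume _ one_pos).ne'
        (measure_ball_lt_top).ne
    have e3 : ∫ y in Metric.closedBall (x + r • p) (r * δ),
        ‖Ω.indicator f y - Ω.indicator f x‖ =
        ∫ y in Metric.closedBall (x + r • p) (r * δ), ‖f y - f x‖ := by
      refine setIntegral_congr_fun hBm fun y hy => ?_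
      rw [indicator_of_mem (hcone r hr hy), indicator_of_mem hxΩ]
    rw [setAverage_eq, e3, smul_eq_mul, Measure.real, hvol]
    calc ‖∫ z in Metric.closedBall (x + r • p) (r * δ), scaledKernel K x r z • (f z - f x)‖
        ≤ ∫ z in Metric.closedBall (x + r • p) (r * δ), (r⁻¹ ^ 3 * κ) * ‖f z - f x‖ := by
          refine norm_integral_le_of_norm_le ((hfB.sub (integrable_const _)).norm.const_mul _)
            (Eventually.of_forall fun z => ?_)
          rw [norm_smul]
          exact mul_le_mul_of_nonneg_right (hkb z) (norm_nonneg _)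
      _ = _ := by
          rw [integral_const_mul]
          have := hr.1
          field_simp
  have h5 : ‖f x‖ ≤ C₂ * Nf + C₁ / β * r₀ ^ β * NG :=
    le_of_tendsto hlim.norm (by
      filter_upwards [Ioc_mem_nhdsGT hr₀] with r hr using hbound r hr)
  have h6 : 0 ≤ C₂ * NG := by positivity
  have h7 : 0 ≤ C₁ / β * r₀ ^ β * Nf := by positivity
  nlinarith

/-- Domains with `C²` boundary have the cone property. -/
lemma IsSmoothBoundedDomain.exists_cone {Ω : Set E3} (hΩ : IsSmoothBoundedDomain Ω) {x₀ : E3}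
    (hx₀ : x₀ ∈ closure Ω) :
    ∃ V ∈ 𝓝 x₀, ∃ (p : E3) (δ r₀ : ℝ), 0 < δ ∧ 0 < r₀ ∧
      ∀ x ∈ Ω, x ∈ V → ∀ r ∈ Ioc 0 r₀, Metric.closedBall (x + r • p) (r * δ) ⊆ Ω := by
  by_cases hin : x₀ ∈ Ω
  · obtain ⟨ε, hε, hεΩ⟩ := Metric.isOpen_iff.1 hΩ.isOpen x₀ hin
    -- At interior points the cone degenerates: with `p = 0` the averaging balls are centred at `x`.
    refine ⟨Metric.ball x₀ (ε / 2), Metric.ball_mem_nhds _ (by linarith), 0, ε / 4, 1,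
      by linarith, one_pos, fun x _ hxV r hr z hz => hεΩ ?_⟩
    rw [Metric.mem_closedBall, smul_zero, add_zero] at hz
    rw [Metric.mem_ball] at hxV ⊢
    have h1 : r * (ε / 4) ≤ 1 * (ε / 4) := mul_le_mul_of_nonneg_right hr.2 (by linarith)
    linarith [dist_triangle z x x₀]
  · have hfr : x₀ ∈ frontier Ω := by
      rw [frontier, hΩ.isOpen.interior_eq]; exact ⟨hx₀, hin⟩
    obtain ⟨U, g, hU, hxU, hg, hdg, hiff⟩ := hΩ.boundary x₀ hfr
    -- A direction of decrease of the defining function, hence pointing into `Ω`.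
    obtain ⟨p, hp⟩ : ∃ p, fderiv ℝ g x₀ p < 0 := by
      by_contra hcon
      push Not at hcon
      apply hdg
      ext v
      have h1 := hcon v
      have h2 := hcon (-v)
      rw [map_neg] at h2
      simp only [zero_apply]
      linarith
    have hc : ContinuousAt (fun zh : E3 × E3 => fderiv ℝ g zh.1 zh.2) (x₀, p) := by
      have h1 : ContinuousAt (fderiv ℝ g) x₀ :=
        (hg.continuousOn_fderiv_of_isOpen hU (by norm_num)).continuousAt (hU.mem_nhds hxU)
      have h2 : ContinuousAt (fun zh : E3 × E3 => fderiv ℝ g zh.1) (x₀, p) :=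
        ContinuousAt.comp (f := fun zh : E3 × E3 => zh.1) (x := (x₀, p)) h1 continuousAt_fst
      exact h2.clm_apply continuousAt_snd
    -- Decrease persists for base points near `x₀` and directions near `p`. Thus `g` decreases along
    -- every short segment `x + s • h` with `h` near `p`, and such a segment cannot leave `Ω`.
    have hev : ∀ᶠ zh : E3 × E3 in 𝓝 (x₀, p), zh.1 ∈ U ∧ fderiv ℝ g zh.1 zh.2 < 0 :=
      (continuousAt_fst.eventually (hU.mem_nhds hxU)).and (hc.eventually (gt_mem_nhds hp))
    obtain ⟨ε, hε, hball⟩ := Metric.eventually_nhds_iff_ball.1 hev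
    have hne : 0 < ‖p‖ + ε + 1 := by positivity
    refine ⟨Metric.ball x₀ (ε / 2), Metric.ball_mem_nhds _ (by linarith), p, ε / 2,
      ε / 2 / (‖p‖ + ε + 1), by linarith, by positivity, fun x hxΩ hxV r hr z hz => ?_⟩
    obtain ⟨h, hh, rfl⟩ := exists_mem_closedBall_of_mem hr.1 hz
    rw [Metric.mem_closedBall, dist_eq_norm] at hh
    rw [Metric.mem_ball] at hxV
    have hnh : ‖h‖ < ‖p‖ + ε + 1 := by
      have := norm_le_norm_add_norm_sub' h p
      linarith
    have hseg : ∀ s ∈ Icc 0 r, x + s • h ∈ U ∧ fderiv ℝ g (x + s • h) h < 0 := by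
      intro s hs
      refine hball (x + s • h, h) ?_
      rw [Metric.mem_ball, Prod.dist_eq, max_lt_iff]
      refine ⟨?_, by simp only [dist_eq_norm]; linarith⟩
      have h1 : dist (x + s • h) x ≤ ε / 2 := by
        rw [dist_eq_norm, add_sub_cancel_left, norm_smul, Real.norm_of_nonneg hs.1]
        have h2 : s ≤ ε / 2 / (‖p‖ + ε + 1) := hs.2.trans hr.2
        rw [le_div_iff₀ hne] at h2
        exact (mul_le_mul_of_nonneg_left hnh.le hs.1).trans h2
      linarith [dist_triangle (x + s • h) x x₀]
    have hd : ∀ s ∈ Icc 0 r, HasDerivAt (fun s : ℝ => g (x + s • h))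
        (fderiv ℝ g (x + s • h) h) s := by
      intro s hs
      have h1 : HasFDerivAt g (fderiv ℝ g (x + s • h)) (x + s • h) :=
        ((hg.differentiableOn (by norm_num)).differentiableAt
          (hU.mem_nhds (hseg s hs).1)).hasFDerivAt
      have h2 : HasDerivAt (fun s : ℝ => x + s • h) h s := by
        simpa using ((hasDerivAt_id s).smul_const h).const_add x
      exact h1.comp_hasDerivAt s h2
    obtain ⟨c, hc1, hc2⟩ := exists_hasDerivAt_eq_slope (fun s : ℝ => g (x + s • h))
      (fun s => fderiv ℝ g (x + s • h) h) hr.1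
      (fun s hs => (hd s hs).continuousAt.continuousWithinAt)
      (fun s hs => hd s (Ioo_subset_Icc_self hs))
    have h3 := (hseg c (Ioo_subset_Icc_self hc1)).2
    rw [hc2, div_neg_iff] at h3
    have hxU' : x ∈ U := by
      simpa using (hseg 0 ⟨le_rfl, hr.1.le⟩).1
    have hgx := (hiff x hxU').1 hxΩ
    refine (hiff _ (hseg r ⟨hr.1.le, le_rfl⟩).1).2 ?_
    have hrpos := hr.1
    simp only [zero_smul, add_zero, sub_zero] at h3
    rcases h3 with h3 | h3
    · linarith [h3.2]
    · linarith [h3.1]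

/-- **Morrey's sup bound** on a bounded domain with `C²` boundary. -/
theorem IsSmoothBoundedDomain.ae_norm_le [CompleteSpace F] {Ω : Set E3}
    (hΩ : IsSmoothBoundedDomain Ω) {q : ℝ} (hq : 3 < q) :
    ∃ C : ℝ, 0 ≤ C ∧ ∀ {f : E3 → F} {G : E3 → E3 →L[ℝ] F}, MemW1 Ω (ENNReal.ofReal q) f G →
      ∀ᵐ x ∂spaceM Ω, ‖f x‖ ≤ C * ((eLpNorm f (ENNReal.ofReal q) (spaceM Ω)).toReal +
          (eLpNorm G (ENNReal.ofReal q) (spaceM Ω)).toReal) := by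
  have hcomp : IsCompact (closure Ω) := hΩ.isBounded.isCompact_closure
  have hm := hΩ.isOpen.measurableSet
  have hv : volume Ω ≠ ⊤ := hΩ.isBounded.measure_lt_top.ne
  have key : ∃ C : ℝ, 0 ≤ C ∧ ∀ {f : E3 → F} {G : E3 → E3 →L[ℝ] F},
      MemW1 Ω (ENNReal.ofReal q) f G → ∀ᵐ x, x ∈ closure Ω → x ∈ Ω →
        ‖f x‖ ≤ C * ((eLpNorm f (ENNReal.ofReal q) (spaceM Ω)).toReal +
          (eLpNorm G (ENNReal.ofReal q) (spaceM Ω)).toReal) := by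
    -- The estimate on a set passes to subsets and finite unions, so by compactness of the closure
    -- it is enough to have it near each point, where one cone serves all nearby `x`.
    refine hcomp.induction_on (p := fun s => ∃ C : ℝ, 0 ≤ C ∧ ∀ {f : E3 → F}
      {G : E3 → E3 →L[ℝ] F}, MemW1 Ω (ENNReal.ofReal q) f G → ∀ᵐ x, x ∈ s → x ∈ Ω →
        ‖f x‖ ≤ C * ((eLpNorm f (ENNReal.ofReal q) (spaceM Ω)).toReal +
          (eLpNorm G (ENNReal.ofReal q) (spaceM Ω)).toReal)) ?_ ?_ ?_ ?_
    · exact ⟨0, le_rfl, fun _ => by simp⟩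
    · rintro s t hst ⟨C, hC, h⟩
      exact ⟨C, hC, fun hw => (h hw).mono fun x hx hxs => hx (hst hxs)⟩
    · rintro s t ⟨C, hC, h⟩ ⟨C', hC', h'⟩
      refine ⟨max C C', le_max_of_le_left hC, fun hw => ?_⟩
      filter_upwards [h hw, h' hw] with x hx hx' hxs hxΩ
      rcases hxs with hxs | hxs
      · refine (hx hxs hxΩ).trans ?_
        gcongr
        exact le_max_left _ _
      · refine (hx' hxs hxΩ).trans ?_
        gcongr
        exact le_max_right _ _
    · intro x₀ hx₀
      obtain ⟨V, hV, p, δ, r₀, hδ, hr₀, hcone⟩ := hΩ.exists_cone hx₀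
      obtain ⟨C, hC, h⟩ := ae_norm_le_of_cone (F := F) hq p hδ hr₀
      refine ⟨V, mem_nhdsWithin_of_mem_nhds hV, C, hC, fun hw => ?_⟩
      filter_upwards [h hm hv hw] with x hx hxV hxΩ
      exact hx hxΩ (hcone x hxΩ hxV)
  obtain ⟨C, hC, h⟩ := key
  refine ⟨C, hC, fun hw => ?_⟩
  rw [ae_restrict_iff' hm]
  filter_upwards [h hw] with x hx hxΩ using hx (subset_closure hxΩ) hxΩ

end Morrey

/-! ### Functions in `H₀¹`: approximation, embedding into `L⁴`, integration by parts. -/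

section HilbertSobolev

variable {F : Type*} [NormedAddCommGroup F] [NormedSpace ℝ F]

/-! ### Integrals of products of square integrable functions -/

lemma norm_integral_smul_le {α : Type*} [MeasurableSpace α] {μ : Measure α} {a : α → ℝ} {f : α → F}
    (ha : MemLp a 2 μ) (hf : MemLp f 2 μ) :
    ‖∫ x, a x • f x ∂μ‖ ≤ (eLpNorm a 2 μ).toReal * (eLpNorm f 2 μ).toReal := by
  have h1 : eLpNorm (a • f) 1 μ ≤ eLpNorm a 2 μ * eLpNorm f 2 μ :=
    eLpNorm_smul_le_mul_eLpNorm hf.1 ha.1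
  have h2 : ‖∫ x, a x • f x ∂μ‖ₑ ≤ eLpNorm (a • f) 1 μ := by
    rw [eLpNorm_one_eq_lintegral_enorm]
    exact enorm_integral_le_lintegral_enorm _
  have h3 := ENNReal.toReal_mono (ENNReal.mul_ne_top ha.2.ne hf.2.ne) (h2.trans h1)
  rwa [ENNReal.toReal_mul, toReal_enorm] at h3

lemma integrable_smul_of_memLp_two {α : Type*} [MeasurableSpace α] {μ : Measure α} {a : α → ℝ}
    {f : α → F} (ha : MemLp a 2 μ) (hf : MemLp f 2 μ) : Integrable (fun x => a x • f x) μ :=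
  memLp_one_iff_integrable.1 (hf.smul ha)

lemma tendsto_integral_smul_of_eLpNorm {α : Type*} [MeasurableSpace α] {μ : Measure α}
    {a : ℕ → α → ℝ} {a₀ : α → ℝ} {f : α → F} (ha : ∀ n, MemLp (a n) 2 μ) (ha₀ : MemLp a₀ 2 μ)
    (hf : MemLp f 2 μ)
    (hlim : Tendsto (fun n => eLpNorm (fun x => a₀ x - a n x) 2 μ) atTop (𝓝 0)) :
    Tendsto (fun n => ∫ x, a n x • f x ∂μ) atTop (𝓝 (∫ x, a₀ x • f x ∂μ)) := by
  rw [tendsto_iff_norm_sub_tendsto_zero]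
  have h1 : Tendsto (fun n => (eLpNorm (fun x => a₀ x - a n x) 2 μ).toReal *
      (eLpNorm f 2 μ).toReal) atTop (𝓝 0) := by
    have := ((ENNReal.tendsto_toReal ENNReal.zero_ne_top).comp hlim).mul_const
      (eLpNorm f 2 μ).toReal
    simpa using this
  refine squeeze_zero (fun n => norm_nonneg _) (fun n => ?_) h1
  rw [norm_sub_rev, ← integral_sub (integrable_smul_of_memLp_two ha₀ hf)
    (integrable_smul_of_memLp_two (ha n) hf)]
  simp_rw [← sub_smul]
  exact norm_integral_smul_le (ha₀.sub (ha n)) hf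

section NormedGroup

/-! Instances of general facts at normed groups, which speed up unification. -/

variable {α : Type*} [MeasurableSpace α] {μ : Measure α} {N : Type*} [NormedAddCommGroup N]

lemma eLpNorm_spaceM_eq_of_support_subset {Ω : Set E3} {g : E3 → N} {p : ℝ≥0∞}
    (h : Function.support g ⊆ Ω) : eLpNorm g p (spaceM Ω) = eLpNorm g p volume :=
  eLpNorm_restrict_eq_of_support_subset h

lemma eLpNorm_add_le_normed {f g : α → N} {p : ℝ≥0∞} (hf : AEStronglyMeasurable f μ)
    (hg : AEStronglyMeasurable g μ) (hp : 1 ≤ p) :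
    eLpNorm (f + g) p μ ≤ eLpNorm f p μ + eLpNorm g p μ := eLpNorm_add_le hf hg hp

lemma memLp_add_normed {f g : α → N} {p : ℝ≥0∞} (hf : MemLp f p μ) (hg : MemLp g p μ) :
    MemLp (fun x => f x + g x) p μ := hf.add hg

end NormedGroup

/-! ### Approximation of functions in `H₀¹` -/

lemma memLp_of_contDiff_of_hasCompactSupport {η : E3 → F} (h1 : ContDiff ℝ ∞ η)
    (h2 : HasCompactSupport η) (Ω : Set E3) (p : ℝ≥0∞) :
    MemLp η p (spaceM Ω) ∧ MemLp (fderiv ℝ η) p (spaceM Ω) :=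
  ⟨(h1.continuous.memLp_of_hasCompactSupport h2).restrict _,
    ((h1.continuous_fderiv (by simp)).memLp_of_hasCompactSupport (h2.fderiv ℝ)).restrict _⟩

/-- The passage to a subsequence provides convergence almost everywhere, which Fatou's lemma needs
in the embedding into `L⁴`. -/
lemma MemH10.exists_seq {Ω : Set E3} {f : E3 → F} {G : E3 → E3 →L[ℝ] F} (h : MemH10 Ω f G) :
    ∃ η : ℕ → E3 → F, (∀ n, ContDiff ℝ ∞ (η n) ∧ HasCompactSupport (η n) ∧ tsupport (η n) ⊆ Ω) ∧
      Tendsto (fun n => eLpNorm (fun x => f x - η n x) 2 (spaceM Ω)) atTop (𝓝 0) ∧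
      Tendsto (fun n => eLpNorm (fun x => G x - fderiv ℝ (η n) x) 2 (spaceM Ω)) atTop (𝓝 0) ∧
      ∀ᵐ x ∂spaceM Ω, Tendsto (fun n => η n x) atTop (𝓝 (f x)) := by
  have hpos : ∀ n : ℕ, (0 : ℝ≥0∞) < ((n : ℝ≥0∞) + 1)⁻¹ := fun n => by
    rw [ENNReal.inv_pos]; exact ENNReal.add_ne_top.2 ⟨ENNReal.natCast_ne_top n, ENNReal.one_ne_top⟩
  choose η h1 h2 h3 h4 h5 using fun n : ℕ => h.2.2 _ (hpos n)
  have hz : Tendsto (fun n : ℕ => ((n : ℝ≥0∞) + 1)⁻¹) atTop (𝓝 0) := by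
    have := ENNReal.tendsto_inv_nat_nhds_zero.comp (tendsto_add_atTop_nat 1)
    refine this.congr fun n => ?_
    simp
  have h6 : Tendsto (fun n => eLpNorm (fun x => f x - η n x) 2 (spaceM Ω)) atTop (𝓝 0) :=
    tendsto_of_tendsto_of_tendsto_of_le_of_le tendsto_const_nhds hz (fun _ => zero_le)
      fun n => (h4 n).le
  have h7 : Tendsto (fun n => eLpNorm (fun x => G x - fderiv ℝ (η n) x) 2 (spaceM Ω)) atTop
      (𝓝 0) :=
    tendsto_of_tendsto_of_tendsto_of_le_of_le tendsto_const_nhds hz (fun _ => zero_le)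
      fun n => (h5 n).le
  have h8 : TendstoInMeasure (spaceM Ω) η atTop f := by
    refine tendstoInMeasure_of_tendsto_eLpNorm two_ne_zero
      (fun n => (memLp_of_contDiff_of_hasCompactSupport (h1 n) (h2 n) Ω 2).1.1) h.1.1 ?_
    refine h6.congr fun n => ?_
    rw [eLpNorm_sub_comm]
    rfl
  obtain ⟨ns, hns, hae⟩ := h8.exists_seq_tendsto_ae
  exact ⟨fun n => η (ns n), fun n => ⟨h1 _, h2 _, h3 _⟩, h6.comp hns.tendsto_atTop,
    h7.comp hns.tendsto_atTop, hae⟩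

/-- The embedding `H₀¹ ⊂ L⁴`. -/
theorem MemH10.eLpNorm_four_le [FiniteDimensional ℝ F] {Ω : Set E3} (hΩ : volume Ω ≠ ⊤) :
    ∃ C : ℝ≥0∞, C ≠ ⊤ ∧ ∀ {f : E3 → F} {G : E3 → E3 →L[ℝ] F}, MemH10 Ω f G →
      eLpNorm f 4 (spaceM Ω) ≤ C * eLpNorm G 2 (spaceM Ω) := by
  set c : ℝ≥0∞ := (SNormLESNormFDerivOfEqConst F (volume : Measure E3) (2 : NNReal) : ℝ≥0∞)
  set v : ℝ≥0∞ := (spaceM Ω univ) ^ (1 / (4 : ℝ≥0∞).toReal - 1 / (6 : ℝ≥0∞).toReal) with hv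
  have hvtop : v ≠ ⊤ := by
    refine ENNReal.rpow_ne_top_of_nonneg (by norm_num) ?_
    rwa [Measure.restrict_apply_univ]
  refine ⟨c * v, ENNReal.mul_ne_top ENNReal.coe_ne_top hvtop, fun {f G} h => ?_⟩
  obtain ⟨η, hη, -, h7, hae⟩ := h.exists_seq
  -- For test functions the Sobolev inequality on the whole space bounds the `L⁶` norm; the finite
  -- measure of `Ω` lowers the exponent to `4`, and the bound passes to the limit by Fatou's lemma.
  have hs : ∀ n, eLpNorm (η n) 4 (spaceM Ω) ≤ c * v * eLpNorm (fderiv ℝ (η n)) 2 (spaceM Ω) := by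
    intro n
    obtain ⟨h1, h2, h3⟩ := hη n
    have g1 : eLpNorm (η n) 6 volume ≤ c * eLpNorm (fderiv ℝ (η n)) 2 volume := by
      have := eLpNorm_le_eLpNorm_fderiv_of_eq (volume : Measure E3) (h1.of_le (by simp)) h2
        (p := 2) (p' := 6) (by norm_num) (by simp) (by simp; norm_num)
      exact_mod_cast this
    have g2 : eLpNorm (η n) 4 (spaceM Ω) ≤ eLpNorm (η n) 6 (spaceM Ω) * v :=
      eLpNorm_le_eLpNorm_mul_rpow_measure_univ (by norm_num)
        (memLp_of_contDiff_of_hasCompactSupport h1 h2 Ω 2).1.1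
    have g3 : eLpNorm (fderiv ℝ (η n)) 2 volume = eLpNorm (fderiv ℝ (η n)) 2 (spaceM Ω) := by
      refine (eLpNorm_spaceM_eq_of_support_subset ?_).symm
      exact (subset_tsupport _).trans ((tsupport_fderiv_subset ℝ).trans h3)
    calc eLpNorm (η n) 4 (spaceM Ω) ≤ eLpNorm (η n) 6 (spaceM Ω) * v := g2
      _ ≤ eLpNorm (η n) 6 volume * v := by gcongr; exact Measure.restrict_le_self
      _ ≤ c * eLpNorm (fderiv ℝ (η n)) 2 volume * v := by gcongr
      _ = _ := by rw [g3]; ring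
  have hlim := Lp.eLpNorm_lim_le_liminf_eLpNorm (p := 4) (μ := spaceM Ω) (f := η)
    (fun n => (memLp_of_contDiff_of_hasCompactSupport (hη n).1 (hη n).2.1 Ω 2).1.1) f hae
  refine hlim.trans ?_
  have hb : ∀ n, eLpNorm (η n) 4 (spaceM Ω) ≤ c * v * (eLpNorm G 2 (spaceM Ω) +
      eLpNorm (fun x => G x - fderiv ℝ (η n) x) 2 (spaceM Ω)) := by
    intro n
    refine (hs n).trans ?_
    gcongr
    have hm := (memLp_of_contDiff_of_hasCompactSupport (hη n).1 (hη n).2.1 Ω 2).2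
    have : fderiv ℝ (η n) = G - fun x => (G x - fderiv ℝ (η n) x) := by ext1 x; simp
    conv_lhs => rw [this]
    exact eLpNorm_sub_le h.2.1.1 (h.2.1.1.sub hm.1) (by norm_num)
  have ht : Tendsto (fun n => c * v * (eLpNorm G 2 (spaceM Ω) +
      eLpNorm (fun x => G x - fderiv ℝ (η n) x) 2 (spaceM Ω))) atTop
      (𝓝 (c * v * (eLpNorm G 2 (spaceM Ω) + 0))) :=
    ENNReal.Tendsto.const_mul (h7.const_add _)
      (Or.inr (ENNReal.mul_ne_top ENNReal.coe_ne_top hvtop))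
  rw [add_zero] at ht
  refine le_trans ?_ (le_of_eq ht.liminf_eq)
  exact liminf_le_liminf (Eventually.of_forall hb)

/-- Integration by parts against a function in `H₀¹`. -/
theorem HasWeakDeriv.integral_smul_eq {Ω : Set E3} {f : E3 → F} {G : E3 → E3 →L[ℝ] F}
    (hfG : HasWeakDeriv Ω f G) (hf : MemLp f 2 (spaceM Ω)) (hG : MemLp G 2 (spaceM Ω))
    {w : E3 → ℝ} {Dw : E3 → E3 →L[ℝ] ℝ} (hw : MemH10 Ω w Dw) (v : E3) :
    ∫ x in Ω, (Dw x v) • f x = -∫ x in Ω, w x • G x v := by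
  obtain ⟨η, hη, h6, h7, -⟩ := hw.exists_seq
  have hm := fun n => memLp_of_contDiff_of_hasCompactSupport (hη n).1 (hη n).2.1 Ω 2
  have happ : ∀ {F' : Type _} [NormedAddCommGroup F'] [NormedSpace ℝ F'] {L : E3 → E3 →L[ℝ] F'},
      MemLp L 2 (spaceM Ω) → MemLp (fun x => L x v) 2 (spaceM Ω) := fun hL =>
    hL.of_le_mul (c := ‖v‖) (hL.1.apply_continuousLinearMap v)
      (Eventually.of_forall fun x => by
        rw [mul_comm]; exact ContinuousLinearMap.le_opNorm _ _)
  have hGv : MemLp (fun x => G x v) 2 (spaceM Ω) := hG.of_le_mul (c := ‖v‖)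
    (hG.1.apply_continuousLinearMap v) (Eventually.of_forall fun x => by
        rw [mul_comm]; exact ContinuousLinearMap.le_opNorm _ _)
  have t1 : Tendsto (fun n => ∫ x in Ω, η n x • G x v) atTop (𝓝 (∫ x in Ω, w x • G x v)) :=
    tendsto_integral_smul_of_eLpNorm (fun n => (hm n).1) hw.1 hGv h6
  have t2 : Tendsto (fun n => ∫ x in Ω, (fderiv ℝ (η n) x v) • f x) atTop
      (𝓝 (∫ x in Ω, (Dw x v) • f x)) := by
    refine tendsto_integral_smul_of_eLpNorm (fun n => happ (hm n).2) (happ hw.2.1) hf ?_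
    have h8 : Tendsto (fun n => ENNReal.ofReal ‖v‖ *
        eLpNorm (fun x => Dw x - fderiv ℝ (η n) x) 2 (spaceM Ω)) atTop (𝓝 0) := by
      have := ENNReal.Tendsto.const_mul h7 (a := ENNReal.ofReal ‖v‖) (Or.inr ENNReal.ofReal_ne_top)
      rwa [mul_zero] at this
    refine tendsto_of_tendsto_of_tendsto_of_le_of_le tendsto_const_nhds h8 (fun _ => zero_le)
      fun n => ?_
    refine eLpNorm_le_mul_eLpNorm_of_ae_le_mul (Eventually.of_forall fun x => ?_) 2
    rw [mul_comm]
    exact ContinuousLinearMap.le_opNorm (Dw x - fderiv ℝ (η n) x) v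
  have h9 : ∀ n, ∫ x in Ω, (fderiv ℝ (η n) x v) • f x = -∫ x in Ω, η n x • G x v := fun n =>
    hfG.2.2 (η n) (hη n).1 (hη n).2.1 (hη n).2.2 v
  refine tendsto_nhds_unique t2 ?_
  simp_rw [h9]
  exact t1.neg

/-- The components of a vector field in `H₀¹` are in `H₀¹`. -/
lemma MemH10.clm_comp {F' : Type*} [NormedAddCommGroup F'] [NormedSpace ℝ F'] {Ω : Set E3}
    {f : E3 → F} {G : E3 → E3 →L[ℝ] F} (h : MemH10 Ω f G) (L : F →L[ℝ] F') :
    MemH10 Ω (fun x => L (f x)) (fun x => L.comp (G x)) := by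
  have hGL : ∀ A : E3 →L[ℝ] F, ‖L.comp A‖ ≤ ‖L‖ * ‖A‖ := fun A => L.opNorm_comp_le A
  refine ⟨L.comp_memLp' h.1, ?_, fun ε hε => ?_⟩
  · refine h.2.1.of_le_mul (c := ‖L‖) ?_ (Eventually.of_forall fun x => hGL _)
    exact (ContinuousLinearMap.compL ℝ E3 F F' L).continuous.comp_aestronglyMeasurable h.2.1.1
  set c : ℝ≥0∞ := ENNReal.ofReal ‖L‖ + 1 with hc
  have hc0 : c ≠ 0 := by simp [hc]
  have hct : c ≠ ⊤ := by simp [hc]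
  obtain ⟨η, h1, h2, h3, h4, h5⟩ := h.2.2 (ε / c) (ENNReal.div_pos hε.ne' hct)
  refine ⟨fun x => L (η x), L.contDiff.comp h1, h2.comp_left (map_zero L),
    (tsupport_comp_subset (map_zero L) η).trans h3, ?_, ?_⟩
  · refine lt_of_le_of_lt ?_ (ENNReal.mul_lt_of_lt_div' h4)
    refine (eLpNorm_le_mul_eLpNorm_of_ae_le_mul (c := ‖L‖) (g := fun x => f x - η x)
      (Eventually.of_forall fun x => ?_) 2).trans ?_
    · rw [← map_sub]; exact L.le_opNorm _
    · gcongr; exact le_self_add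
  · refine lt_of_le_of_lt ?_ (ENNReal.mul_lt_of_lt_div' h5)
    refine (eLpNorm_le_mul_eLpNorm_of_ae_le_mul (c := ‖L‖) (g := fun x => G x - fderiv ℝ η x)
      (Eventually.of_forall fun x => ?_) 2).trans ?_
    · have : fderiv ℝ (fun x => L (η x)) x = L.comp (fderiv ℝ η x) :=
        (L.hasFDerivAt.comp x (h1.differentiable (by simp) x).hasFDerivAt).fderiv
      rw [this, ← ContinuousLinearMap.comp_sub]
      exact hGL _
    · gcongr; exact le_self_add

/-- Multiplication by smooth functions preserves `H₀¹` on bounded domains. -/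
lemma MemH10.smooth_mul {Ω : Set E3} (hΩ : Bornology.IsBounded Ω) (hΩm : MeasurableSet Ω)
    {f : E3 → ℝ} {G : E3 → E3 →L[ℝ] ℝ}
    (h : MemH10 Ω f G) {ψ : E3 → ℝ} (hψ : ContDiff ℝ ∞ ψ) :
    MemH10 Ω (fun x => ψ x * f x) (fun x => ψ x • G x + f x • fderiv ℝ ψ x) := by
  have hψ' : Continuous (fderiv ℝ ψ) := hψ.continuous_fderiv (by simp)
  obtain ⟨B₁, hB₁⟩ := hΩ.isCompact_closure.exists_bound_of_continuousOn hψ.continuous.continuousOn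
  obtain ⟨B₂, hB₂⟩ := hΩ.isCompact_closure.exists_bound_of_continuousOn hψ'.continuousOn
  set B := max (max B₁ B₂) 0 with hB
  have b1 : ∀ᵐ x ∂spaceM Ω, ‖ψ x‖ ≤ B := (ae_restrict_iff' hΩm).2 <| Eventually.of_forall
    fun x hx => (hB₁ x (subset_closure hx)).trans ((le_max_left _ _).trans (le_max_left _ _))
  have b2 : ∀ᵐ x ∂spaceM Ω, ‖fderiv ℝ ψ x‖ ≤ B := (ae_restrict_iff' hΩm).2 <| Eventually.of_forall
    fun x hx => (hB₂ x (subset_closure hx)).trans ((le_max_right _ _).trans (le_max_left _ _))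
  have m1 : ∀ {f : E3 → ℝ}, MemLp f 2 (spaceM Ω) → MemLp (fun x => ψ x * f x) 2 (spaceM Ω) :=
    fun {f} hf => hf.of_le_mul (c := B) (hψ.continuous.aestronglyMeasurable.mul hf.1) (by
      filter_upwards [b1] with x hx
      rw [norm_mul]; exact mul_le_mul_of_nonneg_right hx (norm_nonneg _))
  have m2 : ∀ {G : E3 → E3 →L[ℝ] ℝ}, MemLp G 2 (spaceM Ω) →
      MemLp (fun x => ψ x • G x) 2 (spaceM Ω) :=
    fun {f} hf => hf.of_le_mul (c := B) (hψ.continuous.aestronglyMeasurable.smul hf.1) (by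
      filter_upwards [b1] with x hx
      rw [norm_smul]; exact mul_le_mul_of_nonneg_right hx (norm_nonneg _))
  have m3 : ∀ {f : E3 → ℝ}, MemLp f 2 (spaceM Ω) →
      MemLp (fun x => f x • fderiv ℝ ψ x) 2 (spaceM Ω) :=
    fun {f} hf => hf.of_le_mul (c := B) (hf.1.smul hψ'.aestronglyMeasurable) (by
      filter_upwards [b2] with x hx
      rw [norm_smul, mul_comm]; exact mul_le_mul_of_nonneg_right hx (norm_nonneg _))
  refine ⟨m1 h.1, memLp_add_normed (m2 h.2.1) (m3 h.1), fun ε₀ hε₀ => ?_⟩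
  -- The tolerance is capped at `1` to be finite, since strict inequalities are multiplied by `ε /
  -- c` below.
  obtain ⟨ε, hε, hεt, hεε⟩ : ∃ ε : ℝ≥0∞, 0 < ε ∧ ε ≠ ⊤ ∧ ε ≤ ε₀ :=
    ⟨min ε₀ 1, lt_min hε₀ one_pos, (min_le_right _ _).trans_lt ENNReal.one_lt_top |>.ne,
      min_le_left _ _⟩
  set c : ℝ≥0∞ := ENNReal.ofReal B + ENNReal.ofReal B + 1 with hc
  have hc0 : c ≠ 0 := by simp [hc]
  have hct : c ≠ ⊤ := by simp [hc]
  obtain ⟨η, h1, h2, h3, h4, h5⟩ := h.2.2 (ε / c) (ENNReal.div_pos hε.ne' hct)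
  have hmη := memLp_of_contDiff_of_hasCompactSupport h1 h2 Ω 2
  refine ⟨fun x => ψ x * η x, hψ.mul h1, h2.mul_left, tsupport_mul_subset_right.trans h3,
    lt_of_lt_of_le ?_ hεε, lt_of_lt_of_le ?_ hεε⟩
  · refine lt_of_le_of_lt ?_ (ENNReal.mul_lt_of_lt_div' h4)
    refine (eLpNorm_le_mul_eLpNorm_of_ae_le_mul (c := B) (g := fun x => f x - η x) ?_ 2).trans ?_
    · filter_upwards [b1] with x hx
      rw [← mul_sub, norm_mul]; exact mul_le_mul_of_nonneg_right hx (norm_nonneg _)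
    · gcongr; rw [hc, add_assoc]; exact le_self_add
  · have e1 : (fun x => ψ x • G x + f x • fderiv ℝ ψ x - fderiv ℝ (fun x => ψ x * η x) x) =
        (fun x => ψ x • (G x - fderiv ℝ η x)) + fun x => (f x - η x) • fderiv ℝ ψ x := by
      ext1 x
      have := fderiv_mul (hψ.differentiable (by simp) x) (h1.differentiable (by simp) x)
      simp only [Pi.mul_def] at this
      rw [this]
      simp only [Pi.add_apply, smul_sub, sub_smul]
      abel
    rw [e1]
    refine lt_of_le_of_lt (eLpNorm_add_le_normed (m2 (h.2.1.sub hmη.2)).1 (m3 (h.1.sub hmη.1)).1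
      (by norm_num)) ?_
    have q1 : eLpNorm (fun x => ψ x • (G x - fderiv ℝ η x)) 2 (spaceM Ω) ≤
        ENNReal.ofReal B * (ε / c) := by
      refine (eLpNorm_le_mul_eLpNorm_of_ae_le_mul (c := B) (g := fun x => G x - fderiv ℝ η x)
        ?_ 2).trans ?_
      · filter_upwards [b1] with x hx
        rw [norm_smul]; exact mul_le_mul_of_nonneg_right hx (norm_nonneg _)
      · gcongr
    have q2 : eLpNorm (fun x => (f x - η x) • fderiv ℝ ψ x) 2 (spaceM Ω) ≤
        ENNReal.ofReal B * (ε / c) := by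
      refine (eLpNorm_le_mul_eLpNorm_of_ae_le_mul (c := B) (g := fun x => f x - η x)
        ?_ 2).trans ?_
      · filter_upwards [b2] with x hx
        rw [norm_smul, mul_comm]; exact mul_le_mul_of_nonneg_right hx (norm_nonneg _)
      · gcongr
    refine lt_of_le_of_lt (add_le_add q1 q2) ?_
    have hεc : ε / c ≠ ⊤ := (ENNReal.div_lt_top hεt hc0).ne
    have hεc0 : ε / c ≠ 0 := (ENNReal.div_pos hε.ne' hct).ne'
    calc ENNReal.ofReal B * (ε / c) + ENNReal.ofReal B * (ε / c)
        = (ENNReal.ofReal B + ENNReal.ofReal B) * (ε / c) := by ring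
      _ < c * (ε / c) := by
          rw [ENNReal.mul_lt_mul_iff_left hεc0 hεc]
          exact ENNReal.lt_add_right (by simp) one_ne_zero
      _ = ε := ENNReal.mul_div_cancel hc0 hct

end HilbertSobolev

/-! ### The divergence of the mass flux. -/

section Flux

variable {F : Type*} [NormedAddCommGroup F] [NormedSpace ℝ F]

lemma integrable_smul_of_tsupport_subset {Ω : Set E3} {f : E3 → F} (hf : LocallyIntegrableOn f Ω)
    {ψ : E3 → ℝ} (hψ : Continuous ψ) (hc : HasCompactSupport ψ) (hs : tsupport ψ ⊆ Ω) :
    Integrable (fun x => ψ x • f x) := by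
  obtain ⟨B, hB⟩ := hc.exists_bound_of_continuous hψ
  have h1 : IntegrableOn f (tsupport ψ) := hf.integrableOn_compact_subset hs hc
  have h2 : IntegrableOn (fun x => ψ x • f x) (tsupport ψ) :=
    h1.bdd_smul B hψ.aestronglyMeasurable (Eventually.of_forall hB)
  refine (integrableOn_iff_integrable_of_support_subset ?_).1 h2
  refine (Function.support_smul_subset_left ψ f).trans (subset_tsupport ψ)

lemma setIntegral_smul_eq_of_tsupport_subset {Ω : Set E3} {f : E3 → F}
    {ψ : E3 → ℝ} (hs : tsupport ψ ⊆ Ω) : ∫ x in Ω, ψ x • f x = ∫ x, ψ x • f x := by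
  refine setIntegral_eq_integral_of_forall_compl_eq_zero fun x hx => ?_
  rw [image_eq_zero_of_notMem_tsupport fun h => hx (hs h), zero_smul]

lemma memLp_clm_apply {α : Type*} [MeasurableSpace α] {μ : Measure α} {p : ℝ≥0∞}
    {L : α → E3 →L[ℝ] F} (hL : MemLp L p μ) (v : E3) : MemLp (fun x => L x v) p μ :=
  hL.of_le_mul (c := ‖v‖) (hL.1.apply_continuousLinearMap v)
    (Eventually.of_forall fun x => by rw [mul_comm]; exact ContinuousLinearMap.le_opNorm _ _)

lemma memLp_coord {α : Type*} [MeasurableSpace α] {μ : Measure α} {p : ℝ≥0∞}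
    {g : α → E3} (hg : MemLp g p μ) (i : Fin 3) : MemLp (fun x => g x i) p μ :=
  (EuclideanSpace.proj i : E3 →L[ℝ] ℝ).comp_memLp' hg

lemma memLp_smooth_mul {Ω : Set E3} (hΩ : Bornology.IsBounded Ω) (hΩm : MeasurableSet Ω)
    {ψ : E3 → ℝ} (hψ : Continuous ψ) {p : ℝ≥0∞} {f : E3 → ℝ} (hf : MemLp f p (spaceM Ω)) :
    MemLp (fun x => ψ x * f x) p (spaceM Ω) := by
  obtain ⟨B, hB⟩ := hΩ.isCompact_closure.exists_bound_of_continuousOn hψ.continuousOn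
  refine hf.of_le_mul (c := B) (hψ.aestronglyMeasurable.mul hf.1) ?_
  refine (ae_restrict_iff' hΩm).2 (Eventually.of_forall fun x hx => ?_)
  rw [norm_mul]
  exact mul_le_mul_of_nonneg_right (hB x (subset_closure hx)) (norm_nonneg _)

/-- The weak product rule for `ρ uᵢ`, tested with arbitrary smooth functions; the boundary term
vanishes because `u ∈ H₀¹`. -/
lemma integral_fderiv_mul_flux {Ω : Set E3} (hΩ : Bornology.IsBounded Ω) (hΩm : MeasurableSet Ω)
    {ρ : E3 → ℝ} {Dρ : E3 → E3 →L[ℝ] ℝ} (hρ : HasWeakDeriv Ω ρ Dρ) (hρ2 : MemLp ρ 2 (spaceM Ω))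
    (hDρ2 : MemLp Dρ 2 (spaceM Ω)) {u : E3 → E3} {Du : E3 → E3 →L[ℝ] E3} (hu : MemH10 Ω u Du)
    {ψ : E3 → ℝ} (hψ : ContDiff ℝ ∞ ψ) (i : Fin 3) (v : E3) :
    ∫ x in Ω, fderiv ℝ ψ x v * (ρ x * u x i) =
      -∫ x in Ω, ψ x * (ρ x * (Du x v) i + u x i * Dρ x v) := by
  have hui : MemH10 Ω (fun x => u x i) _ := hu.clm_comp (EuclideanSpace.proj i : E3 →L[ℝ] ℝ)
  -- The product `ψ uᵢ` is in `H₀¹` although `ψ` need not vanish on the boundary, so it may be used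
  -- as a test function for `ρ`.
  have key := hρ.integral_smul_eq hρ2 hDρ2 (hui.smooth_mul hΩ hΩm hψ) v
  have hψv : Continuous fun x => fderiv ℝ ψ x v := by
    have := hψ.continuous_fderiv (by simp)
    fun_prop
  have mu : MemLp (fun x => u x i) 2 (spaceM Ω) := memLp_coord hu.1 i
  have mDu : MemLp (fun x => (Du x v) i) 2 (spaceM Ω) := memLp_coord (memLp_clm_apply hu.2.1 v) i
  have i1 : Integrable (fun x => ψ x * (Du x v) i * ρ x) (spaceM Ω) :=
    integrable_smul_of_memLp_two (memLp_smooth_mul hΩ hΩm hψ.continuous mDu) hρ2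
  have i2 : Integrable (fun x => fderiv ℝ ψ x v * u x i * ρ x) (spaceM Ω) :=
    integrable_smul_of_memLp_two (memLp_smooth_mul hΩ hΩm hψv mu) hρ2
  have i3 : Integrable (fun x => ψ x * u x i * Dρ x v) (spaceM Ω) :=
    integrable_smul_of_memLp_two (memLp_smooth_mul hΩ hΩm hψ.continuous mu) (memLp_clm_apply hDρ2 v)
  have e1 : ∫ x in Ω, ((ψ x • (EuclideanSpace.proj i : E3 →L[ℝ] ℝ).comp (Du x) +
      u x i • fderiv ℝ ψ x) v) • ρ x =
      (∫ x in Ω, ψ x * (Du x v) i * ρ x) + ∫ x in Ω, fderiv ℝ ψ x v * u x i * ρ x := by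
    rw [← integral_add i1 i2]
    refine integral_congr_ae (Eventually.of_forall fun x => ?_)
    simp
    ring
  have e2 : ∫ x in Ω, ψ x * (ρ x * (Du x v) i + u x i * Dρ x v) =
      (∫ x in Ω, ψ x * (Du x v) i * ρ x) + ∫ x in Ω, ψ x * u x i * Dρ x v := by
    rw [← integral_add i1 i3]
    refine integral_congr_ae (Eventually.of_forall fun x => ?_)
    simp only []
    ring
  have e3 : ∫ x in Ω, fderiv ℝ ψ x v * (ρ x * u x i) =
      ∫ x in Ω, fderiv ℝ ψ x v * u x i * ρ x := by
    refine integral_congr_ae (Eventually.of_forall fun x => ?_)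
    simp only []
    ring
  rw [e1] at key
  simp only [smul_eq_mul] at key
  rw [e3, e2]
  linarith

/-- `∫ div (ρ u) ψ = - ∫ ρ u · ∇ψ` for smooth `ψ`, without boundary term since `u ∈ H₀¹`. -/
theorem integral_mul_divOf_flux {Ω : Set E3} (hΩo : IsOpen Ω) (hΩ : Bornology.IsBounded Ω)
    {ρ : E3 → ℝ} {Dρ : E3 → E3 →L[ℝ] ℝ} (hρ : HasWeakDeriv Ω ρ Dρ) (hρ2 : MemLp ρ 2 (spaceM Ω))
    (hDρ2 : MemLp Dρ 2 (spaceM Ω)) {u : E3 → E3} {Du : E3 → E3 →L[ℝ] E3} (hu : MemH10 Ω u Du)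
    {DM : E3 → E3 →L[ℝ] E3} (hM : HasWeakDeriv Ω (fun x => ρ x • u x) DM)
    {ψ : E3 → ℝ} (hψ : ContDiff ℝ ∞ ψ) :
    ∫ x in Ω, ψ x * divOf (DM x) = -∫ x in Ω, ρ x * fderiv ℝ ψ x (u x) := by
  have hΩm := hΩo.measurableSet
  have mu : ∀ i, MemLp (fun x => u x i) 2 (spaceM Ω) := fun i => memLp_coord hu.1 i
  have mDu : ∀ i v, MemLp (fun x => (Du x v) i) 2 (spaceM Ω) := fun i v =>
    memLp_coord (memLp_clm_apply hu.2.1 v) i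
  have hNi : ∀ i v, Integrable (fun x => ρ x * (Du x v) i + u x i * Dρ x v) (spaceM Ω) :=
    fun i v => (integrable_smul_of_memLp_two hρ2 (mDu i v)).add
      (integrable_smul_of_memLp_two (mu i) (memLp_clm_apply hDρ2 v))
  -- Compactly supported tests identify the given derivative of `ρ u` with the product rule
  -- expression, almost everywhere. The latter is integrated by parts against arbitrary smooth `ψ`,
  -- so the identity carries over to `DM`.
  have hae : ∀ i v, ∀ᵐ x ∂spaceM Ω, (DM x v) i = ρ x * (Du x v) i + u x i * Dρ x v := by
    intro i v
    have hDMv : LocallyIntegrableOn (fun x => (DM x v) i) Ω := by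
      have h1 : LocallyIntegrableOn DM Ω := hM.2.1
      intro x hx
      obtain ⟨t, ht, hti⟩ := h1 x hx
      exact ⟨t, ht, ((EuclideanSpace.proj i : E3 →L[ℝ] ℝ).comp
        (ContinuousLinearMap.apply ℝ E3 v)).integrable_comp hti⟩
    have hN : LocallyIntegrableOn (fun x => ρ x * (Du x v) i + u x i * Dρ x v) Ω :=
      IntegrableOn.locallyIntegrableOn (hNi i v)
    have := hΩo.ae_eq_zero_of_integral_contDiff_smul_eq_zero (hDMv.sub hN) (μ := volume) ?_
    · rw [ae_restrict_iff' hΩm]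
      filter_upwards [this] with x hx hxΩ
      exact sub_eq_zero.1 (hx hxΩ)
    intro g hg hgc hgs
    have j1 := integrable_smul_of_tsupport_subset hDMv hg.continuous hgc hgs
    have j2 := integrable_smul_of_tsupport_subset hN hg.continuous hgc hgs
    have e1 := integral_fderiv_mul_flux hΩ hΩm hρ hρ2 hDρ2 hu hg i v
    have e2 := hM.2.2 g hg hgc hgs v
    have hDMl : LocallyIntegrableOn (fun x => DM x v) Ω := by
      intro x hx
      obtain ⟨t, ht, hti⟩ := hM.2.1 x hx
      exact ⟨t, ht, (ContinuousLinearMap.apply ℝ E3 v).integrable_comp hti⟩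
    have j3 := (integrable_smul_of_tsupport_subset hDMl hg.continuous hgc hgs).integrableOn (s := Ω)
    have hgv : Continuous fun x => fderiv ℝ g x v := by
      have := hg.continuous_fderiv (by simp)
      fun_prop
    have j4 := (integrable_smul_of_tsupport_subset hM.1 hgv (hgc.fderiv_apply ℝ v)
      ((tsupport_fderiv_apply_subset ℝ v).trans hgs)).integrableOn (s := Ω)
    have e3 := congrArg (EuclideanSpace.proj i : E3 →L[ℝ] ℝ) e2
    rw [map_neg, ← ContinuousLinearMap.integral_comp_comm _ j3,
      ← ContinuousLinearMap.integral_comp_comm _ j4] at e3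
    simp only [map_smul, PiLp.proj_apply, smul_eq_mul] at e3
    have e4 : ∫ x, g x • ((fun x => (DM x v) i) - fun x =>
        ρ x * (Du x v) i + u x i * Dρ x v) x =
        (∫ x in Ω, g x • (DM x v) i) - ∫ x in Ω, g x • (ρ x * (Du x v) i + u x i * Dρ x v) := by
      rw [setIntegral_smul_eq_of_tsupport_subset hgs, setIntegral_smul_eq_of_tsupport_subset hgs,
        ← integral_sub j1 j2]
      simp only [Pi.sub_apply, smul_sub]
    rw [e4]
    simp only [smul_eq_mul]
    rw [e1] at e3
    linarith
  have e5 : ∫ x in Ω, ψ x * divOf (DM x) =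
      ∑ i, ∫ x in Ω, ψ x * (ρ x * (Du x (e i)) i + u x i * Dρ x (e i)) := by
    have hinteg : ∀ i, Integrable (fun x => ψ x * (ρ x * (Du x (e i)) i + u x i * Dρ x (e i)))
        (spaceM Ω) := fun i => memLp_one_iff_integrable.1
      (memLp_smooth_mul hΩ hΩm hψ.continuous (memLp_one_iff_integrable.2 (hNi i (e i))))
    rw [← integral_finsetSum _ fun i _ => hinteg i]
    refine integral_congr_ae ?_
    filter_upwards [ae_all_iff.2 fun i => hae i (e i)] with x hx
    simp only [divOf, hx, Finset.mul_sum]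
  have hψv : ∀ v, Continuous fun x => fderiv ℝ ψ x v := fun v => by
    have := hψ.continuous_fderiv (by simp)
    fun_prop
  rw [e5]
  have e6 : ∀ i, ∫ x in Ω, ψ x * (ρ x * (Du x (e i)) i + u x i * Dρ x (e i)) =
      -∫ x in Ω, fderiv ℝ ψ x (e i) * (ρ x * u x i) := fun i => by
    rw [integral_fderiv_mul_flux hΩ hΩm hρ hρ2 hDρ2 hu hψ i (e i), neg_neg]
  simp_rw [e6]
  rw [Finset.sum_neg_distrib, ← integral_finsetSum]
  · congr 1
    refine integral_congr_ae (Eventually.of_forall fun x => ?_)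
    simp only []
    rw [map_eq_sum_coord (fderiv ℝ ψ x) (u x), Finset.mul_sum]
    refine Finset.sum_congr rfl fun i _ => ?_
    rw [smul_eq_mul]; ring
  · intro i _
    refine memLp_one_iff_integrable.1 (memLp_smooth_mul hΩ hΩm (hψv (e i)) ?_)
    exact memLp_one_iff_integrable.2 (integrable_smul_of_memLp_two hρ2 (mu i))

end Flux

/-! ### Lipschitz representatives of functions in `H₀¹` with bounded gradient. -/

section Lipschitz

variable {F : Type*} [NormedAddCommGroup F] [NormedSpace ℝ F]

lemma norm_convolution_le {k : E3 → ℝ} {κ : ℝ} (hκ : ∀ x, ‖k x‖ ≤ κ) {h : E3 → F}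
    (hh : Integrable h) (x : E3) :
    ‖convolution k h (ContinuousLinearMap.lsmul ℝ ℝ) volume x‖ ≤ κ * ∫ z, ‖h z‖ := by
  rw [convolution_def, ← integral_const_mul, ← integral_sub_left_eq_self (fun z => κ * ‖h z‖) _ x]
  refine norm_integral_le_of_norm_le ((hh.comp_sub_left x).norm.const_mul κ)
    (Eventually.of_forall fun t => ?_)
  simp only [ContinuousLinearMap.lsmul_apply, norm_smul]
  exact mul_le_mul_of_nonneg_right (hκ t) (norm_nonneg _)

lemma norm_convolution_le_of_ae_le {k : E3 → ℝ} (hk0 : ∀ x, 0 ≤ k x) (hki : Integrable k)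
    (hk1 : ∫ x, k x = 1)
    {h : E3 → F} {a : ℝ} (hh : ∀ᵐ x, ‖h x‖ ≤ a) (x : E3) :
    ‖convolution k h (ContinuousLinearMap.lsmul ℝ ℝ) volume x‖ ≤ a := by
  rw [convolution_def]
  have hae : ∀ᵐ t, ‖h (x - t)‖ ≤ a :=
    (Measure.measurePreserving_sub_left volume x).quasiMeasurePreserving.ae hh
  calc _ ≤ ∫ t, k t * a := by
        refine norm_integral_le_of_norm_le (hki.mul_const a) ?_
        filter_upwards [hae] with t ht
        simp only [ContinuousLinearMap.lsmul_apply, norm_smul, Real.norm_of_nonneg (hk0 t)]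
        exact mul_le_mul_of_nonneg_left ht (hk0 t)
    _ = a := by rw [integral_mul_const, hk1, one_mul]

lemma integrable_indicator_of_memLp_two {N : Type*} [NormedAddCommGroup N] {Ω : Set E3}
    (hΩm : MeasurableSet Ω) [IsFiniteMeasure (spaceM Ω)] {f : E3 → N} (hf : MemLp f 2 (spaceM Ω)) :
    Integrable (Ω.indicator f) :=
  (integrable_indicator_iff hΩm).2 (hf.integrable (by norm_num))

lemma tendsto_integral_norm_of_eLpNorm_two {N : Type*} [NormedAddCommGroup N] {Ω : Set E3}
    (hΩ : volume Ω ≠ ⊤) {h : ℕ → E3 → N} (hm : ∀ n, MemLp (h n) 2 (spaceM Ω))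
    (hlim : Tendsto (fun n => eLpNorm (h n) 2 (spaceM Ω)) atTop (𝓝 0)) :
    Tendsto (fun n => ∫ x in Ω, ‖h n x‖) atTop (𝓝 0) := by
  have : IsFiniteMeasure (spaceM Ω) := ⟨by
    rw [Measure.restrict_apply_univ]; exact hΩ.lt_top⟩
  have h1 : Tendsto (fun n => eLpNorm (h n) 1 (spaceM Ω)) atTop (𝓝 0) := by
    have h2 : Tendsto (fun n => eLpNorm (h n) 2 (spaceM Ω) *
        spaceM Ω univ ^ (1 / (1 : ℝ≥0∞).toReal - 1 / (2 : ℝ≥0∞).toReal)) atTop (𝓝 0) := by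
      have := ENNReal.Tendsto.mul_const hlim (b := spaceM Ω univ ^
        (1 / (1 : ℝ≥0∞).toReal - 1 / (2 : ℝ≥0∞).toReal))
        (Or.inr (ENNReal.rpow_ne_top_of_nonneg (by norm_num) (measure_ne_top _ _)))
      rwa [zero_mul] at this
    exact tendsto_of_tendsto_of_tendsto_of_le_of_le tendsto_const_nhds h2 (fun _ => zero_le)
      fun n => eLpNorm_le_eLpNorm_mul_rpow_measure_univ (by norm_num) (hm n).1
  refine ((ENNReal.tendsto_toReal ENNReal.zero_ne_top).comp h1).congr fun n => ?_
  rw [Function.comp, eLpNorm_one_eq_lintegral_enorm, integral_norm_eq_lintegral_enorm (hm n).1]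

lemma tendsto_integral_norm_sub_indicator {N : Type*} [NormedAddCommGroup N] {Ω : Set E3}
    (hΩm : MeasurableSet Ω) (hΩ : volume Ω ≠ ⊤) {g : E3 → N} {h : ℕ → E3 → N}
    (hg : MemLp g 2 (spaceM Ω)) (hh : ∀ n, MemLp (h n) 2 (spaceM Ω))
    (h0 : ∀ n, ∀ x ∉ Ω, h n x = 0)
    (hlim : Tendsto (fun n => eLpNorm (fun x => g x - h n x) 2 (spaceM Ω)) atTop (𝓝 0)) :
    Tendsto (fun n => ∫ x, ‖(h n - Ω.indicator g) x‖) atTop (𝓝 0) := by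
  refine (tendsto_integral_norm_of_eLpNorm_two hΩ (h := fun n x => g x - h n x)
    (fun n => hg.sub (hh n)) hlim).congr fun n => ?_
  rw [← setIntegral_eq_integral_of_forall_compl_eq_zero (s := Ω)
    (f := fun x => ‖(h n - Ω.indicator g) x‖)]
  · refine setIntegral_congr_fun hΩm fun x hx => ?_
    simp only [Pi.sub_apply]
    rw [indicator_of_mem hx, norm_sub_rev]
  · intro x hx
    rw [Pi.sub_apply, h0 n x hx, indicator_of_notMem hx, sub_zero, norm_zero]

/-- A function in `H₀¹(Ω)` with bounded gradient, extended by zero, has a Lipschitz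
representative on the whole space. -/
theorem MemH10.exists_lipschitzWith [FiniteDimensional ℝ F] {Ω : Set E3} (hΩm : MeasurableSet Ω)
    (hΩ : volume Ω ≠ ⊤) {f : E3 → F} {G : E3 → E3 →L[ℝ] F} (h : MemH10 Ω f G) {a : NNReal}
    (ha : ∀ᵐ x ∂spaceM Ω, ‖G x‖ ≤ a) :
    ∃ g : E3 → F, LipschitzWith (lipschitzExtensionConstant F * a) g ∧
      g =ᵐ[volume] Ω.indicator f := by
  have : CompleteSpace F := FiniteDimensional.complete ℝ F
  have hfin : IsFiniteMeasure (spaceM Ω) := ⟨by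
    rw [Measure.restrict_apply_univ]; exact hΩ.lt_top⟩
  obtain ⟨η, hη, h6, h7, -⟩ := h.exists_seq
  have hmem := fun n => memLp_of_contDiff_of_hasCompactSupport (hη n).1 (hη n).2.1 Ω 2
  have hmem1 := fun n => memLp_of_contDiff_of_hasCompactSupport (hη n).1 (hη n).2.1 univ 1
  have hfi : Integrable (Ω.indicator f) :=
    integrable_indicator_of_memLp_two hΩm h.1
  have hGi : Integrable (Ω.indicator G) :=
    integrable_indicator_of_memLp_two hΩm h.2.1
  have hηi : ∀ n, Integrable (η n) := fun n => by
    have := memLp_one_iff_integrable.1 (hmem1 n).1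
    rwa [spaceM, Measure.restrict_univ] at this
  have hDηi : ∀ n, Integrable (fderiv ℝ (η n)) := fun n => by
    have := memLp_one_iff_integrable.1 (hmem1 n).2
    rwa [spaceM, Measure.restrict_univ] at this
  have hη0 : ∀ n, ∀ x ∉ Ω, η n x = 0 := fun n x hx =>
    image_eq_zero_of_notMem_tsupport fun hh => hx ((hη n).2.2 hh)
  have hDη0 : ∀ n, ∀ x ∉ Ω, fderiv ℝ (η n) x = 0 := fun n x hx =>
    image_eq_zero_of_notMem_tsupport fun hh => hx ((hη n).2.2 (tsupport_fderiv_subset ℝ hh))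
  have l1 : Tendsto (fun n => ∫ x, ‖(η n - Ω.indicator f) x‖) atTop (𝓝 0) :=
    tendsto_integral_norm_sub_indicator hΩm hΩ h.1 (fun n => (hmem n).1) hη0 h6
  have l2 : Tendsto (fun n => ∫ x, ‖(fderiv ℝ (η n) - Ω.indicator G) x‖) atTop (𝓝 0) :=
    tendsto_integral_norm_sub_indicator hΩm hΩ h.2.1 (fun n => (hmem n).2) hDη0 h7
  let φ : ℕ → ContDiffBump (0 : E3) := fun n =>
    ⟨1 / ((n : ℝ) + 1) / 2, 1 / ((n : ℝ) + 1), by positivity,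
      half_lt_self (by positivity)⟩
  -- For a fixed mollifier `k`, the convolution `k * η n` is differentiable with gradient `k * ∇η
  -- n`, of norm at most `a` plus a multiple of the `L¹` distance between `∇η n` and `G` extended by
  -- zero. Letting `n → ∞` removes the error. No geometry of `Ω` enters, since everything takes
  -- place on the whole space.
  have hLip : ∀ m x y, ‖convolution ((φ m).normed volume) (Ω.indicator f)
      (ContinuousLinearMap.lsmul ℝ ℝ) volume x - convolution ((φ m).normed volume) (Ω.indicator f)
      (ContinuousLinearMap.lsmul ℝ ℝ) volume y‖ ≤ a * ‖x - y‖ := by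
    intro m x y
    set k := (φ m).normed volume with hk
    have hkc : Continuous k := (φ m).continuous_normed
    have hks : HasCompactSupport k := (φ m).hasCompactSupport_normed
    have hki : Integrable k := hkc.integrable_of_hasCompactSupport hks
    have hk0 : ∀ x, 0 ≤ k x := fun x => (φ m).nonneg_normed x
    have hk1 : ∫ x, k x = 1 := (φ m).integral_normed
    obtain ⟨κ, hκ⟩ := hks.exists_bound_of_continuous hkc
    have hexF : ∀ {g : E3 → E3 →L[ℝ] F},
        Integrable g → ConvolutionExists k g (ContinuousLinearMap.lsmul ℝ ℝ) volume :=
      fun hg => hks.convolutionExists_left _ hkc hg.locallyIntegrable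
    have c1 : ∀ x, Tendsto (fun n => convolution k (η n) (ContinuousLinearMap.lsmul ℝ ℝ) volume x)
        atTop (𝓝 (convolution k (Ω.indicator f) (ContinuousLinearMap.lsmul ℝ ℝ) volume x)) := by
      intro x
      rw [tendsto_iff_norm_sub_tendsto_zero]
      have := l1.const_mul κ
      rw [mul_zero] at this
      refine squeeze_zero (fun n => norm_nonneg _) (fun n => ?_) this
      have e1 : convolution k (η n) (ContinuousLinearMap.lsmul ℝ ℝ) volume x -
          convolution k (Ω.indicator f) (ContinuousLinearMap.lsmul ℝ ℝ) volume x =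
          convolution k (η n - Ω.indicator f) (ContinuousLinearMap.lsmul ℝ ℝ) volume x := by
        rw [convolution_def, convolution_def, convolution_def, ← integral_sub]
        · simp only [Pi.sub_apply, map_sub]
        · exact hks.convolutionExists_left _ hkc (hηi n).locallyIntegrable x
        · exact hks.convolutionExists_left _ hkc hfi.locallyIntegrable x
      rw [e1]
      exact norm_convolution_le hκ ((hηi n).sub hfi) x
    have c2 : ∀ n, ‖convolution k (η n) (ContinuousLinearMap.lsmul ℝ ℝ) volume x -
        convolution k (η n) (ContinuousLinearMap.lsmul ℝ ℝ) volume y‖ ≤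
        (a + κ * ∫ x, ‖(fderiv ℝ (η n) - Ω.indicator G) x‖) * ‖x - y‖ := by
      intro n
      have hd : ∀ z, HasFDerivAt (convolution k (η n) (ContinuousLinearMap.lsmul ℝ ℝ) volume)
          (convolution k (fderiv ℝ (η n)) (ContinuousLinearMap.lsmul ℝ ℝ) volume z) z := by
        intro z
        have := (hη n).2.1.hasFDerivAt_convolution_right (ContinuousLinearMap.lsmul ℝ ℝ)
          (μ := volume) hki.locallyIntegrable ((hη n).1.of_le (by simp)) z
        have e0 : convolution k (fderiv ℝ (η n)) (ContinuousLinearMap.lsmul ℝ ℝ) volume z =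
            convolution k (fderiv ℝ (η n)) (ContinuousLinearMap.precompR E3
              (ContinuousLinearMap.lsmul ℝ ℝ)) volume z := by
          rw [convolution_def, convolution_def]
          congr 1
        rw [e0]
        exact this
      refine (convex_univ.norm_image_sub_le_of_norm_hasFDerivWithin_le
        (fun z _ => (hd z).hasFDerivWithinAt) (fun z _ => ?_) (mem_univ y) (mem_univ x))
      have e1 : convolution k (fderiv ℝ (η n)) (ContinuousLinearMap.lsmul ℝ ℝ) volume z =
          convolution k (Ω.indicator G) (ContinuousLinearMap.lsmul ℝ ℝ) volume z +
          convolution k (fderiv ℝ (η n) - Ω.indicator G)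
            (ContinuousLinearMap.lsmul ℝ ℝ) volume z := by
        rw [convolution_def, convolution_def, convolution_def, ← integral_add]
        · simp only [Pi.sub_apply, map_sub, add_sub_cancel]
        · exact hexF hGi z
        · exact hexF ((hDηi n).sub hGi) z
      rw [e1]
      refine (norm_add_le _ _).trans (add_le_add ?_ ?_)
      · refine norm_convolution_le_of_ae_le hk0 hki hk1 ?_ z
        have := (ae_restrict_iff' hΩm).1 ha
        filter_upwards [this] with x hx
        by_cases hxΩ : x ∈ Ω
        · rw [indicator_of_mem hxΩ]; exact hx hxΩ
        · rw [indicator_of_notMem hxΩ, norm_zero]; exact a.2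
      · exact norm_convolution_le hκ ((hDηi n).sub hGi) z
    have c3 : Tendsto (fun n => (a + κ * ∫ x, ‖(fderiv ℝ (η n) - Ω.indicator G) x‖) * ‖x - y‖)
        atTop (𝓝 ((a + κ * 0) * ‖x - y‖)) :=
      ((l2.const_mul κ).const_add _).mul_const _
    rw [mul_zero, add_zero] at c3
    exact le_of_tendsto_of_tendsto' ((c1 x).sub (c1 y)).norm c3 c2
  have hZ : ∀ᵐ x, Tendsto (fun m => convolution ((φ m).normed volume) (Ω.indicator f)
      (ContinuousLinearMap.lsmul ℝ ℝ) volume x) atTop (𝓝 (Ω.indicator f x)) := by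
    refine ContDiffBump.ae_convolution_tendsto_right_of_locallyIntegrable (K := 2) (φ := φ) ?_
      ?_ hfi.locallyIntegrable
    · exact tendsto_one_div_add_atTop_nhds_zero_nat
    · refine Eventually.of_forall fun n => ?_
      show 1 / ((n : ℝ) + 1) ≤ 2 * (1 / ((n : ℝ) + 1) / 2)
      linarith
  set Z := {x | Tendsto (fun m => convolution ((φ m).normed volume) (Ω.indicator f)
      (ContinuousLinearMap.lsmul ℝ ℝ) volume x) atTop (𝓝 (Ω.indicator f x))} with hZdef
  -- On the set of full measure where the mollifications converge, the extension of `f` by zero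
  -- inherits their constant `a`. Extending a vector-valued map from this set to the whole space
  -- costs the factor `lipschitzExtensionConstant F`.
  have hZL : LipschitzOnWith a (Ω.indicator f) Z := by
    refine LipschitzOnWith.of_dist_le_mul fun x hx y hy => ?_
    rw [dist_eq_norm, dist_eq_norm]
    exact le_of_tendsto' (hx.sub hy).norm fun m => hLip m x y
  obtain ⟨g, hg, hgZ⟩ := hZL.extend_finite_dimension
  refine ⟨g, hg, ?_⟩
  filter_upwards [hZ] with x hx using (hgZ hx).symm

end Lipschitz

/-! ### Weak time derivatives and primitives. -/

section Time

variable {F : Type*} [NormedAddCommGroup F] [NormedSpace ℝ F]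

/-- Integration by parts for a primitive. -/
lemma integral_deriv_smul_primitive [CompleteSpace F] {a b : ℝ} {G : ℝ → F}
    (hG : IntegrableOn G (Ioo a b)) {χ : ℝ → ℝ} (hχ : ContDiff ℝ ∞ χ) (hs : tsupport χ ⊆ Ioo a b)
    (hc : HasCompactSupport χ) :
    ∫ t in Ioo a b, deriv χ t • ∫ s in a..t, G s = -∫ t in Ioo a b, χ t • G t := by
  have hχ' : Continuous (deriv χ) := hχ.continuous_deriv (by simp)
  obtain ⟨B, hB⟩ := hc.deriv.exists_bound_of_continuous hχ'
  -- Preparation for Fubini's theorem on the triangle `s < t`: for fixed `s` the integral of `χ'`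
  -- over `(s, b)` is `-χ s`.
  have hinteg : Integrable (fun z : ℝ × ℝ => (Iio z.1).indicator (fun _ => deriv χ z.1) z.2 • G z.2)
      ((volume.restrict (Ioo a b)).prod (volume.restrict (Ioo a b))) := by
    have h1 : Integrable (fun z : ℝ × ℝ => G z.2)
        ((volume.restrict (Ioo a b)).prod (volume.restrict (Ioo a b))) := hG.comp_snd _
    have e : (fun z : ℝ × ℝ => (Iio z.1).indicator (fun _ => deriv χ z.1) z.2) =
        {z : ℝ × ℝ | z.2 < z.1}.indicator (fun z => deriv χ z.1) := by
      ext z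
      simp only [indicator_apply, mem_Iio, mem_ofPred_eq]
    refine h1.bdd_smul B ?_ (Eventually.of_forall fun z => ?_)
    · rw [e]
      refine (Continuous.aestronglyMeasurable (by fun_prop)).indicator ?_
      exact measurableSet_lt measurable_snd measurable_fst
    · refine (norm_indicator_le_norm_self _ _).trans (hB _)
  have h1 : ∫ t in Ioo a b, deriv χ t • ∫ s in a..t, G s =
      ∫ t in Ioo a b, ∫ s in Ioo a b, (Iio t).indicator (fun _ => deriv χ t) s • G s := by
    refine setIntegral_congr_fun measurableSet_Ioo fun t ht => ?_
    rw [intervalIntegral.integral_of_le ht.1.le, ← integral_smul, integral_Ioc_eq_integral_Ioo]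
    have e : (fun s => (Iio t).indicator (fun _ => deriv χ t) s • G s) =
        (Iio t).indicator (fun s => deriv χ t • G s) := by
      ext s
      by_cases hs : s < t
      · rw [indicator_of_mem (mem_Iio.2 hs), indicator_of_mem (mem_Iio.2 hs)]
      · rw [indicator_of_notMem (by simpa using hs), indicator_of_notMem (by simpa using hs),
          zero_smul]
    rw [e, setIntegral_indicator measurableSet_Iio, Ioo_inter_Iio, min_eq_right ht.2.le]
  rw [h1, integral_integral_swap hinteg, ← integral_neg]
  refine setIntegral_congr_fun measurableSet_Ioo fun s hs' => ?_
  rw [integral_smul_const, ← neg_smul]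
  congr 1
  have e : (fun t => (Iio t).indicator (fun _ => deriv χ t) s) = (Ioi s).indicator (deriv χ) := by
    ext t
    simp only [indicator_apply, mem_Iio, mem_Ioi]
  rw [e, setIntegral_indicator measurableSet_Ioi, inter_comm, Ioi_inter_Ioo, max_eq_left hs'.1.le,
    ← integral_Ioc_eq_integral_Ioo, ← intervalIntegral.integral_of_le hs'.2.le,
    intervalIntegral.integral_deriv_eq_sub (fun t _ => hχ.differentiable (by simp) t)
      (hχ'.intervalIntegrable _ _)]
  have : χ b = 0 := image_eq_zero_of_notMem_tsupport fun h => (lt_irrefl b (hs h).2)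
  rw [this, zero_sub]

lemma exists_bump_Ioo {a b : ℝ} (hab : a < b) : ∃ χ : ℝ → ℝ, ContDiff ℝ ∞ χ ∧
    HasCompactSupport χ ∧ tsupport χ ⊆ Ioo a b ∧ ∫ t, χ t = 1 := by
  let β : ContDiffBump ((a + b) / 2) := ⟨(b - a) / 8, (b - a) / 4, by linarith, by linarith⟩
  refine ⟨β.normed volume, β.contDiff_normed, β.hasCompactSupport_normed, ?_, β.integral_normed⟩
  rw [β.tsupport_normed_eq]
  intro x hx
  rw [Real.closedBall_eq_Icc] at hx
  have h1 : β.rOut = (b - a) / 4 := rfl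
  rw [h1] at hx
  constructor <;> linarith [hx.1, hx.2]

/-- The primitive starting at `a` vanishes before the support of `ζ`, and also after it because the
total integral is zero; hence it is again a test function on the interval. -/
lemma exists_primitive_of_integral_eq_zero {a b : ℝ} {ζ : ℝ → ℝ} (hζ : ContDiff ℝ ∞ ζ)
    (hc : HasCompactSupport ζ) (hs : tsupport ζ ⊆ Ioo a b) (h0 : ∫ t, ζ t = 0) :
    ∃ X : ℝ → ℝ, ContDiff ℝ ∞ X ∧ HasCompactSupport X ∧ tsupport X ⊆ Ioo a b ∧ deriv X = ζ := by
  by_cases hne : (tsupport ζ).Nonempty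
  · obtain ⟨c, hcm, hcl⟩ := hc.exists_isLeast hne
    obtain ⟨d, hdm, hdl⟩ := hc.exists_isGreatest hne
    have hsub : tsupport ζ ⊆ Icc c d := fun t ht => ⟨hcl ht, hdl ht⟩
    have hζ0 : ∀ t ∉ Icc c d, ζ t = 0 := fun t ht =>
      image_eq_zero_of_notMem_tsupport fun h => ht (hsub h)
    have hder : ∀ t, HasDerivAt (fun t => ∫ s in a..t, ζ s) (ζ t) t := fun t =>
      intervalIntegral.integral_hasDerivAt_right (hζ.continuous.intervalIntegrable _ _)
        (hζ.continuous.stronglyMeasurableAtFilter _ _) hζ.continuous.continuousAt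
    have hd : deriv (fun t => ∫ s in a..t, ζ s) = ζ := funext fun t => (hder t).deriv
    have hz : ∀ t ∉ Icc c d, ∫ s in a..t, ζ s = 0 := by
      intro t ht
      rcases lt_or_ge t c with htc | htc
      · refine intervalIntegral.integral_zero_ae (Eventually.of_forall fun s hs' => ?_)
        refine hζ0 s fun h => ?_
        have h1 : s ≤ max a t := (mem_uIoc.1 hs').elim (fun h => h.2.trans (le_max_right _ _))
          (fun h => h.2.trans (le_max_left _ _))
        have h2 := (hs hcm).1
        exact absurd h.1 (not_le.2 (h1.trans_lt (max_lt h2 htc)))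
      · have htd : d < t := by
          by_contra hcon
          exact ht ⟨htc, not_lt.1 hcon⟩
        rw [intervalIntegral.integral_of_le ((hs hcm).1.le.trans htc),
          setIntegral_eq_integral_of_forall_compl_eq_zero, h0]
        intro s hs'
        refine hζ0 s fun h => hs' ⟨(hs hcm).1.trans_le h.1, h.2.trans htd.le⟩
    refine ⟨fun t => ∫ s in a..t, ζ s, ?_, HasCompactSupport.intro isCompact_Icc hz, ?_, hd⟩
    · rw [contDiff_infty_iff_deriv, hd]
      exact ⟨fun t => (hder t).differentiableAt, hζ⟩
    · refine (closure_minimal (fun t ht => ?_) isClosed_Icc).trans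
        (Icc_subset_Ioo (hs hcm).1 (hs hdm).2)
      by_contra hcon
      exact ht (hz t hcon)
  · have hz : ζ = 0 := by
      rw [not_nonempty_iff_eq_empty, tsupport_eq_empty_iff] at hne
      exact hne
    refine ⟨0, contDiff_const, HasCompactSupport.zero, by simp [tsupport], ?_⟩
    rw [hz]
    ext t
    simp

/-- A function on an interval with an integrable weak derivative is a.e. a primitive of it. -/
theorem ae_eq_add_primitive_of_weak_deriv [CompleteSpace F] {a b : ℝ} (hab : a < b) {f G : ℝ → F}
    (hf : IntegrableOn f (Ioo a b)) (hG : IntegrableOn G (Ioo a b))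
    (h : ∀ χ : ℝ → ℝ, ContDiff ℝ ∞ χ → HasCompactSupport χ → tsupport χ ⊆ Ioo a b →
      ∫ t in Ioo a b, deriv χ t • f t = -∫ t in Ioo a b, χ t • G t) :
    ∃ c : F, ∀ᵐ t ∂volume.restrict (Ioo a b), f t = c + ∫ s in a..t, G s := by
  set I : ℝ → F := fun t => ∫ s in a..t, G s with hI
  have hGi : IntegrableOn G (Icc a b) := by rwa [integrableOn_Icc_iff_integrableOn_Ioo]
  have hIc : ContinuousOn I (Icc a b) := intervalIntegral.continuousOn_primitive_interval (by
    rwa [uIcc_of_le hab.le])  |>.mono (by rw [uIcc_of_le hab.le])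
  have hIi : IntegrableOn I (Ioo a b) := (hIc.integrableOn_Icc).mono_set Ioo_subset_Icc_self
  have hD : IntegrableOn (fun t => f t - I t) (Ioo a b) := hf.sub hIi
  have hsm : ∀ {χ : ℝ → ℝ} {g : ℝ → F}, Continuous χ → HasCompactSupport χ →
      IntegrableOn g (Ioo a b) → IntegrableOn (fun t => χ t • g t) (Ioo a b) := by
    intro χ g h1 h2 h3
    obtain ⟨B, hB⟩ := h2.exists_bound_of_continuous h1
    exact h3.bdd_smul B h1.aestronglyMeasurable (Eventually.of_forall hB)
  have h0 : ∀ χ : ℝ → ℝ, ContDiff ℝ ∞ χ → HasCompactSupport χ → tsupport χ ⊆ Ioo a b →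
      ∫ t in Ioo a b, deriv χ t • (f t - I t) = 0 := by
    intro χ h1 h2 h3
    have hχ' : Continuous (deriv χ) := h1.continuous_deriv (by simp)
    simp_rw [smul_sub]
    rw [integral_sub (hsm hχ' h2.deriv hf) (hsm hχ' h2.deriv hIi), h χ h1 h2 h3,
      integral_deriv_smul_primitive hG h1 h3 h2, sub_self]
  obtain ⟨χ₀, g1, g2, g3, g4⟩ := exists_bump_Ioo hab
  set c : F := ∫ t in Ioo a b, χ₀ t • (f t - I t) with hc
  refine ⟨c, ?_⟩
  have hfin : IntegrableOn (fun _ : ℝ => c) (Ioo a b) := integrableOn_const (by simp)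
  have key := isOpen_Ioo.ae_eq_zero_of_integral_contDiff_smul_eq_zero (μ := volume)
    (f := fun t => (f t - I t) - c) (U := Ioo a b)
    (IntegrableOn.locallyIntegrableOn (hD.sub hfin)) ?_
  · rw [ae_restrict_iff' measurableSet_Ioo]
    filter_upwards [key] with t ht htm
    have := ht htm
    rw [sub_sub, sub_eq_zero] at this
    rw [this, add_comm]
  intro χ h1 h2 h3
  set m := ∫ t, χ t with hm
  have hi0 : Integrable χ := h1.continuous.integrable_of_hasCompactSupport h2
  have hi1 : Integrable χ₀ := g1.continuous.integrable_of_hasCompactSupport g2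
  -- The du Bois-Reymond argument: `χ - (∫ χ) χ₀` has zero integral, so it is the derivative of a
  -- test function and does not see `f - I`. What remains of the pairing with `χ` is `(∫ χ) c`.
  obtain ⟨X, X1, X2, X3, X4⟩ := exists_primitive_of_integral_eq_zero (a := a) (b := b)
    (ζ := fun t => χ t - m * χ₀ t) (h1.sub (contDiff_const.mul g1))
    (h2.sub (g2.mul_left (f := fun _ => m)))
    (by
      refine (closure_minimal (t := tsupport χ ∪ tsupport χ₀) (fun t ht => ?_)
        ((isClosed_tsupport _).union (isClosed_tsupport _))).trans (union_subset h3 g3)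
      by_contra hcon
      rw [mem_union, not_or] at hcon
      apply ht
      simp [image_eq_zero_of_notMem_tsupport hcon.1, image_eq_zero_of_notMem_tsupport hcon.2])
    (by rw [integral_sub hi0 (hi1.const_mul m), integral_const_mul, g4, mul_one, sub_self])
  have h5 := h0 X X1 X2 X3
  rw [X4] at h5
  have e1 : ∫ t, χ t • ((f t - I t) - c) = ∫ t in Ioo a b, χ t • ((f t - I t) - c) := by
    refine (setIntegral_eq_integral_of_forall_compl_eq_zero fun t ht => ?_).symm
    rw [image_eq_zero_of_notMem_tsupport fun h => ht (h3 h), zero_smul]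
  have e2 : ∫ t in Ioo a b, χ t = m :=
    setIntegral_eq_integral_of_forall_compl_eq_zero fun t ht =>
      image_eq_zero_of_notMem_tsupport fun h => ht (h3 h)
  have e3 : ∫ t in Ioo a b, χ t • ((f t - I t) - c) =
      (∫ t in Ioo a b, χ t • (f t - I t)) - m • c := by
    simp_rw [smul_sub _ _ c]
    rw [integral_sub (hsm h1.continuous h2 hD) (hsm h1.continuous h2 hfin), integral_smul_const, e2]
  rw [e1, e3, ← h5]
  simp_rw [sub_smul, mul_smul]
  have i3 : IntegrableOn (fun t => m • χ₀ t • (f t - I t)) (Ioo a b) :=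
    (hsm g1.continuous g2 hD).smul m
  rw [integral_sub (hsm h1.continuous h2 hD) i3, integral_smul, ← hc]

lemma fderiv_tensor {χ : ℝ → ℝ} {ψ : E3 → ℝ} (hχ : ContDiff ℝ ∞ χ) (hψ : ContDiff ℝ ∞ ψ)
    (z : ℝ × E3) :
    fderiv ℝ (fun z : ℝ × E3 => χ z.1 * ψ z.2) z ((1 : ℝ), (0 : E3)) = deriv χ z.1 * ψ z.2 := by
  have h1 : HasFDerivAt (fun z : ℝ × E3 => χ z.1)
      ((fderiv ℝ χ z.1).comp (ContinuousLinearMap.fst ℝ ℝ E3)) z :=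
    (hχ.differentiable (by simp) z.1).hasFDerivAt.comp z hasFDerivAt_fst
  have h2 : HasFDerivAt (fun z : ℝ × E3 => ψ z.2)
      ((fderiv ℝ ψ z.2).comp (ContinuousLinearMap.snd ℝ ℝ E3)) z :=
    (hψ.differentiable (by simp) z.2).hasFDerivAt.comp z hasFDerivAt_snd
  have h3 := (h1.mul h2).fderiv
  simp only [Pi.mul_def] at h3
  rw [h3]
  simp [mul_comm]

lemma tsupport_tensor_subset {χ : ℝ → ℝ} {ψ : E3 → ℝ} :
    tsupport (fun z : ℝ × E3 => χ z.1 * ψ z.2) ⊆ tsupport χ ×ˢ tsupport ψ := by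
  refine closure_minimal (fun z hz => ?_) ((isClosed_tsupport _).prod (isClosed_tsupport _))
  have : χ z.1 * ψ z.2 ≠ 0 := hz
  exact ⟨subset_tsupport _ (left_ne_zero_of_mul this),
    subset_tsupport _ (right_ne_zero_of_mul this)⟩

/-- Tested with `ψ`, the field is a.e. in time a primitive of its weak time derivative. -/
lemma HasWeakTimeDeriv.integral_smul_ae_eq [CompleteSpace F] {Ω : Set E3}
    {T a b : ℝ} {f g : ℝ → E3 → F} (hfg : HasWeakTimeDeriv Ω T f g) (ha : 0 ≤ a) (hab : a < b)
    (hbT : b ≤ T)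
    (hf : Integrable (Function.uncurry f) ((volume.restrict (Ioo a b)).prod (spaceM Ω)))
    (hg : Integrable (Function.uncurry g) ((volume.restrict (Ioo a b)).prod (spaceM Ω)))
    {ψ : E3 → ℝ} (hψ : ContDiff ℝ ∞ ψ) (hψc : HasCompactSupport ψ) (hψs : tsupport ψ ⊆ Ω) :
    ∃ c : F, ∀ᵐ t ∂volume.restrict (Ioo a b),
      ∫ x in Ω, ψ x • f t x = c + ∫ s in a..t, ∫ x in Ω, ψ x • g s x := by
  obtain ⟨B, hB⟩ := hψc.exists_bound_of_continuous hψ.continuous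
  have hinteg : ∀ {χ : ℝ → ℝ} {k : ℝ → E3 → F}, Continuous χ → HasCompactSupport χ →
      Integrable (Function.uncurry k) ((volume.restrict (Ioo a b)).prod (spaceM Ω)) →
      Integrable (fun z : ℝ × E3 => (χ z.1 * ψ z.2) • k z.1 z.2)
        ((volume.restrict (Ioo a b)).prod (spaceM Ω)) := by
    intro χ k h1 h2 h3
    obtain ⟨B', hB'⟩ := h2.exists_bound_of_continuous h1
    refine Integrable.bdd_smul (f := Function.uncurry k) (φ := fun z : ℝ × E3 => χ z.1 * ψ z.2)
      h3 (B' * B) ?_ (Eventually.of_forall fun z => ?_)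
    · have := hψ.continuous
      exact Continuous.aestronglyMeasurable (by fun_prop)
    · rw [norm_mul]
      exact mul_le_mul (hB' _) (hB _) (norm_nonneg _) ((norm_nonneg _).trans (hB' 0))
  have hψi : ∀ {k : ℝ → E3 → F},
      Integrable (Function.uncurry k) ((volume.restrict (Ioo a b)).prod (spaceM Ω)) →
      Integrable (fun z : ℝ × E3 => ψ z.2 • k z.1 z.2)
        ((volume.restrict (Ioo a b)).prod (spaceM Ω)) := by
    intro k h3
    refine Integrable.bdd_smul (f := Function.uncurry k) (φ := fun z : ℝ × E3 => ψ z.2)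
      h3 B ?_ (Eventually.of_forall fun z => hB _)
    have := hψ.continuous
    exact Continuous.aestronglyMeasurable (by fun_prop)
  refine ae_eq_add_primitive_of_weak_deriv hab (hψi hf).integral_prod_left
    (hψi hg).integral_prod_left fun χ h1 h2 h3 => ?_
  have hsub : Ioo a b ×ˢ Ω ⊆ Ioo 0 T ×ˢ Ω :=
    prod_mono (Ioo_subset_Ioo ha hbT) Subset.rfl
  have hsupp : tsupport (fun z : ℝ × E3 => χ z.1 * ψ z.2) ⊆ Ioo a b ×ˢ Ω :=
    tsupport_tensor_subset.trans (prod_mono h3 hψs)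
  have hw := hfg.2.2 (fun z : ℝ × E3 => χ z.1 * ψ z.2)
    ((h1.comp contDiff_fst).mul (hψ.comp contDiff_snd))
    ((h2.prod hψc).of_isClosed_subset (isClosed_tsupport _) tsupport_tensor_subset)
    (hsupp.trans hsub)
  have hred : ∀ {χ : ℝ → ℝ} {k : ℝ → E3 → F}, Continuous χ → HasCompactSupport χ →
      tsupport χ ⊆ Ioo a b →
      Integrable (Function.uncurry k) ((volume.restrict (Ioo a b)).prod (spaceM Ω)) →
      ∫ z in Ioo 0 T ×ˢ Ω, (χ z.1 * ψ z.2) • k z.1 z.2 =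
        ∫ t in Ioo a b, χ t • ∫ x in Ω, ψ x • k t x := by
    intro χ k h1 h2 h3 h4
    have e1 : ∫ z in Ioo 0 T ×ˢ Ω, (χ z.1 * ψ z.2) • k z.1 z.2 =
        ∫ z in Ioo a b ×ˢ Ω, (χ z.1 * ψ z.2) • k z.1 z.2 := by
      have h0 : ∀ z ∉ Ioo a b ×ˢ Ω, (χ z.1 * ψ z.2) • k z.1 z.2 = 0 := fun z hz => by
        have : χ z.1 * ψ z.2 = 0 := image_eq_zero_of_notMem_tsupport
          (f := fun z : ℝ × E3 => χ z.1 * ψ z.2) fun h => hz (tsupport_tensor_subset.trans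
          (prod_mono h3 hψs) h)
        rw [this, zero_smul]
      rw [setIntegral_eq_integral_of_forall_compl_eq_zero h0,
        setIntegral_eq_integral_of_forall_compl_eq_zero fun z hz => h0 z fun h => hz (hsub h)]
    rw [e1, Measure.volume_eq_prod, ← Measure.prod_restrict, integral_prod _ (hinteg h1 h2 h4)]
    simp_rw [mul_smul]
    simp_rw [integral_smul]
  simp_rw [fderiv_tensor h1 hψ] at hw
  rw [hred (h1.continuous_deriv (by simp)) h2.deriv
    ((tsupport_deriv_subset).trans h3) hf, hred h1.continuous h2 h3 hg] at hw
  exact hw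

/-- A field with a weak time derivative is the time integral of it. -/
theorem HasWeakTimeDeriv.exists_ae_sub_eq [CompleteSpace F] {Ω : Set E3} (hΩo : IsOpen Ω)
    (hΩ : Bornology.IsBounded Ω)
    {T a b : ℝ} {f g : ℝ → E3 → F} (hfg : HasWeakTimeDeriv Ω T f g) (ha : 0 ≤ a) (hab : a < b)
    (hbT : b ≤ T)
    (hf : Integrable (Function.uncurry f) ((volume.restrict (Ioo a b)).prod (spaceM Ω)))
    (hg : Integrable (Function.uncurry g) ((volume.restrict (Ioo a b)).prod (spaceM Ω))) :
    ∃ A : Set ℝ, (∀ᵐ t ∂volume.restrict (Ioo a b), t ∈ A) ∧ ∀ s ∈ A, ∀ t ∈ A,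
      ∀ᵐ x ∂spaceM Ω, f t x - f s x = ∫ τ in s..t, g τ x := by
  have hΩm := hΩo.measurableSet
  have hK : CompactSpace (closure Ω) := isCompact_iff_compactSpace.1 hΩ.isCompact_closure
  have hxint : ∀ᵐ x ∂spaceM Ω, IntegrableOn (fun τ => g τ x) (Ioo a b) := hg.prod_left_ae
  set gt : ℝ → E3 → F := fun t x => ∫ τ in a..t, g τ x with hgt
  have hgm : ∀ {t}, t ∈ Ioo a b → Integrable (Function.uncurry g)
      ((volume.restrict (Ioc a t)).prod (spaceM Ω)) := by
    intro t ht
    refine hg.mono_measure (Measure.prod_mono (Measure.restrict_mono ?_ le_rfl) le_rfl)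
    exact fun s hs => ⟨hs.1, hs.2.trans_lt ht.2⟩
  have hgti : ∀ t ∈ Ioo a b, Integrable (gt t) (spaceM Ω) := by
    intro t ht
    have := (hgm ht).integral_prod_right
    refine this.congr (Eventually.of_forall fun x => ?_)
    simp only [hgt]
    rw [intervalIntegral.integral_of_le ht.1.le]
    rfl
  have hfub : ∀ {ψ : E3 → ℝ}, Continuous ψ → HasCompactSupport ψ → ∀ t ∈ Ioo a b,
      ∫ s in a..t, ∫ x in Ω, ψ x • g s x = ∫ x in Ω, ψ x • gt t x := by
    intro ψ h1 h2 t ht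
    obtain ⟨B, hB⟩ := h2.exists_bound_of_continuous h1
    have hi : Integrable (Function.uncurry fun s x => ψ x • g s x)
        ((volume.restrict (Ioc a t)).prod (spaceM Ω)) :=
      Integrable.bdd_smul (f := Function.uncurry g) (φ := fun z : ℝ × E3 => ψ z.2) (hgm ht) B
        (Continuous.aestronglyMeasurable (by fun_prop)) (Eventually.of_forall fun z => hB _)
    rw [intervalIntegral.integral_of_le ht.1.le, integral_integral_swap hi]
    refine integral_congr_ae (Eventually.of_forall fun x => ?_)
    simp only [hgt]
    rw [intervalIntegral.integral_of_le ht.1.le, integral_smul]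
  -- For each test function the identity fails on a null set of times that depends on it. To obtain
  -- one null set for all, test functions are placed in the separable space of continuous functions
  -- on `closure Ω`, and the identity is imposed for a countable dense family. It extends to the
  -- others by uniform approximation, since `Δ` is integrable.
  set S : Set C(closure Ω, ℝ) := {k | ∃ ψ : E3 → ℝ, ContDiff ℝ ∞ ψ ∧ HasCompactSupport ψ ∧
    tsupport ψ ⊆ Ω ∧ ∀ x, k x = ψ x} with hS
  obtain ⟨D, hDS, hDc, hDd⟩ :=
    (TopologicalSpace.IsSeparable.of_separableSpace S).exists_countable_dense_subset
  choose! Ψ h1 h2 h3 h4 using fun k (hk : k ∈ D) => (hDS hk : _)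
  have hae : ∀ k ∈ D, ∃ c : F, ∀ᵐ t ∂volume.restrict (Ioo a b),
      ∫ x in Ω, Ψ k x • f t x = c + ∫ s in a..t, ∫ x in Ω, Ψ k x • g s x := fun k hk =>
    hfg.integral_smul_ae_eq ha hab hbT hf hg (h1 k hk) (h2 k hk) (h3 k hk)
  choose! c hc using hae
  refine ⟨{t | t ∈ Ioo a b ∧ Integrable (f t) (spaceM Ω) ∧ ∀ k ∈ D,
    ∫ x in Ω, Ψ k x • f t x = c k + ∫ s in a..t, ∫ x in Ω, Ψ k x • g s x}, ?_, ?_⟩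
  · filter_upwards [ae_restrict_mem measurableSet_Ioo, hf.prod_right_ae,
      (ae_ball_iff hDc).2 fun k hk => hc k hk] with t h5 h6 h7
    exact ⟨h5, h6, h7⟩
  rintro s ⟨hs, hfs, hcs⟩ t ⟨ht, hft, hct⟩
  set Δ : E3 → F := fun x => (f t x - gt t x) - (f s x - gt s x) with hΔ
  have hΔi : Integrable Δ (spaceM Ω) := (hft.sub (hgti t ht)).sub (hfs.sub (hgti s hs))
  have hbs : ∀ {ψ : E3 → ℝ}, Continuous ψ → HasCompactSupport ψ → ∀ {k : E3 → F},
      Integrable k (spaceM Ω) → Integrable (fun x => ψ x • k x) (spaceM Ω) := by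
    intro ψ g1 g2 k hk
    obtain ⟨B, hB⟩ := g2.exists_bound_of_continuous g1
    exact hk.bdd_smul B g1.aestronglyMeasurable (Eventually.of_forall hB)
  have hzero : ∀ k ∈ D, ∫ x in Ω, Ψ k x • Δ x = 0 := by
    intro k hk
    have e1 := hct k hk
    have e2 := hcs k hk
    rw [hfub (h1 k hk).continuous (h2 k hk) t ht] at e1
    rw [hfub (h1 k hk).continuous (h2 k hk) s hs] at e2
    have b := fun {k' : E3 → F} (hk' : Integrable k' (spaceM Ω)) =>
      hbs (h1 k hk).continuous (h2 k hk) hk'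
    simp only [hΔ, smul_sub]
    have j1 : Integrable (fun x => Ψ k x • f t x - Ψ k x • gt t x) (spaceM Ω) :=
      (b hft).sub (b (hgti t ht))
    have j2 : Integrable (fun x => Ψ k x • f s x - Ψ k x • gt s x) (spaceM Ω) :=
      (b hfs).sub (b (hgti s hs))
    rw [integral_sub j1 j2, integral_sub (b hft) (b (hgti t ht)),
      integral_sub (b hfs) (b (hgti s hs)), e1, e2]
    simp
  have hall : ∀ ψ : E3 → ℝ, ContDiff ℝ ∞ ψ → HasCompactSupport ψ → tsupport ψ ⊆ Ω →
      ∫ x in Ω, ψ x • Δ x = 0 := by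
    intro ψ g1 g2 g3
    set k₀ : C(closure Ω, ℝ) := ⟨fun x => ψ x, g1.continuous.comp continuous_subtype_val⟩
    have hk₀ : k₀ ∈ closure D := hDd ⟨ψ, g1, g2, g3, fun x => rfl⟩
    rw [← norm_eq_zero]
    refine le_antisymm (le_of_forall_pos_le_add fun ε hε => ?_) (norm_nonneg _)
    set m := ∫ x in Ω, ‖Δ x‖ with hm
    have hm0 : 0 ≤ m := integral_nonneg fun x => norm_nonneg _
    obtain ⟨k, hk, hkd⟩ := Metric.mem_closure_iff.1 hk₀ (ε / (m + 1)) (by positivity)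
    have e1 : ∫ x in Ω, ψ x • Δ x = ∫ x in Ω, (ψ x - Ψ k x) • Δ x := by
      simp_rw [sub_smul]
      rw [integral_sub (hbs g1.continuous g2 hΔi) (hbs (h1 k hk).continuous (h2 k hk) hΔi),
        hzero k hk, sub_zero]
    rw [e1, zero_add]
    calc ‖∫ x in Ω, (ψ x - Ψ k x) • Δ x‖ ≤ ∫ x in Ω, (ε / (m + 1)) * ‖Δ x‖ := by
          refine norm_integral_le_of_norm_le (hΔi.norm.const_mul _) ?_
          refine (ae_restrict_iff' hΩm).2 (Eventually.of_forall fun x hx => ?_)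
          rw [norm_smul]
          refine mul_le_mul_of_nonneg_right ?_ (norm_nonneg _)
          have := (ContinuousMap.dist_apply_le_dist (f := k₀) (g := k)
            ⟨x, subset_closure hx⟩).trans hkd.le
          rw [dist_eq_norm, h4 k hk] at this
          exact this
      _ = ε / (m + 1) * m := by rw [integral_const_mul]
      _ ≤ ε := by
          rw [div_mul_eq_mul_div, div_le_iff₀ (by positivity)]
          nlinarith
  have hΔ0 := hΩo.ae_eq_zero_of_integral_contDiff_smul_eq_zero (μ := volume) (f := Δ)
    (IntegrableOn.locallyIntegrableOn hΔi) fun ψ g1 g2 g3 => by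
      rw [← setIntegral_smul_eq_of_tsupport_subset g3]
      exact hall ψ g1 g2 g3
  rw [← ae_restrict_iff' hΩm] at hΔ0
  filter_upwards [hΔ0, hxint] with x hx hxi
  have hii : ∀ r ∈ Ioo a b, IntervalIntegrable (fun τ => g τ x) volume a r := fun r hr => by
    rw [intervalIntegrable_iff_integrableOn_Ioc_of_le hr.1.le]
    exact hxi.mono_set fun σ hσ => ⟨hσ.1, hσ.2.trans_lt hr.2⟩
  have := intervalIntegral.integral_interval_sub_left (hii t ht) (hii s hs)
  rw [← this]
  rw [hΔ] at hx
  simp only [hgt] at hx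
  rw [sub_eq_zero] at hx
  rw [sub_eq_sub_iff_add_eq_add, add_comm, ← sub_eq_sub_iff_add_eq_add]
  rw [sub_eq_sub_iff_add_eq_add] at hx ⊢
  rw [add_comm, hx, add_comm]

end Time

/-! ### Mixed norms in space and time. -/

section Bochner

variable {F : Type*} [NormedAddCommGroup F]

lemma eLpNorm_two_sq {α : Type*} [MeasurableSpace α] {μ : Measure α} (f : α → F) :
    eLpNorm f 2 μ ^ 2 = ∫⁻ x, ‖f x‖ₑ ^ 2 ∂μ := by
  have := eLpNorm_nnreal_pow_eq_lintegral (f := f) (μ := μ) (p := 2) two_ne_zero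
  norm_num at this
  exact_mod_cast this

lemma integral_norm_sq_eq {α : Type*} [MeasurableSpace α] {μ : Measure α} {f : α → F}
    (hf : MemLp f 2 μ) : ∫ x, ‖f x‖ ^ 2 ∂μ = (eLpNorm f 2 μ).toReal ^ 2 := by
  have hm : AEStronglyMeasurable (fun x => ‖f x‖ ^ 2) μ := hf.1.norm.pow 2
  rw [← ENNReal.toReal_pow, eLpNorm_two_sq, integral_eq_lintegral_of_nonneg_ae
    (Eventually.of_forall fun x => by positivity) hm]
  simp_rw [ENNReal.ofReal_pow (norm_nonneg _), ofReal_norm]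

lemma InLL.ae_memLp [NormedSpace ℝ F] {Ω : Set E3} {T : ℝ} {p : ℝ≥0∞} {f : ℝ → E3 → F}
    (h : InLL Ω T ⊤ p f) : ∃ C : ℝ, 0 ≤ C ∧ ∀ᵐ t ∂timeM T, MemLp (f t) p (spaceM Ω) ∧
      (eLpNorm (f t) p (spaceM Ω)).toReal ≤ C := by
  have h2 := h.2
  rw [eLpNorm_exponent_top] at h2
  refine ⟨(eLpNormEssSup (fun t => eLpNorm (f t) p (spaceM Ω)) (timeM T)).toReal,
    ENNReal.toReal_nonneg, ?_⟩
  filter_upwards [h.1.prodMk_left, ae_le_eLpNormEssSup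
    (f := fun t => eLpNorm (f t) p (spaceM Ω)) (μ := timeM T)] with t h3 h4
  rw [enorm_eq_self] at h4
  exact ⟨⟨h3, h4.trans_lt h2⟩, ENNReal.toReal_mono h2.ne h4⟩

lemma InLL.aemeasurable_eLpNorm [NormedSpace ℝ F] {Ω : Set E3} {T : ℝ} {r p : ℝ≥0∞}
    {f : ℝ → E3 → F} (h : InLL Ω T r p f) (hp0 : p ≠ 0) (hp : p ≠ ⊤) :
    AEMeasurable (fun t => eLpNorm (f t) p (spaceM Ω)) (timeM T) := by
  simp_rw [eLpNorm_eq_lintegral_rpow_enorm_toReal hp0 hp]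
  refine AEMeasurable.pow_const ?_ _
  exact (h.1.enorm.pow_const p.toReal).lintegral_prod_right'

/-- `L¹(0,T; Lᵖ)`. -/
lemma InLL.integrable_eLpNorm [NormedSpace ℝ F] {Ω : Set E3} {T : ℝ} {p : ℝ≥0∞}
    {f : ℝ → E3 → F} (h : InLL Ω T 1 p f) (hp0 : p ≠ 0) (hp : p ≠ ⊤) :
    Integrable (fun t => (eLpNorm (f t) p (spaceM Ω)).toReal) (timeM T) ∧
      ∀ᵐ t ∂timeM T, MemLp (f t) p (spaceM Ω) := by
  have hm := h.aemeasurable_eLpNorm hp0 hp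
  have h2 := h.2
  rw [eLpNorm_one_eq_lintegral_enorm] at h2
  simp only [enorm_eq_self] at h2
  refine ⟨integrable_toReal_of_lintegral_ne_top hm h2.ne, ?_⟩
  filter_upwards [h.1.prodMk_left, ae_lt_top' hm h2.ne] with t h3 h4
  exact ⟨h3, h4⟩

/-- `L²(0,T; L²)` is `L²((0,T) × Ω)`. -/
lemma InLL.memLp_two [NormedSpace ℝ F] {Ω : Set E3} {T : ℝ}
    {f : ℝ → E3 → F} (h : InLL Ω T 2 2 f) :
    MemLp (Function.uncurry f) 2 ((timeM T).prod (spaceM Ω)) := by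
  refine ⟨h.1, ?_⟩
  have h2 := h.2
  have e1 : eLpNorm (Function.uncurry f) 2 ((timeM T).prod (spaceM Ω)) ^ 2 =
      eLpNorm (fun t => eLpNorm (f t) 2 (spaceM Ω)) 2 (timeM T) ^ 2 := by
    rw [eLpNorm_two_sq, lintegral_prod _ (h.1.enorm.pow_const 2)]
    have := eLpNorm_nnreal_pow_eq_lintegral (f := fun t => eLpNorm (f t) 2 (spaceM Ω))
      (μ := timeM T) (p := 2) two_ne_zero
    norm_num at this
    have e2 : eLpNorm (fun t => eLpNorm (f t) 2 (spaceM Ω)) 2 (timeM T) ^ 2 =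
        ∫⁻ t, eLpNorm (f t) 2 (spaceM Ω) ^ 2 ∂timeM T := by exact_mod_cast this
    rw [e2]
    simp_rw [eLpNorm_two_sq]
    rfl
  by_contra hc
  rw [not_lt, top_le_iff] at hc
  rw [hc] at e1
  exact (ENNReal.pow_lt_top h2).ne (by rw [← e1]; simp)

lemma InLL.two_of_top [NormedSpace ℝ F] {Ω : Set E3} {T : ℝ} {p : ℝ≥0∞}
    {f : ℝ → E3 → F} (h : InLL Ω T ⊤ p f) : InLL Ω T 2 p f := by
  refine ⟨h.1, ?_⟩
  have h2 := h.2
  rw [eLpNorm_exponent_top] at h2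
  have : ∀ᵐ t ∂timeM T, ‖eLpNorm (f t) p (spaceM Ω)‖ₑ ≤ eLpNormEssSup
    (fun t => eLpNorm (f t) p (spaceM Ω)) (timeM T) := ae_le_eLpNormEssSup
  refine (eLpNorm_mono_enorm_ae (g := fun _ => eLpNormEssSup
    (fun t => eLpNorm (f t) p (spaceM Ω)) (timeM T))
    (this.mono fun t ht => ht.trans ?_)).trans_lt ?_
  · simp
  · rw [eLpNorm_const' _ (by simp) (by simp)]
    refine ENNReal.mul_lt_top (by simpa using h2) ?_
    refine ENNReal.rpow_lt_top_of_nonneg (by simp) (by simp)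

variable [NormedSpace ℝ F]

/-- Cauchy-Schwarz in time for a time integral. -/
lemma lintegral_sq_le_of_ae_eq_integral {Ω : Set E3} {s t : ℝ} (hst : s ≤ t) {d : E3 → F}
    {g : ℝ → E3 → F}
    (hg : AEStronglyMeasurable (Function.uncurry g) ((volume.restrict (Ioc s t)).prod (spaceM Ω)))
    (h : ∀ᵐ x ∂spaceM Ω, d x = ∫ τ in s..t, g τ x) :
    ∫⁻ x in Ω, ‖d x‖ₑ ^ 2 ≤
      ENNReal.ofReal (t - s) * ∫⁻ τ in Ioc s t, ∫⁻ x in Ω, ‖g τ x‖ₑ ^ 2 := by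
  rw [lintegral_lintegral_swap (f := fun τ x => ‖g τ x‖ₑ ^ 2) (hg.enorm.pow_const 2),
    ← lintegral_const_mul' _ _ (by simp)]
  refine lintegral_mono_ae ?_
  filter_upwards [h, hg.prodMk_right] with x hx hm
  have hm' : AEStronglyMeasurable (fun τ => g τ x) (volume.restrict (Ioc s t)) := hm
  rw [hx, intervalIntegral.integral_of_le hst]
  have h1 : ‖∫ τ in Ioc s t, g τ x‖ₑ ≤ eLpNorm (fun τ => g τ x) 1 (volume.restrict (Ioc s t)) := by
    rw [eLpNorm_one_eq_lintegral_enorm]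
    exact enorm_integral_le_lintegral_enorm _
  have h2 := h1.trans (eLpNorm_le_eLpNorm_mul_rpow_measure_univ one_le_two hm')
  calc ‖∫ τ in Ioc s t, g τ x‖ₑ ^ 2
      ≤ (eLpNorm (fun τ => g τ x) 2 (volume.restrict (Ioc s t)) *
        volume.restrict (Ioc s t) univ ^ (1 / (1 : ℝ≥0∞).toReal - 1 / (2 : ℝ≥0∞).toReal)) ^ 2 := by
        gcongr
    _ = _ := by
        rw [mul_pow, eLpNorm_two_sq, mul_comm]
        congr 1
        rw [Measure.restrict_apply_univ, Real.volume_Ioc, ← ENNReal.rpow_natCast,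
          ← ENNReal.rpow_mul]
        norm_num

lemma eLpNorm_two_le_of_ae_eq_integral {Ω : Set E3} {s t a b : ℝ} (hs : s ∈ Ioo a b)
    (ht : t ∈ Ioo a b) {d : E3 → F} {g : ℝ → E3 → F}
    (hg : AEStronglyMeasurable (Function.uncurry g) ((volume.restrict (Ioo a b)).prod (spaceM Ω)))
    (h : ∀ᵐ x ∂spaceM Ω, d x = ∫ τ in s..t, g τ x) {C : ℝ≥0∞}
    (hC : ∫⁻ τ in Ioc (min s t) (max s t), ∫⁻ x in Ω, ‖g τ x‖ₑ ^ 2 ≤ C) :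
    eLpNorm d 2 (spaceM Ω) ^ 2 ≤ ENNReal.ofReal |t - s| * C := by
  rw [eLpNorm_two_sq]
  wlog hst : s ≤ t generalizing s t d
  · have := this (d := -d) ht hs (h.mono fun x hx => by
      rw [Pi.neg_apply, hx, intervalIntegral.integral_symm, neg_neg])
      (by rwa [min_comm, max_comm]) (le_of_not_ge hst)
    rw [abs_sub_comm]
    simpa using this
  · rw [min_eq_left hst, max_eq_right hst] at hC
    rw [abs_of_nonneg (by linarith)]
    have hsub : Ioc s t ⊆ Ioo a b := fun r hr => ⟨hs.1.trans hr.1, hr.2.trans_lt ht.2⟩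
    refine (lintegral_sq_le_of_ae_eq_integral hst (hg.mono_measure
      (Measure.prod_mono (Measure.restrict_mono hsub le_rfl) le_rfl)) h).trans ?_
    gcongr

/-- Sets of full measure are dense. In this way relations known at almost every time reach all
times, in particular the endpoints of the interval, by continuity. -/
lemma subset_closure_of_ae_mem {a b : ℝ} (hab : a < b) {A : Set ℝ}
    (hA : ∀ᵐ t ∂volume.restrict (Ioo a b), t ∈ A) : Icc a b ⊆ closure (A ∩ Ioo a b) := by
  have h1 : Ioo a b ⊆ closure (A ∩ Ioo a b) := by
    intro t ht
    rw [mem_closure_iff]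
    intro o ho hto
    by_contra hc
    have h2 : volume (o ∩ Ioo a b) = 0 := by
      rw [ae_restrict_iff' measurableSet_Ioo] at hA
      refine measure_mono_null ?_ hA
      intro x hx hx2
      exact hc ⟨x, hx.1, hx2 hx.2, hx.2⟩
    exact ((ho.inter isOpen_Ioo).measure_pos volume ⟨t, hto, ht⟩).ne' h2
  rw [← closure_Ioo hab.ne]
  exact closure_minimal h1 isClosed_closure

end Bochner

/-! ### The density as a bounded Lipschitz curve in `L²`. -/

section Density

variable {Ω : Set E3} {T R μ lam κ cv q : ℝ} {ρ₀ : E3 → ℝ} {u₀ : E3 → E3} {θ₀ : E3 → ℝ}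
  {ρ : ℝ → E3 → ℝ} {u : ℝ → E3 → E3} {θ : ℝ → E3 → ℝ}
  {ρt : ℝ → E3 → ℝ} {Dρ : ℝ → E3 → E3 →L[ℝ] ℝ}
  {ut : ℝ → E3 → E3} {Du : ℝ → E3 → E3 →L[ℝ] E3} {D2u : ℝ → E3 → E3 →L[ℝ] E3 →L[ℝ] E3}
  {Dut : ℝ → E3 → E3 →L[ℝ] E3}
  {θt : ℝ → E3 → ℝ} {Dθ : ℝ → E3 → E3 →L[ℝ] ℝ} {D2θ : ℝ → E3 → E3 →L[ℝ] E3 →L[ℝ] ℝ}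
  {Dθt : ℝ → E3 → E3 →L[ℝ] ℝ} {DM : ℝ → E3 → E3 →L[ℝ] E3} {DP : ℝ → E3 → E3 →L[ℝ] ℝ}

lemma isFiniteMeasure_spaceM (hΩ : Bornology.IsBounded Ω) : IsFiniteMeasure (spaceM Ω) :=
  ⟨by rw [Measure.restrict_apply_univ]; exact hΩ.measure_lt_top⟩

lemma memLp_two_of_memLp_ofReal {N : Type*} [NormedAddCommGroup N] (hΩ : Bornology.IsBounded Ω)
    (hq : 2 ≤ q) {f : E3 → N} (hf : MemLp f (ENNReal.ofReal q) (spaceM Ω)) :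
    MemLp f 2 (spaceM Ω) := by
  have := isFiniteMeasure_spaceM hΩ
  refine hf.mono_exponent ?_
  rw [← ENNReal.ofReal_ofNat]
  exact ENNReal.ofReal_le_ofReal hq

/-- A continuous curve in `L²` that is the time integral of a field bounded in `L²` is Lipschitz. -/
lemma IsVersion.exists_lipschitzOnWith (hΩo : IsOpen Ω) (hΩ : Bornology.IsBounded Ω) (hT : 0 < T)
    {f g : ℝ → E3 → ℝ} (hfg : HasWeakTimeDeriv Ω T f g)
    (hf : InLL Ω T 2 2 f) (hg : InLL Ω T ⊤ 2 g) {V : ℝ → Lp ℝ 2 (spaceM Ω)}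
    (hV : IsVersion Ω T f V) (hVc : ContinuousOn V (Icc 0 T)) :
    ∃ C : NNReal, LipschitzOnWith C V (Icc 0 T) := by
  have := isFiniteMeasure_spaceM hΩ
  have hfi := hf.memLp_two.integrable one_le_two
  have hgi := hg.two_of_top.memLp_two.integrable one_le_two
  obtain ⟨A, hA, hAd⟩ := hfg.exists_ae_sub_eq hΩo hΩ le_rfl hT le_rfl hfi hgi
  obtain ⟨C, hC0, hC⟩ := hg.ae_memLp
  refine ⟨⟨C, hC0⟩, ?_⟩
  have hA2 : ∀ᵐ t ∂timeM T, t ∈ {t | t ∈ A ∧ V t =ᵐ[spaceM Ω] f t} := by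
    filter_upwards [hA, hV] with t h1 h2 using ⟨h1, h2⟩
  have hcl := subset_closure_of_ae_mem hT hA2
  have hcl' : closure ({t | t ∈ A ∧ V t =ᵐ[spaceM Ω] f t} ∩ Ioo 0 T) = Icc 0 T :=
    (closure_minimal (inter_subset_right.trans Ioo_subset_Icc_self) isClosed_Icc).antisymm hcl
  rw [← hcl']
  -- The bound is proved on the dense set of times at which `V t` is `f t` and differences are time
  -- integrals; continuity of `V` carries it to the closed interval.
  refine LipschitzOnWith.closure (by rwa [hcl']) ?_
  refine LipschitzOnWith.of_dist_le_mul fun t ht s hs => ?_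
  have h1 : ∀ᵐ x ∂spaceM Ω, (V t - V s : Lp ℝ 2 (spaceM Ω)) x = ∫ τ in s..t, g τ x := by
    filter_upwards [hAd s hs.1.1 t ht.1.1, ht.1.2, hs.1.2, Lp.coeFn_sub (V t) (V s)]
      with x h1 h2 h3 h4
    rw [h4, Pi.sub_apply, h2, h3, h1]
  have h2 := eLpNorm_two_le_of_ae_eq_integral (C := ENNReal.ofReal |t - s| * ENNReal.ofReal C ^ 2)
    hs.2 ht.2 hg.1 h1 (by
      have hsub : Ioc (min s t) (max s t) ⊆ Ioo 0 T := fun r hr =>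
        ⟨(lt_min hs.2.1 ht.2.1).trans hr.1, hr.2.trans_lt (max_lt hs.2.2 ht.2.2)⟩
      calc ∫⁻ τ in Ioc (min s t) (max s t), ∫⁻ x in Ω, ‖g τ x‖ₑ ^ 2
          ≤ ∫⁻ τ in Ioc (min s t) (max s t), ENNReal.ofReal C ^ 2 := by
            refine lintegral_mono_ae (ae_restrict_of_ae_restrict_of_subset hsub ?_)
            filter_upwards [hC] with τ hτ
            rw [← eLpNorm_two_sq]
            gcongr
            rw [ENNReal.le_ofReal_iff_toReal_le hτ.1.2.ne hC0]
            exact hτ.2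
        _ = _ := by
            rw [setLIntegral_const, Real.volume_Ioc, mul_comm, max_sub_min_eq_abs])
  have h3 : eLpNorm (V t - V s : Lp ℝ 2 (spaceM Ω)) 2 (spaceM Ω) ^ 2 ≤
      (ENNReal.ofReal (C * |t - s|)) ^ 2 := by
    refine h2.trans (le_of_eq ?_)
    rw [ENNReal.ofReal_mul hC0]
    ring
  rw [dist_eq_norm, Lp.norm_def, Real.dist_eq]
  refine ENNReal.toReal_le_of_le_ofReal (by positivity) ?_
  exact (ENNReal.pow_le_pow_left_iff two_ne_zero).1 h3

/-- Closed conditions that hold at almost every time hold at every time. -/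
lemma ContinuousOn.mem_of_ae_mem (hT : 0 < T) {X : Type*} [TopologicalSpace X] {V : ℝ → X}
    (hVc : ContinuousOn V (Icc 0 T)) {S : Set X} (hS : IsClosed S)
    (h : ∀ᵐ t ∂timeM T, V t ∈ S) : ∀ t ∈ Icc 0 T, V t ∈ S := by
  intro t ht
  have h1 := subset_closure_of_ae_mem hT (A := V ⁻¹' S) h ht
  have h2 : (𝓝[V ⁻¹' S ∩ Ioo 0 T] t).NeBot := mem_closure_iff_nhdsWithin_neBot.1 h1
  refine hS.mem_of_tendsto (b := 𝓝[V ⁻¹' S ∩ Ioo 0 T] t) ((hVc t ht).mono_left (nhdsWithin_mono t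
    (inter_subset_right.trans Ioo_subset_Icc_self))) ?_
  filter_upwards [self_mem_nhdsWithin] with s hs using hs.1

lemma ae_le_of_tendsto_Lp {C : ℝ} (hΩ : Bornology.IsBounded Ω) :
    IsClosed {f : Lp ℝ 2 (spaceM Ω) | ∀ᵐ x ∂spaceM Ω, f x ≤ C} := by
  have := isFiniteMeasure_spaceM hΩ
  have h1 : {f : Lp ℝ 2 (spaceM Ω) | ∀ᵐ x ∂spaceM Ω, f x ≤ C} =
      Iic ((memLp_const C).toLp (fun _ => C)) := by
    ext f
    rw [mem_ofPred_eq, mem_Iic, ← Lp.coeFn_le]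
    have := (memLp_const (p := 2) (μ := spaceM Ω) C).coeFn_toLp
    constructor
    · intro h
      filter_upwards [h, this] with x h1 h2
      rw [h2]; exact h1
    · intro h
      filter_upwards [h, this] with x h1 h2
      rw [h2] at h1; exact h1
  rw [h1]
  exact isClosed_Iic

lemma isClosed_ae_nonneg : IsClosed {f : Lp ℝ 2 (spaceM Ω) | ∀ᵐ x ∂spaceM Ω, 0 ≤ f x} := by
  have h1 : {f : Lp ℝ 2 (spaceM Ω) | ∀ᵐ x ∂spaceM Ω, 0 ≤ f x} = Ici 0 := by
    ext f
    rw [mem_ofPred_eq, mem_Ici, ← Lp.coeFn_nonneg]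
    rfl
  rw [h1]
  exact isClosed_Ici

/-- The density as a continuous curve in `L²`. -/
structure IsDensityVersion (Ω : Set E3) (T m : ℝ) (ρ₀ : E3 → ℝ) (ρ : ℝ → E3 → ℝ) (u : ℝ → E3 → E3)
    (V : ℝ → Lp ℝ 2 (spaceM Ω)) : Prop where
  version : IsVersion Ω T ρ V
  initial : V 0 =ᵐ[spaceM Ω] ρ₀
  lipschitz : ∃ C : NNReal, LipschitzOnWith C V (Icc 0 T)
  nonneg : ∀ t ∈ Icc 0 T, ∀ᵐ x ∂spaceM Ω, 0 ≤ V t x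
  le : ∀ t ∈ Icc 0 T, ∀ᵐ x ∂spaceM Ω, V t x ≤ m
  weak : ∀ ψ : E3 → ℝ, ContDiff ℝ ∞ ψ → ∀ s ∈ Icc 0 T, ∀ t ∈ Icc 0 T,
    IntervalIntegrable (fun τ => ∫ x in Ω, ρ τ x * fderiv ℝ ψ x (u τ x)) volume s t ∧
    (∫ x in Ω, ψ x * V t x) - (∫ x in Ω, ψ x * V s x) =
      ∫ τ in s..t, ∫ x in Ω, ρ τ x * fderiv ℝ ψ x (u τ x)

lemma memLp_two_of_continuous (hΩ : Bornology.IsBounded Ω) (hΩm : MeasurableSet Ω) {N : Type*}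
    [NormedAddCommGroup N] [SecondCountableTopology N] {ψ : E3 → N} (hψ : Continuous ψ) :
    MemLp ψ 2 (spaceM Ω) := by
  have := isFiniteMeasure_spaceM hΩ
  obtain ⟨B, hB⟩ := hΩ.isCompact_closure.exists_bound_of_continuousOn hψ.continuousOn
  refine MemLp.of_bound hψ.aestronglyMeasurable B ?_
  exact (ae_restrict_iff' hΩm).2 (Eventually.of_forall fun x hx => hB x (subset_closure hx))

lemma continuous_integral_mul {α : Type*} [MeasurableSpace α] {ν : Measure α} {ψ : α → ℝ}
    (hψ : MemLp ψ 2 ν) : Continuous fun f : Lp ℝ 2 ν => ∫ x, ψ x * f x ∂ν := by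
  have : (fun f : Lp ℝ 2 ν => ∫ x, ψ x * f x ∂ν) = fun f => inner ℝ (hψ.toLp ψ) f := by
    ext f
    rw [L2.inner_def]
    refine integral_congr_ae ?_
    filter_upwards [hψ.coeFn_toLp] with x hx
    rw [hx]
    simp [mul_comm]
  rw [this]
  fun_prop

/-- The upper bound `m` is Morrey's bound for `ρ(t)` in `W^{1,q}`, and the Lipschitz constant comes
from `ρt ∈ L^∞(0,T; L²)`. The weak form of the continuity equation holds for all smooth `ψ`, without
boundary condition, because the velocity is in `H₀¹`; this matters since the test functions used for
the flow do not vanish on the boundary. -/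
theorem IsSolutionWith.exists_densityVersion (hΩ : IsSmoothBoundedDomain Ω) (hT : 0 < T)
    (hq : 3 < q)
    (h : IsSolutionWith Ω T R μ lam κ cv q ρ₀ u₀ θ₀ ρ u θ ρt Dρ ut Du D2u Dut θt Dθ D2θ Dθt DM DP) :
    ∃ m V, 0 ≤ m ∧ IsDensityVersion Ω T m ρ₀ ρ u V := by
  have hfin := isFiniteMeasure_spaceM hΩ.isBounded
  have hΩm := hΩ.isOpen.measurableSet
  obtain ⟨V, hV, hVc, hV0⟩ := h.ρ_cont
  obtain ⟨C, hC0, hC⟩ := hΩ.ae_norm_le (F := ℝ) hq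
  obtain ⟨C1, hC10, hC1⟩ := h.ρ_W1q.2.1.ae_memLp
  obtain ⟨C2, hC20, hC2⟩ := h.ρ_W1q.2.2.ae_memLp
  have hρ2 : ∀ᵐ t ∂timeM T, MemLp (ρ t) 2 (spaceM Ω) := by
    filter_upwards [hC1] with t ht using memLp_two_of_memLp_ofReal hΩ.isBounded (by linarith) ht.1
  have hDρ2 : ∀ᵐ t ∂timeM T, MemLp (Dρ t) 2 (spaceM Ω) := by
    filter_upwards [hC2] with t ht using memLp_two_of_memLp_ofReal hΩ.isBounded (by linarith) ht.1
  have hm : ∀ᵐ t ∂timeM T, ∀ᵐ x ∂spaceM Ω, ‖ρ t x‖ ≤ C * (C1 + C2) := by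
    filter_upwards [hC1, hC2, h.ρ_W1q.1] with t h1 h2 h3
    filter_upwards [hC ⟨h3, h1.1, h2.1⟩] with x hx
    exact hx.trans (by gcongr; exacts [h1.2, h2.2])
  have hρLL : InLL Ω T ⊤ 2 ρ := by
    refine ⟨h.ρ_W1q.2.1.1, ?_⟩
    rw [eLpNorm_exponent_top]
    refine (eLpNormEssSup_le_of_ae_enorm_bound (C := ENNReal.ofReal (C * (C1 + C2)) *
      (spaceM Ω univ) ^ ((2 : ℝ≥0∞).toReal)⁻¹) ?_).trans_lt ?_
    · filter_upwards [hm] with t ht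
      rw [enorm_eq_self, mul_comm]
      exact eLpNorm_le_of_ae_bound ht
    · exact ENNReal.mul_lt_top (by simp)
        (ENNReal.rpow_lt_top_of_nonneg (by simp) (measure_ne_top _ _))
  obtain ⟨CL, hCL⟩ := hV.exists_lipschitzOnWith hΩ.isOpen hΩ.isBounded hT h.ρ_time
    hρLL.two_of_top h.ρt_mem hVc
  refine ⟨C * (C1 + C2), V, by positivity, hV, hV0, ⟨CL, hCL⟩, ?_, ?_, ?_⟩
  · refine ContinuousOn.mem_of_ae_mem hT hVc isClosed_ae_nonneg ?_
    filter_upwards [hV, h.ρ_nonneg] with t h1 h2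
    filter_upwards [h1, h2] with x h3 h4
    rw [h3]; exact h4
  · refine ContinuousOn.mem_of_ae_mem hT hVc (ae_le_of_tendsto_Lp hΩ.isBounded) ?_
    filter_upwards [hV, hm] with t h1 h2
    filter_upwards [h1, h2] with x h3 h4
    rw [h3]; exact (le_abs_self _).trans h4
  · intro ψ hψ s hs t ht
    have hψ2 := memLp_two_of_continuous hΩ.isBounded hΩm hψ.continuous
    have hρi := hρLL.two_of_top.memLp_two.integrable one_le_two
    have hρti := h.ρt_mem.two_of_top.memLp_two.integrable one_le_two
    have hψp : MemLp (fun z : ℝ × E3 => ψ z.2) ⊤ ((timeM T).prod (spaceM Ω)) := by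
      obtain ⟨B, hB⟩ := hΩ.isBounded.isCompact_closure.exists_bound_of_continuousOn
        hψ.continuous.continuousOn
      have hc := hψ.continuous
      refine memLp_top_of_bound (Continuous.aestronglyMeasurable (by fun_prop)) B ?_
      have : ∀ᵐ x ∂spaceM Ω, ‖ψ x‖ ≤ B :=
        (ae_restrict_iff' hΩm).2 (Eventually.of_forall fun x hx => hB x (subset_closure hx))
      exact Measure.quasiMeasurePreserving_snd.ae this
    have hprod : Integrable (fun z : ℝ × E3 => ψ z.2 * ρt z.1 z.2) ((timeM T).prod (spaceM Ω)) :=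
      hρti.mul_of_top_right hψp
    have hkey : ∀ᵐ τ ∂timeM T, ∫ x in Ω, ψ x * ρt τ x = ∫ x in Ω, ρ τ x * fderiv ℝ ψ x (u τ x) := by
      filter_upwards [h.mass, h.ρ_W1q.1, hρ2, hDρ2, h.u_H10.1, h.M_deriv] with τ h1 h2 h3 h4 h5 h6
      have := integral_mul_divOf_flux hΩ.isOpen hΩ.isBounded h2 h3 h4 h5 h6 hψ
      rw [← neg_eq_iff_eq_neg] at this
      rw [← this, ← integral_neg]
      refine integral_congr_ae ?_
      filter_upwards [h1] with x hx
      rw [eq_neg_of_add_eq_zero_left hx]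
      ring
    have hinteg : IntegrableOn (fun τ => ∫ x in Ω, ρ τ x * fderiv ℝ ψ x (u τ x)) (Ioo 0 T) :=
      (hprod.integral_prod_left).congr hkey
    have hii : ∀ {s t}, s ∈ Icc 0 T → t ∈ Icc 0 T → IntervalIntegrable
        (fun τ => ∫ x in Ω, ρ τ x * fderiv ℝ ψ x (u τ x)) volume s t := by
      intro s t hs ht
      have h1 : IntervalIntegrable
        (fun τ => ∫ x in Ω, ρ τ x * fderiv ℝ ψ x (u τ x)) volume 0 T := by
        rw [intervalIntegrable_iff_integrableOn_Ioo_of_le hT.le]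
        exact hinteg
      exact h1.mono_set (by
        rw [uIcc_of_le hT.le]
        exact uIcc_subset_Icc hs ht)
    refine ⟨hii hs ht, ?_⟩
    obtain ⟨A, hA, hAd⟩ := h.ρ_time.exists_ae_sub_eq hΩ.isOpen hΩ.isBounded le_rfl hT
      le_rfl hρi hρti
    have hT0 : (0 : ℝ) ∈ Icc 0 T := ⟨le_rfl, hT.le⟩
    -- The weak form says that `G` is constant. It is continuous on `[0, T]`, and it takes a single
    -- value on the good times, which are dense.
    set G : ℝ → ℝ := fun t => (∫ x in Ω, ψ x * V t x) -
      ∫ τ in (0 : ℝ)..t, ∫ x in Ω, ρ τ x * fderiv ℝ ψ x (u τ x) with hG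
    have hGc : ContinuousOn G (Icc 0 T) := by
      refine ContinuousOn.sub ((continuous_integral_mul hψ2).comp_continuousOn hVc) ?_
      have := intervalIntegral.continuousOn_primitive_interval (a := (0 : ℝ)) (b := T)
        (f := fun τ => ∫ x in Ω, ρ τ x * fderiv ℝ ψ x (u τ x)) (μ := volume) (by
          rw [uIcc_of_le hT.le, integrableOn_Icc_iff_integrableOn_Ioo]; exact hinteg)
      rwa [uIcc_of_le hT.le] at this
    have hG0 : ∀ s ∈ A ∩ {t | V t =ᵐ[spaceM Ω] ρ t} ∩ Ioo 0 T,
        ∀ t ∈ A ∩ {t | V t =ᵐ[spaceM Ω] ρ t} ∩ Ioo 0 T, G t = G s := by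
      intro s hs t ht
      have hst : uIoc s t ⊆ Ioo 0 T := fun r hr =>
        ⟨(lt_min hs.2.1 ht.2.1).trans hr.1, hr.2.trans_lt (max_lt hs.2.2 ht.2.2)⟩
      have hVi : ∀ r, Integrable (fun x => ψ x * V r x) (spaceM Ω) := fun r =>
        integrable_smul_of_memLp_two hψ2 (Lp.memLp (V r))
      have e1 : (∫ x in Ω, ψ x * V t x) - (∫ x in Ω, ψ x * V s x) =
          ∫ x in Ω, ∫ τ in s..t, ψ x * ρt τ x := by
        rw [← integral_sub (hVi t) (hVi s)]
        refine integral_congr_ae ?_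
        filter_upwards [hAd s hs.1.1 t ht.1.1, hs.1.2, ht.1.2] with x h1 h2 h3
        rw [h2, h3, ← mul_sub, h1, intervalIntegral.integral_const_mul]
      have e2 : ∫ x in Ω, ∫ τ in s..t, ψ x * ρt τ x = ∫ τ in s..t, ∫ x in Ω, ψ x * ρt τ x := by
        refine (intervalIntegral_integral_swap (f := fun τ x => ψ x * ρt τ x) ?_).symm
        exact hprod.mono_measure (Measure.prod_mono (Measure.restrict_mono hst le_rfl) le_rfl)
      have e3 : ∫ τ in s..t, ∫ x in Ω, ψ x * ρt τ x =
          ∫ τ in s..t, ∫ x in Ω, ρ τ x * fderiv ℝ ψ x (u τ x) := by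
        refine intervalIntegral.integral_congr_ae ?_
        have := (ae_restrict_iff' measurableSet_Ioo).1 hkey
        filter_upwards [this] with τ h1 h2 using h1 (hst h2)
      have e4 := intervalIntegral.integral_interval_sub_left
        (hii hT0 (Ioo_subset_Icc_self ht.2)) (hii hT0 (Ioo_subset_Icc_self hs.2))
      simp only [hG]
      linarith
    have hGT : ∀ s ∈ Icc 0 T, ∀ t ∈ Icc 0 T, G t = G s := by
      have hae : ∀ᵐ t ∂timeM T, t ∈ A ∩ {t | V t =ᵐ[spaceM Ω] ρ t} ∩ Ioo 0 T := by
        filter_upwards [hA, hV, ae_restrict_mem measurableSet_Ioo] with t h1 h2 h3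
          using ⟨⟨h1, h2⟩, h3⟩
      have hne : (timeM T) ≠ 0 := by
        rw [Ne, Measure.restrict_eq_zero, Real.volume_Ioo]; simpa using hT
      have : (ae (timeM T)).NeBot := ae_neBot.2 hne
      obtain ⟨s₀, hs₀⟩ := hae.exists
      have h1 := ContinuousOn.mem_of_ae_mem hT hGc (isClosed_singleton (x := G s₀))
        (hae.mono fun t ht => hG0 s₀ hs₀ t ht)
      intro s hs t ht
      rw [h1 s hs, h1 t ht]
    have h1 := hGT s hs t ht
    simp only [hG] at h1
    rw [← intervalIntegral.integral_interval_sub_left (hii hT0 ht) (hii hT0 hs)]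
    linarith

end Density

/-! ### The velocity as a Lipschitz field with integrable constant. -/

section Velocity

variable {Ω : Set E3} {T R μ lam κ cv q : ℝ} {ρ₀ : E3 → ℝ} {u₀ : E3 → E3} {θ₀ : E3 → ℝ}
  {ρ : ℝ → E3 → ℝ} {u : ℝ → E3 → E3} {θ : ℝ → E3 → ℝ}
  {ρt : ℝ → E3 → ℝ} {Dρ : ℝ → E3 → E3 →L[ℝ] ℝ}
  {ut : ℝ → E3 → E3} {Du : ℝ → E3 → E3 →L[ℝ] E3} {D2u : ℝ → E3 → E3 →L[ℝ] E3 →L[ℝ] E3}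
  {Dut : ℝ → E3 → E3 →L[ℝ] E3}
  {θt : ℝ → E3 → ℝ} {Dθ : ℝ → E3 → E3 →L[ℝ] ℝ} {D2θ : ℝ → E3 → E3 →L[ℝ] E3 →L[ℝ] ℝ}
  {Dθt : ℝ → E3 → E3 →L[ℝ] ℝ} {DM : ℝ → E3 → E3 →L[ℝ] E3} {DP : ℝ → E3 → E3 →L[ℝ] ℝ}

/-- At almost every time `u τ`, extended by zero, has a representative that is bounded and Lipschitz
with constant `a τ`, and `a` is integrable in time. -/
structure IsLipschitzVelocity (Ω : Set E3) (T : ℝ) (u : ℝ → E3 → E3) (a : ℝ → ℝ) : Prop where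
  one_le : ∀ τ, 1 ≤ a τ
  integrable : IntegrableOn a (Ioo 0 T)
  meas : AEStronglyMeasurable (Function.uncurry u) ((timeM T).prod (spaceM Ω))
  lip : ∀ᵐ τ ∂timeM T, ∃ g : E3 → E3, LipschitzWith (a τ).toNNReal g ∧ (∀ x, ‖g x‖ ≤ a τ) ∧
    g =ᵐ[volume] Ω.indicator (u τ)

lemma norm_le_of_ae_norm_le {N : Type*} [NormedAddCommGroup N] {g : E3 → N} (hg : Continuous g)
    {c : ℝ} (h : ∀ᵐ x, ‖g x‖ ≤ c) (x : E3) : ‖g x‖ ≤ c := by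
  have h1 : {x | ‖g x‖ ≤ c} = univ :=
    (isClosed_le hg.norm continuous_const).ae_eq_univ_iff_eq.1 (by
      rw [ae_eq_univ]; exact h)
  exact (h1 ▸ mem_univ x : x ∈ {x | ‖g x‖ ≤ c})

/-- Morrey's bound for `u(τ)` and for `Du(τ)` controls both in sup norm by the `W^{2,q}` norm, which
is integrable in time. Membership in `H₀¹` then makes the zero extension Lipschitz across the
boundary. -/
theorem IsSolutionWith.exists_lipschitzVelocity (hΩ : IsSmoothBoundedDomain Ω) (hq : 3 < q)
    (h : IsSolutionWith Ω T R μ lam κ cv q ρ₀ u₀ θ₀ ρ u θ ρt Dρ ut Du D2u Dut θt Dθ D2θ Dθt DM DP) :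
    ∃ a, IsLipschitzVelocity Ω T u a ∧ ∀ᵐ τ ∂timeM T, ∀ᵐ x ∂spaceM Ω, ‖Du τ x‖ ≤ a τ := by
  have hΩm := hΩ.isOpen.measurableSet
  obtain ⟨C1, hC1, h1⟩ := hΩ.ae_norm_le (F := E3) hq
  obtain ⟨C2, hC2, h2⟩ := hΩ.ae_norm_le (F := E3 →L[ℝ] E3) hq
  set p := ENNReal.ofReal q with hp
  have hp0 : p ≠ 0 := by
    rw [hp, Ne, ENNReal.ofReal_eq_zero]; linarith
  obtain ⟨i1, m1⟩ := h.u_W2q.1.2.1.integrable_eLpNorm hp0 ENNReal.ofReal_ne_top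
  obtain ⟨i2, m2⟩ := h.u_W2q.1.2.2.integrable_eLpNorm hp0 ENNReal.ofReal_ne_top
  obtain ⟨i3, m3⟩ := h.u_W2q.2.2.2.integrable_eLpNorm hp0 ENNReal.ofReal_ne_top
  set c : ℝ := ((lipschitzExtensionConstant E3 : NNReal) : ℝ) with hc
  have hc0 : 0 ≤ c := NNReal.coe_nonneg _
  set n1 : ℝ → ℝ := fun t => (eLpNorm (u t) p (spaceM Ω)).toReal with hn1
  set n2 : ℝ → ℝ := fun t => (eLpNorm (Du t) p (spaceM Ω)).toReal with hn2
  set n3 : ℝ → ℝ := fun t => (eLpNorm (D2u t) p (spaceM Ω)).toReal with hn3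
  have p1 : ∀ t, 0 ≤ n1 t := fun t => ENNReal.toReal_nonneg
  have p2 : ∀ t, 0 ≤ n2 t := fun t => ENNReal.toReal_nonneg
  have p3 : ∀ t, 0 ≤ n3 t := fun t => ENNReal.toReal_nonneg
  -- The summand `1` gives `1 ≤ a`, so that elapsed time is bounded by the integral of `a`. The
  -- factor `c + 1` covers both the Lipschitz constant, with the loss `c` of the extension theorem,
  -- and the bare bound for `Du`.
  set a : ℝ → ℝ := fun t => 1 + C1 * (n1 t + n2 t) + (c + 1) * (C2 * (n2 t + n3 t)) with ha
  have ha1 : ∀ t, C1 * (n1 t + n2 t) ≤ a t := fun t => by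
    have := p1 t; have := p2 t; have := p3 t
    simp only [ha]
    have : 0 ≤ (c + 1) * (C2 * (n2 t + n3 t)) := by positivity
    linarith
  have ha2 : ∀ t, (c + 1) * (C2 * (n2 t + n3 t)) ≤ a t := fun t => by
    have := p1 t; have := p2 t; have := p3 t
    simp only [ha]
    have : 0 ≤ C1 * (n1 t + n2 t) := by positivity
    linarith
  have hone : ∀ t, 1 ≤ a t := fun t => by
    have := p1 t; have := p2 t; have := p3 t
    simp only [ha]
    have : 0 ≤ C1 * (n1 t + n2 t) := by positivity
    have : 0 ≤ (c + 1) * (C2 * (n2 t + n3 t)) := by positivity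
    linarith
  refine ⟨a, ⟨hone, ?_, h.u_H10.2.1.1, ?_⟩, ?_⟩
  · have : Integrable (fun _ : ℝ => (1 : ℝ)) (timeM T) := integrable_const _
    exact (this.add ((i1.add i2).const_mul C1)).add (((i2.add i3).const_mul C2).const_mul (c + 1))
  · filter_upwards [m1, m2, m3, h.u_W2q.1.1, h.u_W2q.2.1, h.u_H10.1] with τ q1 q2 q3 q4 q5 q6
    have e1 := h1 ⟨q4, q1, q2⟩
    have e2 := h2 ⟨q5, q2, q3⟩
    have hL0 : 0 ≤ C2 * (n2 τ + n3 τ) := mul_nonneg hC2 (add_nonneg (p2 τ) (p3 τ))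
    obtain ⟨g, hg, hgu⟩ := q6.exists_lipschitzWith hΩm hΩ.isBounded.measure_lt_top.ne
      (a := (C2 * (n2 τ + n3 τ)).toNNReal) (by rwa [Real.coe_toNNReal _ hL0])
    refine ⟨g, hg.weaken ?_, norm_le_of_ae_norm_le hg.continuous ?_, hgu⟩
    · rw [← NNReal.coe_le_coe, Real.coe_toNNReal _ (by linarith [hone τ])]
      refine le_trans ?_ (ha2 τ)
      rw [NNReal.coe_mul, Real.coe_toNNReal _ hL0]
      exact mul_le_mul_of_nonneg_right (by rw [← hc]; linarith) hL0
    · have e3 := (ae_restrict_iff' hΩm).1 e1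
      filter_upwards [hgu, e3] with x hx h3
      rw [hx]
      by_cases hxΩ : x ∈ Ω
      · rw [indicator_of_mem hxΩ]
        exact (h3 hxΩ).trans (ha1 τ)
      · rw [indicator_of_notMem hxΩ, norm_zero]
        linarith [hone τ]
  · filter_upwards [m2, m3, h.u_W2q.2.1] with τ q2 q3 q5
    filter_upwards [h2 ⟨q5, q2, q3⟩] with x hx
    refine hx.trans (le_trans ?_ (ha2 τ))
    have hL0 : 0 ≤ C2 * (n2 τ + n3 τ) := mul_nonneg hC2 (add_nonneg (p2 τ) (p3 τ))
    refine le_mul_of_one_le_left hL0 (by linarith)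

end Velocity

/-! ### The flow: representatives, continuity in time, Lipschitz continuity in space. -/

section Flow

variable {Ω : Set E3} {T : ℝ} {u : ℝ → E3 → E3} {a : ℝ → ℝ} {φ : ℝ → E3 → E3}

lemma IsLipschitzVelocity.intervalIntegrable (h : IsLipschitzVelocity Ω T u a) {s t : ℝ}
    (hs : s ∈ Icc 0 T) (ht : t ∈ Icc 0 T) : IntervalIntegrable a volume s t := by
  have hT := hs.1.trans hs.2
  have h1 : IntervalIntegrable a volume 0 T := by
    rw [intervalIntegrable_iff_integrableOn_Ioo_of_le hT]
    exact h.integrable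
  exact h1.mono_set (by rw [uIcc_of_le hT]; exact uIcc_subset_Icc hs ht)

lemma IsLipschitzVelocity.nonneg (h : IsLipschitzVelocity Ω T u a) (t : ℝ) : 0 ≤ a t := by
  linarith [h.one_le t]

lemma IsLipschitzVelocity.sub_le_integral (h : IsLipschitzVelocity Ω T u a) {s t : ℝ}
    (hs : s ∈ Icc 0 T) (ht : t ∈ Icc 0 T) (hst : s ≤ t) : t - s ≤ ∫ τ in s..t, a τ := by
  have := intervalIntegral.integral_mono_on (f := fun _ => (1 : ℝ)) hst
    (by simp) (h.intervalIntegrable hs ht) fun τ _ => h.one_le τ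
  simpa using this

lemma IsLipschitzVelocity.integral_nonneg (h : IsLipschitzVelocity Ω T u a) {s t : ℝ}
    (hst : s ≤ t) : 0 ≤ ∫ τ in s..t, a τ :=
  intervalIntegral.integral_nonneg hst fun τ _ => h.nonneg τ

lemma IsLipschitzVelocity.integral_mono (h : IsLipschitzVelocity Ω T u a) {s r t : ℝ}
    (hs : s ∈ Icc 0 T) (ht : t ∈ Icc 0 T) (hsr : s ≤ r) (hrt : r ≤ t) :
    ∫ τ in s..r, a τ ≤ ∫ τ in s..t, a τ := by
  have hr : r ∈ Icc 0 T := ⟨hs.1.trans hsr, hrt.trans ht.2⟩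
  rw [← intervalIntegral.integral_add_adjacent_intervals (h.intervalIntegrable hs hr)
    (h.intervalIntegrable hr ht)]
  linarith [h.integral_nonneg hrt]

/-- A fine uniform partition on whose intervals the integral of `a` is small. -/
lemma IsLipschitzVelocity.exists_partition (h : IsLipschitzVelocity Ω T u a) {t : ℝ}
    (ht : t ∈ Icc 0 T) {β : ℝ} (hβ : 0 < β) : ∃ n : ℕ, 0 < n ∧ ∀ i < n,
      ∫ τ in (i * (t / n))..((i + 1 : ℕ) * (t / n)), a τ ≤ β := by
  have hT := ht.1.trans ht.2
  have h0 : (0 : ℝ) ∈ Icc 0 T := ⟨le_rfl, hT⟩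
  have hc := intervalIntegral.continuousOn_primitive_interval (a := (0 : ℝ)) (b := T)
    (f := a) (μ := volume) (by
      rw [uIcc_of_le hT, integrableOn_Icc_iff_integrableOn_Ioo]; exact h.integrable)
  rw [uIcc_of_le hT] at hc
  have huc := isCompact_Icc.uniformContinuousOn_of_continuous hc
  obtain ⟨δ, hδ, hd⟩ := Metric.uniformContinuousOn_iff.1 huc β hβ
  obtain ⟨n, hn⟩ := exists_nat_gt (t / δ)
  have hn0 : 0 < n := by
    have : (0 : ℝ) < n := (div_nonneg ht.1 hδ.le).trans_lt hn
    exact_mod_cast this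
  have hn0' : (0 : ℝ) < n := by exact_mod_cast hn0
  refine ⟨n, hn0, fun i hi => ?_⟩
  have hmem : ∀ j : ℕ, j ≤ n → (j * (t / n) : ℝ) ∈ Icc 0 T := fun j hj => by
    have h1 : (j : ℝ) ≤ n := by exact_mod_cast hj
    refine ⟨mul_nonneg (Nat.cast_nonneg _) (div_nonneg ht.1 hn0'.le), ?_⟩
    calc (j * (t / n) : ℝ) ≤ n * (t / n) := by
          refine mul_le_mul_of_nonneg_right h1 (div_nonneg ht.1 hn0'.le)
      _ = t := by field_simp
      _ ≤ T := ht.2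
  have h1 := hd _ (hmem (i + 1) hi) _ (hmem i hi.le) (by
    rw [Real.dist_eq, ← sub_mul]
    push_cast
    rw [add_sub_cancel_left, one_mul, abs_of_nonneg (div_nonneg ht.1 hn0'.le)]
    rw [div_lt_iff₀ hδ] at hn
    rw [div_lt_iff₀ hn0']
    linarith)
  rw [Real.dist_eq, intervalIntegral.integral_interval_sub_left
    (h.intervalIntegrable h0 (hmem _ hi)) (h.intervalIntegrable h0 (hmem _ hi.le))] at h1
  exact (le_abs_self _).trans h1.le

/-- The velocity along the flow, expressed through Lipschitz representatives. -/
lemma IsFlow.exists_velocity (hΩo : IsOpen Ω) (h : IsLipschitzVelocity Ω T u a)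
    (hφ : IsFlow Ω T u φ) : ∃ W : ℝ → E3 → E3,
      (∀ᵐ τ ∂timeM T, LipschitzWith (a τ).toNNReal (W τ) ∧ (∀ x, ‖W τ x‖ ≤ a τ) ∧
        W τ =ᵐ[volume] Ω.indicator (u τ)) ∧
      ∀ y ∈ Ω, ∀ s ∈ Icc 0 T, ∀ t ∈ Icc 0 T,
        IntervalIntegrable (fun τ => W τ (φ τ y)) volume s t ∧
        φ t y - φ s y = ∫ τ in s..t, W τ (φ τ y) := by
  obtain ⟨U, hU, hφU⟩ := hφ
  have hex : ∃ W : ℝ → E3 → E3, ∀ᵐ τ ∂timeM T, LipschitzWith (a τ).toNNReal (W τ) ∧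
      (∀ x, ‖W τ x‖ ≤ a τ) ∧ W τ =ᵐ[volume] Ω.indicator (u τ) := by
    -- The representatives are chosen separately at each time. No measurability in time is needed,
    -- because along trajectories `W` agrees almost everywhere with the given `U`: two continuous
    -- representatives coincide on the open set `Ω`.
    refine ⟨fun τ => Classical.epsilon fun g : E3 → E3 => LipschitzWith (a τ).toNNReal g ∧
      (∀ x, ‖g x‖ ≤ a τ) ∧ g =ᵐ[volume] Ω.indicator (u τ), ?_⟩
    filter_upwards [h.lip] with τ hτ using Classical.epsilon_spec hτ
  obtain ⟨W, hW⟩ := hex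
  refine ⟨W, hW, fun y hy s hs t ht => ?_⟩
  have heq : ∀ᵐ τ ∂timeM T, EqOn (U τ) (W τ) Ω := by
    filter_upwards [hU, hW] with τ h1 h2
    refine Measure.eqOn_open_of_ae_eq (μ := volume) ?_ hΩo h1.1 h2.1.continuous.continuousOn
    have h3 : W τ =ᵐ[spaceM Ω] Ω.indicator (u τ) := ae_restrict_of_ae h2.2.2
    exact h1.2.trans ((h3.trans (indicator_ae_eq_restrict hΩo.measurableSet)).symm)
  have hT := hs.1.trans hs.2
  have heq' : ∀ᵐ τ, τ ∈ Ioc 0 T → U τ (φ τ y) = W τ (φ τ y) := by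
    have h1 : ∀ᵐ τ, τ ≠ T := Measure.ae_ne volume T
    filter_upwards [(ae_restrict_iff' measurableSet_Ioo).1 heq, h1] with τ h2 h3 h4
    have h5 : τ ∈ Ioo 0 T := ⟨h4.1, lt_of_le_of_ne h4.2 h3⟩
    exact h2 h5 (hφU y hy τ (Ioo_subset_Icc_self h5)).1
  have hi : ∀ t ∈ Icc 0 T, IntervalIntegrable (fun τ => W τ (φ τ y)) volume 0 t := by
    intro t ht
    refine (hφU y hy t ht).2.1.congr_ae ?_
    rw [uIoc_of_le ht.1]
    filter_upwards [ae_restrict_of_ae heq', ae_restrict_mem measurableSet_Ioc] with τ h1 h2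
    exact h1 ⟨h2.1, h2.2.trans ht.2⟩
  have he : ∀ t ∈ Icc 0 T, φ t y = y + ∫ τ in (0 : ℝ)..t, W τ (φ τ y) := by
    intro t ht
    rw [(hφU y hy t ht).2.2]
    congr 1
    refine intervalIntegral.integral_congr_ae ?_
    rw [uIoc_of_le ht.1]
    filter_upwards [heq'] with τ h1 h2
    exact h1 ⟨h2.1, h2.2.trans ht.2⟩
  refine ⟨(hi s hs).symm.trans (hi t ht), ?_⟩
  rw [he t ht, he s hs, add_sub_add_left_eq_sub,
    intervalIntegral.integral_interval_sub_left (hi t ht) (hi s hs)]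

lemma ae_imp_of_ae_timeM {s t : ℝ} (hs : s ∈ Icc 0 T) (ht : t ∈ Icc 0 T) {p : ℝ → Prop}
    (h : ∀ᵐ τ ∂timeM T, p τ) : ∀ᵐ τ, τ ∈ Ioc s t → p τ := by
  have h1 : ∀ᵐ τ, τ ≠ T := Measure.ae_ne volume T
  filter_upwards [(ae_restrict_iff' measurableSet_Ioo).1 h, h1] with τ h2 h3 h4
  exact h2 ⟨hs.1.trans_lt h4.1, lt_of_le_of_ne (h4.2.trans ht.2) h3⟩

lemma IsFlow.norm_sub_le (hΩo : IsOpen Ω) (h : IsLipschitzVelocity Ω T u a)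
    (hφ : IsFlow Ω T u φ) {y : E3} (hy : y ∈ Ω) {s t : ℝ} (hs : s ∈ Icc 0 T) (ht : t ∈ Icc 0 T)
    (hst : s ≤ t) : ‖φ t y - φ s y‖ ≤ ∫ τ in s..t, a τ := by
  obtain ⟨W, hW, hφW⟩ := hφ.exists_velocity hΩo h
  rw [(hφW y hy s hs t ht).2]
  refine intervalIntegral.norm_integral_le_of_norm_le hst ?_ (h.intervalIntegrable hs ht)
  exact ae_imp_of_ae_timeM hs ht (hW.mono fun τ hτ => hτ.2.1 _)

lemma IsFlow.continuousOn_time (hΩo : IsOpen Ω) (h : IsLipschitzVelocity Ω T u a)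
    (hφ : IsFlow Ω T u φ) {y : E3} (hy : y ∈ Ω) : ContinuousOn (fun t => φ t y) (Icc 0 T) := by
  rcases lt_or_ge T 0 with hT | hT
  · rw [Icc_eq_empty (by linarith)]; exact continuousOn_empty _
  obtain ⟨W, hW, hφW⟩ := hφ.exists_velocity hΩo h
  have h0 : (0 : ℝ) ∈ Icc 0 T := ⟨le_rfl, hT⟩
  have hi := (hφW y hy 0 h0 T ⟨hT, le_rfl⟩).1
  have hc := intervalIntegral.continuousOn_primitive_interval (a := (0 : ℝ)) (b := T)
    (f := fun τ => W τ (φ τ y)) (μ := volume) (by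
      rw [uIcc_of_le hT, integrableOn_Icc_iff_integrableOn_Ioc]
      exact (intervalIntegrable_iff_integrableOn_Ioc_of_le hT).1 hi)
  rw [uIcc_of_le hT] at hc
  refine (hc.const_add (φ 0 y)).congr fun t ht => ?_
  simp only [← (hφW y hy 0 h0 t ht).2]
  abel

/-- The flow is Lipschitz in space. -/
lemma IsFlow.exists_lipschitzOnWith (hΩo : IsOpen Ω) (h : IsLipschitzVelocity Ω T u a)
    (hφ : IsFlow Ω T u φ) {t : ℝ} (ht : t ∈ Icc 0 T) : ∃ L : NNReal, LipschitzOnWith L (φ t) Ω := by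
  obtain ⟨W, hW, hφW⟩ := hφ.exists_velocity hΩo h
  -- A substitute for Grönwall's inequality: on an interval where `∫ a ≤ 1/2`, half of the maximal
  -- distance of two trajectories can be absorbed, so this distance is at most twice the initial
  -- one. After `n` intervals the factor is `2 ^ n`.
  obtain ⟨n, hn, hp⟩ := h.exists_partition ht (β := 1 / 2) (by norm_num)
  have hn' : (0 : ℝ) < n := by exact_mod_cast hn
  have hmem : ∀ j : ℕ, j ≤ n → (j * (t / n) : ℝ) ∈ Icc 0 T := fun j hj => by
    have h1 : (j : ℝ) ≤ n := by exact_mod_cast hj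
    refine ⟨mul_nonneg (Nat.cast_nonneg _) (div_nonneg ht.1 hn'.le), ?_⟩
    calc (j * (t / n) : ℝ) ≤ n * (t / n) := by
          refine mul_le_mul_of_nonneg_right h1 (div_nonneg ht.1 hn'.le)
      _ = t := by field_simp
      _ ≤ T := ht.2
  refine ⟨2 ^ n, LipschitzOnWith.of_dist_le_mul fun y hy z hz => ?_⟩
  have hind : ∀ i : ℕ, i ≤ n → ‖φ (i * (t / n)) y - φ (i * (t / n)) z‖ ≤ 2 ^ i * ‖y - z‖ := by
    intro i
    induction i with
    | zero =>
      intro _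
      have h0 : (0 : ℝ) ∈ Icc 0 T := ⟨le_rfl, ht.1.trans ht.2⟩
      obtain ⟨U, -, hU⟩ := hφ
      simp [(hU y hy 0 h0).2.2, (hU z hz 0 h0).2.2]
    | succ i ih =>
      intro hi
      have ih := ih (by omega)
      set s : ℝ := i * (t / n) with hs
      set r : ℝ := (i + 1 : ℕ) * (t / n) with hr
      have hsm : s ∈ Icc 0 T := hmem i (by omega)
      have hrm : r ∈ Icc 0 T := hmem (i + 1) hi
      have hsr : s ≤ r := by
        rw [hs, hr]
        refine mul_le_mul_of_nonneg_right (by push_cast; linarith) (div_nonneg ht.1 hn'.le)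
      have hsub : Icc s r ⊆ Icc 0 T := Icc_subset_Icc hsm.1 hrm.2
      obtain ⟨τ, hτ, hmax⟩ := isCompact_Icc.exists_isMaxOn (nonempty_Icc.2 hsr)
        (((hφ.continuousOn_time hΩo h hy).sub (hφ.continuousOn_time hΩo h hz)).norm.mono hsub)
      have hmax' : ∀ σ ∈ Icc s r, ‖φ σ y - φ σ z‖ ≤ ‖φ τ y - φ τ z‖ := fun σ hσ => hmax hσ
      have hτm := hsub hτ
      have e1 : φ τ y - φ τ z = (φ s y - φ s z) +
          ∫ σ in s..τ, (W σ (φ σ y) - W σ (φ σ z)) := by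
        rw [intervalIntegral.integral_sub (hφW y hy s hsm τ hτm).1 (hφW z hz s hsm τ hτm).1,
          ← (hφW y hy s hsm τ hτm).2, ← (hφW z hz s hsm τ hτm).2]
        abel
      have e2 : ‖∫ σ in s..τ, (W σ (φ σ y) - W σ (φ σ z))‖ ≤
          ∫ σ in s..τ, a σ * ‖φ τ y - φ τ z‖ := by
        refine intervalIntegral.norm_integral_le_of_norm_le hτ.1 ?_
          ((h.intervalIntegrable hsm hτm).mul_const _)
        filter_upwards [ae_imp_of_ae_timeM hsm hτm hW] with σ h1 h2
        have h3 := (h1 h2).1.dist_le_mul (φ σ y) (φ σ z)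
        rw [dist_eq_norm, dist_eq_norm, Real.coe_toNNReal _ (h.nonneg σ)] at h3
        exact h3.trans (mul_le_mul_of_nonneg_left (hmax' σ ⟨h2.1.le, h2.2.trans hτ.2⟩)
          (h.nonneg σ))
      rw [intervalIntegral.integral_mul_const] at e2
      have e3 : ∫ σ in s..τ, a σ ≤ 1 / 2 :=
        (h.integral_mono hsm hrm hτ.1 hτ.2).trans (hp i (by omega))
      have e4 : ‖φ τ y - φ τ z‖ ≤ ‖φ s y - φ s z‖ + 1 / 2 * ‖φ τ y - φ τ z‖ := by
        conv_lhs => rw [e1]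
        refine (norm_add_le _ _).trans ?_
        gcongr
        exact e2.trans (by gcongr)
      have e5 := hmax' r ⟨hsr, le_rfl⟩
      rw [pow_succ]
      linarith
  have := hind n le_rfl
  rw [mul_div_cancel₀ _ hn'.ne'] at this
  rw [dist_eq_norm, dist_eq_norm]
  exact_mod_cast this

end Flow

/-! ### Mollified velocity and displacements over short times. -/

section Mollify

variable {Ω : Set E3} {T : ℝ} {u : ℝ → E3 → E3} {a : ℝ → ℝ}

/-- Mollification by the kernel `k` of a field on `Ω`, extended by zero. -/
def mollify (Ω : Set E3) (k : E3 → ℝ) (f : E3 → E3) (x : E3) : E3 := ∫ z in Ω, k (x - z) • f z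

lemma mollify_eq_convolution (hΩm : MeasurableSet Ω) (k : E3 → ℝ) (f : E3 → E3) :
    mollify Ω k f = convolution k (Ω.indicator f) (ContinuousLinearMap.lsmul ℝ ℝ) volume := by
  ext1 x
  rw [mollify, convolution_eq_swap, ← integral_indicator hΩm]
  refine integral_congr_ae (Eventually.of_forall fun z => ?_)
  simp only [ContinuousLinearMap.lsmul_apply]
  by_cases hz : z ∈ Ω
  · simp [hz]
  · simp [hz]

/-- Averaging with a probability kernel preserves the sup bound and the Lipschitz constant, and
moves a Lipschitz function by at most its constant times the radius of the kernel. -/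
lemma mollify_bump (hΩm : MeasurableSet Ω) (b : ContDiffBump (0 : E3)) {f g : E3 → E3} {c : ℝ}
    (hc : 0 ≤ c) (hg : LipschitzWith c.toNNReal g) (hgc : ∀ x, ‖g x‖ ≤ c)
    (hgf : g =ᵐ[volume] Ω.indicator f) (x : E3) :
    ‖mollify Ω (b.normed volume) f x - g x‖ ≤ c * b.rOut ∧
    ‖mollify Ω (b.normed volume) f x‖ ≤ c ∧
    ∀ y, ‖mollify Ω (b.normed volume) f x - mollify Ω (b.normed volume) f y‖ ≤ c * ‖x - y‖ := by
  have e0 : mollify Ω (b.normed volume) f =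
      convolution (b.normed volume) g (ContinuousLinearMap.lsmul ℝ ℝ) volume := by
    rw [mollify_eq_convolution hΩm]
    exact convolution_congr _ EventuallyEq.rfl hgf.symm
  have hgl : ∀ x y, ‖g x - g y‖ ≤ c * ‖x - y‖ := fun x y => by
    have := hg.dist_le_mul x y
    rwa [dist_eq_norm, dist_eq_norm, Real.coe_toNNReal _ hc] at this
  have hk := b.continuous_normed (μ := volume)
  have hkc := b.hasCompactSupport_normed (μ := volume)
  have hk1 := b.integral_normed (μ := volume)
  have hki : Integrable (b.normed volume) := hk.integrable_of_hasCompactSupport hkc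
  have hi : ∀ x, Integrable (fun t => b.normed volume t • g (x - t)) := fun x => by
    have := hg.continuous
    exact Continuous.integrable_of_hasCompactSupport (by fun_prop) hkc.smul_right
  have hbd : ∀ (G : E3 → E3) (C : ℝ), (∀ t, ‖G t‖ ≤ C) → ‖∫ t, b.normed volume t • G t‖ ≤ C := by
    intro G C hG
    calc ‖∫ t, b.normed volume t • G t‖ ≤ ∫ t, b.normed volume t * C := by
          refine norm_integral_le_of_norm_le (hki.mul_const C) (Eventually.of_forall fun t => ?_)
          rw [norm_smul, Real.norm_of_nonneg (b.nonneg_normed t)]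
          exact mul_le_mul_of_nonneg_left (hG t) (b.nonneg_normed t)
      _ = C := by rw [integral_mul_const, hk1, one_mul]
  refine ⟨?_, ?_, fun y => ?_⟩
  · rw [e0, ← dist_eq_norm]
    refine ContDiffBump.dist_normed_convolution_le hg.continuous.aestronglyMeasurable fun y hy => ?_
    rw [dist_eq_norm]
    refine (hgl y x).trans (mul_le_mul_of_nonneg_left ?_ hc)
    rw [← dist_eq_norm]
    exact (Metric.mem_ball.1 hy).le
  · rw [e0]
    exact hbd _ _ fun t => hgc _
  · rw [e0]
    simp only [convolution, ContinuousLinearMap.lsmul_apply]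
    rw [← integral_sub (hi x) (hi y)]
    simp_rw [← smul_sub]
    refine hbd _ _ fun t => (hgl _ _).trans (le_of_eq ?_)
    rw [sub_sub_sub_cancel_right]

/-- The constant `c` is a Lipschitz constant of the gradient of the kernel. It depends on the bump
and carries no uniformity as its radius shrinks, which later dictates the order of the limits. -/
lemma exists_mollify_contDiff (hΩm : MeasurableSet Ω) (b : ContDiffBump (0 : E3)) :
    ∃ c : ℝ, 0 ≤ c ∧ ∀ f : E3 → E3, Integrable f (spaceM Ω) →
      ContDiff ℝ ∞ (mollify Ω (b.normed volume) f) ∧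
      ∀ x y, ‖fderiv ℝ (mollify Ω (b.normed volume) f) x -
        fderiv ℝ (mollify Ω (b.normed volume) f) y‖ ≤ c * (∫ z in Ω, ‖f z‖) * ‖x - y‖ := by
  set k := b.normed volume with hk
  have hkc : HasCompactSupport k := b.hasCompactSupport_normed
  have hks : ContDiff ℝ ∞ k := b.contDiff_normed
  have hDk : ContDiff ℝ 1 (fderiv ℝ k) := hks.fderiv_right (m := 1) (by norm_cast)
  obtain ⟨C, hC⟩ := hDk.lipschitzWith_of_hasCompactSupport (hkc.fderiv ℝ) (by simp)
  refine ⟨C, C.2, fun f hf => ?_⟩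
  have hfi : Integrable (Ω.indicator f) := (integrable_indicator_iff hΩm).2 hf
  rw [mollify_eq_convolution hΩm]
  refine ⟨hkc.contDiff_convolution_left _ hks hfi.locallyIntegrable, fun x y => ?_⟩
  set L := (ContinuousLinearMap.lsmul ℝ ℝ : ℝ →L[ℝ] E3 →L[ℝ] E3)
  rw [(hkc.hasFDerivAt_convolution_left L (hks.of_le (by norm_cast))
    hfi.locallyIntegrable x).fderiv,
    (hkc.hasFDerivAt_convolution_left L (hks.of_le (by norm_cast)) hfi.locallyIntegrable y).fderiv]
  have hex := fun x => (hkc.fderiv ℝ).convolutionExists_left (L.precompL E3)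
    hDk.continuous hfi.locallyIntegrable x
  rw [convolution_eq_swap, convolution_eq_swap]
  have hi : ∀ x, Integrable fun t => (L.precompL E3 (fderiv ℝ k (x - t))) (Ω.indicator f t) :=
    fun x => (hex x).integrable_swap
  rw [← integral_sub (hi x) (hi y)]
  calc ‖∫ t, (L.precompL E3 (fderiv ℝ k (x - t))) (Ω.indicator f t) -
        (L.precompL E3 (fderiv ℝ k (y - t))) (Ω.indicator f t)‖
      ≤ ∫ t, (C * ‖x - y‖) * ‖Ω.indicator f t‖ := by
        refine norm_integral_le_of_norm_le (hfi.norm.const_mul _) (Eventually.of_forall fun t => ?_)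
        rw [← sub_apply, ← map_sub]
        refine (ContinuousLinearMap.le_opNorm₂ _ _ _).trans ?_
        have h1 : ‖L.precompL E3‖ ≤ 1 :=
          (ContinuousLinearMap.norm_precompL_le _ _).trans ContinuousLinearMap.opNorm_lsmul_le
        have h2 := hC.dist_le_mul (x - t) (y - t)
        rw [dist_eq_norm, dist_eq_norm, sub_sub_sub_cancel_right] at h2
        refine mul_le_mul_of_nonneg_right ?_ (norm_nonneg _)
        calc _ ≤ 1 * ‖fderiv ℝ k (x - t) - fderiv ℝ k (y - t)‖ := by gcongr
          _ ≤ _ := by rw [one_mul]; exact h2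
    _ = C * (∫ z in Ω, ‖f z‖) * ‖x - y‖ := by
        rw [integral_const_mul]
        simp_rw [norm_indicator_eq_indicator_norm]
        rw [integral_indicator hΩm]
        ring

lemma IsLipschitzVelocity.ae_norm_le (hΩm : MeasurableSet Ω) (h : IsLipschitzVelocity Ω T u a) :
    ∀ᵐ τ ∂timeM T, ∀ᵐ x ∂spaceM Ω, ‖u τ x‖ ≤ a τ := by
  filter_upwards [h.lip] with τ ⟨g, _, hg, hgu⟩
  have h0 : g =ᵐ[spaceM Ω] Ω.indicator (u τ) := ae_restrict_of_ae hgu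
  have h1 : g =ᵐ[spaceM Ω] u τ := h0.trans (indicator_ae_eq_restrict hΩm)
  filter_upwards [h1] with x hx
  rw [← hx]; exact hg x

lemma IsLipschitzVelocity.integrable_uncurry (hΩm : MeasurableSet Ω) (hΩ : Bornology.IsBounded Ω)
    (h : IsLipschitzVelocity Ω T u a) :
    Integrable (Function.uncurry u) ((timeM T).prod (spaceM Ω)) ∧
    ∀ᵐ τ ∂timeM T, ∫ x in Ω, ‖u τ x‖ ≤ volume.real Ω * a τ := by
  have := isFiniteMeasure_spaceM hΩ
  have h1 : ∀ᵐ τ ∂timeM T, ∫ x in Ω, ‖u τ x‖ ≤ volume.real Ω * a τ := by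
    filter_upwards [h.ae_norm_le hΩm, h.meas.prodMk_left] with τ hτ hm
    calc ∫ x in Ω, ‖u τ x‖ ≤ ∫ x in Ω, a τ := by
          refine integral_mono_of_nonneg (Eventually.of_forall fun x => norm_nonneg _)
            (integrable_const _) hτ
      _ = _ := by simp
  refine ⟨(integrable_prod_iff h.meas).2 ⟨?_, ?_⟩, h1⟩
  · filter_upwards [h.ae_norm_le hΩm, h.meas.prodMk_left] with τ hτ hm
    exact Integrable.of_bound hm (a τ) hτ
  · refine Integrable.mono' (h.integrable.const_mul (volume.real Ω))
      h.meas.norm.integral_prod_right' ?_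
    filter_upwards [h1] with τ hτ
    rw [Real.norm_of_nonneg (MeasureTheory.integral_nonneg fun x => norm_nonneg _)]
    exact hτ

/-- The displacement during `[s, t]` under the mollified velocity. -/
def displacement (Ω : Set E3) (k : E3 → ℝ) (u : ℝ → E3 → E3) (s t : ℝ) (x : E3) : E3 :=
  ∫ τ in s..t, mollify Ω k (u τ) x

lemma IsLipschitzVelocity.integrable_kernel (hΩm : MeasurableSet Ω) (hΩ : Bornology.IsBounded Ω)
    (h : IsLipschitzVelocity Ω T u a) (b : ContDiffBump (0 : E3)) (x : E3) :
    Integrable (fun z : ℝ × E3 => b.normed volume (x - z.2) • u z.1 z.2)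
      ((timeM T).prod (spaceM Ω)) := by
  have hk := b.continuous_normed (μ := volume)
  obtain ⟨B, hB⟩ := (b.hasCompactSupport_normed (μ := volume)).exists_bound_of_continuous hk
  exact Integrable.bdd_smul (f := Function.uncurry u)
    (φ := fun z : ℝ × E3 => b.normed volume (x - z.2)) (h.integrable_uncurry hΩm hΩ).1 B
    (Continuous.aestronglyMeasurable (by fun_prop)) (Eventually.of_forall fun z => hB _)

lemma restrict_uIoc_le_timeM {s t : ℝ} (hs : s ∈ Icc 0 T) (ht : t ∈ Icc 0 T) :
    (volume.restrict (uIoc s t) : Measure ℝ) ≤ timeM T := by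
  rw [timeM, Measure.restrict_congr_set (Ioo_ae_eq_Ioc (a := (0 : ℝ)) (b := T))]
  have hsub : uIoc s t ⊆ Ioc 0 T := fun r hr =>
    ⟨(le_min hs.1 ht.1).trans_lt hr.1, hr.2.trans (max_le hs.2 ht.2)⟩
  exact Measure.restrict_mono hsub le_rfl

lemma intervalIntegrable_of_integrable_timeM {N : Type*} [NormedAddCommGroup N]
    {f : ℝ → N} (hf : Integrable f (timeM T)) {s t : ℝ} (hs : s ∈ Icc 0 T) (ht : t ∈ Icc 0 T) :
    IntervalIntegrable f volume s t := by
  rw [intervalIntegrable_iff]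
  exact hf.mono_measure (restrict_uIoc_le_timeM hs ht)

/-- By Fubini's theorem the displacement is the mollification of the time integral of `u`, hence
smooth in space without any regularity in time. The first order bounds do not involve the bump; only
the second order constant `c` does. -/
lemma IsLipschitzVelocity.displacement_spec (hΩm : MeasurableSet Ω) (hΩ : Bornology.IsBounded Ω)
    (h : IsLipschitzVelocity Ω T u a) (b : ContDiffBump (0 : E3)) :
    ∃ c : ℝ, 0 ≤ c ∧ ∀ s ∈ Icc 0 T, ∀ t ∈ Icc 0 T, s ≤ t →
      ContDiff ℝ ∞ (displacement Ω (b.normed volume) u s t) ∧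
      (∀ x, ‖displacement Ω (b.normed volume) u s t x‖ ≤ ∫ τ in s..t, a τ) ∧
      (∀ x, ‖fderiv ℝ (displacement Ω (b.normed volume) u s t) x‖ ≤ ∫ τ in s..t, a τ) ∧
      ∀ x y, ‖fderiv ℝ (displacement Ω (b.normed volume) u s t) x -
        fderiv ℝ (displacement Ω (b.normed volume) u s t) y‖ ≤
          c * (∫ τ in s..t, a τ) * ‖x - y‖ := by
  obtain ⟨c, hc, hm⟩ := exists_mollify_contDiff hΩm b
  refine ⟨c * volume.real Ω, by positivity, fun s hs t ht hst => ?_⟩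
  obtain ⟨hui, hun⟩ := h.integrable_uncurry hΩm hΩ
  have hle := restrict_uIoc_le_timeM hs ht
  set f : E3 → E3 := fun z => ∫ τ in s..t, u τ z with hf
  have hui' : Integrable (Function.uncurry u) ((volume.restrict (uIoc s t)).prod (spaceM Ω)) :=
    hui.mono_measure (Measure.prod_mono hle le_rfl)
  have hfi : Integrable f (spaceM Ω) := by
    have := hui'.integral_prod_right
    refine this.congr (Eventually.of_forall fun x => ?_)
    simp only [hf, intervalIntegral.integral_of_le hst, uIoc_of_le hst, Function.uncurry]
  have hfn : ∫ z in Ω, ‖f z‖ ≤ volume.real Ω * ∫ τ in s..t, a τ := by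
    calc ∫ z in Ω, ‖f z‖ ≤ ∫ z in Ω, ∫ τ in s..t, ‖u τ z‖ := by
          refine integral_mono_of_nonneg (Eventually.of_forall fun x => norm_nonneg _) ?_
            (Eventually.of_forall fun x =>
              intervalIntegral.norm_integral_le_integral_norm hst)
          have := hui'.norm.integral_prod_right
          refine this.congr (Eventually.of_forall fun x => ?_)
          simp only [intervalIntegral.integral_of_le hst, uIoc_of_le hst, Function.uncurry]
      _ = ∫ τ in s..t, ∫ z in Ω, ‖u τ z‖ :=
          (intervalIntegral_integral_swap (f := fun τ z => ‖u τ z‖) hui'.norm).symm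
      _ ≤ ∫ τ in s..t, volume.real Ω * a τ := by
          refine intervalIntegral.integral_mono_ae_restrict hst
            (intervalIntegrable_of_integrable_timeM hui.norm.integral_prod_left hs ht)
            ((h.intervalIntegrable hs ht).const_mul _) ?_
          have h1 : ∀ᵐ τ, τ ∈ Ioc s t → ∫ x in Ω, ‖u τ x‖ ≤ volume.real Ω * a τ :=
            ae_imp_of_ae_timeM hs ht hun
          rw [restrict_Ioc_eq_restrict_Icc.symm]
          exact (ae_restrict_iff' measurableSet_Ioc).2 h1
      _ = _ := intervalIntegral.integral_const_mul _ _
  have heq : displacement Ω (b.normed volume) u s t = mollify Ω (b.normed volume) f := by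
    ext1 x
    rw [displacement]
    simp only [mollify]
    have := intervalIntegral_integral_swap (f := fun τ z => b.normed volume (x - z) • u τ z)
      ((h.integrable_kernel hΩm hΩ b x).mono_measure (Measure.prod_mono hle le_rfl))
    rw [this]
    refine integral_congr_ae (Eventually.of_forall fun z => ?_)
    simp only [hf]
    rw [intervalIntegral.integral_smul]
  have hii : ∀ x, IntervalIntegrable (fun τ => mollify Ω (b.normed volume) (u τ) x) volume s t :=
    fun x => intervalIntegrable_of_integrable_timeM
      (h.integrable_kernel hΩm hΩ b x).integral_prod_left hs ht
  have hα := h.integral_nonneg hst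
  obtain ⟨h1, h2⟩ := hm f hfi
  refine ⟨heq ▸ h1, fun x => ?_, fun x => ?_, fun x y => ?_⟩
  · refine intervalIntegral.norm_integral_le_of_norm_le hst ?_ (h.intervalIntegrable hs ht)
    refine ae_imp_of_ae_timeM hs ht ?_
    filter_upwards [h.lip] with τ ⟨g, g1, g2, g3⟩
    exact (mollify_bump hΩm b (h.nonneg τ) g1 g2 g3 x).2.1
  · have hL : LipschitzWith (∫ τ in s..t, a τ).toNNReal
        (displacement Ω (b.normed volume) u s t) := by
      refine LipschitzWith.of_dist_le_mul fun x y => ?_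
      rw [dist_eq_norm, dist_eq_norm, Real.coe_toNNReal _ hα, displacement, displacement,
        ← intervalIntegral.integral_sub (hii x) (hii y), ← intervalIntegral.integral_mul_const]
      refine intervalIntegral.norm_integral_le_of_norm_le hst ?_
        ((h.intervalIntegrable hs ht).mul_const _)
      refine ae_imp_of_ae_timeM hs ht ?_
      filter_upwards [h.lip] with τ ⟨g, g1, g2, g3⟩
      exact (mollify_bump hΩm b (h.nonneg τ) g1 g2 g3 x).2.2 y
    have := norm_fderiv_le_of_lipschitz ℝ hL (x₀ := x)
    rwa [Real.coe_toNNReal _ hα] at this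
  · rw [heq]
    refine (h2 x y).trans ?_
    rw [mul_assoc c (volume.real Ω)]
    gcongr

end Mollify

/-! ### Conservation of mass along the flow, by discretisation in time. -/

section Transport

variable {Ω : Set E3} {T m : ℝ} {u : ℝ → E3 → E3} {a : ℝ → ℝ} {φ : ℝ → E3 → E3} {ρ₀ : E3 → ℝ}
  {ρ : ℝ → E3 → ℝ} {V : ℝ → Lp ℝ 2 (spaceM Ω)}

/-- First and second order bounds for a smooth function. -/
structure IsC2Bounded (ψ : E3 → ℝ) (L K : ℝ) : Prop where
  smooth : ContDiff ℝ ∞ ψ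
  fst : ∀ x, ‖fderiv ℝ ψ x‖ ≤ L
  snd : ∀ x y, ‖fderiv ℝ ψ x - fderiv ℝ ψ y‖ ≤ K * ‖x - y‖

lemma IsC2Bounded.nonneg {ψ : E3 → ℝ} {L K : ℝ} (h : IsC2Bounded ψ L K) : 0 ≤ L ∧ 0 ≤ K := by
  refine ⟨(norm_nonneg _).trans (h.fst 0), ?_⟩
  have := (norm_nonneg _).trans (h.snd (e 0) 0)
  simpa using this

lemma IsC2Bounded.abs_sub_le {ψ : E3 → ℝ} {L K : ℝ} (h : IsC2Bounded ψ L K) (x y : E3) :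
    |ψ x - ψ y| ≤ L * ‖x - y‖ :=
  Convex.norm_image_sub_le_of_norm_fderiv_le (𝕜 := ℝ)
    (fun z _ => (h.smooth.differentiable (by simp)).differentiableAt) (fun z _ => h.fst z)
    convex_univ (mem_univ y) (mem_univ x)

lemma IsC2Bounded.abs_taylor_le {ψ : E3 → ℝ} {L K : ℝ} (h : IsC2Bounded ψ L K) (x w : E3) :
    |ψ (x + w) - ψ x - fderiv ℝ ψ x w| ≤ K * ‖w‖ ^ 2 := by
  have hK := h.nonneg.2
  have h1 := (convex_closedBall x ‖w‖).norm_image_sub_le_of_norm_fderiv_le' (𝕜 := ℝ) (f := ψ)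
    (φ := fderiv ℝ ψ x) (C := K * ‖w‖) (x := x) (y := x + w)
    (fun z _ => (h.smooth.differentiable (by simp)).differentiableAt)
    (fun z hz => (h.snd z x).trans (by
      rw [← dist_eq_norm]
      exact mul_le_mul_of_nonneg_left (Metric.mem_closedBall.1 hz) hK))
    (Metric.mem_closedBall_self (norm_nonneg _)) (by simp)
  rw [add_sub_cancel_left] at h1
  rw [Real.norm_eq_abs] at h1
  linarith [h1]

/-- The chain rule for `ψ ∘ (id + w)`. Displacing the test function by one step multiplies the
bounds by powers of `1 + α`, up to the term `L c α`. Over a partition these factors multiply to at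
most an exponential of `∫ a`. -/
lemma IsC2Bounded.comp_add {ψ : E3 → ℝ} {L K : ℝ} (h : IsC2Bounded ψ L K) {w : E3 → E3}
    {α c : ℝ} (hα : 0 ≤ α) (hw : ContDiff ℝ ∞ w) (hw1 : ∀ x, ‖fderiv ℝ w x‖ ≤ α)
    (hw2 : ∀ x y, ‖fderiv ℝ w x - fderiv ℝ w y‖ ≤ c * α * ‖x - y‖) :
    IsC2Bounded (fun x => ψ (x + w x)) (L * (1 + α)) (K * (1 + α) ^ 2 + L * (c * α)) := by
  obtain ⟨hL, hK⟩ := h.nonneg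
  have hwd : Differentiable ℝ w := hw.differentiable (by simp)
  have hψd : Differentiable ℝ ψ := h.smooth.differentiable (by simp)
  have hS : ∀ x, HasFDerivAt (fun x => x + w x) (ContinuousLinearMap.id ℝ E3 + fderiv ℝ w x) x :=
    fun x => (hasFDerivAt_id x).add (hwd x).hasFDerivAt
  have hD : ∀ x, fderiv ℝ (fun x => ψ (x + w x)) x =
      (fderiv ℝ ψ (x + w x)).comp (ContinuousLinearMap.id ℝ E3 + fderiv ℝ w x) := fun x =>
    ((hψd (x + w x)).hasFDerivAt.comp x (hS x)).fderiv
  have hN : ∀ x, ‖ContinuousLinearMap.id ℝ E3 + fderiv ℝ w x‖ ≤ 1 + α := fun x =>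
    (norm_add_le _ _).trans (add_le_add ContinuousLinearMap.norm_id_le (hw1 x))
  have hSL : ∀ x y, ‖(x + w x) - (y + w y)‖ ≤ (1 + α) * ‖x - y‖ := fun x y =>
    Convex.norm_image_sub_le_of_norm_hasFDerivWithin_le (𝕜 := ℝ)
      (fun z _ => (hS z).hasFDerivWithinAt) (fun z _ => hN z) convex_univ (mem_univ y) (mem_univ x)
  refine ⟨h.smooth.comp (contDiff_id.add hw), fun x => ?_, fun x y => ?_⟩
  · rw [hD]
    refine (ContinuousLinearMap.opNorm_comp_le _ _).trans ?_
    gcongr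
    exacts [h.fst _, hN x]
  · rw [hD, hD]
    have e1 : (fderiv ℝ ψ (x + w x)).comp (ContinuousLinearMap.id ℝ E3 + fderiv ℝ w x) -
        (fderiv ℝ ψ (y + w y)).comp (ContinuousLinearMap.id ℝ E3 + fderiv ℝ w y) =
        (fderiv ℝ ψ (x + w x) - fderiv ℝ ψ (y + w y)).comp
          (ContinuousLinearMap.id ℝ E3 + fderiv ℝ w x) +
        (fderiv ℝ ψ (y + w y)).comp (fderiv ℝ w x - fderiv ℝ w y) := by
      ext v
      simp only [sub_apply, ContinuousLinearMap.comp_apply, add_apply, map_add, map_sub,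
        ContinuousLinearMap.id_apply]
      ring
    rw [e1]
    refine (norm_add_le _ _).trans ?_
    have e2 : ‖(fderiv ℝ ψ (x + w x) - fderiv ℝ ψ (y + w y)).comp
        (ContinuousLinearMap.id ℝ E3 + fderiv ℝ w x)‖ ≤ K * (1 + α) ^ 2 * ‖x - y‖ := by
      refine (ContinuousLinearMap.opNorm_comp_le _ _).trans ?_
      calc _ ≤ (K * ((1 + α) * ‖x - y‖)) * (1 + α) := by
            gcongr
            · exact (h.snd _ _).trans (mul_le_mul_of_nonneg_left (hSL x y) hK)
            · exact hN x
        _ = _ := by ring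
    have e3 : ‖(fderiv ℝ ψ (y + w y)).comp (fderiv ℝ w x - fderiv ℝ w y)‖ ≤
        L * (c * α * ‖x - y‖) := by
      refine (ContinuousLinearMap.opNorm_comp_le _ _).trans ?_
      gcongr
      exacts [h.fst _, hw2 x y]
    linarith

/-- One step along the flow compared with the mollified displacement. -/
lemma IsFlow.norm_step_le (hΩo : IsOpen Ω) (hΩ : Bornology.IsBounded Ω)
    (h : IsLipschitzVelocity Ω T u a)
    (hφ : IsFlow Ω T u φ) (b : ContDiffBump (0 : E3)) {y : E3} (hy : y ∈ Ω) {s t : ℝ}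
    (hs : s ∈ Icc 0 T) (ht : t ∈ Icc 0 T) (hst : s ≤ t) :
    ‖φ t y - (φ s y + displacement Ω (b.normed volume) u s t (φ s y))‖ ≤
      (∫ τ in s..t, a τ) * (b.rOut + ∫ τ in s..t, a τ) := by
  obtain ⟨W, hW, hφW⟩ := hφ.exists_velocity hΩo h
  have hΩm := hΩo.measurableSet
  have hii : IntervalIntegrable (fun τ => mollify Ω (b.normed volume) (u τ) (φ s y)) volume s t :=
    intervalIntegrable_of_integrable_timeM
      (h.integrable_kernel hΩm hΩ b _).integral_prod_left hs ht
  rw [← sub_sub, (hφW y hy s hs t ht).2, displacement,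
    ← intervalIntegral.integral_sub (hφW y hy s hs t ht).1 hii,
    ← intervalIntegral.integral_mul_const]
  refine intervalIntegral.norm_integral_le_of_norm_le hst ?_
    ((h.intervalIntegrable hs ht).mul_const _)
  filter_upwards [ae_imp_of_ae_timeM hs ht hW] with τ h1 h2
  obtain ⟨g1, g2, g3⟩ := h1 h2
  have e1 := (mollify_bump hΩm b (h.nonneg τ) g1 g2 g3 (φ s y)).1
  have e2 := g1.dist_le_mul (φ τ y) (φ s y)
  rw [dist_eq_norm, dist_eq_norm, Real.coe_toNNReal _ (h.nonneg τ)] at e2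
  have hτ : τ ∈ Icc 0 T := ⟨hs.1.trans h2.1.le, h2.2.trans ht.2⟩
  have e3 := hφ.norm_sub_le hΩo h hy hs hτ h2.1.le
  have e4 := h.integral_mono hs ht h2.1.le h2.2
  -- The first difference is due to the motion of the trajectory since time `s`, the second to
  -- mollification.
  calc ‖W τ (φ τ y) - mollify Ω (b.normed volume) (u τ) (φ s y)‖
      = ‖(W τ (φ τ y) - W τ (φ s y)) -
          (mollify Ω (b.normed volume) (u τ) (φ s y) - W τ (φ s y))‖ := by congr 1; abel
    _ ≤ ‖W τ (φ τ y) - W τ (φ s y)‖ + ‖mollify Ω (b.normed volume) (u τ) (φ s y) - W τ (φ s y)‖ :=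
        _root_.norm_sub_le _ _
    _ ≤ a τ * (∫ τ in s..t, a τ) + a τ * b.rOut := by
        refine add_le_add (e2.trans ?_) e1
        exact mul_le_mul_of_nonneg_left (e3.trans e4) (h.nonneg τ)
    _ = _ := by ring

lemma IsLipschitzVelocity.aestronglyMeasurable_mollify (h : IsLipschitzVelocity Ω T u a)
    (b : ContDiffBump (0 : E3)) :
    AEStronglyMeasurable (fun z : ℝ × E3 => mollify Ω (b.normed volume) (u z.1) z.2)
      ((timeM T).prod (spaceM Ω)) := by
  have hk := b.continuous_normed (μ := volume)
  refine AEStronglyMeasurable.integral_prod_right' (f := fun p : (ℝ × E3) × E3 =>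
    b.normed volume (p.1.2 - p.2) • u p.1.1 p.2) ?_
  have h1 : AEStronglyMeasurable (fun p : (ℝ × E3) × E3 => b.normed volume (p.1.2 - p.2))
      (((timeM T).prod (spaceM Ω)).prod (spaceM Ω)) :=
    Continuous.aestronglyMeasurable (by fun_prop)
  refine h1.smul (g := fun p : (ℝ × E3) × E3 => u p.1.1 p.2) ?_
  have hq : Measure.QuasiMeasurePreserving (Prod.map Prod.fst id : (ℝ × E3) × E3 → ℝ × E3)
      (((timeM T).prod (spaceM Ω)).prod (spaceM Ω)) ((timeM T).prod (spaceM Ω)) :=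
    MeasureTheory.QuasiMeasurePreserving.prodMap Measure.quasiMeasurePreserving_fst
      (Measure.QuasiMeasurePreserving.id _)
  exact h.meas.comp_quasiMeasurePreserving hq

lemma integral_abs_le_of_memLp_two {f : E3 → ℝ} (hΩ : Bornology.IsBounded Ω)
    (hf : MemLp f 2 (spaceM Ω)) : ∫ x in Ω, |f x| ≤
      (eLpNorm (fun _ : E3 => (1 : ℝ)) 2 (spaceM Ω)).toReal * (eLpNorm f 2 (spaceM Ω)).toReal := by
  have := isFiniteMeasure_spaceM hΩ
  have h1 := norm_integral_smul_le (μ := spaceM Ω) (memLp_const (1 : ℝ)) hf.norm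
  rw [eLpNorm_norm] at h1
  refine le_trans ?_ h1
  simp only [one_smul]
  exact le_abs_self _

/-- One step of the density compared with its push-forward by the mollified displacement. -/
lemma IsDensityVersion.exists_step_le (hΩo : IsOpen Ω) (hΩ : Bornology.IsBounded Ω)
    (hD : IsDensityVersion Ω T m ρ₀ ρ u V) (h : IsLipschitzVelocity Ω T u a) (hm : 0 ≤ m) :
    ∃ B : ℝ, 0 ≤ B ∧ ∀ (b : ContDiffBump (0 : E3)) (ψ : E3 → ℝ) (L K : ℝ), IsC2Bounded ψ L K →
      ∀ s ∈ Icc 0 T, ∀ t ∈ Icc 0 T, s ≤ t →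
      |(∫ x in Ω, ψ x * V t x) -
        ∫ x in Ω, ψ (x + displacement Ω (b.normed volume) u s t x) * V s x| ≤
      (∫ τ in s..t, a τ) * (B * b.rOut * L + B * (∫ τ in s..t, a τ) * (K + L)) := by
  have hfin := isFiniteMeasure_spaceM hΩ
  have hΩm := hΩo.measurableSet
  obtain ⟨CL, hCL⟩ := hD.lipschitz
  set Cv := (eLpNorm (fun _ : E3 => (1 : ℝ)) 2 (spaceM Ω)).toReal with hCv
  have hCv0 : 0 ≤ Cv := ENNReal.toReal_nonneg
  set M := volume.real Ω * m with hM
  have hM0 : 0 ≤ M := by positivity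
  refine ⟨M + Cv * CL, by positivity, fun b ψ L K hψ s hs t ht hst => ?_⟩
  obtain ⟨hL, hK⟩ := hψ.nonneg
  obtain ⟨c, -, hdisp⟩ := h.displacement_spec hΩm hΩ b
  obtain ⟨w1, w2, -, -⟩ := hdisp s hs t ht hst
  set w := displacement Ω (b.normed volume) u s t with hw
  set α := ∫ τ in s..t, a τ with hα
  have hα0 : 0 ≤ α := h.integral_nonneg hst
  have hVi : ∀ r, Integrable (V r) (spaceM Ω) := fun r => (Lp.memLp (V r)).integrable one_le_two
  have hVs : ∫ x in Ω, |V s x| ≤ M := by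
    calc ∫ x in Ω, |V s x| ≤ ∫ x in Ω, m := by
          refine integral_mono_ae (hVi s).norm (integrable_const _) ?_
          filter_upwards [hD.nonneg s hs, hD.le s hs] with x h1 h2
          rw [abs_of_nonneg h1]; exact h2
      _ = M := by simp [hM]
  have hDψc : Continuous (fderiv ℝ ψ) := hψ.smooth.continuous_fderiv (by simp)
  have hVψ : ∀ g : E3 → ℝ, Continuous g → ∀ r, Integrable (fun x => g x * V r x) (spaceM Ω) :=
    fun g hg r => integrable_smul_of_memLp_two (memLp_two_of_continuous hΩ hΩm hg) (Lp.memLp (V r))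
  -- second order Taylor expansion of the displaced test function
  have t1 : |(∫ x in Ω, ψ (x + w x) * V s x) - (∫ x in Ω, ψ x * V s x) -
      ∫ x in Ω, fderiv ℝ ψ x (w x) * V s x| ≤ K * α ^ 2 * M := by
    have c1 := w1.continuous
    have c2 := hψ.smooth.continuous
    have i1 := hVψ (fun x => ψ (x + w x)) (by fun_prop) s
    have i2 := hVψ ψ c2 s
    have i3 := hVψ (fun x => fderiv ℝ ψ x (w x)) (hDψc.clm_apply c1) s
    have i4 : Integrable (fun x => ψ (x + w x) * V s x - ψ x * V s x) (spaceM Ω) := i1.sub i2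
    rw [← integral_sub i1 i2, ← integral_sub i4 i3, ← Real.norm_eq_abs]
    calc _ ≤ ∫ x in Ω, K * α ^ 2 * |V s x| := by
          refine norm_integral_le_of_norm_le ((hVi s).norm.const_mul _)
            (Eventually.of_forall fun x => ?_)
          rw [← sub_mul, ← sub_mul, norm_mul]
          refine mul_le_mul_of_nonneg_right ((hψ.abs_taylor_le x (w x)).trans ?_) (norm_nonneg _)
          have := w2 x
          gcongr
      _ ≤ _ := by
          rw [integral_const_mul]
          gcongr
  have hle := restrict_uIoc_le_timeM hs ht
  have t2i : Integrable (fun z : ℝ × E3 =>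
      fderiv ℝ ψ z.2 (mollify Ω (b.normed volume) (u z.1) z.2) * V s z.2)
      ((timeM T).prod (spaceM Ω)) := by
    have g1 : Integrable (fun z : ℝ × E3 => L * (a z.1 * V s z.2)) ((timeM T).prod (spaceM Ω)) :=
      (h.integrable.mul_prod (hVi s)).const_mul L
    refine g1.mono ?_ ?_
    · refine AEStronglyMeasurable.mul ?_ (hVi s).1.comp_snd
      have g2 : AEStronglyMeasurable (fun z : ℝ × E3 => fderiv ℝ ψ z.2)
        ((timeM T).prod (spaceM Ω)) := Continuous.aestronglyMeasurable (by fun_prop)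
      exact (ContinuousLinearMap.apply ℝ ℝ).flip.aestronglyMeasurable_comp₂ g2
        (h.aestronglyMeasurable_mollify b)
    · have g3 : ∀ᵐ z ∂(timeM T).prod (spaceM Ω),
          ∀ x, ‖mollify Ω (b.normed volume) (u z.1) x‖ ≤ a z.1 := by
        refine Measure.quasiMeasurePreserving_fst.ae (p := fun τ =>
          ∀ x, ‖mollify Ω (b.normed volume) (u τ) x‖ ≤ a τ) ?_
        filter_upwards [h.lip] with τ ⟨g, g1, g2, g3⟩ x
        exact (mollify_bump hΩm b (h.nonneg τ) g1 g2 g3 x).2.1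
      filter_upwards [g3] with z hz
      rw [norm_mul, norm_mul, norm_mul, ← mul_assoc]
      refine mul_le_mul_of_nonneg_right ?_ (norm_nonneg _)
      refine (ContinuousLinearMap.le_opNorm _ _).trans ?_
      rw [Real.norm_of_nonneg hL, Real.norm_of_nonneg (h.nonneg _)]
      exact mul_le_mul (hψ.fst _) (hz _) (norm_nonneg _) hL
  have t2 : ∫ x in Ω, fderiv ℝ ψ x (w x) * V s x =
      ∫ τ in s..t, ∫ x in Ω, fderiv ℝ ψ x (mollify Ω (b.normed volume) (u τ) x) * V s x := by
    rw [intervalIntegral_integral_swap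
      (f := fun τ x => fderiv ℝ ψ x (mollify Ω (b.normed volume) (u τ) x) * V s x)
      (t2i.mono_measure (Measure.prod_mono hle le_rfl))]
    refine integral_congr_ae (Eventually.of_forall fun x => ?_)
    simp only []
    rw [intervalIntegral.integral_mul_const]
    congr 1
    exact ((fderiv ℝ ψ x).intervalIntegral_comp_comm (intervalIntegrable_of_integrable_timeM
      (h.integrable_kernel hΩm hΩ b x).integral_prod_left hs ht)).symm
  obtain ⟨hwi, hweak⟩ := hD.weak ψ hψ.smooth s hs t ht
  -- In the weak continuity equation, the density at time `τ` is replaced by that at time `s`, at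
  -- the cost of the Lipschitz bound in `L²`, and the velocity by its mollification, at the cost of
  -- the radius `b.rOut`. The result is the first order Taylor term of the displaced test function.
  have t3 : |(∫ τ in s..t, ∫ x in Ω, ρ τ x * fderiv ℝ ψ x (u τ x)) -
      ∫ τ in s..t, ∫ x in Ω, fderiv ℝ ψ x (mollify Ω (b.normed volume) (u τ) x) * V s x| ≤
      α * (L * (Cv * CL) * α + L * M * b.rOut) := by
    rw [← intervalIntegral.integral_sub hwi
      (intervalIntegrable_of_integrable_timeM t2i.integral_prod_left hs ht), hα,
      ← intervalIntegral.integral_mul_const, ← Real.norm_eq_abs]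
    refine intervalIntegral.norm_integral_le_of_norm_le hst ?_
      ((h.intervalIntegrable hs ht).mul_const _)
    filter_upwards [ae_imp_of_ae_timeM hs ht h.lip, ae_imp_of_ae_timeM hs ht hD.version,
      ae_imp_of_ae_timeM hs ht h.meas.prodMk_left] with τ q1 q2 q3 hτ
    obtain ⟨g, g1, g2, g3⟩ := q1 hτ
    have q2 := q2 hτ
    have q3 : AEStronglyMeasurable (u τ) (spaceM Ω) := q3 hτ
    have hτT : τ ∈ Icc 0 T := ⟨hs.1.trans hτ.1.le, hτ.2.trans ht.2⟩
    have ha := h.nonneg τ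
    have g4 := mollify_bump hΩm b ha g1 g2 g3
    set f := mollify Ω (b.normed volume) (u τ) with hf
    have hfL : LipschitzWith (a τ).toNNReal f := LipschitzWith.of_dist_le_mul fun x y => by
      rw [dist_eq_norm, dist_eq_norm, Real.coe_toNNReal _ ha]; exact (g4 x).2.2 y
    have g5 : g =ᵐ[spaceM Ω] Ω.indicator (u τ) := ae_restrict_of_ae g3
    have g6 : g =ᵐ[spaceM Ω] u τ := g5.trans (indicator_ae_eq_restrict hΩm)
    have hum : AEStronglyMeasurable (fun x => fderiv ℝ ψ x (u τ x)) (spaceM Ω) := by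
      have : Continuous fun p : (E3 →L[ℝ] ℝ) × E3 => p.1 p.2 := by fun_prop
      exact this.comp_aestronglyMeasurable (hDψc.aestronglyMeasurable.prodMk q3)
    have hub : ∀ᵐ x ∂spaceM Ω, ‖fderiv ℝ ψ x (u τ x)‖ ≤ L * a τ := by
      filter_upwards [g6] with x hx
      refine (ContinuousLinearMap.le_opNorm _ _).trans ?_
      rw [← hx]
      exact mul_le_mul (hψ.fst _) (g2 _) (norm_nonneg _) hL
    have hfm : AEStronglyMeasurable (fun x => fderiv ℝ ψ x (f x)) (spaceM Ω) :=
      (hDψc.clm_apply hfL.continuous).aestronglyMeasurable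
    have hfb : ∀ᵐ x ∂spaceM Ω, ‖fderiv ℝ ψ x (f x)‖ ≤ L * a τ := Eventually.of_forall fun x =>
      (ContinuousLinearMap.le_opNorm _ _).trans
        (mul_le_mul (hψ.fst _) (g4 x).2.1 (norm_nonneg _) hL)
    have j1 : Integrable (fun x => fderiv ℝ ψ x (u τ x) * V τ x) (spaceM Ω) :=
      (hVi τ).bdd_smul _ hum hub
    have j2 : Integrable (fun x => fderiv ℝ ψ x (f x) * V s x) (spaceM Ω) :=
      (hVi s).bdd_smul _ hfm hfb
    have e1 : ∫ x in Ω, ρ τ x * fderiv ℝ ψ x (u τ x) =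
        ∫ x in Ω, fderiv ℝ ψ x (u τ x) * V τ x := by
      refine integral_congr_ae ?_
      filter_upwards [q2] with x hx
      rw [hx, mul_comm]
    rw [e1, ← integral_sub j1 j2]
    have hVsa : Integrable (fun x => |V s x|) (spaceM Ω) := (hVi s).norm
    have hdi : Integrable (fun x => |V τ x - V s x|) (spaceM Ω) := ((hVi τ).sub (hVi s)).norm
    have e2 : ∫ x in Ω, |V τ x - V s x| ≤ Cv * CL * α := by
      have k1 := integral_abs_le_of_memLp_two hΩ (Lp.memLp (V τ - V s))
      have k2 : ∫ x in Ω, |V τ x - V s x| = ∫ x in Ω, |(V τ - V s : Lp ℝ 2 (spaceM Ω)) x| := by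
        refine integral_congr_ae ?_
        filter_upwards [Lp.coeFn_sub (V τ) (V s)] with x hx
        rw [hx, Pi.sub_apply]
      have k3 := hCL.dist_le_mul τ hτT s hs
      rw [dist_eq_norm, Real.dist_eq, abs_of_nonneg (by linarith [hτ.1]), Lp.norm_def] at k3
      -- The inequality `1 ≤ a` expresses the elapsed time through `α`, so that every error in the
      -- step is measured by the integral of `a`.
      have k4 : τ - s ≤ α := le_trans (by linarith [hτ.2]) (h.sub_le_integral hs ht hst)
      rw [k2]
      refine k1.trans ?_
      rw [mul_assoc]
      refine mul_le_mul_of_nonneg_left (k3.trans ?_) hCv0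
      exact mul_le_mul_of_nonneg_left k4 CL.2
    calc _ ≤ ∫ x in Ω, (L * a τ * |V τ x - V s x| + L * (a τ * b.rOut) * |V s x|) := by
          refine norm_integral_le_of_norm_le
            ((hdi.const_mul _).add ((hVi s).norm.const_mul _)) ?_
          filter_upwards [hub, g6] with x hx hgx
          have k1 : fderiv ℝ ψ x (u τ x) * V τ x - fderiv ℝ ψ x (f x) * V s x =
              fderiv ℝ ψ x (u τ x) * (V τ x - V s x) - fderiv ℝ ψ x (f x - u τ x) * V s x := by
            rw [map_sub]; ring
          rw [k1]
          refine (_root_.norm_sub_le _ _).trans (add_le_add ?_ ?_)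
          · rw [norm_mul]
            exact mul_le_mul_of_nonneg_right hx (norm_nonneg _)
          · rw [norm_mul]
            refine mul_le_mul_of_nonneg_right ?_ (norm_nonneg _)
            refine (ContinuousLinearMap.le_opNorm _ _).trans ?_
            rw [← hgx]
            exact mul_le_mul (hψ.fst _) (g4 x).1 (norm_nonneg _) hL
      _ = L * a τ * (∫ x in Ω, |V τ x - V s x|) + L * (a τ * b.rOut) * ∫ x in Ω, |V s x| := by
          rw [integral_add (hdi.const_mul _) (hVsa.const_mul _), integral_const_mul,
            integral_const_mul]
      _ ≤ L * a τ * (Cv * CL * α) + L * (a τ * b.rOut) * M := by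
          have := b.rOut_pos.le
          gcongr
      _ = _ := by ring
  rw [← hweak, ← t2] at t3
  have hr := b.rOut_pos.le
  have e5 : (∫ x in Ω, ψ x * V t x) - (∫ x in Ω, ψ (x + w x) * V s x) =
      ((∫ x in Ω, ψ x * V t x) - (∫ x in Ω, ψ x * V s x) -
        ∫ x in Ω, fderiv ℝ ψ x (w x) * V s x) -
      ((∫ x in Ω, ψ (x + w x) * V s x) - (∫ x in Ω, ψ x * V s x) -
        ∫ x in Ω, fderiv ℝ ψ x (w x) * V s x) := by ring
  rw [e5]
  refine (abs_sub _ _).trans ((add_le_add t3 t1).trans ?_)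
  have p1 : 0 ≤ α * (Cv * CL * b.rOut * L) := by positivity
  have p2 : 0 ≤ α * (M * α * L) := by positivity
  have p3 : 0 ≤ α * (Cv * CL * α * K) := by positivity
  nlinarith [p1, p2, p3]

lemma IsFlow.mem (hφ : IsFlow Ω T u φ) {y : E3} (hy : y ∈ Ω) {t : ℝ} (ht : t ∈ Icc 0 T) :
    φ t y ∈ Ω := by
  obtain ⟨U, -, hU⟩ := hφ
  exact (hU y hy t ht).1

lemma IsFlow.initial (hφ : IsFlow Ω T u φ) (hT : 0 ≤ T) {y : E3} (hy : y ∈ Ω) : φ 0 y = y := by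
  obtain ⟨U, -, hU⟩ := hφ
  simpa using (hU y hy 0 ⟨le_rfl, hT⟩).2.2

lemma IsFlow.aestronglyMeasurable (hΩo : IsOpen Ω) (h : IsLipschitzVelocity Ω T u a)
    (hφ : IsFlow Ω T u φ) {t : ℝ} (ht : t ∈ Icc 0 T) : AEStronglyMeasurable (φ t) (spaceM Ω) := by
  obtain ⟨L, hL⟩ := hφ.exists_lipschitzOnWith hΩo h ht
  exact hL.continuousOn.aestronglyMeasurable hΩo.measurableSet

lemma IsFlow.integrable_comp_mul (hΩo : IsOpen Ω) (hΩ : Bornology.IsBounded Ω)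
    (h : IsLipschitzVelocity Ω T u a) (hφ : IsFlow Ω T u φ) {t : ℝ} (ht : t ∈ Icc 0 T)
    {g : E3 → ℝ} (hg : Continuous g) {r : E3 → ℝ} (hr : Integrable r (spaceM Ω)) :
    Integrable (fun y => g (φ t y) * r y) (spaceM Ω) := by
  obtain ⟨B, hB⟩ := hΩ.isCompact_closure.exists_bound_of_continuousOn hg.continuousOn
  refine hr.bdd_smul B (hg.comp_aestronglyMeasurable (hφ.aestronglyMeasurable hΩo h ht)) ?_
  exact (ae_restrict_iff' hΩo.measurableSet).2 (Eventually.of_forall fun y hy =>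
    hB _ (subset_closure (hφ.mem hy ht)))

/-- The arithmetic of the induction over the partition. The first summand on the left is the
previous bound for the displaced test function, whose constants have grown; the second collects the
errors of the new step. Growth is absorbed by `(1 + α)² ≤ exp (2 α)`, and the new errors by the
increase of the factor `A` to `A + α`. -/
lemma partition_step_arith {B M r L K β c A α : ℝ} (hB : 0 ≤ B) (hM : 0 ≤ M) (hr : 0 ≤ r)
    (hL : 0 ≤ L) (hK : 0 ≤ K) (hc : 0 ≤ c) (hA : 0 ≤ A) (hα : 0 ≤ α) (hαβ : α ≤ β) :
    Real.exp (2 * A) * A * ((B + M) * r * (L * (1 + α)) + (B + M) * β *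
      (K * (1 + α) ^ 2 + L * (c * α) + L * (1 + α) + c * A * (L * (1 + α)))) +
      (α * (B * r * L + B * α * (K + L)) + L * (α * (r + α)) * M) ≤
    Real.exp (2 * (A + α)) * (A + α) *
      ((B + M) * r * L + (B + M) * β * (K + L + c * (A + α) * L)) := by
  have hβ : 0 ≤ β := hα.trans hαβ
  have e1 : (1 + α) ^ 2 ≤ Real.exp (2 * α) := by
    have := Real.add_one_le_exp α
    rw [two_mul, Real.exp_add, pow_two]
    exact mul_le_mul (by linarith) (by linarith) (by linarith) (Real.exp_pos _).le
  have e2 : 1 + α ≤ (1 + α) ^ 2 := by nlinarith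
  set E := (1 + α) ^ 2 with hE
  have hE1 : 1 ≤ E := by linarith
  set Q := (B + M) * r * L + (B + M) * β * (K + L + c * (A + α) * L) with hQ
  have hQ0 : 0 ≤ Q := by positivity
  have s2 : (B + M) * r * (L * (1 + α)) + (B + M) * β *
      (K * E + L * (c * α) + L * (1 + α) + c * A * (L * (1 + α))) ≤ E * Q := by
    calc _ ≤ (B + M) * r * (L * E) + (B + M) * β *
          (K * E + E * (L * (c * α)) + L * E + c * A * (L * E)) := by
          have q1 : L * (c * α) ≤ E * (L * (c * α)) := le_mul_of_one_le_left (by positivity) hE1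
          gcongr
      _ = E * Q := by rw [hQ]; ring
  have s1 : α * (B * r * L + B * α * (K + L)) + L * (α * (r + α)) * M ≤ α * Q := by
    calc _ = α * (B * r * L + M * r * L + (B * α * (K + L) + M * α * (0 + L))) := by ring
      _ ≤ α * (B * r * L + M * r * L + (B * β * (K + L) + M * β * (K + L)) +
          (B + M) * β * (c * (A + α) * L)) := by
          refine mul_le_mul_of_nonneg_left (le_add_of_le_of_nonneg ?_ (by positivity)) hα
          gcongr
      _ = α * Q := by rw [hQ]; ring
  have hexp : Real.exp (2 * (A + α)) = Real.exp (2 * A) * Real.exp (2 * α) := by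
    rw [← Real.exp_add]; ring_nf
  have hX : 1 ≤ Real.exp (2 * A) := Real.one_le_exp (by positivity)
  have k2 : 1 ≤ Real.exp (2 * A) * Real.exp (2 * α) :=
    one_le_mul_of_one_le_of_one_le hX (Real.one_le_exp (by positivity))
  rw [hexp]
  calc _ ≤ Real.exp (2 * A) * A * (Real.exp (2 * α) * Q) +
        (Real.exp (2 * A) * Real.exp (2 * α)) * (α * Q) := by
        refine add_le_add (mul_le_mul_of_nonneg_left (s2.trans ?_) (by positivity))
          (s1.trans (le_mul_of_one_le_left (by positivity) k2))
        gcongr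
    _ = _ := by ring

/-- Comparison of the density and the transported initial density after `i` steps. -/
lemma IsDensityVersion.abs_sub_le_partition (hΩo : IsOpen Ω) (hΩ : Bornology.IsBounded Ω)
    (hD : IsDensityVersion Ω T m ρ₀ ρ u V) (h : IsLipschitzVelocity Ω T u a) (hm : 0 ≤ m)
    (hφ : IsFlow Ω T u φ) : ∃ B : ℝ, 0 ≤ B ∧ ∀ b : ContDiffBump (0 : E3), ∃ c : ℝ, 0 ≤ c ∧
      ∀ (β : ℝ) (N : ℕ) (p : ℕ → ℝ), 0 < β → p 0 = 0 → (∀ i ≤ N, p i ∈ Icc 0 T) →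
      (∀ i < N, p i ≤ p (i + 1)) → (∀ i < N, ∫ τ in (p i)..(p (i + 1)), a τ ≤ β) →
      ∀ i ≤ N, ∀ (ψ : E3 → ℝ) (L K : ℝ), IsC2Bounded ψ L K →
      |(∫ x in Ω, ψ x * V (p i) x) - ∫ y in Ω, ψ (φ (p i) y) * V 0 y| ≤
        Real.exp (2 * ∫ τ in (0 : ℝ)..(p i), a τ) * (∫ τ in (0 : ℝ)..(p i), a τ) *
          (B * b.rOut * L + B * β * (K + L + c * (∫ τ in (0 : ℝ)..(p i), a τ) * L)) := by
  have hfin := isFiniteMeasure_spaceM hΩ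
  have hΩm := hΩo.measurableSet
  obtain ⟨B, hB, hstep⟩ := hD.exists_step_le hΩo hΩ h hm
  set M := volume.real Ω * m with hM
  have hM0 : 0 ≤ M := by positivity
  have hVi : ∀ r, Integrable (V r) (spaceM Ω) := fun r => (Lp.memLp (V r)).integrable one_le_two
  refine ⟨B + M, by positivity, fun b => ?_⟩
  obtain ⟨c, hc, hdisp⟩ := h.displacement_spec hΩm hΩ b
  refine ⟨c, hc, fun β N p hβ hp0 hpm hpmono hpβ i => ?_⟩
  have hr := b.rOut_pos.le
  induction i with
  | zero =>
    intro hi ψ L K hψ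
    have hT : 0 ≤ T := (hpm 0 hi).1.trans (hpm 0 hi).2
    have : ∫ y in Ω, ψ (φ (p 0) y) * V 0 y = ∫ x in Ω, ψ x * V (p 0) x := by
      rw [hp0]
      refine setIntegral_congr_fun hΩm fun y hy => ?_
      simp only [hφ.initial hT hy]
    rw [this, hp0]
    simp
  | succ i ih =>
    intro hi ψ L K hψ
    obtain ⟨hL, hK⟩ := hψ.nonneg
    have hT : 0 ≤ T := (hpm _ hi).1.trans (hpm _ hi).2
    have h0 : (0 : ℝ) ∈ Icc 0 T := ⟨le_rfl, hT⟩
    set s := p i with hs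
    set t := p (i + 1) with ht
    have hsm : s ∈ Icc 0 T := hpm i (by omega)
    have htm : t ∈ Icc 0 T := hpm (i + 1) hi
    have hst : s ≤ t := hpmono i (by omega)
    obtain ⟨w1, w2, w3, w4⟩ := hdisp s hsm t htm hst
    set w := displacement Ω (b.normed volume) u s t with hw
    set α := ∫ τ in s..t, a τ with hα
    have hα0 : 0 ≤ α := h.integral_nonneg hst
    have hαβ : α ≤ β := hpβ i (by omega)
    set A := ∫ τ in (0 : ℝ)..s, a τ with hA
    have hA0 : 0 ≤ A := h.integral_nonneg hsm.1
    have hA1 : ∫ τ in (0 : ℝ)..t, a τ = A + α :=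
      (intervalIntegral.integral_add_adjacent_intervals (h.intervalIntegrable h0 hsm)
        (h.intervalIntegrable hsm htm)).symm
    rw [hA1]
    -- The induction runs over all test functions at once: at node `i` the hypothesis is applied to
    -- `ψ` precomposed with the displacement of the next step.
    have hψ' := hψ.comp_add hα0 w1 w3 w4
    have s1 := hstep b ψ L K hψ s hsm t htm hst
    have s2 := ih (by omega) _ _ _ hψ'
    have s3 : |(∫ y in Ω, ψ (φ s y + w (φ s y)) * V 0 y) - ∫ y in Ω, ψ (φ t y) * V 0 y| ≤
        L * (α * (b.rOut + α)) * M := by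
      have c1 := w1.continuous
      have c2 := hψ.smooth.continuous
      rw [← integral_sub (hφ.integrable_comp_mul hΩo hΩ h hsm (g := fun x => ψ (x + w x))
        (by fun_prop) (hVi 0)) (hφ.integrable_comp_mul hΩo hΩ h htm c2 (hVi 0)),
        ← Real.norm_eq_abs]
      calc _ ≤ ∫ y in Ω, L * (α * (b.rOut + α)) * m := by
            refine norm_integral_le_of_norm_le (integrable_const _) ?_
            filter_upwards [hD.nonneg 0 h0, hD.le 0 h0, ae_restrict_mem hΩm] with y k1 k2 hy
            rw [← sub_mul, norm_mul, Real.norm_of_nonneg k1]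
            refine mul_le_mul ?_ k2 k1 (by positivity)
            refine (hψ.abs_sub_le _ _).trans (mul_le_mul_of_nonneg_left ?_ hL)
            rw [norm_sub_rev]
            exact hφ.norm_step_le hΩo hΩ h b hy hsm htm hst
        _ = _ := by
            rw [integral_const, Measure.real, Measure.restrict_apply_univ, smul_eq_mul, hM,
              Measure.real]
            ring
    refine le_trans ?_ (partition_step_arith hB hM0 hr hL hK hc hA0 hα0 hαβ)
    have tri : (∫ x in Ω, ψ x * V t x) - ∫ y in Ω, ψ (φ t y) * V 0 y =
        ((∫ x in Ω, ψ x * V t x) - ∫ x in Ω, ψ (x + w x) * V s x) +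
        ((∫ x in Ω, ψ (x + w x) * V s x) - ∫ y in Ω, ψ (φ s y + w (φ s y)) * V 0 y) +
        ((∫ y in Ω, ψ (φ s y + w (φ s y)) * V 0 y) - ∫ y in Ω, ψ (φ t y) * V 0 y) := by ring
    rw [tri]
    refine (abs_add_three _ _ _).trans ?_
    linarith

/-- Conservation of mass along the flow. -/
theorem IsDensityVersion.integral_eq_comp_flow (hΩo : IsOpen Ω) (hΩ : Bornology.IsBounded Ω)
    (hD : IsDensityVersion Ω T m ρ₀ ρ u V) (h : IsLipschitzVelocity Ω T u a) (hm : 0 ≤ m)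
    (hφ : IsFlow Ω T u φ) {t : ℝ} (ht : t ∈ Icc 0 T) {ψ : E3 → ℝ} {L K : ℝ}
    (hψ : IsC2Bounded ψ L K) :
    ∫ x in Ω, ψ x * V t x = ∫ y in Ω, ψ (φ t y) * V 0 y := by
  obtain ⟨B, hB, hpart⟩ := hD.abs_sub_le_partition hΩo hΩ h hm hφ
  obtain ⟨hL, hK⟩ := hψ.nonneg
  set A := ∫ τ in (0 : ℝ)..t, a τ with hA
  have hA0 : 0 ≤ A := h.integral_nonneg ht.1
  rw [← sub_eq_zero, ← abs_eq_zero]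
  refine le_antisymm ?_ (abs_nonneg _)
  set D := |(∫ x in Ω, ψ x * V t x) - ∫ y in Ω, ψ (φ t y) * V 0 y| with hDdef
  -- Order of limits: the constant `c` depends on the bump, so the mesh parameter `β` tends to zero
  -- for a fixed radius `r`, which removes `c`; only afterwards `r → 0`.
  have key : ∀ r > 0, D ≤ Real.exp (2 * A) * A * (B * r * L) := by
    intro r hr
    set b : ContDiffBump (0 : E3) := ⟨r / 2, r, half_pos hr, half_lt_self hr⟩ with hb
    obtain ⟨c, hc, hpart⟩ := hpart b
    have hlim : ∀ β > 0, D ≤ Real.exp (2 * A) * A * (B * r * L + B * β * (K + L + c * A * L)) := by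
      intro β hβ
      obtain ⟨n, hn, hp⟩ := h.exists_partition ht hβ
      have hn' : (0 : ℝ) < n := by exact_mod_cast hn
      have hd : 0 ≤ t / n := div_nonneg ht.1 hn'.le
      have := hpart β n (fun i => i * (t / n)) hβ (by simp) (fun i hi => by
          have h1 : (i : ℝ) ≤ n := by exact_mod_cast hi
          refine ⟨mul_nonneg (Nat.cast_nonneg _) hd, ?_⟩
          calc (i * (t / n) : ℝ) ≤ n * (t / n) := mul_le_mul_of_nonneg_right h1 hd
            _ = t := by field_simp
            _ ≤ T := ht.2)
        (fun i hi => mul_le_mul_of_nonneg_right (by push_cast; linarith) hd) hp n le_rfl ψ L K hψ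
      simp only [mul_div_cancel₀ _ hn'.ne'] at this
      exact this
    have hl : Tendsto (fun β : ℝ => Real.exp (2 * A) * A *
        (B * r * L + B * β * (K + L + c * A * L))) (𝓝[>] 0)
        (𝓝 (Real.exp (2 * A) * A * (B * r * L + B * 0 * (K + L + c * A * L)))) := by
      refine tendsto_nhdsWithin_of_tendsto_nhds (Continuous.tendsto ?_ 0)
      fun_prop
    have := ge_of_tendsto hl (eventually_nhdsWithin_of_forall fun β hβ => hlim β hβ)
    simpa using this
  have hl : Tendsto (fun r : ℝ => Real.exp (2 * A) * A * (B * r * L)) (𝓝[>] 0)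
      (𝓝 (Real.exp (2 * A) * A * (B * 0 * L))) := by
    refine tendsto_nhdsWithin_of_tendsto_nhds (Continuous.tendsto ?_ 0)
    fun_prop
  have := ge_of_tendsto hl (eventually_nhdsWithin_of_forall fun r hr => key r hr)
  simpa using this

end Transport

/-! ### Transport of the mass measure, and composition with the flow. -/

section Lagrangian

variable {Ω : Set E3} {T m : ℝ} {u : ℝ → E3 → E3} {a : ℝ → ℝ} {φ : ℝ → E3 → E3} {ρ₀ : E3 → ℝ}
  {ρ : ℝ → E3 → ℝ} {V : ℝ → Lp ℝ 2 (spaceM Ω)}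

/-- The measure on `Ω` with density `r`. -/
def massM (Ω : Set E3) (r : E3 → ℝ) : Measure E3 :=
  (spaceM Ω).withDensity fun x => ((r x).toNNReal : ℝ≥0∞)

lemma massM_absolutelyContinuous (r : E3 → ℝ) : massM Ω r ≪ spaceM Ω :=
  withDensity_absolutelyContinuous _ _

lemma isFiniteMeasure_massM {r : E3 → ℝ} (hr : Integrable r (spaceM Ω)) :
    IsFiniteMeasure (massM Ω r) :=
  isFiniteMeasure_withDensity_ofReal hr.2

lemma integral_massM {G : Type*} [NormedAddCommGroup G] [NormedSpace ℝ G] {r : E3 → ℝ}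
    (hr : Integrable r (spaceM Ω)) (hr0 : ∀ᵐ x ∂spaceM Ω, 0 ≤ r x) (g : E3 → G) :
    ∫ x, g x ∂massM Ω r = ∫ x in Ω, r x • g x := by
  rw [massM, integral_withDensity_eq_integral_smul₀ hr.1.aemeasurable.real_toNNReal]
  refine integral_congr_ae ?_
  filter_upwards [hr0] with x hx
  rw [NNReal.smul_def, Real.coe_toNNReal _ hx]

/-- Trigonometric functions are admissible test functions for the conservation of mass. The phases
`0` and `-π/2` yield the real and imaginary parts of a characteristic function. -/
lemma isC2Bounded_cos (ξ : E3) (c : ℝ) :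
    IsC2Bounded (fun x => Real.cos (inner ℝ x ξ + c)) ‖ξ‖ (‖ξ‖ * ‖ξ‖) := by
  have hd : ∀ x, HasFDerivAt (fun x => Real.cos (inner ℝ x ξ + c))
      (-Real.sin (inner ℝ x ξ + c) • innerSL ℝ ξ) x := by
    intro x
    have h1 : HasFDerivAt (fun x : E3 => inner ℝ x ξ + c) (innerSL ℝ ξ) x := by
      have := (innerSL ℝ ξ).hasFDerivAt (x := x)
      refine (this.add_const c).congr_of_eventuallyEq (Eventually.of_forall fun y => ?_)
      simp [real_inner_comm]
    exact (Real.hasDerivAt_cos _).comp_hasFDerivAt x h1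
  refine ⟨?_, fun x => ?_, fun x y => ?_⟩
  · exact Real.contDiff_cos.comp ((contDiff_id.inner ℝ contDiff_const).add contDiff_const)
  · rw [(hd x).fderiv, norm_smul, innerSL_apply_norm, norm_neg]
    exact mul_le_of_le_one_left (norm_nonneg _) (Real.abs_sin_le_one _)
  · rw [(hd x).fderiv, (hd y).fderiv, ← sub_smul, norm_smul, innerSL_apply_norm]
    rw [mul_assoc, mul_comm ‖ξ‖ (‖ξ‖ * ‖x - y‖)]
    refine mul_le_mul_of_nonneg_right ?_ (norm_nonneg _)
    rw [neg_sub_neg, norm_sub_rev]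
    refine (Real.abs_sin_sub_sin_le _ _).trans ?_
    rw [add_sub_add_right_eq_sub, ← inner_sub_left, mul_comm]
    exact abs_real_inner_le_norm _ _

/-- The flow transports the initial mass to the mass at time `t`. -/
theorem IsDensityVersion.map_flow (hΩo : IsOpen Ω) (hΩ : Bornology.IsBounded Ω)
    (hD : IsDensityVersion Ω T m ρ₀ ρ u V) (h : IsLipschitzVelocity Ω T u a) (hm : 0 ≤ m)
    (hφ : IsFlow Ω T u φ) {t : ℝ} (ht : t ∈ Icc 0 T) :
    AEMeasurable (φ t) (massM Ω (V 0)) ∧ Measure.map (φ t) (massM Ω (V 0)) = massM Ω (V t) := by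
  have hfin := isFiniteMeasure_spaceM hΩ
  have h0 : (0 : ℝ) ∈ Icc 0 T := ⟨le_rfl, ht.1.trans ht.2⟩
  have hVi : ∀ r, Integrable (V r) (spaceM Ω) := fun r => (Lp.memLp (V r)).integrable one_le_two
  have hφm : AEMeasurable (φ t) (massM Ω (V 0)) :=
    (hφ.aestronglyMeasurable hΩo h ht).aemeasurable.mono_ac (massM_absolutelyContinuous _)
  refine ⟨hφm, ?_⟩
  have f1 := isFiniteMeasure_massM (hVi 0)
  have f2 := isFiniteMeasure_massM (hVi t)
  -- Finite measures are determined by their characteristic functions, so cosines suffice and no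
  -- approximation of general test functions is needed.
  refine Measure.ext_of_charFun ?_
  ext1 ξ
  have key : ∀ c : ℝ, ∫ x, Real.cos (inner ℝ x ξ + c) ∂Measure.map (φ t) (massM Ω (V 0)) =
      ∫ x, Real.cos (inner ℝ x ξ + c) ∂massM Ω (V t) := by
    intro c
    have hψ := isC2Bounded_cos ξ c
    rw [integral_map hφm hψ.smooth.continuous.aestronglyMeasurable,
      integral_massM (hVi 0) (hD.nonneg 0 h0), integral_massM (hVi t) (hD.nonneg t ht)]
    simp only [smul_eq_mul]
    have := hD.integral_eq_comp_flow hΩo hΩ h hm hφ ht hψ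
    simp_rw [mul_comm (V t _ : ℝ), mul_comm (V 0 _ : ℝ)]
    exact this.symm
  have hsplit : ∀ ν : Measure E3, IsFiniteMeasure ν → charFun ν ξ =
      ((∫ x, Real.cos (inner ℝ x ξ + 0) ∂ν : ℝ) : ℂ) +
        ((∫ x, Real.cos (inner ℝ x ξ + -(Real.pi / 2)) ∂ν : ℝ) : ℂ) * Complex.I := by
    intro ν _
    rw [charFun_apply, ← integral_complex_ofReal, ← integral_complex_ofReal,
      ← integral_mul_const, ← integral_add]
    · refine integral_congr_ae (Eventually.of_forall fun x => ?_)
      simp only [Complex.exp_mul_I, add_zero, ← sub_eq_add_neg, Real.cos_sub_pi_div_two]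
      push_cast
      rfl
    · refine Integrable.of_bound (C := 1) ?_ (Eventually.of_forall fun x => ?_)
      · exact Continuous.aestronglyMeasurable
          (Complex.continuous_ofReal.comp (isC2Bounded_cos ξ 0).smooth.continuous)
      · rw [Complex.norm_real]; exact Real.abs_cos_le_one _
    · refine Integrable.of_bound (C := 1) ?_ (Eventually.of_forall fun x => ?_)
      · exact Continuous.aestronglyMeasurable
          ((Complex.continuous_ofReal.comp (isC2Bounded_cos ξ _).smooth.continuous).mul
            continuous_const)
      · rw [norm_mul, Complex.norm_real, Complex.norm_I, mul_one]; exact Real.abs_cos_le_one _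
  rw [hsplit _ inferInstance, hsplit _ f2, key, key]

variable {F : Type*} [NormedAddCommGroup F]

lemma IsDensityVersion.eLpNorm_massM_le (hD : IsDensityVersion Ω T m ρ₀ ρ u V)
    {t : ℝ} (ht : t ∈ Icc 0 T) (f : E3 → F) :
    eLpNorm f 2 (massM Ω (V t)) ≤ ENNReal.ofReal √m * eLpNorm f 2 (spaceM Ω) := by
  have h1 : massM Ω (V t) ≤ ENNReal.ofReal m • spaceM Ω := by
    rw [← withDensity_const, massM]
    refine withDensity_mono ?_
    filter_upwards [hD.le t ht] with x hx
    exact ENNReal.ofReal_le_ofReal hx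
  refine (eLpNorm_mono_measure _ h1).trans ?_
  rw [eLpNorm_smul_measure_of_ne_top (by simp)]
  rw [smul_eq_mul, ENNReal.ofReal, ENNReal.ofReal, Real.sqrt_eq_rpow]
  refine mul_le_mul_left ?_ _
  simp only [one_div, ENNReal.toReal_inv, ENNReal.toReal_ofNat]
  rw [← ENNReal.coe_rpow_of_nonneg _ (by norm_num)]
  rcases le_or_gt 0 m with hm | hm
  · rw [Real.toNNReal_rpow_of_nonneg hm]
  · rw [Real.toNNReal_of_nonpos hm.le]
    simp

/-- The change of variables contained in `IsDensityVersion.map_flow`: it requires neither a Jacobian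
nor the invertibility of the flow. -/
lemma IsDensityVersion.eLpNorm_comp_flow (hΩo : IsOpen Ω) (hΩ : Bornology.IsBounded Ω)
    (hD : IsDensityVersion Ω T m ρ₀ ρ u V) (h : IsLipschitzVelocity Ω T u a) (hm : 0 ≤ m)
    (hφ : IsFlow Ω T u φ) {t : ℝ} (ht : t ∈ Icc 0 T) {f : E3 → F}
    (hf : AEStronglyMeasurable f (massM Ω (V t))) :
    AEStronglyMeasurable (fun y => f (φ t y)) (massM Ω (V 0)) ∧
    eLpNorm (fun y => f (φ t y)) 2 (massM Ω (V 0)) = eLpNorm f 2 (massM Ω (V t)) := by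
  obtain ⟨h1, h2⟩ := hD.map_flow hΩo hΩ h hm hφ ht
  rw [← h2] at hf ⊢
  exact ⟨hf.comp_aemeasurable h1, (eLpNorm_map_measure hf h1).symm⟩

/-- Composition of a fixed continuous function with the flow is continuous in time. -/
lemma IsFlow.tendsto_eLpNorm_comp_sub (hΩo : IsOpen Ω) (h : IsLipschitzVelocity Ω T u a)
    (hφ : IsFlow Ω T u φ) {r : E3 → ℝ} (hr : Integrable r (spaceM Ω)) {ψ : E3 → F}
    (hψ : Continuous ψ) (hψc : HasCompactSupport ψ) {t₁ : ℝ} (ht₁ : t₁ ∈ Icc 0 T) :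
    Tendsto (fun t => eLpNorm (fun y => ψ (φ t y) - ψ (φ t₁ y)) 2 (massM Ω r))
      (𝓝[Icc 0 T] t₁) (𝓝 0) := by
  have := isFiniteMeasure_massM hr
  obtain ⟨B, hB⟩ := hψc.exists_bound_of_continuous hψ
  have hB0 : 0 ≤ B := (norm_nonneg _).trans (hB 0)
  have hmem : ∀ᵐ y ∂massM Ω r, y ∈ Ω :=
    (massM_absolutelyContinuous r).ae_le (ae_restrict_mem hΩo.measurableSet)
  have hms : ∀ t ∈ Icc 0 T, AEStronglyMeasurable (fun y => ψ (φ t y)) (massM Ω r) := fun t ht =>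
    (hψ.comp_aestronglyMeasurable (hφ.aestronglyMeasurable hΩo h ht)).mono_ac
      (massM_absolutelyContinuous r)
  have hsq : Tendsto (fun t => eLpNorm (fun y => ψ (φ t y) - ψ (φ t₁ y)) 2 (massM Ω r) ^ 2)
      (𝓝[Icc 0 T] t₁) (𝓝 0) := by
    simp_rw [eLpNorm_two_sq]
    have h0 : ∫⁻ y, (0 : ℝ≥0∞) ∂massM Ω r = 0 := by simp
    rw [← h0]
    refine tendsto_lintegral_filter_of_dominated_convergence' (fun _ => ENNReal.ofReal (2 * B) ^ 2)
      ?_ ?_ ?_ ?_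
    · filter_upwards [self_mem_nhdsWithin] with t ht
      exact ((hms t ht).sub (hms t₁ ht₁)).enorm.pow_const 2
    · refine Eventually.of_forall fun t => Eventually.of_forall fun y => ?_
      gcongr
      rw [← ofReal_norm]
      refine ENNReal.ofReal_le_ofReal ?_
      have := _root_.norm_sub_le (ψ (φ t y)) (ψ (φ t₁ y))
      linarith [hB (φ t y), hB (φ t₁ y)]
    · rw [lintegral_const]
      exact ENNReal.mul_ne_top (ENNReal.pow_ne_top ENNReal.ofReal_ne_top) (measure_ne_top _ _)
    · filter_upwards [hmem] with y hy
      have h1 := hφ.continuousOn_time hΩo h hy t₁ ht₁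
      have h2 : Tendsto (fun t => ψ (φ t y) - ψ (φ t₁ y)) (𝓝[Icc 0 T] t₁) (𝓝 0) := by
        have := (hψ.tendsto (φ t₁ y)).comp h1
        simpa using this.sub_const (ψ (φ t₁ y))
      have h3 := (ENNReal.continuous_pow 2).tendsto 0 |>.comp
        ((continuous_enorm.tendsto (0 : F)).comp h2 |>.trans (by simp))
      simpa [Function.comp_def] using h3
  have h3 := (ENNReal.continuous_rpow_const (y := 1 / 2)).tendsto 0 |>.comp hsq
  simp only [Function.comp_def, ENNReal.zero_rpow_of_pos (by norm_num : (0 : ℝ) < 1 / 2)] at h3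
  refine h3.congr fun t => ?_
  rw [← ENNReal.rpow_natCast, ← ENNReal.rpow_mul]
  norm_num

end Lagrangian

/-! ### Continuity in time of Lagrangian quantities. -/

section Continuity

variable {Ω : Set E3} {T m : ℝ} {u : ℝ → E3 → E3} {a : ℝ → ℝ} {φ : ℝ → E3 → E3} {ρ₀ : E3 → ℝ}
  {ρ : ℝ → E3 → ℝ} {V : ℝ → Lp ℝ 2 (spaceM Ω)} {F : Type*} [NormedAddCommGroup F] [NormedSpace ℝ F]

/-- The mass measure gives no information where `r` is not positive, but there the factor `√r`
vanishes. -/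
lemma sqrt_smul_eq_of_ae_massM {r : E3 → ℝ} (hr : Measurable r) {f g : E3 → F}
    (h : f =ᵐ[massM Ω r] g) : (fun x => √(r x) • f x) =ᵐ[spaceM Ω] fun x => √(r x) • g x := by
  have h1 := (ae_withDensity_iff (hr.real_toNNReal.coe_nnreal_ennreal)).1 h
  filter_upwards [h1] with x hx
  by_cases h0 : 0 < r x
  · rw [hx (by simpa using h0)]
  · rw [Real.sqrt_eq_zero_of_nonpos (not_lt.1 h0), zero_smul, zero_smul]

lemma aestronglyMeasurable_sqrt_smul {r : E3 → ℝ} (hr : Measurable r) {f : E3 → F}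
    (hf : AEStronglyMeasurable f (massM Ω r)) :
    AEStronglyMeasurable (fun x => √(r x) • f x) (spaceM Ω) := by
  have h1 := (aestronglyMeasurable_withDensity_iff hr.real_toNNReal).1 hf
  have h2 : AEStronglyMeasurable (fun x => (√(r x))⁻¹ • (((r x).toNNReal : ℝ) • f x)) (spaceM Ω) :=
    (hr.sqrt.inv.aestronglyMeasurable).smul h1
  refine h2.congr (Eventually.of_forall fun x => ?_)
  simp only []
  by_cases h0 : 0 < r x
  · rw [Real.coe_toNNReal _ h0.le, smul_smul]
    congr 1
    have := Real.mul_self_sqrt h0.le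
    have h3 : √(r x) ≠ 0 := (Real.sqrt_pos.2 h0).ne'
    field_simp
    rw [sq, this]
  · rw [Real.sqrt_eq_zero_of_nonpos (not_lt.1 h0)]
    simp

lemma eLpNorm_sqrt_smul {r : E3 → ℝ} (hr : Measurable r) (f : E3 → F) :
    eLpNorm (fun x => √(r x) • f x) 2 (spaceM Ω) = eLpNorm f 2 (massM Ω r) := by
  have h : eLpNorm (fun x => √(r x) • f x) 2 (spaceM Ω) ^ 2 = eLpNorm f 2 (massM Ω r) ^ 2 := by
    rw [eLpNorm_two_sq, eLpNorm_two_sq, massM,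
      lintegral_withDensity_eq_lintegral_mul_non_measurable _
      hr.real_toNNReal.coe_nnreal_ennreal (Eventually.of_forall fun x => ENNReal.coe_lt_top)]
    refine lintegral_congr fun x => ?_
    rw [Pi.mul_apply, enorm_smul, mul_pow]
    congr 1
    rw [← ofReal_norm, Real.norm_of_nonneg (Real.sqrt_nonneg _), ← ENNReal.ofReal_pow
      (Real.sqrt_nonneg _)]
    rcases le_or_gt 0 (r x) with h0 | h0
    · rw [Real.sq_sqrt h0]; rfl
    · rw [Real.sqrt_eq_zero_of_nonpos h0.le, Real.toNNReal_of_nonpos h0.le]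
      simp
  exact (ENNReal.pow_right_strictMono two_ne_zero).injective h

/-- Multiplication by `√r` is an isometry from `L²(r dx)` to `L²(dx)`. -/
lemma exists_isometry_sqrt_smul {r : E3 → ℝ} (hr : Measurable r) :
    ∃ J : Lp F 2 (massM Ω r) → Lp F 2 (spaceM Ω), Isometry J ∧
      ∀ f : Lp F 2 (massM Ω r), J f =ᵐ[spaceM Ω] fun x => √(r x) • f x := by
  have hmem : ∀ f : Lp F 2 (massM Ω r), MemLp (fun x => √(r x) • f x) 2 (spaceM Ω) := fun f =>
    ⟨aestronglyMeasurable_sqrt_smul hr (Lp.memLp f).1, by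
      rw [eLpNorm_sqrt_smul hr]; exact (Lp.memLp f).2⟩
  refine ⟨fun f => (hmem f).toLp _, fun f g => ?_, fun f => (hmem f).coeFn_toLp⟩
  rw [Lp.edist_toLp_toLp, Lp.edist_def, ← eLpNorm_sqrt_smul hr]
  congr 1
  ext1 x
  simp [smul_sub]

/-- Continuity in time of a Lagrangian quantity, away from `t = 0` by continuity in `L²` and at
`t = 0` by assumption. -/
theorem IsDensityVersion.exists_continuous_version [CompleteSpace F] (hΩo : IsOpen Ω)
    (hΩ : Bornology.IsBounded Ω) (hT : 0 < T)
    (hD : IsDensityVersion Ω T m ρ₀ ρ u V) (hv : IsLipschitzVelocity Ω T u a) (hm : 0 ≤ m)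
    (hφ : IsFlow Ω T u φ) {h : ℝ → E3 → F} {h₀ : E3 → F} {A : Set ℝ}
    (hA : ∀ᵐ t ∂timeM T, t ∈ A) (hAT : A ⊆ Ioo 0 T)
    (hmem : ∀ t ∈ A, MemLp (h t) 2 (spaceM Ω))
    (hcau : ∀ t₁ ∈ Ioc 0 T, ∀ ε > 0, ∃ δ > 0, ∀ s ∈ A, ∀ t ∈ A, |s - t₁| < δ → |t - t₁| < δ →
      eLpNorm (fun x => h t x - h s x) 2 (spaceM Ω) ≤ ENNReal.ofReal ε)
    (h₀mem : MemLp h₀ 2 (massM Ω (V 0)))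
    (h₀lim : Tendsto (fun t => eLpNorm (fun y => h t (φ t y) - h₀ y) 2 (massM Ω (V 0)))
      (𝓝[A] 0) (𝓝 0)) :
    ∃ (X : ℝ → Lp F 2 (spaceM Ω)) (X₀ : Lp F 2 (spaceM Ω)),
      IsVersion Ω T (fun t y => √(ρ₀ y) • h t (φ t y)) X ∧
      ContinuousOn X (Icc 0 T) ∧
      X₀ =ᵐ[spaceM Ω] (fun y => √(ρ₀ y) • h₀ y) ∧
      Tendsto X (𝓝[>] 0) (𝓝 X₀) := by
  classical
  have hfin := isFiniteMeasure_spaceM hΩ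
  have hVm : Measurable (V 0) := (Lp.stronglyMeasurable (V 0)).measurable
  have hVi : ∀ r, Integrable (V r) (spaceM Ω) := fun r => (Lp.memLp (V r)).integrable one_le_two
  have hAc : Icc 0 T ⊆ closure A :=
    (subset_closure_of_ae_mem hT hA).trans (closure_mono inter_subset_left)
  have hAI : A ⊆ Icc 0 T := hAT.trans Ioo_subset_Icc_self
  set ν := massM Ω (V 0) with hν
  set c := ENNReal.ofReal √m with hc
  -- composition with the flow is bounded from `L²(Ω)` to `L²(ν)`
  have hcomp : ∀ t ∈ Icc 0 T, ∀ f : E3 → F, AEStronglyMeasurable f (spaceM Ω) →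
      AEStronglyMeasurable (fun y => f (φ t y)) ν ∧
      eLpNorm (fun y => f (φ t y)) 2 ν ≤ c * eLpNorm f 2 (spaceM Ω) := by
    intro t ht f hf
    obtain ⟨h1, h2⟩ := hD.eLpNorm_comp_flow hΩo hΩ hv hm hφ ht
      (hf.mono_ac (massM_absolutelyContinuous (V t)))
    exact ⟨h1, h2 ▸ hD.eLpNorm_massM_le ht f⟩
  have hXmem : ∀ t ∈ A, MemLp (fun y => h t (φ t y)) 2 ν := fun t ht =>
    ⟨(hcomp t (hAI ht) _ (hmem t ht).1).1, (hcomp t (hAI ht) _ (hmem t ht).1).2.trans_lt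
      (ENNReal.mul_lt_top ENNReal.ofReal_lt_top (hmem t ht).2)⟩
  set X : ℝ → Lp F 2 ν := fun t => if ht : t ∈ A then (hXmem t ht).toLp _ else 0 with hX
  have hXe : ∀ t (ht : t ∈ A), X t = (hXmem t ht).toLp _ := fun t ht => by
    simp only [hX, ht, dite_true]
  have hlim0 : Tendsto X (𝓝[A] 0) (𝓝 (h₀mem.toLp h₀)) := by
    rw [tendsto_iff_edist_tendsto_0]
    refine h₀lim.congr' ?_
    filter_upwards [self_mem_nhdsWithin] with t ht
    rw [hXe t ht, Lp.edist_toLp_toLp]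
    rfl
  -- It suffices that limits along the good times `A` exist at every `t₁`: since `A` is dense in
  -- `[0, T]`, `extendFrom` then provides a continuous curve, which agrees with `X` on `A`.
  have hlim : ∀ t₁ ∈ Icc 0 T, ∃ y, Tendsto X (𝓝[A] t₁) (𝓝 y) := by
    intro t₁ ht₁
    rcases eq_or_lt_of_le ht₁.1 with h0 | h0
    · rw [← h0]; exact ⟨_, hlim0⟩
    have hne : (𝓝[A] t₁).NeBot := mem_closure_iff_nhdsWithin_neBot.1 (hAc ht₁)
    rw [← cauchy_map_iff_exists_tendsto, EMetric.cauchy_iff]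
    refine ⟨(hne.map X).ne, fun ε hε => ?_⟩
    -- Each element of the Cauchy set will be within `(2c + 1) η` of `ψ ∘ φ t₁`: `c` times the
    -- distance `2η` between `h t` and `ψ`, plus `η` for the motion of the flow. Two elements double
    -- this.
    obtain ⟨η, hη, hηε⟩ := ENNReal.exists_nnreal_pos_mul_lt (a := 2 * (2 * c + 1)) (b := ε)
      (by finiteness) hε.ne'
    obtain ⟨δ, hδ, hcd⟩ := hcau t₁ ⟨h0, ht₁.2⟩ η (by exact_mod_cast hη)
    have hball : ∀ᶠ t in 𝓝[A] t₁, |t - t₁| < δ := by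
      refine mem_nhdsWithin_of_mem_nhds ?_
      exact Metric.ball_mem_nhds t₁ hδ
    obtain ⟨s, hsδ, hsA⟩ := (hball.and self_mem_nhdsWithin).exists
    -- One good time `s` near `t₁` is enough: a function approximating `h s` also approximates `h t`
    -- for all good `t` near `t₁`, by the Cauchy condition.
    obtain ⟨ψ, hψc, hψε, hψ, hψm⟩ := (hmem s hsA).exists_hasCompactSupport_eLpNorm_sub_le
      (by simp) (ε := η) (by exact_mod_cast hη.ne')
    have hψt := (hφ.tendsto_eLpNorm_comp_sub hΩo hv (hVi 0) hψ hψc ht₁).mono_left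
      (nhdsWithin_mono _ hAI)
    have hψt' : ∀ᶠ t in 𝓝[A] t₁,
        eLpNorm (fun y => ψ (φ t y) - ψ (φ t₁ y)) 2 (massM Ω (V 0)) ≤ η :=
      (hψt.eventually_lt_const (by exact_mod_cast hη)).mono fun t ht => ht.le
    have hψ₁ := (hcomp t₁ ht₁ ψ hψm.1).1
    have hmain : ∀ᶠ t in 𝓝[A] t₁, eLpNorm (fun y => h t (φ t y) - ψ (φ t₁ y)) 2 ν ≤
        (2 * c + 1) * η ∧ t ∈ A := by
      filter_upwards [hball, hψt', self_mem_nhdsWithin] with t g1 g2 htA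
      refine ⟨?_, htA⟩
      have ht := hAI htA
      have g3 : AEStronglyMeasurable (fun x => h t x - ψ x) (spaceM Ω) :=
        (hmem t htA).1.sub hψm.1
      have g4 := hcomp t ht _ g3
      have g5 := hcomp t ht ψ hψm.1
      have g6 : eLpNorm (fun x => h t x - ψ x) 2 (spaceM Ω) ≤ η + η := by
        have e1 : (fun x => h t x - ψ x) = (fun x => h t x - h s x) + (fun x => h s x - ψ x) := by
          ext1 x; simp
        rw [e1]
        refine (eLpNorm_add_le ((hmem t htA).1.sub (hmem s hsA).1) ((hmem s hsA).1.sub hψm.1)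
          one_le_two).trans (add_le_add ?_ hψε)
        have := hcd s hsA t htA hsδ g1
        rwa [ENNReal.ofReal_coe_nnreal] at this
      have e2 : (fun y => h t (φ t y) - ψ (φ t₁ y)) = (fun y => h t (φ t y) - ψ (φ t y)) +
          (fun y => ψ (φ t y) - ψ (φ t₁ y)) := by ext1 y; simp
      rw [e2]
      refine (eLpNorm_add_le g4.1 (g5.1.sub hψ₁) one_le_two).trans ?_
      calc _ ≤ c * (η + η) + η := add_le_add (g4.2.trans (by gcongr)) g2
        _ = _ := by ring
    refine ⟨X '' {t | eLpNorm (fun y => h t (φ t y) - ψ (φ t₁ y)) 2 ν ≤ (2 * c + 1) * η ∧ t ∈ A},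
      image_mem_map hmain, ?_⟩
    rintro _ ⟨t, ⟨k1, htA⟩, rfl⟩ _ ⟨r, ⟨k2, hrA⟩, rfl⟩
    rw [hXe t htA, hXe r hrA, Lp.edist_toLp_toLp]
    have e3 : (fun y => h t (φ t y)) - (fun y => h r (φ r y)) =
        (fun y => h t (φ t y) - ψ (φ t₁ y)) - (fun y => h r (φ r y) - ψ (φ t₁ y)) := by
      ext1 y; simp
    rw [e3]
    refine (eLpNorm_sub_le ((hXmem t htA).1.sub hψ₁) ((hXmem r hrA).1.sub hψ₁)
      one_le_two).trans_lt ((add_le_add k1 k2).trans_lt ?_)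
    calc _ = η * (2 * (2 * c + 1)) := by ring
      _ < ε := hηε
  obtain ⟨J, hJ, hJe⟩ := exists_isometry_sqrt_smul (F := F) (Ω := Ω) hVm
  have hY := continuousOn_extendFrom hAc hlim
  have h0I : (0 : ℝ) ∈ Icc 0 T := ⟨le_rfl, hT.le⟩
  have hY0 : extendFrom A X 0 = h₀mem.toLp h₀ := extendFrom_eq (hAc h0I) hlim0
  have hρV : ∀ f : E3 → F, (fun x => √(V 0 x) • f x) =ᵐ[spaceM Ω] fun x => √(ρ₀ x) • f x :=
    fun f => hD.initial.mono fun x hx => by simp only [hx]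
  refine ⟨fun t => J (extendFrom A X t), J (h₀mem.toLp h₀), ?_, hJ.continuous.comp_continuousOn hY,
    ?_, ?_⟩
  · refine hA.mono fun t ht => ?_
    obtain ⟨y, hy⟩ := hlim t (hAI ht)
    have e1 : extendFrom A X t = X t := by
      rw [extendFrom_eq (hAc (hAI ht)) hy]
      have h1 : Tendsto X (pure t) (𝓝 y) := hy.mono_left (by
        rw [← nhdsWithin_singleton]
        exact nhdsWithin_mono t (singleton_subset_iff.2 ht))
      exact (tendsto_nhds_unique h1 (tendsto_pure_nhds X t))
    simp only [e1, hXe t ht]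
    exact (hJe _).trans ((sqrt_smul_eq_of_ae_massM hVm (hXmem t ht).coeFn_toLp).trans (hρV _))
  · exact (hJe _).trans ((sqrt_smul_eq_of_ae_massM hVm h₀mem.coeFn_toLp).trans (hρV _))
  · have h1 := (hJ.continuous.comp_continuousOn hY) 0 h0I
    have h2 : Tendsto (J ∘ extendFrom A X) (𝓝[Icc 0 T] 0) (𝓝 (J (h₀mem.toLp h₀))) := by
      have := h1.tendsto
      rwa [Function.comp_apply, hY0] at this
    refine h2.mono_left ?_
    rw [← nhdsWithin_Ioc_eq_nhdsGT hT]
    exact nhdsWithin_mono _ Ioc_subset_Icc_self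

end Continuity

/-! ### Strong convergence at the initial time. -/

section InitialTime

/-- If `N - ⟪X₀, X⟫ → 0`, `‖X‖² ≤ N + C` and `X → X₀` weakly on a set whose closure contains `X₀`,
then `N → ‖X₀‖²`. -/
lemma tendsto_norm_sq_of_weak {ι H : Type*} [NormedAddCommGroup H] [InnerProductSpace ℝ H]
    {l : Filter ι} {X : ι → H} {X₀ : H} {N : ι → ℝ} {S : Set H} (hS : X₀ ∈ closure S) {C : ℝ}
    (hN : Tendsto (fun i => N i - inner ℝ X₀ (X i)) l (𝓝 0))
    (hC : ∀ᶠ i in l, ‖X i‖ ^ 2 ≤ N i + C)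
    (hw : ∀ g ∈ S, Tendsto (fun i => inner ℝ g (X i)) l (𝓝 (inner ℝ g X₀))) :
    Tendsto N l (𝓝 (‖X₀‖ ^ 2)) := by
  -- Eventually `N ≤ ⟪X₀, X⟫ + 1`, hence `‖X‖² ≤ |C| + 1 + ‖X₀‖ ‖X‖`, which is impossible for `‖X‖ >
  -- K`. With this bound, convergence of the pairings extends from `S` to its closure, in particular
  -- to `X₀`.
  set K := |C| + 1 + ‖X₀‖ + 1 with hK
  have hK0 : 0 < K := by positivity
  have hb : ∀ᶠ i in l, ‖X i‖ ≤ K := by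
    filter_upwards [hC, hN.eventually_lt_const one_pos] with i h1 h2
    have h3 := real_inner_le_norm X₀ (X i)
    by_contra hlt
    push Not at hlt
    have h4 : ‖X i‖ ^ 2 ≤ |C| + 1 + ‖X₀‖ * ‖X i‖ := by linarith [le_abs_self C]
    have h5 : 1 ≤ ‖X i‖ := by
      have := abs_nonneg C; have := norm_nonneg X₀
      linarith
    have h6 : |C| + 1 ≤ (|C| + 1) * ‖X i‖ := le_mul_of_one_le_right (by positivity) h5
    have h7 : (|C| + 1 + ‖X₀‖) * ‖X i‖ < ‖X i‖ * ‖X i‖ :=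
      mul_lt_mul_of_pos_right (by linarith) (by linarith)
    nlinarith
  have hin : Tendsto (fun i => inner ℝ X₀ (X i)) l (𝓝 (inner ℝ X₀ X₀)) := by
    rw [Metric.tendsto_nhds]
    intro ε hε
    obtain ⟨g, hg, hgd⟩ := Metric.mem_closure_iff.1 hS (ε / (3 * K)) (by positivity)
    rw [dist_eq_norm] at hgd
    have hKX : ‖X₀‖ ≤ K := by
      have := abs_nonneg C
      linarith
    filter_upwards [hb, Metric.tendsto_nhds.1 (hw g hg) (ε / 3) (by positivity)] with i h1 h2
    rw [Real.dist_eq] at h2 ⊢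
    have e1 : inner ℝ X₀ (X i) - inner ℝ X₀ X₀ = inner ℝ (X₀ - g) (X i) +
        (inner ℝ g (X i) - inner ℝ g X₀) - inner ℝ (X₀ - g) X₀ := by
      simp only [inner_sub_left]; ring
    have hb2 : ∀ x : H, ‖x‖ ≤ K → |inner ℝ (X₀ - g) x| < ε / 3 := by
      intro x hx
      calc |inner ℝ (X₀ - g) x| ≤ ‖X₀ - g‖ * ‖x‖ := abs_real_inner_le_norm _ _
        _ ≤ ‖X₀ - g‖ * K := by gcongr
        _ < ε / (3 * K) * K := by gcongr
        _ = ε / 3 := by field_simp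
    have k1 := hb2 (X i) h1
    have k2 := hb2 X₀ hKX
    rw [e1]
    rw [abs_lt] at *
    constructor <;> linarith [k1.1, k1.2, k2.1, k2.2, h2.1, h2.2]
  have := hN.add hin
  simp only [sub_add_cancel, zero_add, real_inner_self_eq_norm_sq] at this
  exact this

variable {Ω : Set E3} {T m : ℝ} {u : ℝ → E3 → E3} {a : ℝ → ℝ} {φ : ℝ → E3 → E3} {ρ₀ : E3 → ℝ}
  {ρ : ℝ → E3 → ℝ} {V : ℝ → Lp ℝ 2 (spaceM Ω)} {F : Type*} [NormedAddCommGroup F]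
  [InnerProductSpace ℝ F]

lemma inner_toLp {α : Type*} [MeasurableSpace α] {μ : Measure α} {f g : α → F}
    (hf : MemLp f 2 μ) (hg : MemLp g 2 μ) :
    inner ℝ (hf.toLp f) (hg.toLp g) = ∫ x, inner ℝ (f x) (g x) ∂μ := by
  rw [L2.inner_def]
  refine integral_congr_ae ?_
  filter_upwards [hf.coeFn_toLp, hg.coeFn_toLp] with x h1 h2
  rw [h1, h2]

lemma IsDensityVersion.inner_toLp_massM (hΩ : Bornology.IsBounded Ω)
    (hD : IsDensityVersion Ω T m ρ₀ ρ u V) {t : ℝ} (ht : t ∈ Icc 0 T) {f g : E3 → F}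
    (hf : MemLp f 2 (massM Ω (V t))) (hg : MemLp g 2 (massM Ω (V t))) :
    inner ℝ (hf.toLp f) (hg.toLp g) = ∫ x in Ω, V t x * inner ℝ (f x) (g x) := by
  have := isFiniteMeasure_spaceM hΩ
  rw [inner_toLp, integral_massM ((Lp.memLp (V t)).integrable one_le_two) (hD.nonneg t ht)]
  rfl

lemma IsDensityVersion.abs_integral_sub_le (hD : IsDensityVersion Ω T m ρ₀ ρ u V) :
    ∃ CL : ℝ, 0 ≤ CL ∧ ∀ t ∈ Icc 0 T, ∀ f : E3 → ℝ, MemLp f 2 (spaceM Ω) →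
      |(∫ x in Ω, V t x * f x) - ∫ x in Ω, V 0 x * f x| ≤
        CL * t * (eLpNorm f 2 (spaceM Ω)).toReal := by
  obtain ⟨CL, hCL⟩ := hD.lipschitz
  refine ⟨CL, CL.2, fun t ht f hf => ?_⟩
  have h0 : (0 : ℝ) ∈ Icc 0 T := ⟨le_rfl, ht.1.trans ht.2⟩
  have i1 : Integrable (fun x => V t x * f x) (spaceM Ω) :=
    integrable_smul_of_memLp_two (Lp.memLp (V t)) hf
  have i2 : Integrable (fun x => V 0 x * f x) (spaceM Ω) :=
    integrable_smul_of_memLp_two (Lp.memLp (V 0)) hf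
  have e1 : (∫ x in Ω, V t x * f x) - ∫ x in Ω, V 0 x * f x =
      ∫ x in Ω, (V t - V 0 : Lp ℝ 2 (spaceM Ω)) x • f x := by
    rw [← integral_sub i1 i2]
    refine integral_congr_ae ?_
    filter_upwards [Lp.coeFn_sub (V t) (V 0)] with x hx
    rw [hx, Pi.sub_apply, smul_eq_mul, sub_mul]
  have h1 := hCL.dist_le_mul t ht 0 h0
  rw [dist_eq_norm, Real.dist_eq, sub_zero, abs_of_nonneg ht.1, Lp.norm_def] at h1
  rw [e1, ← Real.norm_eq_abs]
  refine (norm_integral_smul_le (Lp.memLp _) hf).trans ?_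
  gcongr

lemma eLpNorm_norm_sq {α N : Type*} [MeasurableSpace α] [NormedAddCommGroup N] {μ : Measure α}
    (f : α → N) :
    eLpNorm (fun x => ‖f x‖ ^ 2) 2 μ = eLpNorm f 4 μ ^ 2 := by
  have h := eLpNorm_norm_rpow (μ := μ) (p := 2) f (q := 2) (by norm_num)
  have e1 : (2 : ℝ≥0∞) * ENNReal.ofReal 2 = 4 := by
    rw [ENNReal.ofReal_ofNat]; norm_num
  rw [e1] at h
  simpa using h

/-- Strong convergence in Lagrangian coordinates at the initial time. -/
theorem IsDensityVersion.tendsto_initial [CompleteSpace F] (hΩo : IsOpen Ω)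
    (hΩ : Bornology.IsBounded Ω) (hT : 0 < T)
    (hD : IsDensityVersion Ω T m ρ₀ ρ u V) (hv : IsLipschitzVelocity Ω T u a) (hm : 0 ≤ m)
    (hφ : IsFlow Ω T u φ) {h : ℝ → E3 → F} {h₀ : E3 → F} {A : Set ℝ} (hAT : A ⊆ Ioo 0 T)
    (hmem : ∀ t ∈ A, MemLp (h t) 4 (spaceM Ω)) {C : ℝ}
    (hC : ∀ t ∈ A, t * (eLpNorm (h t) 4 (spaceM Ω)).toReal ^ 2 ≤ C)
    (h₀mem : MemLp h₀ 2 (massM Ω (V 0)))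
    (hM : ∀ ψ : E3 → F, Continuous ψ → HasCompactSupport ψ →
      Tendsto (fun t => ∫ x in Ω, V t x * inner ℝ (h t x) (ψ x)) (𝓝[A] 0)
        (𝓝 (∫ x in Ω, V 0 x * inner ℝ (h₀ x) (ψ x))))
    (hN : Tendsto (fun t => (∫ x in Ω, V t x * ‖h t x‖ ^ 2) -
      ∫ x in Ω, V 0 x * inner ℝ (h₀ x) (h t x)) (𝓝[A] 0) (𝓝 0)) :
    Tendsto (fun t => eLpNorm (fun y => h t (φ t y) - h₀ y) 2 (massM Ω (V 0)))
      (𝓝[A] 0) (𝓝 0) := by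
  have hfin := isFiniteMeasure_spaceM hΩ
  have hVi : ∀ r, Integrable (V r) (spaceM Ω) := fun r => (Lp.memLp (V r)).integrable one_le_two
  have hνfin := fun r => isFiniteMeasure_massM (hVi r)
  have h0I : (0 : ℝ) ∈ Icc 0 T := ⟨le_rfl, hT.le⟩
  have hAI : A ⊆ Icc 0 T := hAT.trans Ioo_subset_Icc_self
  obtain ⟨CL, hCL0, hCL⟩ := hD.abs_integral_sub_le
  have hm2 : ∀ t ∈ A, MemLp (h t) 2 (spaceM Ω) := fun t ht =>
    (hmem t ht).mono_exponent (by norm_num)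
  have hmν : ∀ (s : ℝ), s ∈ Icc 0 T → ∀ f : E3 → F, MemLp f 2 (spaceM Ω) →
      MemLp f 2 (massM Ω (V s)) := fun s hs f hf =>
    ⟨hf.1.mono_ac (massM_absolutelyContinuous _), (hD.eLpNorm_massM_le hs f).trans_lt
      (ENNReal.mul_lt_top ENNReal.ofReal_lt_top hf.2)⟩
  have hψν : ∀ ψ : E3 → F, Continuous ψ → HasCompactSupport ψ → ∀ s : ℝ,
      MemLp ψ 2 (massM Ω (V s)) := fun ψ h1 h2 s => h1.memLp_of_hasCompactSupport h2
  -- the time filter on the subtype of good times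
  set l : Filter A := comap Subtype.val (𝓝 0) with hl
  have hmap : map Subtype.val l = 𝓝[A] 0 := by
    rw [hl, map_comap, Subtype.range_coe]; rfl
  have hval : Tendsto (Subtype.val : A → ℝ) l (𝓝[A] 0) := hmap.le
  have hval0 : Tendsto (Subtype.val : A → ℝ) l (𝓝 0) := tendsto_comap
  set X : A → Lp F 2 (massM Ω (V 0)) := fun t => (hmν 0 h0I _ (hm2 t t.2)).toLp _ with hX
  set X₀ := h₀mem.toLp h₀ with hX₀
  have hNlim : Tendsto (fun t : A => ∫ x in Ω, V t x * ‖h t x‖ ^ 2) l (𝓝 (‖X₀‖ ^ 2)) := by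
    refine tendsto_norm_sq_of_weak (X := X) (C := CL * C)
      (S := {g | ∃ ψ : E3 → F, ∃ (h1 : Continuous ψ) (h2 : HasCompactSupport ψ),
        g = (hψν ψ h1 h2 0).toLp ψ}) ?_ ?_ ?_ ?_
    · rw [EMetric.mem_closure_iff]
      intro ε hε
      obtain ⟨δ, hδ0, hδ⟩ := exists_between hε
      obtain ⟨ψ, h2, h3, h1, -⟩ := h₀mem.exists_hasCompactSupport_eLpNorm_sub_le (by simp) hδ0.ne'
      refine ⟨_, ⟨ψ, h1, h2, rfl⟩, ?_⟩
      rw [hX₀, Lp.edist_toLp_toLp]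
      exact h3.trans_lt hδ
    · refine (hN.comp hval).congr fun t => ?_
      rw [Function.comp_apply, hX₀, hX, hD.inner_toLp_massM hΩ h0I]
    · refine Eventually.of_forall fun t => ?_
      rw [← real_inner_self_eq_norm_sq, hX, hD.inner_toLp_massM hΩ h0I]
      simp only [real_inner_self_eq_norm_sq]
      -- The density changes by `O(t)` in `L²` while `‖h‖²` is `O(1/t)` in `L²`. Hence the integrals
      -- of `‖h‖²` against `V t` and `V 0` differ by a bounded amount, not necessarily a small one;
      -- boundedness is all that `tendsto_norm_sq_of_weak` asks for.
      have hsq : MemLp (fun x => ‖h t x‖ ^ 2) 2 (spaceM Ω) := by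
        refine ⟨(hm2 t t.2).1.norm.pow 2, ?_⟩
        rw [eLpNorm_norm_sq]
        exact ENNReal.pow_lt_top (hmem t t.2).2
      have h1 := hCL t (hAI t.2) _ hsq
      rw [eLpNorm_norm_sq, ENNReal.toReal_pow] at h1
      have h2 := mul_le_mul_of_nonneg_left (hC t t.2) hCL0
      rw [abs_le] at h1
      linarith [h1.1]
    · rintro _ ⟨ψ, h1, h2, rfl⟩
      obtain ⟨B, hB⟩ := h2.exists_bound_of_continuous h1
      have hB0 : 0 ≤ B := (norm_nonneg _).trans (hB 0)
      have e0 : inner ℝ ((hψν ψ h1 h2 0).toLp ψ) X₀ = ∫ x in Ω, V 0 x * inner ℝ (h₀ x) (ψ x) := by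
        rw [real_inner_comm, hX₀, hD.inner_toLp_massM hΩ h0I]
      have e1 : ∀ t : A, inner ℝ ((hψν ψ h1 h2 0).toLp ψ) (X t) =
          ∫ x in Ω, V 0 x * inner ℝ (h t x) (ψ x) := fun t => by
        rw [real_inner_comm, hX, hD.inner_toLp_massM hΩ h0I]
      simp_rw [e1, e0]
      set k := (spaceM Ω univ ^ (1 / (2 : ℝ≥0∞).toReal - 1 / (4 : ℝ≥0∞).toReal)).toReal with hk
      -- Against a bounded `ψ` only one factor `h` remains, and `t ‖h t‖₄ ≤ √(t C)` tends to zero;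
      -- here the change of density is negligible.
      have hdiff : Tendsto (fun t : A => (∫ x in Ω, V t x * inner ℝ (h t x) (ψ x)) -
          ∫ x in Ω, V 0 x * inner ℝ (h t x) (ψ x)) l (𝓝 0) := by
        have hg : Tendsto (fun t : A => CL * (B * k) * √(t * C)) l (𝓝 0) := by
          have : Continuous fun t : ℝ => CL * (B * k) * √(t * C) := by fun_prop
          simpa [Function.comp_def] using (this.tendsto 0).comp hval0
        refine squeeze_zero_norm (fun t => ?_) hg
        have hpos : 0 ≤ (t : ℝ) := (hAI t.2).1
        have hin : MemLp (fun x => inner ℝ (h t x) (ψ x)) 2 (spaceM Ω) := by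
          refine ((hm2 t t.2).norm.const_mul B).mono
            ((hm2 t t.2).1.inner h1.aestronglyMeasurable) (Eventually.of_forall fun x => ?_)
          rw [norm_mul, norm_norm, Real.norm_of_nonneg hB0, mul_comm]
          exact (norm_inner_le_norm _ _).trans (mul_le_mul_of_nonneg_left (hB x) (norm_nonneg _))
        have q1 := hCL t (hAI t.2) _ hin
        have q2 : (eLpNorm (fun x => inner ℝ (h t x) (ψ x)) 2 (spaceM Ω)).toReal ≤
            B * ((eLpNorm (h t) 4 (spaceM Ω)).toReal * k) := by
          have r1 : eLpNorm (fun x => inner ℝ (h t x) (ψ x)) 2 (spaceM Ω) ≤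
              ENNReal.ofReal B * eLpNorm (h t) 2 (spaceM Ω) := by
            refine eLpNorm_le_mul_eLpNorm_of_ae_le_mul (Eventually.of_forall fun x => ?_) 2
            rw [mul_comm]
            exact (norm_inner_le_norm _ _).trans (mul_le_mul_of_nonneg_left (hB x) (norm_nonneg _))
          have r2 := eLpNorm_le_eLpNorm_mul_rpow_measure_univ (p := 2) (q := 4) (by norm_num)
            (hmem t t.2).1
          have r3 := r1.trans (mul_le_mul_right r2 (ENNReal.ofReal B))
          refine (ENNReal.toReal_mono ?_ r3).trans (le_of_eq ?_)
          · refine ENNReal.mul_ne_top ENNReal.ofReal_ne_top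
              (ENNReal.mul_ne_top (hmem t t.2).2.ne ?_)
            exact ENNReal.rpow_ne_top_of_nonneg (by norm_num) (measure_ne_top _ _)
          · rw [ENNReal.toReal_mul, ENNReal.toReal_mul, ENNReal.toReal_ofReal hB0]
        have q3 : t * (eLpNorm (h t) 4 (spaceM Ω)).toReal ≤ √(t * C) := by
          refine Real.le_sqrt_of_sq_le ?_
          have := mul_le_mul_of_nonneg_left (hC t t.2) hpos
          nlinarith
        rw [Real.norm_eq_abs]
        refine q1.trans ?_
        calc CL * t * _ ≤ CL * t * (B * ((eLpNorm (h t) 4 (spaceM Ω)).toReal * k)) := by gcongr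
          _ = CL * (B * k) * (t * (eLpNorm (h t) 4 (spaceM Ω)).toReal) := by ring
          _ ≤ _ := by gcongr
      have := ((hM ψ h1 h2).comp hval).sub hdiff
      simpa using this
  rw [← hmap, tendsto_map'_iff, ENNReal.tendsto_nhds_zero]
  intro ε hε
  -- The final splitting has a part below `2δ` (`h t - ψ`, moved to `L²(V t)` by transport) and two
  -- parts of size at most `δ` (`ψ` along the flow, and `h₀ - ψ`); hence the factor `4`.
  obtain ⟨δ, hδ, hδε⟩ := ENNReal.exists_nnreal_pos_mul_lt (a := 4) (b := ε) (by simp) hε.ne'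
  obtain ⟨ψ, hψc, hψδ, hψ, -⟩ := h₀mem.exists_hasCompactSupport_eLpNorm_sub_le (by simp)
    (ε := (δ : ℝ≥0∞)) (by exact_mod_cast hδ.ne')
  -- The norms live in the spaces `L²(V s)`, which vary with `s`. Expanding the square reduces their
  -- comparison to the convergence of three scalar integrals.
  have hexp : ∀ (s : ℝ) (hs : s ∈ Icc 0 T) (f : E3 → F) (hf : MemLp f 2 (massM Ω (V s))),
      (eLpNorm (f - ψ) 2 (massM Ω (V s))).toReal ^ 2 =
        ‖hf.toLp f‖ ^ 2 - 2 * (∫ x in Ω, V s x * inner ℝ (f x) (ψ x)) +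
          ∫ x in Ω, V s x * ‖ψ x‖ ^ 2 := by
    intro s hs f hf
    have g1 := hψν ψ hψ hψc s
    rw [← Lp.norm_toLp _ (hf.sub g1), MemLp.toLp_sub hf g1, norm_sub_sq_real,
      hD.inner_toLp_massM hΩ hs hf g1]
    congr 1
    rw [← real_inner_self_eq_norm_sq, hD.inner_toLp_massM hΩ hs g1 g1]
    simp only [real_inner_self_eq_norm_sq]
  have hψψ : Tendsto (fun t : A => ∫ x in Ω, V t x * ‖ψ x‖ ^ 2) l
      (𝓝 (∫ x in Ω, V 0 x * ‖ψ x‖ ^ 2)) := by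
    have hψsq : MemLp (fun x => ‖ψ x‖ ^ 2) 2 (spaceM Ω) :=
      memLp_two_of_continuous hΩ hΩo.measurableSet (by fun_prop)
    rw [tendsto_iff_norm_sub_tendsto_zero]
    have hg : Tendsto (fun t : A => CL * t * (eLpNorm (fun x => ‖ψ x‖ ^ 2) 2 (spaceM Ω)).toReal) l
        (𝓝 0) := by
      have : Continuous fun t : ℝ =>
        CL * t * (eLpNorm (fun x => ‖ψ x‖ ^ 2) 2 (spaceM Ω)).toReal := by fun_prop
      simpa [Function.comp_def] using (this.tendsto 0).comp hval0
    exact squeeze_zero (fun t => norm_nonneg _) (fun t => hCL t (hAI t.2) _ hψsq) hg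
  have hlim : Tendsto (fun t : A => (eLpNorm (h t - ψ) 2 (massM Ω (V t))).toReal ^ 2) l
      (𝓝 ((eLpNorm (h₀ - ψ) 2 (massM Ω (V 0))).toReal ^ 2)) := by
    rw [hexp 0 h0I h₀ h₀mem]
    refine ((hNlim.sub (((hM ψ hψ hψc).comp hval).const_mul 2)).add hψψ).congr fun t => ?_
    rw [hexp t (hAI t.2) (h t) (hmν t (hAI t.2) _ (hm2 t t.2)), ← real_inner_self_eq_norm_sq,
      hD.inner_toLp_massM hΩ (hAI t.2)]
    simp only [real_inner_self_eq_norm_sq, Function.comp_apply]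
  have hψδ' : (eLpNorm (h₀ - ψ) 2 (massM Ω (V 0))).toReal ≤ δ := by
    refine ENNReal.toReal_le_of_le_ofReal δ.2 ?_
    rwa [ENNReal.ofReal_coe_nnreal]
  have hδ' : (0 : ℝ) < δ := by exact_mod_cast hδ
  have hlt : (eLpNorm (h₀ - ψ) 2 (massM Ω (V 0))).toReal ^ 2 < (2 * δ : ℝ) ^ 2 := by
    have := ENNReal.toReal_nonneg (a := eLpNorm (h₀ - ψ) 2 (massM Ω (V 0)))
    nlinarith
  have hψt := (hφ.tendsto_eLpNorm_comp_sub hΩo hv (hVi 0) hψ hψc h0I).mono_left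
    (nhdsWithin_mono _ hAI) |>.comp hval
  have hψt' := hψt.eventually_lt_const (u := (δ : ℝ≥0∞)) (by exact_mod_cast hδ)
  filter_upwards [hlim.eventually_lt_const hlt, hψt'] with t k1 k2
  have ht := hAI t.2
  have g0 : MemLp (h t - ψ) 2 (massM Ω (V t)) := (hmν t ht _ (hm2 t t.2)).sub (hψν ψ hψ hψc t)
  have g1 : eLpNorm (h t - ψ) 2 (massM Ω (V t)) ≤ 2 * δ := by
    have : (eLpNorm (h t - ψ) 2 (massM Ω (V t))).toReal ≤ 2 * δ :=
      (lt_of_pow_lt_pow_left₀ 2 (by positivity) k1).le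
    rw [← ENNReal.ofReal_toReal g0.2.ne]
    refine (ENNReal.ofReal_le_ofReal this).trans (le_of_eq ?_)
    rw [ENNReal.ofReal_mul (by norm_num), ENNReal.ofReal_coe_nnreal, ENNReal.ofReal_ofNat]
  obtain ⟨g2, g3⟩ := hD.eLpNorm_comp_flow hΩo hΩ hv hm hφ ht g0.1
  have hmψ : ∀ s ∈ Icc 0 T, AEStronglyMeasurable (fun y => ψ (φ s y)) (massM Ω (V 0)) := fun s hs =>
    (hD.eLpNorm_comp_flow hΩo hΩ hv hm hφ hs (hψν ψ hψ hψc s).1).1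
  have hinit : ∀ᵐ y ∂massM Ω (V 0), φ 0 y = y := by
    refine (massM_absolutelyContinuous (V 0)).ae_le ?_
    filter_upwards [ae_restrict_mem hΩo.measurableSet] with y hy using hφ.initial hT.le hy
  have e1 : (fun y => h t (φ t y) - h₀ y) =ᵐ[massM Ω (V 0)]
      ((fun y => (h t - ψ) (φ t y)) + (fun y => ψ (φ t y) - ψ (φ 0 y))) - (h₀ - ψ) := by
    filter_upwards [hinit] with y hy
    simp only [Pi.add_apply, Pi.sub_apply, hy]
    abel
  rw [Function.comp_apply, eLpNorm_congr_ae e1]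
  have hψm2 : AEStronglyMeasurable (fun y => ψ (φ t y) - ψ (φ 0 y)) (massM Ω (V 0)) :=
    (hmψ t ht).sub (hmψ 0 h0I)
  refine (eLpNorm_sub_le (g2.add hψm2) (h₀mem.sub (hψν ψ hψ hψc 0)).1 one_le_two).trans ?_
  refine le_trans (add_le_add ((eLpNorm_add_le g2 hψm2 one_le_two).trans
    (add_le_add (g3.trans_le g1) k2.le)) hψδ) (le_trans (le_of_eq ?_) hδε.le)
  ring

end InitialTime

/-! ### Continuity in `L²` away from the initial time. -/

section TimeRegularity

variable {Ω : Set E3} {T : ℝ} {F : Type*} [NormedAddCommGroup F] [NormedSpace ℝ F]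

lemma restrict_Ioo_prod_le {a : ℝ} (ha : 0 ≤ a) :
    (volume.restrict (Ioo a T)).prod (spaceM Ω) ≤ (timeM T).prod (spaceM Ω) :=
  Measure.prod_mono (Measure.restrict_mono (Ioo_subset_Ioo_left ha) le_rfl) le_rfl

/-- A time weight that is positive for positive times can be removed away from the initial time. -/
lemma InLL.memLp_two_of_wt {w : ℝ → ℝ} (hwm : Monotone w) (hw : ∀ t, 0 < t → 0 < w t)
    {g : ℝ → E3 → F} (hg : InLL Ω T 2 2 (wt w g)) {a : ℝ} (ha : 0 < a) :
    MemLp (Function.uncurry g) 2 ((volume.restrict (Ioo a T)).prod (spaceM Ω)) := by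
  have h1 := hg.memLp_two.mono_measure (restrict_Ioo_prod_le (Ω := Ω) (T := T) ha.le)
  have hmem : ∀ᵐ z ∂(volume.restrict (Ioo a T)).prod (spaceM Ω), z.1 ∈ Ioo a T :=
    Measure.quasiMeasurePreserving_fst.ae (ae_restrict_mem measurableSet_Ioo)
  have hm : AEStronglyMeasurable (Function.uncurry g)
      ((volume.restrict (Ioo a T)).prod (spaceM Ω)) := by
    refine ((hwm.measurable.inv.comp measurable_fst).aestronglyMeasurable.smul h1.1).congr ?_
    filter_upwards [hmem] with z hz
    simp only [Pi.smul_apply', Function.comp_apply, Pi.inv_apply, Function.uncurry_def, wt]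
    rw [smul_smul, inv_mul_cancel₀ (hw _ (ha.trans hz.1)).ne', one_smul]
  refine h1.of_le_mul (c := (w a)⁻¹) hm ?_
  filter_upwards [hmem] with z hz
  simp only [Function.uncurry_def, wt]
  rw [norm_smul, Real.norm_of_nonneg (hw _ (ha.trans hz.1)).le, ← mul_assoc]
  refine le_mul_of_one_le_left (norm_nonneg _) ?_
  rw [inv_mul_eq_div, one_le_div (hw a ha)]
  exact hwm hz.1.le

/-- A field whose time derivative is square integrable away from the initial time is the time
integral of that derivative, and a locally uniformly continuous curve in `L²` on `(0, T]`. -/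
theorem HasWeakTimeDeriv.exists_good_times [CompleteSpace F] (hΩo : IsOpen Ω)
    (hΩ : Bornology.IsBounded Ω) (hT : 0 < T)
    {f g : ℝ → E3 → F} (hfg : HasWeakTimeDeriv Ω T f g) (hf : InLL Ω T 2 2 f)
    (hg : ∀ a > 0, MemLp (Function.uncurry g) 2 ((volume.restrict (Ioo a T)).prod (spaceM Ω))) :
    ∃ A : Set ℝ, (∀ᵐ t ∂timeM T, t ∈ A) ∧ A ⊆ Ioo 0 T ∧
      (∀ s ∈ A, ∀ t ∈ A, ∀ᵐ x ∂spaceM Ω, f t x - f s x = ∫ τ in s..t, g τ x) ∧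
      ∀ t₁ ∈ Ioc 0 T, ∀ ε > 0, ∃ δ > 0, ∀ s ∈ A, ∀ t ∈ A, |s - t₁| < δ → |t - t₁| < δ →
        eLpNorm (fun x => f t x - f s x) 2 (spaceM Ω) ≤ ENNReal.ofReal ε := by
  have hfin := isFiniteMeasure_spaceM hΩ
  -- Initial times decreasing to zero, the shift by `2` keeping them below `T`. The derivative is
  -- known to be integrable only on each `(b n, T)`, so a time is good if it is good for every `n`
  -- with `b n < t`.
  set b : ℕ → ℝ := fun n => T / (n + 2) with hb
  have hb0 : ∀ n, 0 < b n := fun n => by positivity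
  have hbT : ∀ n, b n < T := fun n => by
    rw [hb, div_lt_iff₀ (by positivity)]
    have : (0 : ℝ) ≤ n := n.cast_nonneg
    nlinarith
  have hlim : ∀ r : ℝ, 0 < r → ∃ n, b n < r := fun r hr => by
    obtain ⟨n, hn⟩ := exists_nat_gt (T / r)
    refine ⟨n, ?_⟩
    rw [hb, div_lt_iff₀ (by positivity)]
    rw [div_lt_iff₀ hr] at hn
    nlinarith
  have hex := fun n => hfg.exists_ae_sub_eq hΩo hΩ (hb0 n).le (hbT n) le_rfl
    ((hf.memLp_two.mono_measure (restrict_Ioo_prod_le (hb0 n).le)).integrable one_le_two)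
    ((hg _ (hb0 n)).integrable one_le_two)
  choose A hA hAd using hex
  have hfund : ∀ s ∈ {t | t ∈ Ioo 0 T ∧ ∀ n, b n < t → t ∈ A n},
      ∀ t ∈ {t | t ∈ Ioo 0 T ∧ ∀ n, b n < t → t ∈ A n},
      ∀ᵐ x ∂spaceM Ω, f t x - f s x = ∫ τ in s..t, g τ x := by
    rintro s ⟨hs, hs'⟩ t ⟨ht, ht'⟩
    obtain ⟨n, hn⟩ := hlim (min s t) (lt_min hs.1 ht.1)
    exact hAd n s (hs' n (hn.trans_le (min_le_left _ _))) t (ht' n (hn.trans_le (min_le_right _ _)))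
  refine ⟨{t | t ∈ Ioo 0 T ∧ ∀ n, b n < t → t ∈ A n}, ?_, fun t ht => ht.1, hfund, ?_⟩
  · have h1 : ∀ᵐ t ∂timeM T, ∀ n, b n < t → t ∈ A n := by
      rw [ae_all_iff]
      intro n
      have := (ae_restrict_iff' measurableSet_Ioo).1 (hA n)
      refine (ae_restrict_iff' measurableSet_Ioo).2 ?_
      filter_upwards [this] with t ht h2 h3 using ht ⟨h3, h2.2⟩
    filter_upwards [h1, ae_restrict_mem measurableSet_Ioo] with t h2 h3 using ⟨h3, h2⟩
  · intro t₁ ht₁ ε hε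
    have hpos : 0 < t₁ / 2 := half_pos ht₁.1
    have hgm := hg _ hpos
    set C : ℝ≥0∞ := ∫⁻ τ in Ioo (t₁ / 2) T, ∫⁻ x in Ω, ‖g τ x‖ₑ ^ 2 with hC
    have hCfin : C ≠ ⊤ := by
      have : C = eLpNorm (Function.uncurry g) 2
          ((volume.restrict (Ioo (t₁ / 2) T)).prod (spaceM Ω)) ^ 2 := by
        rw [eLpNorm_two_sq, lintegral_prod _ (hgm.1.enorm.pow_const 2)]
        rfl
      rw [this]
      exact (ENNReal.pow_lt_top hgm.2).ne
    set c := C.toReal with hc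
    have hc0 : 0 ≤ c := ENNReal.toReal_nonneg
    -- The first bound keeps both times in `(t₁/2, T)`, where `g` has squared norm `c`; the second
    -- gives `|t - s| ≤ ε² / (c + 1)`, as the Cauchy-Schwarz estimate requires.
    refine ⟨min (t₁ / 2) (ε ^ 2 / (2 * (c + 1))), lt_min hpos (by positivity), ?_⟩
    intro s hs t ht h1 h2
    rw [lt_min_iff, abs_lt] at h1 h2
    have hs' : s ∈ Ioo (t₁ / 2) T := ⟨by linarith [h1.1.1], hs.1.2⟩
    have ht' : t ∈ Ioo (t₁ / 2) T := ⟨by linarith [h2.1.1], ht.1.2⟩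
    have h3 := eLpNorm_two_le_of_ae_eq_integral (C := C) hs' ht' hgm.1 (hfund s hs t ht) (by
      refine lintegral_mono_set fun r hr => ?_
      exact ⟨(lt_min hs'.1 ht'.1).trans hr.1, hr.2.trans_lt (max_lt hs'.2 ht'.2)⟩)
    have h4 : |t - s| * c ≤ ε ^ 2 := by
      have h5 : |t - s| ≤ ε ^ 2 / (c + 1) := by
        have := abs_sub_le t t₁ s
        rw [abs_sub_comm t₁ s] at this
        have e : ε ^ 2 / (c + 1) = ε ^ 2 / (2 * (c + 1)) + ε ^ 2 / (2 * (c + 1)) := by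
          field_simp; norm_num
        linarith [h1.2, h2.2]
      calc |t - s| * c ≤ ε ^ 2 / (c + 1) * c := by gcongr
        _ ≤ ε ^ 2 := by
          rw [div_mul_eq_mul_div, div_le_iff₀ (by positivity)]
          nlinarith [sq_nonneg ε]
    rw [← ENNReal.ofReal_toReal hCfin, ← ENNReal.ofReal_mul (abs_nonneg _)] at h3
    have h6 := h3.trans (ENNReal.ofReal_le_ofReal h4)
    rw [ENNReal.ofReal_pow hε.le] at h6
    exact (ENNReal.pow_le_pow_left_iff two_ne_zero).1 h6

end TimeRegularity

/-! ### The product rule in time. -/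

section ProductRule

/-- Product rule for two functions that are almost everywhere equal to primitives. -/
lemma mul_sub_mul_eq_integral {p q g h : ℝ → ℝ} {s t : ℝ} (hst : s ≤ t)
    (hg : IntervalIntegrable g volume s t) (hh : IntervalIntegrable h volume s t)
    (hpt : p t - p s = ∫ τ in s..t, g τ) (hqt : q t - q s = ∫ τ in s..t, h τ)
    (hp : ∀ᵐ τ ∂volume.restrict (Ioo s t), p τ - p s = ∫ r in s..τ, g r)
    (hq : ∀ᵐ τ ∂volume.restrict (Ioo s t), q τ - q s = ∫ r in s..τ, h r) :
    p t * q t - p s * q s = ∫ τ in s..t, (g τ * q τ + p τ * h τ) := by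
  have hs : s ∈ uIcc s t := left_mem_uIcc
  have hc : ∀ c : ℝ, AbsolutelyContinuousOnInterval (fun _ : ℝ => c) s t := fun c =>
    (LipschitzWith.const c).lipschitzOnWith.absolutelyContinuousOnInterval
  have hP := (hc (p s)).add (hg.absolutelyContinuousOnInterval_intervalIntegral hs)
  have hQ := (hc (q s)).add (hh.absolutelyContinuousOnInterval_intervalIntegral hs)
  have key := hP.integral_deriv_mul_eq_sub hQ
  simp only [Pi.add_apply, intervalIntegral.integral_same, add_zero, ← hpt, ← hqt,
    add_sub_cancel] at key
  rw [← key, intervalIntegral.integral_of_le hst, intervalIntegral.integral_of_le hst,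
    integral_Ioc_eq_integral_Ioo, integral_Ioc_eq_integral_Ioo]
  refine setIntegral_congr_ae measurableSet_Ioo ?_
  rw [ae_restrict_iff' measurableSet_Ioo] at hp hq
  filter_upwards [hp, hq, hg.ae_hasDerivAt_integral, hh.ae_hasDerivAt_integral]
    with τ h1 h2 h4 h5 hτ
  have hτu : τ ∈ uIcc s t := by rw [uIcc_of_le hst]; exact ⟨hτ.1.le, hτ.2.le⟩
  have d1 := ((h4 hτu s hs).const_add (p s)).deriv
  have d2 := ((h5 hτu s hs).const_add (q s)).deriv
  have e1 := h1 hτ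
  have e2 := h2 hτ
  have f1 : deriv ((fun _ => p s) + fun x => ∫ v in s..x, g v) τ = g τ := d1
  have f2 : deriv ((fun _ => q s) + fun x => ∫ v in s..x, h v) τ = h τ := d2
  rw [f1, f2, ← e1, ← e2]
  ring

variable {Ω : Set E3} {T : ℝ}

/-- Writing the primitive as an integral of an indicator over a fixed interval reduces its joint
measurability to that of a parameter integral. -/
lemma aestronglyMeasurable_primitive {s t : ℝ} {g : ℝ → E3 → ℝ}
    (hg : AEStronglyMeasurable (Function.uncurry g)
      ((volume.restrict (Ioo s t)).prod (spaceM Ω))) :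
    AEStronglyMeasurable (fun z : ℝ × E3 => ∫ r in s..z.1, g r z.2)
      ((volume.restrict (Ioo s t)).prod (spaceM Ω)) := by
  set ν : Measure ℝ := volume.restrict (Ioo s t) with hν
  have h1 : AEStronglyMeasurable (fun z : (ℝ × E3) × ℝ => g z.2 z.1.2)
      ((ν.prod (spaceM Ω)).prod ν) :=
    hg.prod_swap.comp_quasiMeasurePreserving
      (f := Prod.map Prod.snd id)
      (MeasureTheory.QuasiMeasurePreserving.prodMap Measure.quasiMeasurePreserving_snd
        (Measure.QuasiMeasurePreserving.id _))
  have h2 := (h1.indicator (measurableSet_le measurable_snd measurable_fst.fst :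
    MeasurableSet {z : (ℝ × E3) × ℝ | z.2 ≤ z.1.1})).integral_prod_right'
  refine h2.congr ?_
  have hmem : ∀ᵐ z ∂ν.prod (spaceM Ω), z.1 ∈ Ioo s t :=
    Measure.quasiMeasurePreserving_fst.ae (ae_restrict_mem measurableSet_Ioo)
  filter_upwards [hmem] with z hz
  rw [intervalIntegral.integral_of_le hz.1.le]
  have e1 : (fun r => {z : (ℝ × E3) × ℝ | z.2 ≤ z.1.1}.indicator
      (fun z : (ℝ × E3) × ℝ => g z.2 z.1.2) (z, r)) = (Iic z.1).indicator fun r => g r z.2 := by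
    ext r
    simp only [indicator_apply, mem_Iic, mem_ofPred_eq]
  rw [e1, integral_indicator measurableSet_Iic, hν, Measure.restrict_restrict measurableSet_Iic]
  congr 2
  ext r
  exact ⟨fun h => ⟨h.2.1, h.1⟩, fun h => ⟨h.2, h.1, h.2.trans_lt hz.2⟩⟩

/-- By Tonelli's theorem for `‖f - g‖`, both orders of quantifiers say that this integral over the
product vanishes. It turns identities valid at each good time for almost every point into identities
along almost every time line. -/
lemma ae_ae_swap_of_eq {α β : Type*} [MeasurableSpace α] [MeasurableSpace β] {μ : Measure α}
    {ν : Measure β} [SFinite μ] [SFinite ν] {f g : α × β → ℝ}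
    (hf : AEStronglyMeasurable f (μ.prod ν)) (hg : AEStronglyMeasurable g (μ.prod ν))
    (h : ∀ᵐ x ∂μ, ∀ᵐ y ∂ν, f (x, y) = g (x, y)) : ∀ᵐ y ∂ν, ∀ᵐ x ∂μ, f (x, y) = g (x, y) := by
  have hm : AEMeasurable (fun z => ‖f z - g z‖ₑ) (μ.prod ν) := (hf.sub hg).enorm
  have h0 : ∫⁻ z, ‖f z - g z‖ₑ ∂μ.prod ν = 0 := by
    rw [lintegral_prod _ hm, ← lintegral_zero (μ := μ)]
    refine lintegral_congr_ae ?_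
    filter_upwards [h] with x hx
    rw [← lintegral_zero (μ := ν)]
    refine lintegral_congr_ae ?_
    filter_upwards [hx] with y hy
    simp [hy]
  rw [lintegral_prod_symm _ hm, lintegral_eq_zero_iff' hm.lintegral_prod_left'] at h0
  filter_upwards [h0, (hf.sub hg).prodMk_right] with y hy hmy
  have hmy' : AEMeasurable (fun x => ‖f (x, y) - g (x, y)‖ₑ) μ := hmy.enorm
  rw [Pi.zero_apply, lintegral_eq_zero_iff' hmy'] at hy
  filter_upwards [hy] with x hx
  simpa [sub_eq_zero] using hx

/-- Product rule in time for fields that are time integrals of their derivatives. -/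
theorem mul_sub_mul_ae_eq_integral {s t : ℝ} (hst : s < t) {f₁ g₁ f₂ g₂ : ℝ → E3 → ℝ} {A : Set ℝ}
    (hA : ∀ᵐ τ ∂volume.restrict (Ioo s t), τ ∈ A) (hs : s ∈ A) (ht : t ∈ A)
    (hf₁ : AEStronglyMeasurable (Function.uncurry f₁)
      ((volume.restrict (Ioo s t)).prod (spaceM Ω)))
    (hf₂ : AEStronglyMeasurable (Function.uncurry f₂)
      ((volume.restrict (Ioo s t)).prod (spaceM Ω)))
    (hm₁ : AEStronglyMeasurable (f₁ s) (spaceM Ω)) (hm₂ : AEStronglyMeasurable (f₂ s) (spaceM Ω))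
    (hg₁ : Integrable (Function.uncurry g₁) ((volume.restrict (Ioo s t)).prod (spaceM Ω)))
    (hg₂ : Integrable (Function.uncurry g₂) ((volume.restrict (Ioo s t)).prod (spaceM Ω)))
    (h₁ : ∀ s ∈ A, ∀ t ∈ A, ∀ᵐ x ∂spaceM Ω, f₁ t x - f₁ s x = ∫ τ in s..t, g₁ τ x)
    (h₂ : ∀ s ∈ A, ∀ t ∈ A, ∀ᵐ x ∂spaceM Ω, f₂ t x - f₂ s x = ∫ τ in s..t, g₂ τ x) :
    ∀ᵐ x ∂spaceM Ω, f₁ t x * f₂ t x - f₁ s x * f₂ s x =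
      ∫ τ in s..t, (g₁ τ x * f₂ τ x + f₁ τ x * g₂ τ x) := by
  have swap : ∀ {f g : ℝ → E3 → ℝ}, AEStronglyMeasurable (Function.uncurry f)
      ((volume.restrict (Ioo s t)).prod (spaceM Ω)) → AEStronglyMeasurable (f s) (spaceM Ω) →
      Integrable (Function.uncurry g) ((volume.restrict (Ioo s t)).prod (spaceM Ω)) →
      (∀ s ∈ A, ∀ t ∈ A, ∀ᵐ x ∂spaceM Ω, f t x - f s x = ∫ τ in s..t, g τ x) →
      ∀ᵐ x ∂spaceM Ω, ∀ᵐ τ ∂volume.restrict (Ioo s t), f τ x - f s x = ∫ r in s..τ, g r x := by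
    intro f g hf hm hg h
    refine ae_ae_swap_of_eq (f := fun z => f z.1 z.2 - f s z.2)
      (g := fun z => ∫ r in s..z.1, g r z.2) (hf.sub hm.comp_snd)
      (aestronglyMeasurable_primitive hg.1) ?_
    filter_upwards [hA] with τ hτ using h s hs τ hτ
  have int : ∀ {g : ℝ → E3 → ℝ},
      Integrable (Function.uncurry g) ((volume.restrict (Ioo s t)).prod (spaceM Ω)) →
      ∀ᵐ x ∂spaceM Ω, IntervalIntegrable (fun τ => g τ x) volume s t := by
    intro g hg
    filter_upwards [hg.prod_left_ae] with x hx
    rw [intervalIntegrable_iff_integrableOn_Ioo_of_le hst.le]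
    exact hx
  filter_upwards [swap hf₁ hm₁ hg₁ h₁, swap hf₂ hm₂ hg₂ h₂, int hg₁, int hg₂, h₁ s hs t ht,
    h₂ s hs t ht] with x e1 e2 e3 e4 e5 e6
  exact mul_sub_mul_eq_integral (p := fun τ => f₁ τ x) (q := fun τ => f₂ τ x) hst.le e3 e4 e5 e6
    e1 e2

end ProductRule

/-! ### Hölder's inequality with exponents 2, 4, 4. -/

section Holder

variable {α N₁ N₂ N₃ : Type*} [MeasurableSpace α] {ν : Measure α} [NormedAddCommGroup N₁]
  [NormedAddCommGroup N₂] [NormedAddCommGroup N₃]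

lemma memLp_two_norm_mul_norm {b : α → N₂} {c : α → N₃} (hb : MemLp b 4 ν) (hc : MemLp c 4 ν) :
    MemLp (fun x => ‖b x‖ * ‖c x‖) 2 ν ∧
      eLpNorm (fun x => ‖b x‖ * ‖c x‖) 2 ν ≤ eLpNorm b 4 ν * eLpNorm c 4 ν := by
  have : ENNReal.HolderTriple 4 4 2 := ⟨by
    rw [← two_mul, show (4 : ℝ≥0∞) = 2 * 2 by norm_num,
      ENNReal.mul_inv (by norm_num) (by norm_num), ← mul_assoc,
      ENNReal.mul_inv_cancel (by norm_num) (by norm_num), one_mul]⟩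
  refine ⟨hc.norm.smul hb.norm, ?_⟩
  have := eLpNorm_smul_le_mul_eLpNorm (p := 4) (q := 4) (r := 2) hc.norm.1 hb.norm.1
  rw [eLpNorm_norm, eLpNorm_norm] at this
  exact this

/-- Hölder's inequality with exponents `2, 4, 4`. -/
lemma integrable_norm_mul_norm_mul_norm {a : α → N₁} {b : α → N₂} {c : α → N₃} (ha : MemLp a 2 ν)
    (hb : MemLp b 4 ν) (hc : MemLp c 4 ν) :
    Integrable (fun x => ‖a x‖ * (‖b x‖ * ‖c x‖)) ν ∧
      ∫ x, ‖a x‖ * (‖b x‖ * ‖c x‖) ∂ν ≤ (eLpNorm a 2 ν).toReal *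
        ((eLpNorm b 4 ν).toReal * (eLpNorm c 4 ν).toReal) := by
  obtain ⟨h1, h2⟩ := memLp_two_norm_mul_norm hb hc
  refine ⟨integrable_smul_of_memLp_two ha.norm h1, ?_⟩
  have h3 := norm_integral_smul_le ha.norm h1
  rw [eLpNorm_norm] at h3
  refine ((le_abs_self _).trans h3).trans ?_
  gcongr
  rw [← ENNReal.toReal_mul]
  exact ENNReal.toReal_mono (ENNReal.mul_ne_top hb.2.ne hc.2.ne) h2

/-- A bounded square integrable function is in `L⁴`. -/
lemma memLp_four_of_ae_norm_le {a : α → N₁} (ha : MemLp a 2 ν) {M : ℝ} (hM : 0 ≤ M)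
    (h : ∀ᵐ x ∂ν, ‖a x‖ ≤ M) : MemLp a 4 ν ∧
      (eLpNorm a 4 ν).toReal ≤ √M * √(eLpNorm a 2 ν).toReal := by
  have h1 : eLpNorm a 4 ν ^ 2 ≤ ENNReal.ofReal M * eLpNorm a 2 ν := by
    rw [← eLpNorm_norm_sq]
    refine eLpNorm_le_mul_eLpNorm_of_ae_le_mul ?_ 2
    filter_upwards [h] with x hx
    rw [Real.norm_of_nonneg (by positivity), sq]
    gcongr
  have h2 : eLpNorm a 4 ν < ⊤ := by
    by_contra hc
    rw [not_lt, top_le_iff] at hc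
    rw [hc] at h1
    exact (ENNReal.mul_lt_top ENNReal.ofReal_lt_top ha.2).ne (top_le_iff.1 (by simpa using h1))
  refine ⟨⟨ha.1, h2⟩, ?_⟩
  rw [← Real.sqrt_mul hM]
  refine Real.le_sqrt_of_sq_le ?_
  have := ENNReal.toReal_mono (ENNReal.mul_ne_top ENNReal.ofReal_ne_top ha.2.ne) h1
  rwa [ENNReal.toReal_pow, ENNReal.toReal_mul, ENNReal.toReal_ofReal hM] at this

end Holder

/-! ### Pointwise bounds for the forms in the equations, and Green's formula. -/

section Forms

lemma norm_e (i : Fin 3) : ‖e i‖ = 1 := by simp [e]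

lemma abs_apply_coord_le (L : E3 →L[ℝ] E3) (i j : Fin 3) : |(L (e i)) j| ≤ ‖L‖ := by
  have h1 : |(L (e i)) j| ≤ ‖L (e i)‖ := PiLp.norm_apply_le (L (e i)) j
  exact h1.trans ((L.le_opNorm _).trans (by rw [norm_e, mul_one]))

lemma abs_divOf_le (L : E3 →L[ℝ] E3) : |divOf L| ≤ 3 * ‖L‖ := by
  refine (Finset.abs_sum_le_sum_abs _ _).trans ?_
  refine (Finset.sum_le_sum fun i _ => abs_apply_coord_le L i i).trans ?_
  simp

/-- Nine entries, each of square at most `4 ‖L‖²`, give `36`, halved by the factor `μ / 2`; the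
divergence is at most `3 ‖L‖`, which gives `9`. -/
lemma abs_dissip_le (μ lam : ℝ) (L : E3 →L[ℝ] E3) :
    |dissip μ lam L| ≤ (18 * |μ| + 9 * |lam|) * (‖L‖ * ‖L‖) := by
  have h1 : ∀ i j : Fin 3, ((L (e i)) j + (L (e j)) i) ^ 2 ≤ 4 * (‖L‖ * ‖L‖) := fun i j => by
    have := (abs_add_le ((L (e i)) j) ((L (e j)) i)).trans
      (add_le_add (abs_apply_coord_le L i j) (abs_apply_coord_le L j i))
    rw [← sq_abs]
    nlinarith [abs_nonneg ((L (e i)) j + (L (e j)) i)]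
  have h2 : |∑ i, ∑ j, ((L (e i)) j + (L (e j)) i) ^ 2| ≤ 36 * (‖L‖ * ‖L‖) := by
    rw [abs_of_nonneg (Finset.sum_nonneg fun i _ => Finset.sum_nonneg fun j _ => sq_nonneg _)]
    refine (Finset.sum_le_sum fun i _ => Finset.sum_le_sum fun j _ => h1 i j).trans ?_
    simp only [Finset.sum_const, Finset.card_univ, Fintype.card_fin, nsmul_eq_mul]
    exact le_of_eq (by push_cast; ring)
  have h3 : |divOf L ^ 2| ≤ 9 * (‖L‖ * ‖L‖) := by
    rw [abs_pow]
    nlinarith [abs_divOf_le L, abs_nonneg (divOf L)]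
  unfold dissip
  refine (abs_add_le _ _).trans ?_
  rw [abs_mul, abs_mul, abs_div, abs_two]
  have h4 := mul_le_mul_of_nonneg_left h2 (by positivity : 0 ≤ |μ| / 2)
  have h5 := mul_le_mul_of_nonneg_left h3 (abs_nonneg lam)
  linarith

/-- Integration by parts, tested with a function in `H₀¹` and a continuous linear functional. -/
lemma HasWeakDeriv.integral_mul_clm_apply {F : Type*} [NormedAddCommGroup F] [NormedSpace ℝ F]
    [CompleteSpace F] {Ω : Set E3} {f : E3 → F} {G : E3 → E3 →L[ℝ] F} {c : ℝ} (hc : c ≠ 0)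
    (h : HasWeakDeriv Ω (fun x => c • f x) fun x => c • G x)
    (hf : MemLp f 2 (spaceM Ω)) (hG : MemLp G 2 (spaceM Ω)) {w : E3 → ℝ} {Dw : E3 → E3 →L[ℝ] ℝ}
    (hw : MemH10 Ω w Dw) (v : E3) (l : F →L[ℝ] ℝ) :
    Integrable (fun x => l (G x v) * w x) (spaceM Ω) ∧
    ∫ x in Ω, l (G x v) * w x = -∫ x in Ω, Dw x v * l (f x) := by
  -- The weight `c` cancels. It is carried along because second derivatives of the temperature are
  -- given only for the field weighted by `√t`, at a fixed time a nonzero constant.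
  have h1 := h.integral_smul_eq (hf.const_smul c) (hG.const_smul c) hw v
  have hGv : MemLp (fun x => G x v) 2 (spaceM Ω) := memLp_clm_apply hG v
  have j1 : Integrable (fun x => Dw x v • (c • f x)) (spaceM Ω) :=
    integrable_smul_of_memLp_two (memLp_clm_apply hw.2.1 v) (hf.const_smul c)
  have j2 : Integrable (fun x => w x • (c • G x v)) (spaceM Ω) :=
    integrable_smul_of_memLp_two hw.1 (hGv.const_smul c)
  have h2 : l (∫ x in Ω, Dw x v • (c • f x)) = l (-∫ x in Ω, w x • (c • G x v)) := congrArg l h1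
  rw [map_neg, ← l.integral_comp_comm j1, ← l.integral_comp_comm j2] at h2
  simp only [map_smul, smul_eq_mul] at h2
  have h3 : (∫ x in Ω, Dw x v * (c * l (f x))) = c * ∫ x in Ω, Dw x v * l (f x) := by
    rw [← integral_const_mul]
    congr 1; ext x; ring
  have h4 : (∫ x in Ω, w x * (c * l (G x v))) = c * ∫ x in Ω, l (G x v) * w x := by
    rw [← integral_const_mul]
    congr 1; ext x; ring
  rw [h3, h4, ← mul_neg] at h2
  refine ⟨?_, by linarith [mul_left_cancel₀ hc h2]⟩
  exact integrable_smul_of_memLp_two (hGv.continuousLinearMap_comp l) hw.1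

/-- Green's formula for the Laplacian, with a scalar weight on the derivatives. -/
lemma integral_mul_lapOf {Ω : Set E3} {G : E3 → E3 →L[ℝ] ℝ} {H : E3 → E3 →L[ℝ] E3 →L[ℝ] ℝ} {c : ℝ}
    (hc : c ≠ 0) (h : HasWeakDeriv Ω (fun x => c • G x) fun x => c • H x)
    (hG : MemLp G 2 (spaceM Ω)) (hH : MemLp H 2 (spaceM Ω)) {w : E3 → ℝ} {Dw : E3 → E3 →L[ℝ] ℝ}
    (hw : MemH10 Ω w Dw) :
    Integrable (fun x => lapOf (H x) * w x) (spaceM Ω) ∧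
    ∫ x in Ω, lapOf (H x) * w x = -∑ i, ∫ x in Ω, Dw x (e i) * G x (e i) := by
  have key := fun i => h.integral_mul_clm_apply hc hG hH hw (e i)
    (ContinuousLinearMap.apply ℝ ℝ (e i))
  simp only [ContinuousLinearMap.apply_apply] at key
  have e0 : (fun x => lapOf (H x) * w x) = fun x => ∑ i, H x (e i) (e i) * w x := by
    ext x
    rw [lapOf, Finset.sum_mul]
  rw [e0]
  refine ⟨integrable_finsetSum _ fun i _ => (key i).1, ?_⟩
  rw [integral_finsetSum _ fun i _ => (key i).1, ← Finset.sum_neg_distrib]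
  exact Finset.sum_congr rfl fun i _ => (key i).2

end Forms

/-! ### Energy estimate at a fixed time. -/

section Energy

/-- The energy equation at a fixed time, tested with a function in `H₀¹`. -/
lemma abs_integral_energy_le {Ω : Set E3} {R μ lam κ cv m Cρ CU c c' α : ℝ} (hR : 0 ≤ R)
    (hκ : 0 ≤ κ) (hcv : 0 < cv) (hm : 0 ≤ m) (hCρ : 0 ≤ Cρ) (hCU : 0 ≤ CU) (hc0 : 0 ≤ c)
    (hα : 0 ≤ α)
    (hc : ∀ {f : E3 → ℝ} {G : E3 → E3 →L[ℝ] ℝ}, MemH10 Ω f G → MemLp f 4 (spaceM Ω) ∧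
      (eLpNorm f 4 (spaceM Ω)).toReal ≤ c * (eLpNorm G 2 (spaceM Ω)).toReal)
    {r rt th tht w : E3 → ℝ} {U : E3 → E3} {DU : E3 → E3 →L[ℝ] E3} {Dth Dw : E3 → E3 →L[ℝ] ℝ}
    {D2th : E3 → E3 →L[ℝ] E3 →L[ℝ] ℝ}
    (hrm : AEStronglyMeasurable r (spaceM Ω)) (hr : ∀ᵐ x ∂spaceM Ω, |r x| ≤ m)
    (hrt : MemLp rt 2 (spaceM Ω)) (hrt' : (eLpNorm rt 2 (spaceM Ω)).toReal ≤ Cρ)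
    (hth : MemH10 Ω th Dth) (htht : AEStronglyMeasurable tht (spaceM Ω))
    (hU : MemLp U 4 (spaceM Ω)) (hU' : (eLpNorm U 4 (spaceM Ω)).toReal ≤ c')
    (hDU : MemLp DU 2 (spaceM Ω)) (hDU' : (eLpNorm DU 2 (spaceM Ω)).toReal ≤ CU)
    (hDUα : ∀ᵐ x ∂spaceM Ω, ‖DU x‖ ≤ α) {k : ℝ} (hk : k ≠ 0)
    (hD : HasWeakDeriv Ω (fun x => k • Dth x) fun x => k • D2th x)
    (hD2 : MemLp D2th 2 (spaceM Ω)) (hw : MemH10 Ω w Dw)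
    (heq : ∀ᵐ x ∂spaceM Ω, cv * r x * (tht x + Dth x (U x)) - κ * lapOf (D2th x)
      + R * r x * th x * divOf (DU x) = dissip μ lam (DU x)) :
    |∫ x in Ω, (rt x * th x + r x * tht x) * w x| ≤
      (3 * κ + cv * Cρ * c ^ 2 + cv * m * c' * c + 3 * R * m * CU * c ^ 2 +
        (18 * |μ| + 9 * |lam|) * CU * √CU * c) / cv * (eLpNorm Dw 2 (spaceM Ω)).toReal *
        ((eLpNorm Dth 2 (spaceM Ω)).toReal + √α) := by
  set W := (eLpNorm Dw 2 (spaceM Ω)).toReal with hW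
  set G := (eLpNorm Dth 2 (spaceM Ω)).toReal with hG
  have hW0 : 0 ≤ W := ENNReal.toReal_nonneg
  have hG0 : 0 ≤ G := ENNReal.toReal_nonneg
  obtain ⟨w4, w4'⟩ := hc hw
  obtain ⟨t4, t4'⟩ := hc hth
  -- In the dissipation, which is quadratic in `DU`, one factor is taken in `L²` and the other in
  -- `L⁴`, where interpolation with the sup bound costs only `√α`. Since `α` will be integrable in
  -- time, this is square integrable in time, like the norm of `∇θ`.
  obtain ⟨D4, D4'⟩ := memLp_four_of_ae_norm_le hDU hα hDUα
  have hc'0 : 0 ≤ c' := ENNReal.toReal_nonneg.trans hU'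
  set K := 18 * |μ| + 9 * |lam| with hK
  have hK0 : 0 ≤ K := by positivity
  obtain ⟨i1, b1⟩ := integrable_norm_mul_norm_mul_norm hrt t4 w4
  obtain ⟨i2, b2⟩ := integrable_norm_mul_norm_mul_norm hth.2.1 hU w4
  obtain ⟨i3, b3⟩ := integrable_norm_mul_norm_mul_norm hDU t4 w4
  obtain ⟨i4, b4⟩ := integrable_norm_mul_norm_mul_norm hDU D4 w4
  obtain ⟨il, el⟩ := integral_mul_lapOf hk hD hth.2.1 hD2 hw
  -- The time derivative without diffusion. Diffusion must be integrated by parts, because no bound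
  -- of `D²θ` may enter; by the equation, all other terms are products that Hölder's inequality
  -- controls.
  set rest : E3 → ℝ := fun x =>
    cv * ((rt x * th x + r x * tht x) * w x) - κ * (lapOf (D2th x) * w x)
    with hrest
  have hrestm : AEStronglyMeasurable rest (spaceM Ω) :=
    ((((hrt.1.mul hth.1.1).add (hrm.mul htht)).mul hw.1.1).const_mul cv).sub (il.1.const_mul κ)
  set dom : E3 → ℝ := fun x => cv * (‖rt x‖ * (‖th x‖ * ‖w x‖)) +
    cv * m * (‖Dth x‖ * (‖U x‖ * ‖w x‖)) + 3 * R * m * (‖DU x‖ * (‖th x‖ * ‖w x‖)) +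
    K * (‖DU x‖ * (‖DU x‖ * ‖w x‖)) with hdom
  have hle : ∀ᵐ x ∂spaceM Ω, ‖rest x‖ ≤ dom x := by
    filter_upwards [hr, heq] with x h1 h2
    have e1 : rest x = cv * (rt x * (th x * w x)) - cv * (r x * (Dth x (U x) * w x)) -
        R * (r x * (divOf (DU x) * (th x * w x))) + dissip μ lam (DU x) * w x := by
      simp only [hrest]
      rw [← h2]; ring
    rw [e1]
    refine (norm_add_le _ _).trans (add_le_add ((_root_.norm_sub_le _ _).trans (add_le_add
      ((_root_.norm_sub_le _ _).trans (add_le_add ?_ ?_)) ?_)) ?_)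
    · rw [norm_mul, norm_mul, norm_mul, Real.norm_of_nonneg hcv.le]
    · rw [norm_mul, norm_mul, norm_mul, Real.norm_of_nonneg hcv.le, ← mul_assoc, mul_assoc cv,
        mul_assoc cv]
      have h3 := (Dth x).le_opNorm (U x)
      have h4 : ‖r x‖ ≤ m := h1
      calc cv * (‖r x‖ * (‖Dth x (U x)‖ * ‖w x‖)) ≤ cv * (m * (‖Dth x‖ * ‖U x‖ * ‖w x‖)) := by
            gcongr
        _ = _ := by ring
    · simp only [norm_mul, Real.norm_of_nonneg hR]
      have h3 : ‖divOf (DU x)‖ ≤ 3 * ‖DU x‖ := abs_divOf_le _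
      have h4 : ‖r x‖ ≤ m := h1
      calc R * (‖r x‖ * (‖divOf (DU x)‖ * (‖th x‖ * ‖w x‖)))
          ≤ R * (m * (3 * ‖DU x‖ * (‖th x‖ * ‖w x‖))) := by gcongr
        _ = _ := by ring
    · rw [norm_mul]
      have h3 : ‖dissip μ lam (DU x)‖ ≤ K * (‖DU x‖ * ‖DU x‖) := abs_dissip_le _ _ _
      calc ‖dissip μ lam (DU x)‖ * ‖w x‖ ≤ K * (‖DU x‖ * ‖DU x‖) * ‖w x‖ := by gcongr
        _ = _ := by ring
  have j1 := i1.const_mul cv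
  have j2 := i2.const_mul (cv * m)
  have j3 := i3.const_mul (3 * R * m)
  have j4 := i4.const_mul K
  have hdomi : Integrable dom (spaceM Ω) := ((j1.add j2).add j3).add j4
  have hresti : Integrable rest (spaceM Ω) := hdomi.mono' hrestm hle
  have hrestb : |∫ x in Ω, rest x| ≤ cv * (Cρ * (c * G * (c * W))) + cv * m * (G * (c' * (c * W))) +
      3 * R * m * (CU * (c * G * (c * W))) + K * (CU * (√α * √CU * (c * W))) := by
    rw [← Real.norm_eq_abs]
    refine (norm_integral_le_of_norm_le hdomi hle).trans ?_
    have j12 : Integrable (fun x => cv * (‖rt x‖ * (‖th x‖ * ‖w x‖)) +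
      cv * m * (‖Dth x‖ * (‖U x‖ * ‖w x‖))) (spaceM Ω) := j1.add j2
    have j123 : Integrable (fun x => cv * (‖rt x‖ * (‖th x‖ * ‖w x‖)) +
      cv * m * (‖Dth x‖ * (‖U x‖ * ‖w x‖)) + 3 * R * m * (‖DU x‖ * (‖th x‖ * ‖w x‖)))
      (spaceM Ω) := j12.add j3
    rw [hdom, integral_add j123 j4, integral_add j12 j3, integral_add j1 j2, integral_const_mul,
      integral_const_mul, integral_const_mul, integral_const_mul]
    have hD4 : (eLpNorm DU 4 (spaceM Ω)).toReal ≤ √α * √CU := D4'.trans (by gcongr)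
    have z := fun {p : ℝ≥0∞} {N : Type} [NormedAddCommGroup N] (f : E3 → N) =>
      ENNReal.toReal_nonneg (a := eLpNorm f p (spaceM Ω))
    gcongr
    · exact b1.trans (by gcongr)
    · exact b2.trans (by gcongr)
    · exact b3.trans (by gcongr)
    · exact b4.trans (by gcongr)
  have hlapb : |∫ x in Ω, lapOf (D2th x) * w x| ≤ 3 * (W * G) := by
    rw [el, abs_neg]
    refine (Finset.abs_sum_le_sum_abs _ _).trans ?_
    have : ∀ i : Fin 3, |∫ x in Ω, Dw x (e i) * Dth x (e i)| ≤ W * G := by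
      intro i
      have hb : ∀ {L : E3 → E3 →L[ℝ] ℝ}, MemLp L 2 (spaceM Ω) →
          (eLpNorm (fun x => L x (e i)) 2 (spaceM Ω)).toReal ≤
            (eLpNorm L 2 (spaceM Ω)).toReal := by
        intro L hL
        refine ENNReal.toReal_mono hL.2.ne (eLpNorm_mono fun x => ?_)
        exact ((L x).le_opNorm _).trans (by rw [norm_e, mul_one])
      refine (norm_integral_smul_le (memLp_clm_apply hw.2.1 (e i))
        (memLp_clm_apply hth.2.1 (e i))).trans ?_
      exact mul_le_mul (hb hw.2.1) (hb hth.2.1) ENNReal.toReal_nonneg hW0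
    refine (Finset.sum_le_sum fun i _ => this i).trans ?_
    simp
  have etot : cv * ∫ x in Ω, (rt x * th x + r x * tht x) * w x =
      κ * (∫ x in Ω, lapOf (D2th x) * w x) + ∫ x in Ω, rest x := by
    have jl : Integrable (fun x => κ * (lapOf (D2th x) * w x)) (spaceM Ω) := il.const_mul κ
    rw [← integral_const_mul, ← integral_const_mul, ← integral_add jl hresti]
    refine integral_congr_ae (Eventually.of_forall fun x => ?_)
    simp only [hrest]
    ring
  have hsα : 0 ≤ √α := Real.sqrt_nonneg _
  have hsC : 0 ≤ √CU := Real.sqrt_nonneg _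
  rw [div_mul_eq_mul_div, div_mul_eq_mul_div, le_div_iff₀ hcv]
  calc |∫ x in Ω, (rt x * th x + r x * tht x) * w x| * cv
      = |κ * (∫ x in Ω, lapOf (D2th x) * w x) + ∫ x in Ω, rest x| := by
        rw [← etot, abs_mul, abs_of_pos hcv, mul_comm]
    _ ≤ κ * (3 * (W * G)) + (cv * (Cρ * (c * G * (c * W))) + cv * m * (G * (c' * (c * W))) +
      3 * R * m * (CU * (c * G * (c * W))) + K * (CU * (√α * √CU * (c * W)))) := by
        refine (abs_add_le _ _).trans (add_le_add ?_ hrestb)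
        rw [abs_mul, abs_of_nonneg hκ]
        gcongr
    _ ≤ _ := by
        have p1 : 0 ≤ (3 * κ + cv * Cρ * c ^ 2 + cv * m * c' * c +
            3 * R * m * CU * c ^ 2) * W * √α := by
          positivity
        have p2 : 0 ≤ K * CU * √CU * c * W * G := by positivity
        linarith

end Energy

/-! ### Time slices of fields on space-time. -/

section Slices

variable {F : Type*} [NormedAddCommGroup F] [NormedSpace ℝ F] {Ω : Set E3} {T : ℝ}

lemma MemH10.exists_eLpNorm_four_le (F : Type*) [NormedAddCommGroup F] [NormedSpace ℝ F]
    [FiniteDimensional ℝ F] (hΩ : Bornology.IsBounded Ω) :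
    ∃ c : ℝ, 0 ≤ c ∧ ∀ {f : E3 → F} {G : E3 → E3 →L[ℝ] F}, MemH10 Ω f G →
      MemLp f 4 (spaceM Ω) ∧
        (eLpNorm f 4 (spaceM Ω)).toReal ≤ c * (eLpNorm G 2 (spaceM Ω)).toReal := by
  obtain ⟨C, hC, h⟩ := MemH10.eLpNorm_four_le (F := F) hΩ.measure_lt_top.ne
  refine ⟨C.toReal, ENNReal.toReal_nonneg, fun hf => ?_⟩
  have hfin := ENNReal.mul_ne_top hC hf.2.1.2.ne
  refine ⟨⟨hf.1.1, (h hf).trans_lt hfin.lt_top⟩, ?_⟩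
  rw [← ENNReal.toReal_mul]
  exact ENNReal.toReal_mono hfin (h hf)

lemma InLL.ae_memLp_two {f : ℝ → E3 → F} (h : InLL Ω T 2 2 f) :
    ∀ᵐ t ∂timeM T, MemLp (f t) 2 (spaceM Ω) := by
  have h2 := h.memLp_two.integrable_norm_pow two_ne_zero
  filter_upwards [h.1.prodMk_left, h2.prod_right_ae] with t h3 h4
  exact (memLp_two_iff_integrable_sq_norm h3).2 h4

lemma InLL.integrable_sq {f : ℝ → E3 → F} (h : InLL Ω T 2 2 f) :
    Integrable (fun t => (eLpNorm (f t) 2 (spaceM Ω)).toReal ^ 2) (timeM T) := by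
  have h2 := (h.memLp_two.integrable_norm_pow two_ne_zero).integral_prod_left
  refine h2.congr ?_
  filter_upwards [h.ae_memLp_two] with t ht
  exact integral_norm_sq_eq ht

lemma memLp_of_const_smul {c : ℝ} (hc : c ≠ 0) {p : ℝ≥0∞} {f : E3 → F}
    (h : MemLp (fun x => c • f x) p (spaceM Ω)) : MemLp f p (spaceM Ω) := by
  have := h.const_smul c⁻¹
  have e1 : (c⁻¹ • fun x => c • f x) = f := by
    ext x
    simp [smul_smul, inv_mul_cancel₀ hc]
  rwa [e1] at this

lemma ae_prod_norm_le_of_ae_ae {α β N : Type*} [MeasurableSpace α] [MeasurableSpace β]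
    [NormedAddCommGroup N] {μ : Measure α} {ν : Measure β} [SFinite ν] {f : α × β → N} {c : ℝ}
    (hf : AEStronglyMeasurable f (μ.prod ν)) (h : ∀ᵐ x ∂μ, ∀ᵐ y ∂ν, ‖f (x, y)‖ ≤ c) :
    ∀ᵐ z ∂μ.prod ν, ‖f z‖ ≤ c := by
  have h1 : ∀ᵐ z ∂μ.prod ν, ‖hf.mk f z‖ ≤ c := by
    refine (Measure.ae_prod_iff_ae_ae
      (measurableSet_le hf.stronglyMeasurable_mk.norm.measurable measurable_const)).2 ?_
    filter_upwards [h, Measure.ae_ae_of_ae_prod hf.ae_eq_mk] with x h2 h3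
    filter_upwards [h2, h3] with y h4 h5
    rwa [← h5]
  filter_upwards [h1, hf.ae_eq_mk] with z h2 h3
  rwa [h3]

/-- A field in `L²(0,T; H₀¹)` times a function in `L⁴` is square integrable. -/
lemma InLH10.memLp_two_mul {f : ℝ → E3 → ℝ} {Df : ℝ → E3 → E3 →L[ℝ] ℝ}
    (hΩ : Bornology.IsBounded Ω) (h : InLH10 Ω T 2 f Df) {w : E3 → ℝ} (hw : MemLp w 4 (spaceM Ω)) :
    MemLp (fun z : ℝ × E3 => f z.1 z.2 * w z.2) 2 ((timeM T).prod (spaceM Ω)) := by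
  obtain ⟨C, hC, h4⟩ := MemH10.eLpNorm_four_le (F := ℝ) hΩ.measure_lt_top.ne
  have hK : C * eLpNorm w 4 (spaceM Ω) ≠ ⊤ := ENNReal.mul_ne_top hC hw.2.ne
  have hin : InLL Ω T 2 2 (fun t x => f t x * w x) := by
    refine ⟨h.2.1.1.mul hw.1.comp_snd, ?_⟩
    refine (eLpNorm_le_nnreal_smul_eLpNorm_of_ae_le_mul'
      (c := (C * eLpNorm w 4 (spaceM Ω)).toNNReal)
      (g := fun t => eLpNorm (Df t) 2 (spaceM Ω)) ?_ 2).trans_lt ?_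
    · filter_upwards [h.1] with t ht
      have m4 : MemLp (f t) 4 (spaceM Ω) :=
        ⟨ht.1.1, (h4 ht).trans_lt (ENNReal.mul_lt_top hC.lt_top ht.2.1.2)⟩
      rw [enorm_eq_self, enorm_eq_self, ENNReal.coe_toNNReal hK]
      have e1 : eLpNorm (fun x => f t x * w x) 2 (spaceM Ω) =
          eLpNorm (fun x => ‖f t x‖ * ‖w x‖) 2 (spaceM Ω) :=
        eLpNorm_congr_norm_ae (Eventually.of_forall fun x => by simp)
      rw [e1]
      calc _ ≤ _ := (memLp_two_norm_mul_norm m4 hw).2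
        _ ≤ C * eLpNorm (Df t) 2 (spaceM Ω) * eLpNorm w 4 (spaceM Ω) := by
          gcongr
          exact h4 ht
        _ = _ := by ring
    · exact ENNReal.mul_lt_top ENNReal.coe_lt_top h.2.2.2
  exact hin.memLp_two

end Slices

/-! ### Energy estimate integrated in time. -/

section EnergyInTime

variable {Ω : Set E3} {T R μ lam κ cv q : ℝ} {ρ₀ : E3 → ℝ} {u₀ : E3 → E3} {θ₀ : E3 → ℝ}
  {ρ : ℝ → E3 → ℝ} {u : ℝ → E3 → E3} {θ : ℝ → E3 → ℝ}
  {ρt : ℝ → E3 → ℝ} {Dρ : ℝ → E3 → E3 →L[ℝ] ℝ}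
  {ut : ℝ → E3 → E3} {Du : ℝ → E3 → E3 →L[ℝ] E3} {D2u : ℝ → E3 → E3 →L[ℝ] E3 →L[ℝ] E3}
  {Dut : ℝ → E3 → E3 →L[ℝ] E3}
  {θt : ℝ → E3 → ℝ} {Dθ : ℝ → E3 → E3 →L[ℝ] ℝ} {D2θ : ℝ → E3 → E3 →L[ℝ] E3 →L[ℝ] ℝ}
  {Dθt : ℝ → E3 → E3 →L[ℝ] ℝ} {DM : ℝ → E3 → E3 →L[ℝ] E3} {DP : ℝ → E3 → E3 →L[ℝ] ℝ}
  {m : ℝ} {V : ℝ → Lp ℝ 2 (spaceM Ω)} {a : ℝ → ℝ}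

lemma IsDensityVersion.ae_abs_le (hD : IsDensityVersion Ω T m ρ₀ ρ u V) :
    ∀ᵐ t ∂timeM T, ∀ᵐ x ∂spaceM Ω, |ρ t x| ≤ m := by
  filter_upwards [hD.version, ae_restrict_mem measurableSet_Ioo] with t h1 h2
  filter_upwards [h1, hD.nonneg t (Ioo_subset_Icc_self h2), hD.le t (Ioo_subset_Icc_self h2)]
    with x h3 h4 h5
  rw [← h3, abs_of_nonneg h4]
  exact h5

/-- The time derivative of `ρθ` in the dual of `H₀¹`. -/
theorem IsSolutionWith.exists_energy_bound (hΩ : IsSmoothBoundedDomain Ω)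
    (pc : PhysicalConstants R μ lam κ cv)
    (h : IsSolutionWith Ω T R μ lam κ cv q ρ₀ u₀ θ₀ ρ u θ ρt Dρ ut Du D2u Dut θt Dθ D2θ Dθt DM DP)
    (hD : IsDensityVersion Ω T m ρ₀ ρ u V) (hm : 0 ≤ m) (hv : IsLipschitzVelocity Ω T u a)
    (ha : ∀ᵐ τ ∂timeM T, ∀ᵐ x ∂spaceM Ω, ‖Du τ x‖ ≤ a τ) :
    ∃ (C : ℝ) (b : ℝ → ℝ), 0 ≤ C ∧ (∀ τ, 0 ≤ b τ) ∧ Integrable b (timeM T) ∧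
      ∀ᵐ τ ∂timeM T, ∀ w Dw, MemH10 Ω w Dw → ∀ l : ℝ, 0 < l →
        |∫ x in Ω, (ρt τ x * θ τ x + ρ τ x * θt τ x) * w x| ≤
          C * (eLpNorm Dw 2 (spaceM Ω)).toReal * (l + b τ / l) := by
  obtain ⟨c, hc0, hc⟩ := MemH10.exists_eLpNorm_four_le ℝ hΩ.isBounded
  obtain ⟨c₁, hc₁0, hc₁⟩ := MemH10.exists_eLpNorm_four_le E3 hΩ.isBounded
  obtain ⟨Cρ, hCρ, hρt⟩ := h.ρt_mem.ae_memLp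
  obtain ⟨CU, hCU, hU⟩ := h.u_H10.2.2.ae_memLp
  refine ⟨(3 * κ + cv * Cρ * c ^ 2 + cv * m * (c₁ * CU) * c + 3 * R * m * CU * c ^ 2 +
        (18 * |μ| + 9 * |lam|) * CU * √CU * c) / cv,
    fun τ => (eLpNorm (Dθ τ) 2 (spaceM Ω)).toReal ^ 2 + a τ, ?_, fun τ => ?_, ?_, ?_⟩
  · have := pc.κ_pos; have := pc.cv_pos; have := pc.R_pos
    positivity
  · have := hv.nonneg τ
    positivity
  · exact h.θ_H10.2.2.integrable_sq.add hv.integrable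
  have hD2 := h.sqrt_θ_H2.2.2.2.ae_memLp_two
  have hθt := h.id_θt.2.1.ae_memLp_two
  filter_upwards [hρt, hU, hD.ae_abs_le, h.θ_H10.1, h.u_H10.1, ha, h.sqrt_θ_H2.2.1, hD2, hθt,
    h.ρ_W1q.2.1.1.prodMk_left, h.energy, ae_restrict_mem measurableSet_Ioo]
    with τ g1 g2 g3 g4 g5 g6 g7 g8 g9 g10 g11 hτ w Dw hw l hl
  have hk : √τ ≠ 0 := (Real.sqrt_pos.2 hτ.1).ne'
  obtain ⟨U4, U4'⟩ := hc₁ g5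
  have key := abs_integral_energy_le (μ := μ) (lam := lam) (c := c) (m := m) pc.R_pos.le pc.κ_pos.le
    pc.cv_pos hm hCρ hCU hc0 (hv.nonneg τ) hc g10 g3 g1.1 g1.2 g4
    (memLp_of_const_smul (c := τ) hτ.1.ne' g9).1 U4
    (U4'.trans (mul_le_mul_of_nonneg_left g2.2 hc₁0)) g2.1 g2.2 g6 hk g7
    (memLp_of_const_smul hk g8) hw g11
  refine key.trans (mul_le_mul_of_nonneg_left ?_ ?_)
  -- Young's inequality in the form `G + √a ≤ l + (G² + a) / l`. The parameter `l` stays free;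
  -- optimising it after integration replaces the Cauchy-Schwarz inequality in time.
  · set G := (eLpNorm (Dθ τ) 2 (spaceM Ω)).toReal with hG
    have hs := Real.sq_sqrt (hv.nonneg τ)
    have e1 : l + (G ^ 2 + a τ) / l = (l ^ 2 + (G ^ 2 + √(a τ) ^ 2)) / l := by
      rw [hs]; field_simp
    rw [e1, le_div_iff₀ hl]
    nlinarith [sq_nonneg (G - l / 2), sq_nonneg (√(a τ) - l / 2), sq_nonneg l, sq_nonneg G]
  · have := pc.κ_pos; have := pc.cv_pos; have := pc.R_pos
    positivity

/-- Time continuity of `ρθ` in the dual of `H₀¹`. -/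
theorem IsSolutionWith.abs_integral_mul_sub_le (hΩ : IsSmoothBoundedDomain Ω)
    (h : IsSolutionWith Ω T R μ lam κ cv q ρ₀ u₀ θ₀ ρ u θ ρt Dρ ut Du D2u Dut θt Dθ D2θ Dθt DM DP)
    (hD : IsDensityVersion Ω T m ρ₀ ρ u V) {C : ℝ} {b : ℝ → ℝ}
    (hb : Integrable b (timeM T)) {A : Set ℝ} (hA : ∀ᵐ τ ∂timeM T, τ ∈ A) (hAT : A ⊆ Ioo 0 T)
    (h₁ : ∀ s ∈ A, ∀ t ∈ A, ∀ᵐ x ∂spaceM Ω, ρ t x - ρ s x = ∫ τ in s..t, ρt τ x)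
    (h₂ : ∀ s ∈ A, ∀ t ∈ A, ∀ᵐ x ∂spaceM Ω, θ t x - θ s x = ∫ τ in s..t, θt τ x)
    {s t : ℝ} (hs : s ∈ A) (ht : t ∈ A) (hst : s < t)
    (hρs : AEStronglyMeasurable (ρ s) (spaceM Ω)) (hθs : AEStronglyMeasurable (θ s) (spaceM Ω))
    {w : E3 → ℝ} {Dw : E3 → E3 →L[ℝ] ℝ} (hw : MemH10 Ω w Dw) {l : ℝ} (hl : 0 < l)
    (hbd : ∀ᵐ τ ∂timeM T, ∀ w Dw, MemH10 Ω w Dw → ∀ l : ℝ, 0 < l →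
        |∫ x in Ω, (ρt τ x * θ τ x + ρ τ x * θt τ x) * w x| ≤
          C * (eLpNorm Dw 2 (spaceM Ω)).toReal * (l + b τ / l)) :
    |∫ x in Ω, (ρ t x * θ t x - ρ s x * θ s x) * w x| ≤
      C * (eLpNorm Dw 2 (spaceM Ω)).toReal * (l * (t - s) + (∫ τ in s..t, b τ) / l) := by
  have hfin := isFiniteMeasure_spaceM hΩ.isBounded
  obtain ⟨c, hc0, hc⟩ := MemH10.exists_eLpNorm_four_le ℝ hΩ.isBounded
  have hsub : Ioo s t ⊆ Ioo 0 T := Ioo_subset_Ioo (hAT hs).1.le (hAT ht).2.le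
  have hμle : volume.restrict (Ioo s t) ≤ timeM T := Measure.restrict_mono hsub le_rfl
  have hle : (volume.restrict (Ioo s t)).prod (spaceM Ω) ≤ (timeM T).prod (spaceM Ω) :=
    Measure.prod_mono hμle le_rfl
  have hρt2 := h.ρt_mem.two_of_top.memLp_two.mono_measure hle
  have hθt2 : MemLp (Function.uncurry θt) 2 ((volume.restrict (Ioo s t)).prod (spaceM Ω)) :=
    (h.id_θt.2.1.memLp_two_of_wt monotone_id (fun _ h => h) (hAT hs).1).mono_measure
      (Measure.prod_mono (Measure.restrict_mono (Ioo_subset_Ioo_right (hAT ht).2.le) le_rfl) le_rfl)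
  have hρm := h.ρ_W1q.2.1.1.mono_measure hle
  have hprod := mul_sub_mul_ae_eq_integral hst (ae_mono hμle hA) hs ht hρm
    (h.θ_H10.2.1.1.mono_measure hle) hρs hθs (hρt2.integrable one_le_two)
    (hθt2.integrable one_le_two) h₁ h₂
  -- As `ρt` is merely square integrable, `θ w` has to be so as well; this is where `H₀¹ ⊂ L⁴` is
  -- used for both factors.
  have i1 : Integrable (fun z : ℝ × E3 => ρt z.1 z.2 * (θ z.1 z.2 * w z.2))
      ((volume.restrict (Ioo s t)).prod (spaceM Ω)) :=
    integrable_smul_of_memLp_two hρt2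
      ((h.θ_H10.memLp_two_mul hΩ.isBounded (hc hw).1).mono_measure hle)
  have hw2 : MemLp (fun z : ℝ × E3 => w z.2) 2 ((volume.restrict (Ioo s t)).prod (spaceM Ω)) :=
    hw.1.comp_snd _
  have hρb : ∀ᵐ z ∂(volume.restrict (Ioo s t)).prod (spaceM Ω), ‖ρ z.1 z.2‖ ≤ m :=
    ae_prod_norm_le_of_ae_ae hρm (ae_mono hμle hD.ae_abs_le)
  have i2 : Integrable (fun z : ℝ × E3 => ρ z.1 z.2 * (θt z.1 z.2 * w z.2))
      ((volume.restrict (Ioo s t)).prod (spaceM Ω)) :=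
    (integrable_smul_of_memLp_two hθt2 hw2).bdd_mul hρm hρb
  have i3 : Integrable (Function.uncurry fun τ x =>
      (ρt τ x * θ τ x + ρ τ x * θt τ x) * w x)
      ((volume.restrict (Ioo s t)).prod (spaceM Ω)) := by
    refine (i1.add i2).congr (Eventually.of_forall fun z => ?_)
    simp only [Pi.add_apply, Function.uncurry_def]
    ring
  have e1 : ∫ x in Ω, (ρ t x * θ t x - ρ s x * θ s x) * w x =
      ∫ τ in Ioo s t, ∫ x in Ω, (ρt τ x * θ τ x + ρ τ x * θt τ x) * w x := by
    rw [integral_integral_swap i3]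
    refine integral_congr_ae ?_
    filter_upwards [hprod] with x hx
    rw [hx, integral_mul_const, intervalIntegral.integral_of_le hst.le,
      integral_Ioc_eq_integral_Ioo]
  set W := (eLpNorm Dw 2 (spaceM Ω)).toReal with hW
  have hbi : Integrable b (volume.restrict (Ioo s t)) := hb.mono_measure hμle
  have hbl : Integrable (fun τ => l + b τ / l) (volume.restrict (Ioo s t)) :=
    (integrable_const l).add (hbi.div_const l)
  rw [e1, ← Real.norm_eq_abs]
  refine (norm_integral_le_of_norm_le (hbl.const_mul (C * W)) ?_).trans (le_of_eq ?_)
  · filter_upwards [ae_mono hμle hbd] with τ hτ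
    exact hτ w Dw hw l hl
  · have j2 : Integrable (fun τ => b τ / l) (volume.restrict (Ioo s t)) := hbi.div_const l
    rw [integral_const_mul, integral_add (integrable_const l) j2, integral_div,
      intervalIntegral.integral_of_le hst.le, integral_Ioc_eq_integral_Ioo]
    simp [hst.le, mul_comm]

end EnergyInTime

/-! ### Velocity and temperature in Lagrangian coordinates. -/

section Conclusion

variable {Ω : Set E3} {T R μ lam κ cv q : ℝ} {ρ₀ : E3 → ℝ} {u₀ : E3 → E3} {θ₀ : E3 → ℝ}
  {ρ : ℝ → E3 → ℝ} {u : ℝ → E3 → E3} {θ : ℝ → E3 → ℝ}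
  {ρt : ℝ → E3 → ℝ} {Dρ : ℝ → E3 → E3 →L[ℝ] ℝ}
  {ut : ℝ → E3 → E3} {Du : ℝ → E3 → E3 →L[ℝ] E3} {D2u : ℝ → E3 → E3 →L[ℝ] E3 →L[ℝ] E3}
  {Dut : ℝ → E3 → E3 →L[ℝ] E3}
  {θt : ℝ → E3 → ℝ} {Dθ : ℝ → E3 → E3 →L[ℝ] ℝ} {D2θ : ℝ → E3 → E3 →L[ℝ] E3 →L[ℝ] ℝ}
  {Dθt : ℝ → E3 → E3 →L[ℝ] ℝ} {DM : ℝ → E3 → E3 →L[ℝ] E3} {DP : ℝ → E3 → E3 →L[ℝ] ℝ}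
  {m : ℝ} {V : ℝ → Lp ℝ 2 (spaceM Ω)} {a : ℝ → ℝ} {φ : ℝ → E3 → E3}

lemma integral_mul_inner_eq_inner {F : Type*} [NormedAddCommGroup F] [InnerProductSpace ℝ F]
    {r' r : E3 → ℝ} {h f : E3 → F} {M : Lp F 2 (spaceM Ω)} (hM : M =ᵐ[spaceM Ω] fun x => r x • h x)
    (hr : r' =ᵐ[spaceM Ω] r) (hf : MemLp f 2 (spaceM Ω)) :
    ∫ x in Ω, r' x * inner ℝ (h x) (f x) = inner ℝ M (hf.toLp f) := by
  rw [L2.inner_def]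
  refine integral_congr_ae ?_
  filter_upwards [hM, hr, hf.coeFn_toLp] with x h1 h2 h3
  rw [h1, h2, h3, real_inner_smul_left]

lemma toReal_eLpNorm_const_smul {N : Type*} [NormedAddCommGroup N] [NormedSpace ℝ N] {c : ℝ}
    (hc : 0 ≤ c) (f : E3 → N) (p : ℝ≥0∞) :
    (eLpNorm (fun x => c • f x) p (spaceM Ω)).toReal =
      c * (eLpNorm f p (spaceM Ω)).toReal := by
  have := eLpNorm_const_smul c f p (spaceM Ω)
  have e : (fun x => c • f x) = c • f := rfl
  rw [e, this, ENNReal.toReal_mul, toReal_enorm, Real.norm_of_nonneg hc]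

/-- Strong continuity of the velocity in Lagrangian coordinates. -/
theorem IsSolutionWith.exists_continuous_velocity (hΩ : IsSmoothBoundedDomain Ω) (hT : 0 < T)
    (hdata : InitialData Ω q ρ₀ u₀ θ₀)
    (h : IsSolutionWith Ω T R μ lam κ cv q ρ₀ u₀ θ₀ ρ u θ ρt Dρ ut Du D2u Dut θt Dθ D2θ Dθt DM DP)
    (hD : IsDensityVersion Ω T m ρ₀ ρ u V) (hm : 0 ≤ m) (hv : IsLipschitzVelocity Ω T u a)
    (hφ : IsFlow Ω T u φ) :
    ∃ (X : ℝ → Lp E3 2 (spaceM Ω)) (X₀ : Lp E3 2 (spaceM Ω)),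
      IsVersion Ω T (fun t y => √(ρ₀ y) • u t (φ t y)) X ∧ ContinuousOn X (Icc 0 T) ∧
      X₀ =ᵐ[spaceM Ω] (fun y => √(ρ₀ y) • u₀ y) ∧ Tendsto X (𝓝[>] 0) (𝓝 X₀) := by
  have hΩo := hΩ.isOpen
  have hΩb := hΩ.isBounded
  have hfin := isFiniteMeasure_spaceM hΩb
  obtain ⟨c, hc0, hc⟩ := MemH10.exists_eLpNorm_four_le E3 hΩb
  obtain ⟨CD, hCD0, hCD⟩ := h.u_H10.2.2.ae_memLp
  obtain ⟨CU, hCU0, hCU⟩ := h.u_H10.2.1.ae_memLp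
  obtain ⟨M, hMv, hMc, hM0⟩ := h.ρu_cont
  obtain ⟨A₀, hA₀, hA₀T, -, hcau⟩ := h.u_time.exists_good_times hΩo hΩb hT h.u_H10.2.1.two_of_top
    fun a ha => h.sqrt_ut.2.1.memLp_two_of_wt (fun _ _ h => Real.sqrt_le_sqrt h)
      (fun _ h => Real.sqrt_pos.2 h) ha
  set A : Set ℝ := {t | t ∈ A₀ ∧ MemH10 Ω (u t) (Du t) ∧
    (eLpNorm (Du t) 2 (spaceM Ω)).toReal ≤ CD ∧ (eLpNorm (u t) 2 (spaceM Ω)).toReal ≤ CU ∧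
    V t =ᵐ[spaceM Ω] ρ t ∧ M t =ᵐ[spaceM Ω] fun x => ρ t x • u t x} with hAdef
  have hA : ∀ᵐ t ∂timeM T, t ∈ A := by
    filter_upwards [hA₀, h.u_H10.1, hCD, hCU, hD.version, hMv] with t h1 h2 h3 h4 h5 h6
    exact ⟨h1, h2, h3.2, h4.2, h5, h6⟩
  have hAT : A ⊆ Ioo 0 T := fun t ht => hA₀T ht.1
  have hAI : A ⊆ Icc 0 T := hAT.trans Ioo_subset_Icc_self
  have h0I : (0 : ℝ) ∈ Icc 0 T := ⟨le_rfl, hT.le⟩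
  obtain ⟨Du₀, hu₀⟩ := hdata.u_mem
  have h₀mem : MemLp u₀ 2 (massM Ω (V 0)) :=
    ⟨hu₀.1.1.mono_ac (massM_absolutelyContinuous _), (hD.eLpNorm_massM_le h0I u₀).trans_lt
      (ENNReal.mul_lt_top ENNReal.ofReal_lt_top hu₀.1.2)⟩
  have hMlim : Tendsto M (𝓝[A] 0) (𝓝 (M 0)) := (hMc 0 h0I).mono_left (nhdsWithin_mono _ hAI)
  refine hD.exists_continuous_version hΩo hΩb hT hv hm hφ hA hAT (fun t ht => ht.2.1.1)
    (fun t₁ ht₁ ε hε => ?_) h₀mem (hD.tendsto_initial hΩo hΩb hT hv hm hφ hAT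
      (fun t ht => (hc ht.2.1).1) (C := T * (c * CD) ^ 2) (fun t ht => ?_) h₀mem
      (fun ψ h1 h2 => ?_) ?_)
  · obtain ⟨δ, hδ, hδ'⟩ := hcau t₁ ht₁ ε hε
    exact ⟨δ, hδ, fun s hs t ht => hδ' s hs.1 t ht.1⟩
  · have h1 := (hc ht.2.1).2.trans (mul_le_mul_of_nonneg_left ht.2.2.1 hc0)
    have h2 := (hAI ht).2
    have := (hAI ht).1
    gcongr
  · have hψ : MemLp ψ 2 (spaceM Ω) := h1.memLp_of_hasCompactSupport h2
    rw [integral_mul_inner_eq_inner hM0 hD.initial hψ]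
    refine (hMlim.inner tendsto_const_nhds).congr' ?_
    filter_upwards [self_mem_nhdsWithin] with t ht
    rw [integral_mul_inner_eq_inner ht.2.2.2.2.2 ht.2.2.2.2.1 hψ]
  -- The difference of the two integrals is `⟪M t - M 0, u t⟫`, where `M` is the momentum curve.
  -- Strong continuity of the momentum and the uniform `L²` bound of `u` suffice.
  · have hlim : Tendsto (fun t => ‖M t - M 0‖ * CU) (𝓝[A] 0) (𝓝 0) := by
      have := ((hMlim.sub_const (M 0)).norm).mul_const CU
      simpa using this
    refine squeeze_zero_norm' ?_ hlim
    filter_upwards [self_mem_nhdsWithin] with t ht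
    have e1 : ∫ x in Ω, V t x * ‖u t x‖ ^ 2 = inner ℝ (M t) (ht.2.1.1.toLp (u t)) := by
      rw [← integral_mul_inner_eq_inner ht.2.2.2.2.2 ht.2.2.2.2.1 ht.2.1.1]
      simp only [real_inner_self_eq_norm_sq]
    rw [e1, integral_mul_inner_eq_inner hM0 hD.initial ht.2.1.1, ← inner_sub_left]
    refine (norm_inner_le_norm _ _).trans ?_
    rw [Lp.norm_toLp]
    exact mul_le_mul_of_nonneg_left ht.2.2.2.1 (norm_nonneg _)

lemma IsDensityVersion.inLL (hΩ : Bornology.IsBounded Ω) (hD : IsDensityVersion Ω T m ρ₀ ρ u V)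
    (hρ : AEStronglyMeasurable (Function.uncurry ρ) ((timeM T).prod (spaceM Ω))) :
    InLL Ω T ⊤ 2 ρ := by
  have hfin := isFiniteMeasure_spaceM hΩ
  refine ⟨hρ, ?_⟩
  rw [eLpNorm_exponent_top]
  refine (eLpNormEssSup_le_of_ae_enorm_bound (C := ENNReal.ofReal m *
    (spaceM Ω univ) ^ ((2 : ℝ≥0∞).toReal)⁻¹) ?_).trans_lt ?_
  · filter_upwards [hD.ae_abs_le] with t ht
    rw [enorm_eq_self, mul_comm]
    exact eLpNorm_le_of_ae_bound ht
  · exact ENNReal.mul_lt_top (by simp)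
      (ENNReal.rpow_lt_top_of_nonneg (by simp) (measure_ne_top _ _))

/-- If `Q t ≤ K (η + B t / η)` for all `η > 0` and `B → 0`, then `Q → 0`. -/
lemma tendsto_zero_of_le_add_div {l : Filter ℝ} {Q B : ℝ → ℝ} {K : ℝ} (hK : 0 ≤ K)
    (hB : Tendsto B l (𝓝 0))
    (hQ : ∀ᶠ t in l, ∀ η : ℝ, 0 < η → |Q t| ≤ K * (η + B t / η)) : Tendsto Q l (𝓝 0) := by
  rw [Metric.tendsto_nhds]
  intro ε hε
  set η := ε / (2 * (K + 1)) with hη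
  have hη0 : 0 < η := by positivity
  filter_upwards [hQ, hB.eventually_lt_const (by positivity : 0 < η * η)] with t h1 h2
  rw [Real.dist_eq, sub_zero]
  refine (h1 η hη0).trans_lt ?_
  have h3 : B t / η < η := by rwa [div_lt_iff₀ hη0]
  calc K * (η + B t / η) ≤ K * (η + η) := by gcongr
    _ < (K + 1) * (η + η) := by gcongr; linarith
    _ = ε := by rw [hη]; field_simp; norm_num

/-- Strong continuity of the temperature in Lagrangian coordinates. -/
theorem IsSolutionWith.exists_continuous_temperature (hΩ : IsSmoothBoundedDomain Ω) (hT : 0 < T)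
    (pc : PhysicalConstants R μ lam κ cv) (hdata : InitialData Ω q ρ₀ u₀ θ₀)
    (h : IsSolutionWith Ω T R μ lam κ cv q ρ₀ u₀ θ₀ ρ u θ ρt Dρ ut Du D2u Dut θt Dθ D2θ Dθt DM DP)
    (hD : IsDensityVersion Ω T m ρ₀ ρ u V) (hm : 0 ≤ m) (hv : IsLipschitzVelocity Ω T u a)
    (ha : ∀ᵐ τ ∂timeM T, ∀ᵐ x ∂spaceM Ω, ‖Du τ x‖ ≤ a τ) (hφ : IsFlow Ω T u φ) :
    ∃ (X : ℝ → Lp ℝ 2 (spaceM Ω)) (X₀ : Lp ℝ 2 (spaceM Ω)),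
      IsVersion Ω T (fun t y => √(ρ₀ y) • θ t (φ t y)) X ∧ ContinuousOn X (Icc 0 T) ∧
      X₀ =ᵐ[spaceM Ω] (fun y => √(ρ₀ y) • θ₀ y) ∧ Tendsto X (𝓝[>] 0) (𝓝 X₀) := by
  have hΩo := hΩ.isOpen
  have hΩb := hΩ.isBounded
  have hfin := isFiniteMeasure_spaceM hΩb
  obtain ⟨c, hc0, hc⟩ := MemH10.exists_eLpNorm_four_le ℝ hΩb
  obtain ⟨CD, hCD0, hCD⟩ := h.sqrt_θ_H10.2.2.ae_memLp
  obtain ⟨M, hMv, hMc, hM0⟩ := h.ρθ_cont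
  obtain ⟨C, b, hC0, hb0, hb, hbd⟩ := h.exists_energy_bound hΩ pc hD hm hv ha
  obtain ⟨A₀, hA₀, hA₀T, hA₀d, hcau⟩ := h.θ_time.exists_good_times hΩo hΩb hT h.θ_H10.2.1
    fun a ha => h.id_θt.2.1.memLp_two_of_wt monotone_id (fun _ h => h) ha
  obtain ⟨A₁, hA₁, hA₁T, hA₁d, -⟩ := h.ρ_time.exists_good_times hΩo hΩb hT
    (hD.inLL hΩb h.ρ_W1q.2.1.1).two_of_top
    fun a ha => h.ρt_mem.two_of_top.memLp_two.mono_measure (restrict_Ioo_prod_le ha.le)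
  set A : Set ℝ := {t | t ∈ A₀ ∧ t ∈ A₁ ∧ MemH10 Ω (θ t) (Dθ t) ∧
    √t * (eLpNorm (Dθ t) 2 (spaceM Ω)).toReal ≤ CD ∧
    V t =ᵐ[spaceM Ω] ρ t ∧ M t =ᵐ[spaceM Ω] fun x => ρ t x * θ t x} with hAdef
  have hA : ∀ᵐ t ∂timeM T, t ∈ A := by
    filter_upwards [hA₀, hA₁, h.θ_H10.1, hCD, hD.version, hMv] with t h1 h2 h3 h4 h5 h6
    refine ⟨h1, h2, h3, ?_, h5, h6⟩
    rw [← toReal_eLpNorm_const_smul (Real.sqrt_nonneg t)]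
    exact h4.2
  have hAT : A ⊆ Ioo 0 T := fun t ht => hA₀T ht.1
  have hAI : A ⊆ Icc 0 T := hAT.trans Ioo_subset_Icc_self
  have h0I : (0 : ℝ) ∈ Icc 0 T := ⟨le_rfl, hT.le⟩
  have h0A : (0 : ℝ) ∈ closure A :=
    closure_mono inter_subset_left (subset_closure_of_ae_mem hT hA h0I)
  have hne : (𝓝[A] (0 : ℝ)).NeBot := mem_closure_iff_nhdsWithin_neBot.1 h0A
  have hVm : Measurable (V 0) := (Lp.stronglyMeasurable (V 0)).measurable
  have h₀mem : MemLp θ₀ 2 (massM Ω (V 0)) := by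
    refine ⟨hdata.θ_meas.mono_ac (massM_absolutelyContinuous _), ?_⟩
    rw [← eLpNorm_sqrt_smul hVm]
    refine lt_of_le_of_lt (le_of_eq (eLpNorm_congr_ae ?_)) hdata.θ_mem.2
    filter_upwards [hD.initial] with x hx
    rw [hx, smul_eq_mul]
  have hMlim : ∀ f : Lp ℝ 2 (spaceM Ω),
      Tendsto (fun t => inner ℝ (M t) f) (𝓝[A] 0) (𝓝 (inner ℝ (M 0) f)) := by
    intro f
    have := (hMc (innerSL ℝ f) 0 h0I).mono_left (nhdsWithin_mono _ hAI)
    simp only [innerSL_apply_apply] at this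
    simp_rw [real_inner_comm f]
    exact this
  have hr : ∀ t ∈ A, M t =ᵐ[spaceM Ω] fun x => ρ t x • θ t x := fun t ht => ht.2.2.2.2.2
  have hM0' : M 0 =ᵐ[spaceM Ω] fun x => ρ₀ x • θ₀ x := hM0
  refine hD.exists_continuous_version hΩo hΩb hT hv hm hφ hA hAT (fun t ht => ht.2.2.1.1)
    (fun t₁ ht₁ ε hε => ?_) h₀mem (hD.tendsto_initial hΩo hΩb hT hv hm hφ hAT
      (fun t ht => (hc ht.2.2.1).1) (C := (c * CD) ^ 2) (fun t ht => ?_) h₀mem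
      (fun ψ h1 h2 => ?_) ?_)
  · obtain ⟨δ, hδ, hδ'⟩ := hcau t₁ ht₁ ε hε
    exact ⟨δ, hδ, fun s hs t ht => hδ' s hs.1 t ht.1⟩
  · have h1 := (hc ht.2.2.1).2
    have h2 := mul_le_mul_of_nonneg_left ht.2.2.2.1 hc0
    have h3 := Real.sq_sqrt (hAI ht).1
    calc t * (eLpNorm (θ t) 4 (spaceM Ω)).toReal ^ 2
        ≤ t * (c * (eLpNorm (Dθ t) 2 (spaceM Ω)).toReal) ^ 2 := by
          have := (hAI ht).1
          gcongr
      _ = (c * (√t * (eLpNorm (Dθ t) 2 (spaceM Ω)).toReal)) ^ 2 := by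
          nth_rewrite 1 [← h3]
          ring
      _ ≤ (c * CD) ^ 2 := by gcongr
  · have hψ : MemLp ψ 2 (spaceM Ω) := h1.memLp_of_hasCompactSupport h2
    rw [integral_mul_inner_eq_inner hM0' hD.initial hψ]
    refine (hMlim _).congr' ?_
    filter_upwards [self_mem_nhdsWithin] with t ht
    rw [integral_mul_inner_eq_inner (hr t ht) ht.2.2.2.2.1 hψ]
  -- The quantity is `⟪M t - M 0, θ t⟫` with `M` only weakly continuous and `θ t` varying with `t`.
  -- It is controlled by the dual bound for the time derivative of `ρθ`, tested with the fixed
  -- function `θ t ∈ H₀¹`.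
  · have hBlim : Tendsto (fun t => ∫ τ in (0 : ℝ)..t, b τ) (𝓝[A] 0) (𝓝 0) := by
      have h1 := intervalIntegral.continuousOn_primitive_interval'
        (intervalIntegrable_of_integrable_timeM hb h0I ⟨hT.le, le_rfl⟩) left_mem_uIcc
      rw [uIcc_of_le hT.le] at h1
      have := (h1 0 h0I).mono_left (nhdsWithin_mono _ hAI)
      simpa using this
    refine tendsto_zero_of_le_add_div (K := C * CD) (by positivity) hBlim ?_
    filter_upwards [self_mem_nhdsWithin] with t ht η hη
    have ht0 : 0 < t := (hAT ht).1
    have e1 : ∫ x in Ω, V t x * ‖θ t x‖ ^ 2 = inner ℝ (M t) (ht.2.2.1.1.toLp (θ t)) := by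
      rw [← integral_mul_inner_eq_inner (hr t ht) ht.2.2.2.2.1 ht.2.2.1.1]
      simp only [real_inner_self_eq_norm_sq]
    rw [e1, integral_mul_inner_eq_inner hM0' hD.initial ht.2.2.1.1]
    set w := ht.2.2.1.1.toLp (θ t) with hw
    set D := (eLpNorm (Dθ t) 2 (spaceM Ω)).toReal with hDdef
    have hst : 0 < √t := Real.sqrt_pos.2 ht0
    -- The choice `l = η / √t` balances the growth of the test function: with `√t D ≤ CD` the
    -- right-hand side becomes at most `C CD (η + (∫₀ᵗ b) / η)`.
    have hstep : ∀ᶠ s in 𝓝[A] 0, |inner ℝ (M t) w - inner ℝ (M s) w| ≤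
        C * D * (η / √t * t + (∫ τ in (0 : ℝ)..t, b τ) / (η / √t)) := by
      filter_upwards [self_mem_nhdsWithin, mem_nhdsWithin_of_mem_nhds (Iio_mem_nhds ht0)]
        with s hs hslt
      have hmρ : AEStronglyMeasurable (ρ s) (spaceM Ω) := (Lp.memLp (V s)).1.congr hs.2.2.2.2.1
      have key := h.abs_integral_mul_sub_le hΩ hD hb (A := A₀ ∩ A₁)
        (by filter_upwards [hA₀, hA₁] with τ h1 h2 using ⟨h1, h2⟩)
        (fun τ hτ => hA₀T hτ.1) (fun s hs t ht => hA₁d s hs.2 t ht.2)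
        (fun s hs t ht => hA₀d s hs.1 t ht.1) ⟨hs.1, hs.2.1⟩ ⟨ht.1, ht.2.1⟩ hslt hmρ
        hs.2.2.1.1.1 ht.2.2.1 (div_pos hη hst) hbd
      have e2 : inner ℝ (M t) w - inner ℝ (M s) w =
          ∫ x in Ω, (ρ t x * θ t x - ρ s x * θ s x) * θ t x := by
        rw [← inner_sub_left, L2.inner_def]
        refine integral_congr_ae ?_
        filter_upwards [Lp.coeFn_sub (M t) (M s), hr t ht, hr s hs, ht.2.2.1.1.coeFn_toLp]
          with x g1 g2 g3 g4
        rw [g1, Pi.sub_apply, g2, g3, hw, g4]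
        simp only [smul_eq_mul, RCLike.inner_apply, conj_trivial]
        ring
      rw [e2]
      refine key.trans ?_
      have hsI := hAI hs
      have htI := hAI ht
      have hsplit := intervalIntegral.integral_add_adjacent_intervals
        (intervalIntegrable_of_integrable_timeM hb h0I hsI)
        (intervalIntegrable_of_integrable_timeM hb hsI htI)
      have hpos : 0 ≤ ∫ τ in (0 : ℝ)..s, b τ :=
        intervalIntegral.integral_nonneg hsI.1 fun τ _ => hb0 τ
      have hD0 : 0 ≤ D := ENNReal.toReal_nonneg
      gcongr
      · linarith [hsI.1]
      · linarith
    -- The energy estimate holds between positive good times. As `w` does not depend on `s`, weak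
    -- continuity is enough to let `s → 0`.
    have hlim := (tendsto_const_nhds (x := inner ℝ (M t) w)).sub (hMlim w)
    have hle := le_of_tendsto hlim.abs hstep
    refine hle.trans (le_of_eq_of_le ?_ (mul_le_mul_of_nonneg_right
      (mul_le_mul_of_nonneg_left ht.2.2.2.1 hC0) ?_))
    · have h3 := Real.sq_sqrt ht0.le
      field_simp
      rw [h3, hDdef]
      ring
    · have : 0 ≤ ∫ τ in (0 : ℝ)..t, b τ :=
        intervalIntegral.integral_nonneg ht0.le fun τ _ => hb0 τ
      positivity

end Conclusion

end CNS

end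

theorem proposition4p4 (Ω : Set CNS.E3) (hΩ : CNS.IsSmoothBoundedDomain Ω)
    (R μ lam κ cv : ℝ) (hc : CNS.PhysicalConstants R μ lam κ cv)
    (q : ℝ) (hq : q ∈ Ioo (3 : ℝ) 6) (T₀ : ℝ) (hT₀ : 0 < T₀)
    (ρ₀ : CNS.E3 → ℝ) (u₀ : CNS.E3 → CNS.E3) (θ₀ : CNS.E3 → ℝ)
    (hdata : CNS.InitialData Ω q ρ₀ u₀ θ₀)
    (ρ : ℝ → CNS.E3 → ℝ) (u : ℝ → CNS.E3 → CNS.E3) (θ : ℝ → CNS.E3 → ℝ)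
    (hsol : CNS.IsSolution Ω T₀ R μ lam κ cv q ρ₀ u₀ θ₀ ρ u θ)
    (φ : ℝ → CNS.E3 → CNS.E3) (hφ : CNS.IsFlow Ω T₀ u φ)
    (v : ℝ → CNS.E3 → CNS.E3) (hv : ∀ t y, v t y = u t (φ t y))
    (ϑ : ℝ → CNS.E3 → ℝ) (hϑ : ∀ t y, ϑ t y = θ t (φ t y)) :
    (∃ (V : ℝ → Lp CNS.E3 2 (CNS.spaceM Ω)) (V₀ : Lp CNS.E3 2 (CNS.spaceM Ω)),
      CNS.IsVersion Ω T₀ (fun t y => √(ρ₀ y) • v t y) V ∧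
      ContinuousOn V (Icc 0 T₀) ∧
      V₀ =ᵐ[CNS.spaceM Ω] (fun y => √(ρ₀ y) • u₀ y) ∧
      Tendsto V (𝓝[>] 0) (𝓝 V₀)) ∧
    (∃ (Θ : ℝ → Lp ℝ 2 (CNS.spaceM Ω)) (Θ₀ : Lp ℝ 2 (CNS.spaceM Ω)),
      CNS.IsVersion Ω T₀ (fun t y => √(ρ₀ y) * ϑ t y) Θ ∧
      ContinuousOn Θ (Icc 0 T₀) ∧
      Θ₀ =ᵐ[CNS.spaceM Ω] (fun y => √(ρ₀ y) * θ₀ y) ∧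
      Tendsto Θ (𝓝[>] 0) (𝓝 Θ₀)) := by
  obtain ⟨ρt, Dρ, ut, Du, D2u, Dut, θt, Dθ, D2θ, Dθt, DM, DP, h⟩ := hsol
  obtain ⟨m, V, hm, hD⟩ := h.exists_densityVersion hΩ hT₀ hq.1
  obtain ⟨a, hvel, ha⟩ := h.exists_lipschitzVelocity hΩ hq.1
  simp only [hv, hϑ]
  exact ⟨h.exists_continuous_velocity hΩ hT₀ hdata hD hm hvel hφ,
    h.exists_continuous_temperature hΩ hT₀ hc hdata hD hm hvel ha hφ⟩
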